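/- For a Riemannian manifold $(N,h)$ of even dimension $n$ with Levi-Civita connection $\nabla$, let $\pi:\mathcal Z(N)\to N$ be its twistor space, whose fibre at $p$ consists of the complex structures $J$ on $T_pN$ that are orthogonal with respect to $h_p$. It is a submanifold of the bundle of skew-symmetric endomorphisms of $TN$. The connection $\nabla$ splits $T\mathcal Z(N)=\mathcal H\oplus\mathcal V$ into horizontal and vertical parts, where $\mathcal V_J$ is the space of skew-symmetric endomorphisms of $T_{\pi(J)}N$ that anti-commute with $J$. For $r>0$, let $h_r$ be the Riemannian metric on $\mathcal Z(N)$ for which $\mathcal H\perp\mathcal V$, which equals $\pi^*h$ on $\mathcal H$, and which equals $rG$ on $\mathcal V$, where $G(A,B)=-\frac1n\operatorname{Trace}(A\circ B)$. An almost complex structure on $N$ compatible with $h$ is a section of $\mathcal Z(N)$, hence a map $J:(N,h)\to(\mathcal Z(N),h_r)$. Its second fundamental form $\widetilde\nabla J_*$ is the covariant derivative of its differential $J_*$, a section of $\operatorname{Hom}(TN,J^*T\mathcal Z(N))$, with respect to the Levi-Civita connections of $h$ and $h_r$. Let $(M,g)$ be a connected oriented Riemannian $4$-manifold. Let $\mathcal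 Z$ be its negative twistor space, i.e. the open subset of $\mathcal Z(M)$ of those $J$ that induce on $T_{\pi(J)}M$ the orientation opposite to that of $M$, with the metric $h_t=\pi^*g+tG$ for some $t>0$. For $k=1,2$ let $\mathcal J_k$ be the almost complex structure on $\mathcal Z$ which at $J\in\mathcal Z$ is the horizontal lift of $J$ on $\mathcal H_J$ and is $V\mapsto(-1)^{k+1}J\circ V$ on $\mathcal V_J$ ($\mathcal J_1$ is the Atiyah-Hitchin-Singer and $\mathcal J_2$ the Eells-Salamon structure). Each $\mathcal J_k$ is compatible with $h_t$. Regard $\mathcal J_k$ as a map from the six-manifold $(\mathcal Z,h_t)$ to its twistor space $\mathcal Z(\mathcal Z)$, endowed with the metric built from $h_t$ as above with any parameter $t'>0$, and let $\mathcal V\operatorname{Trace}\widetilde\nabla\mathcal J_{k*}$ be the vertical part of the trace, with respect to $h_t$, of its second fundamental form. Then, for all $t,t'>0$: (i) $\mathcal V\operatorname{Trace}\widetilde\nabla\mathcal J_{1*}=0$ on $\mathcal Z$ if and only if $(M,g)$ is self-dual; (ii) $\mathcal V\operatorname{Trace}\widetilde\nabla\mathcal J_{2*}=0$ on $\mathcal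 Z$ if and only if $(M,g)$ is self-dual and has constant scalar curvature. Here $(M,g)$ is called self-dual if $\mathcal W_-=0$, where $\mathcal W_-$ is the restriction of the Weyl curvature operator $\mathcal W:\Lambda^2TM\to\Lambda^2TM$ to the $(-1)$-eigenbundle $\Lambda^2_-TM$ of the Hodge star operator. -/

import Mathlib

open Filter Topology
open scoped Manifold ContDiff

set_option maxSynthPendingDepth 3

namespace Twistor

noncomputable section

/-- The coordinate space `ℝⁿ`. -/
abbrev Coord (n : ℕ) : Type := EuclideanSpace ℝ (Fin n)

/-! ### Riemannian geometry on open subsets of a vector space -/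

section Local

variable {F : Type*} [NormedAddCommGroup F] [NormedSpace ℝ F]
variable {F' : Type*} [NormedAddCommGroup F'] [NormedSpace ℝ F']

/-- Christoffel symbols of the first kind of the field `g` of bilinear forms:
`(X, Y, Z) ↦ ½ (D_X g(Y, Z) + D_Y g(X, Z) - D_Z g(X, Y))`. -/
def christoffelFirst (g : F → F →L[ℝ] F →L[ℝ] ℝ) (x : F) : F →L[ℝ] F →L[ℝ] F →L[ℝ] ℝ :=
  (1 / 2 : ℝ) • (fderiv ℝ g x + (fderiv ℝ g x).flip
    - (ContinuousLinearMap.flipₗᵢ ℝ F F ℝ).toContinuousLinearEquiv.toContinuousLinearMap ∘L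
        (fderiv ℝ g x).flip)

theorem christoffelFirst_apply (g : F → F →L[ℝ] F →L[ℝ] ℝ) (x X Y Z : F) :
    christoffelFirst g x X Y Z =
      (1 / 2) * (fderiv ℝ g x X Y Z + fderiv ℝ g x Y X Z - fderiv ℝ g x Z X Y) := by
  simp [christoffelFirst]

/-- Christoffel symbols `Γ(X, Y)` of the Levi-Civita connection of the metric `g`:
`g(Γ(X, Y), Z)` is the symbol of the first kind, and `∇_X Y = D_X Y + Γ(X, Y)`. -/
def christoffel (g : F → F →L[ℝ] F →L[ℝ] ℝ) (x : F) : F →L[ℝ] F →L[ℝ] F :=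
  (ContinuousLinearMap.compL ℝ F (F →L[ℝ] ℝ) F (g x).inverse) ∘L christoffelFirst g x

theorem christoffel_apply (g : F → F →L[ℝ] F →L[ℝ] ℝ) (x X Y : F) :
    christoffel g x X Y = (g x).inverse (christoffelFirst g x X Y) := rfl

/-- The curvature tensor, with the sign convention `R(X, Y) = ∇_{[X, Y]} - [∇_X, ∇_Y]`. -/
def curvature (g : F → F →L[ℝ] F →L[ℝ] ℝ) (x X Y Z : F) : F :=
  -(fderiv ℝ (christoffel g) x X Y Z - fderiv ℝ (christoffel g) x Y X Z
    + christoffel g x X (christoffel g x Y Z) - christoffel g x Y (christoffel g x X Z))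

/-- The pull-back of the field `h` of bilinear forms by the map `φ`. -/
def pullbackMetric (h : F' → F' →L[ℝ] F' →L[ℝ] ℝ) (φ : F → F') (q : F) : F →L[ℝ] F →L[ℝ] ℝ :=
  (h (φ q)).bilinearComp (fderiv ℝ φ q) (fderiv ℝ φ q)

/-- The second fundamental form `(∇̃u_*)(X, Y) = D̃_X(u_* Y) - u_*(∇_X Y)` of a map `u` between open
subsets of vector spaces with the metrics `h` and `h'`. -/
def secondFundamentalForm (h : F → F →L[ℝ] F →L[ℝ] ℝ) (h' : F' → F' →L[ℝ] F' →L[ℝ] ℝ)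
    (u : F → F') (q X Y : F) : F' :=
  fderiv ℝ (fderiv ℝ u) q X Y + christoffel h' (u q) (fderiv ℝ u q X) (fderiv ℝ u q Y)
    - fderiv ℝ u q (christoffel h q X Y)

/-- `φ` on the open set `Ω` is a local parametrization (the inverse of a local chart) of the
embedded submanifold `S`: a smooth immersion that maps `Ω` into `S`, as an open map to `S`. -/
structure IsLocalParam (S : Set F') (Ω : Set F) (φ : F → F') : Prop where
  isOpen : IsOpen Ω
  contDiffOn : ContDiffOn ℝ ∞ φ Ω
  mapsTo : Set.MapsTo φ Ω S
  injective_fderiv : ∀ q ∈ Ω, Function.Injective (fderiv ℝ φ q)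
  map_nhds : ∀ q ∈ Ω, map φ (𝓝 q) = 𝓝[S] (φ q)

/-- The twistor space of `(U, g)`, for an open set `U` of a vector space `F`: the pairs `(x, I)`
where `x ∈ U` and `I` is a complex structure on `T_x U = F` that is orthogonal for `g_x`. It is a
submanifold of the bundle `U × End F` of endomorphisms. -/
def twistorSet (U : Set F) (g : F → F →L[ℝ] F →L[ℝ] ℝ) : Set (F × (F →L[ℝ] F)) :=
  {z | z.1 ∈ U ∧ (∀ v, z.2 (z.2 v) = -v) ∧ ∀ v w, g z.1 (z.2 v) (z.2 w) = g z.1 v w}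

/-- The vertical component of a vector `(X, A)` tangent to the bundle of endomorphisms at
`z = (x, I)`, for the horizontal distribution of the Levi-Civita connection of `g`:
`A + [Γ_x(X), I]`. Vertical vectors are identified with endomorphisms of `T_x U`. -/
def verticalPart (g : F → F →L[ℝ] F →L[ℝ] ℝ) (z : F × (F →L[ℝ] F)) :
    F × (F →L[ℝ] F) →L[ℝ] (F →L[ℝ] F) :=
  ContinuousLinearMap.snd ℝ F (F →L[ℝ] F)
    + ((ContinuousLinearMap.compL ℝ F F F).flip z.2 - ContinuousLinearMap.compL ℝ F F F z.2) ∘L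
        christoffel g z.1 ∘L ContinuousLinearMap.fst ℝ F (F →L[ℝ] F)

theorem verticalPart_apply (g : F → F →L[ℝ] F →L[ℝ] ℝ) (z v : F × (F →L[ℝ] F)) :
    verticalPart g z v =
      v.2 + (christoffel g z.1 v.1 ∘L z.2 - z.2 ∘L christoffel g z.1 v.1) := by
  simp [verticalPart]

/-- The horizontal lift of `X ∈ T_x U` at `z = (x, I)`. -/
def horizontalLift (g : F → F →L[ℝ] F →L[ℝ] ℝ) (z : F × (F →L[ℝ] F)) (X : F) :
    F × (F →L[ℝ] F) :=
  (X, -(christoffel g z.1 X ∘L z.2 - z.2 ∘L christoffel g z.1 X))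

/-- The bilinear form `G(A, B) = -(1/n) Trace (A ∘ B)` on endomorphisms, `n = dim F`. -/
def endForm (F : Type*) [NormedAddCommGroup F] [NormedSpace ℝ F] [FiniteDimensional ℝ F] :
    (F →L[ℝ] F) →L[ℝ] (F →L[ℝ] F) →L[ℝ] ℝ :=
  (-(1 / (Module.finrank ℝ F : ℝ))) •
    (ContinuousLinearMap.compL ℝ (F →L[ℝ] F) (F →L[ℝ] F) ℝ
      (LinearMap.toContinuousLinearMap
        (LinearMap.trace ℝ F ∘ₗ ContinuousLinearMap.coeLM ℝ))) ∘L
      ContinuousLinearMap.compL ℝ F F F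

theorem endForm_apply [FiniteDimensional ℝ F] (A B : F →L[ℝ] F) :
    endForm F A B = -(1 / (Module.finrank ℝ F : ℝ)) *
      LinearMap.trace ℝ F ((A ∘L B : F →L[ℝ] F) : F →ₗ[ℝ] F) := by
  simp [endForm]

/-- The metric `h_t = π^* g + t G` on the twistor space: the lift of `g` on horizontal vectors,
`t` times `G` on vertical vectors, and horizontal vectors orthogonal to vertical ones. (The formula
makes sense on `U × End F`; it is only used on vectors tangent to the twistor space.) -/
def twistorMetric [FiniteDimensional ℝ F] (g : F → F →L[ℝ] F →L[ℝ] ℝ) (t : ℝ)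
    (z : F × (F →L[ℝ] F)) :
    F × (F →L[ℝ] F) →L[ℝ] F × (F →L[ℝ] F) →L[ℝ] ℝ :=
  (g z.1).bilinearComp (ContinuousLinearMap.fst ℝ F (F →L[ℝ] F))
      (ContinuousLinearMap.fst ℝ F (F →L[ℝ] F))
    + t • (endForm F).bilinearComp (verticalPart g z) (verticalPart g z)

theorem twistorMetric_apply [FiniteDimensional ℝ F] (g : F → F →L[ℝ] F →L[ℝ] ℝ) (t : ℝ)
    (z v w : F × (F →L[ℝ] F)) :
    twistorMetric g t z v w =
      g z.1 v.1 w.1 + t * endForm F (verticalPart g z v) (verticalPart g z w) := by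
  simp [twistorMetric]

/-- The almost complex structure `𝒥_k` of the twistor space at `z = (x, I)`: the lift of `I` on
horizontal vectors, and `V ↦ (-1)^{k+1} I ∘ V` on vertical vectors. `𝒥₁` is the structure of
Atiyah-Hitchin-Singer and `𝒥₂` that of Eells-Salamon. -/
def twistorACS (g : F → F →L[ℝ] F →L[ℝ] ℝ) (k : ℕ) (z v : F × (F →L[ℝ] F)) :
    F × (F →L[ℝ] F) :=
  horizontalLift g z (z.2 v.1) + (0, (-1 : ℝ) ^ (k + 1) • (z.2 ∘L verticalPart g z v))

end Local

/-! ### Traces, Ricci, scalar and Weyl curvature in coordinates -/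

section Trace

variable {n : ℕ} {W : Type*} [AddCommGroup W]

/-- The trace of a bilinear map with respect to a scalar product `h` on `ℝⁿ`:
`∑ h^{ij} B(∂_i, ∂_j)`, that is, `∑ B(e_i, e_i)` for an `h`-orthonormal basis. -/
def metricTrace (h : Coord n →L[ℝ] Coord n →L[ℝ] ℝ) (B : Coord n → Coord n → W) : W :=
  ∑ i, B (EuclideanSpace.single i 1) (h.inverse (EuclideanSpace.proj i))

/-- `Ricci(Y, Z) = Trace (X ↦ R(Y, X) Z)`. -/
def ricci (g : Coord n → Coord n →L[ℝ] Coord n →L[ℝ] ℝ) (x Y Z : Coord n) : ℝ :=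
  ∑ i, (curvature g x Y (EuclideanSpace.single i 1) Z) i

/-- The scalar curvature of a metric on an open subset of `ℝⁿ`. -/
def scalar (g : Coord n → Coord n →L[ℝ] Coord n →L[ℝ] ℝ) (x : Coord n) : ℝ :=
  metricTrace (g x) (ricci g x)

/-- The Weyl tensor `g(𝒲(X ∧ Y), Z ∧ T)` in dimension four, that is, `g(R(X, Y)Z, T)` minus the
components `s/6 Id` and `ℬ` of the curvature operator, `ℬ` being the operator of the traceless Ricci
tensor, and `g(X ∧ Y, Z ∧ T) = ½ (g(X, Z) g(Y, T) - g(X, T) g(Y, Z))`. -/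
def weyl (g : Coord 4 → Coord 4 →L[ℝ] Coord 4 →L[ℝ] ℝ) (x X Y Z T : Coord 4) : ℝ :=
  g x (curvature g x X Y Z) T
    - scalar g x / 6 * ((1 / 2) * (g x X Z * g x Y T - g x X T * g x Y Z))
    - ((1 / 2) * (ricci g x X Z * g x Y T - ricci g x X T * g x Y Z
          + g x X Z * ricci g x Y T - g x X T * ricci g x Y Z)
        - scalar g x / 2 * ((1 / 2) * (g x X Z * g x Y T - g x X T * g x Y Z)))

/-- Let `𝒥` be an almost complex structure on the open set `Ω ⊆ ℝⁿ`, compatible with the metric `h`,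
let `Ψ` be a local parametrization of the twistor space of `(Ω, h)`, and let `u` be the map
`q ↦ (q, 𝒥_q)` read in the coordinates `Ψ`. The definition is the vertical part of the trace of the
second fundamental form of this map from `(Ω, h)` to its twistor space with the metric `h_t`. -/
def verticalTrace {d : ℕ} (h : Coord n → Coord n →L[ℝ] Coord n →L[ℝ] ℝ) (t : ℝ)
    (Ψ : Coord d → Coord n × (Coord n →L[ℝ] Coord n)) (u : Coord n → Coord d) (q : Coord n) :
    Coord n →L[ℝ] Coord n :=
  verticalPart h (Ψ (u q)) (fderiv ℝ Ψ (u q)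
    (metricTrace (h q)
      (secondFundamentalForm h (pullbackMetric (twistorMetric h t) Ψ) u q)))

/-- The vertical part of `Trace ∇̃𝒥_*` vanishes at all points of `Ω`, where the almost complex
structure `𝒥` is regarded as a map from `(Ω, h)` to its twistor space with the metric `h_t`, a
manifold of dimension `d`. -/
def VerticalTraceVanishesOn (d : ℕ) (Ω : Set (Coord n))
    (h : Coord n → Coord n →L[ℝ] Coord n →L[ℝ] ℝ) (t : ℝ)
    (J : Coord n → Coord n →L[ℝ] Coord n) : Prop :=
  ∀ q ∈ Ω, ∀ (Ω' : Set (Coord d)) (Ψ : Coord d → Coord n × (Coord n →L[ℝ] Coord n))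
    (u : Coord n → Coord d),
    IsLocalParam (twistorSet Ω h) Ω' Ψ → ContDiffAt ℝ ∞ u q → u q ∈ Ω' →
    (∀ᶠ q' in 𝓝 q, Ψ (u q') = (q', J q')) → verticalTrace h t Ψ u q = 0

end Trace

/-! ### Oriented Riemannian four-manifolds -/

section Global

variable (M : Type*) [TopologicalSpace M] [ChartedSpace (Coord 4) M] [IsManifold (𝓡 4) ∞ M]

/-- A smooth Riemannian metric on the four-manifold `M`. -/
abbrev RiemMetric :=
  Bundle.ContMDiffRiemannianMetric (𝓡 4) ∞ (Coord 4) (fun p : M => TangentSpace (𝓡 4) p)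

/-- An orientation of the manifold `M`: an orientation of every tangent space, such that the
differential of a chart takes it to a locally constant orientation of `ℝ⁴`. -/
structure ManifoldOrientation where
  orient : ∀ p : M, Orientation ℝ (TangentSpace (𝓡 4) p) (Fin 4)
  locally_constant : ∀ p : M, ∃ c : Orientation ℝ (Coord 4) (Fin 4), ∀ᶠ y in 𝓝 p,
    ∀ (b : Module.Basis (Fin 4) ℝ (TangentSpace (𝓡 4) y)) (b' : Module.Basis (Fin 4) ℝ (Coord 4)),
      (∀ i, b' i = mfderiv (𝓡 4) 𝓘(ℝ, Coord 4) (extChartAt (𝓡 4) p) y (b i)) →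
      (b.orientation = orient y ↔ b'.orientation = c)

variable {M}

/-- The metric in the coordinates given by the chart at `p`. -/
def coordMetric (g : RiemMetric M) (p : M) (x : Coord 4) : Coord 4 →L[ℝ] Coord 4 →L[ℝ] ℝ :=
  let L := mfderiv 𝓘(ℝ, Coord 4) (𝓡 4) (extChartAt (𝓡 4) p).symm x
  (ContinuousLinearMap.precomp ℝ L) ∘L (g.inner ((extChartAt (𝓡 4) p).symm x)) ∘L L

/-- The scalar curvature of `(M, g)`. -/
def scalarCurvature (g : RiemMetric M) (p : M) : ℝ :=
  scalar (coordMetric g p) (extChartAt (𝓡 4) p p)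

/-- `(M, g)` is self-dual: `𝒲₋ = 0`, that is, the Weyl operator vanishes on the vectors
`e₁ ∧ e₂ - e₃ ∧ e₄`, `e₁ ∧ e₃ - e₄ ∧ e₂`, `e₁ ∧ e₄ - e₂ ∧ e₃`, which form a basis of `Λ²₋ T_p M`
when `e` is an oriented orthonormal basis of `T_p M`. -/
def IsSelfDual (g : RiemMetric M) (o : ManifoldOrientation M) : Prop :=
  ∀ (p : M) (b : Module.Basis (Fin 4) ℝ (TangentSpace (𝓡 4) p)),
    (∀ i j, g.inner p (b i) (b j) = if i = j then 1 else 0) → b.orientation = o.orient p →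
    let e : Fin 4 → Coord 4 :=
      fun i => mfderiv (𝓡 4) 𝓘(ℝ, Coord 4) (extChartAt (𝓡 4) p) p (b i)
    let W : Coord 4 → Coord 4 → Coord 4 → Coord 4 → ℝ :=
      weyl (coordMetric g p) (extChartAt (𝓡 4) p p)
    ∀ Z T : Coord 4,
      W (e 0) (e 1) Z T - W (e 2) (e 3) Z T = 0 ∧
      W (e 0) (e 2) Z T - W (e 3) (e 1) Z T = 0 ∧
      W (e 0) (e 3) Z T - W (e 1) (e 2) Z T = 0

/-- `J` is a point over `y` of the negative twistor space of `M`: a complex structure on `T_y M` that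
is orthogonal and induces the orientation opposite to that of `M`. -/
structure IsNegTwistor (g : RiemMetric M) (o : ManifoldOrientation M) (y : M)
    (J : TangentSpace (𝓡 4) y →L[ℝ] TangentSpace (𝓡 4) y) : Prop where
  sq : ∀ v, J (J v) = -v
  orthogonal : ∀ v w, g.inner y (J v) (J w) = g.inner y v w
  orientation : ∀ b : Module.Basis (Fin 4) ℝ (TangentSpace (𝓡 4) y),
    b 1 = J (b 0) → b 3 = J (b 2) → b.orientation = -o.orient y

/-- The part of the negative twistor space `𝒵` of `M` over the domain of the chart at `p`, read in
this chart. -/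
def negTwistorPatch (g : RiemMetric M) (o : ManifoldOrientation M) (p : M) :
    Set (Coord 4 × (Coord 4 →L[ℝ] Coord 4)) :=
  {z | z.1 ∈ (extChartAt (𝓡 4) p).target ∧
    ∃ J : TangentSpace (𝓡 4) ((extChartAt (𝓡 4) p).symm z.1) →L[ℝ]
        TangentSpace (𝓡 4) ((extChartAt (𝓡 4) p).symm z.1),
      IsNegTwistor g o ((extChartAt (𝓡 4) p).symm z.1) J ∧
      ∀ v : Coord 4,
        mfderiv 𝓘(ℝ, Coord 4) (𝓡 4) (extChartAt (𝓡 4) p).symm z.1 (z.2 v) =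
          J (mfderiv 𝓘(ℝ, Coord 4) (𝓡 4) (extChartAt (𝓡 4) p).symm z.1 v)}

/-- The vertical part of `Trace ∇̃𝒥_{k*}` vanishes on the whole negative twistor space `𝒵` of `M`,
where `𝒵` has the metric `h_t`, and `𝒥_k` is regarded as a map from the six-manifold `(𝒵, h_t)` to
its twistor space, of dimension `6 + 6 = 12`, with the metric of parameter `t'` built from `h_t`.
Here `φ` runs over the local parametrizations of `𝒵`, and `J` is `𝒥_k` in the coordinates `φ`. -/
def VerticalTraceVanishes (g : RiemMetric M) (o : ManifoldOrientation M) (t t' : ℝ) (k : ℕ) :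
    Prop :=
  ∀ (p : M) (Ω : Set (Coord 6)) (φ : Coord 6 → Coord 4 × (Coord 4 →L[ℝ] Coord 4))
    (J : Coord 6 → Coord 6 →L[ℝ] Coord 6),
    IsLocalParam (negTwistorPatch g o p) Ω φ →
    (∀ q ∈ Ω, ∀ a, fderiv ℝ φ q (J q a) =
      twistorACS (coordMetric g p) k (φ q) (fderiv ℝ φ q a)) →
    VerticalTraceVanishesOn 12 Ω (pullbackMetric (twistorMetric (coordMetric g p) t) φ) t' J

end Global

end

end Twistor

/-! Let `J` be an almost complex structure on `(N, h)`, seen as a map to the twistor space. The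
vertical part of the trace of its second fundamental form is `∑ ∇²J - (∑ (∇J)²) J`, whatever the
parameter of the metric on the target. Differentiating `J² = -1` twice shows that this is the
component of the rough Laplacian `T = ∑ ∇²J` that anti-commutes with `J`. The condition is therefore
`[T, J] = 0` (`verticalTrace_eq_zero_iff`), and `t'` plays no role.

For the structures `𝒥` on the negative twistor space, with `ε = 1` for Atiyah-Hitchin-Singer and `ε
= -1` for Eells-Salamon, `T` is computed from the Levi-Civita connection of `h_t` (`christoffel_eq`,
`horiz_nablaTwo`). The commutator `[T, 𝒥]` is skew and anti-commutes with `𝒥`. Since the fibres are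
two-dimensional, its horizontal components determine it. At a point `i`, completed to a quaternionic
triple `i, j, k`, two conditions remain (`roughLap_comm_iff`): the endomorphism `lapBlock` of the
horizontal space commutes with `i`, and `i (div 𝓡(k)) + ε div 𝓡(j) = 0`, where `𝓡` is the curvature
operator.

The first condition amounts to two quadratic equations in the 3 × 3 matrix `a` of `𝓡` on
anti-self-dual bivectors. They have to hold at every point of the fibre, hence in every oriented
frame. Comparing a frame with its cyclic permutation gives `a_ij (a_jj - a_ii) = 0`, and a rotation
of the frame turns this into `a_ij = 0` and `a_ii = a_jj`. So `a` is scalar, necessarily `s / 24`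
with `s` the scalar curvature, which is the equation `𝒲₋ = 0` (`curvIsotropic_of_comm`,
`weyl_eq_zero_iff`). Conversely, a scalar `a` satisfies both equations because its off-diagonal
entries vanish.

Once `a = s / 24`, the second Bianchi identity yields `div 𝓡(i) = i (grad s) / 12`, and the second
condition reads `(ε - 1) j (grad s) = 0` (`divTerm_of_isotropic`). It is empty for `ε = 1` and means
`ds = 0` for `ε = -1`; on a connected manifold that is constancy of `s`.

The conditions are quantified over local parametrizations of the two twistor spaces. To extract
information from them, parametrizations must exist around every point. They are produced by the
Cayley transform `V ↦ (1 + V) J (1 + V)⁻¹` and a local trivialization of the metric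
(`exists_vertical_param`). Isometry invariance of the curvature removes the dependence on the charts
of `M`. -/

set_option linter.unusedSectionVars false

namespace Twistor

noncomputable section

/-! ### Calculus of directional derivatives -/

section Calculus

variable {N : Type*} [NormedAddCommGroup N] [NormedSpace ℝ N]
variable {F : Type*} [NormedAddCommGroup F] [NormedSpace ℝ F]
variable {F' : Type*} [NormedAddCommGroup F'] [NormedSpace ℝ F']
variable {F'' : Type*} [NormedAddCommGroup F''] [NormedSpace ℝ F'']

theorem fderiv_clm_apply_apply {c : N → F →L[ℝ] F'} {u : N → F} {q : N}
    (hc : DifferentiableAt ℝ c q) (hu : DifferentiableAt ℝ u q) (a : N) :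
    fderiv ℝ (fun y => c y (u y)) q a = fderiv ℝ c q a (u q) + c q (fderiv ℝ u q a) := by
  rw [fderiv_clm_apply hc hu]; simp [add_comm]

theorem fderiv_clm_apply_const {c : N → F →L[ℝ] F'} {q : N}
    (hc : DifferentiableAt ℝ c q) (v : F) (a : N) :
    fderiv ℝ (fun y => c y v) q a = fderiv ℝ c q a v := by
  rw [fderiv_clm_apply_apply hc (differentiableAt_const v)]; simp

theorem fderiv_end_mul_apply {A B : N → F →L[ℝ] F} {q : N}
    (hA : DifferentiableAt ℝ A q) (hB : DifferentiableAt ℝ B q) (a : N) :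
    fderiv ℝ (fun y => A y * B y) q a = fderiv ℝ A q a * B q + A q * fderiv ℝ B q a :=
  (congrArg (fun L => L a) (fderiv_clm_comp hA hB)).trans (add_comm _ _)

theorem fderiv_bilin_apply {b : N → F →L[ℝ] F' →L[ℝ] F''} {u : N → F} {v : N → F'} {q : N}
    (hb : DifferentiableAt ℝ b q) (hu : DifferentiableAt ℝ u q) (hv : DifferentiableAt ℝ v q)
    (a : N) :
    fderiv ℝ (fun y => b y (u y) (v y)) q a =
      fderiv ℝ b q a (u q) (v q) + b q (fderiv ℝ u q a) (v q) + b q (u q) (fderiv ℝ v q a) := by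
  rw [fderiv_clm_apply_apply (hb.clm_apply hu) hv, fderiv_clm_apply_apply hb hu]
  simp

theorem fderiv_comp_apply {g : F → F'} {f : N → F} {q : N}
    (hg : DifferentiableAt ℝ g (f q)) (hf : DifferentiableAt ℝ f q) (a : N) :
    fderiv ℝ (fun y => g (f y)) q a = fderiv ℝ g (f q) (fderiv ℝ f q a) := by
  have := fderiv_comp q hg hf
  rw [show (fun y => g (f y)) = g ∘ f from rfl, this]; rfl

theorem smoothAt_fderiv {u : N → F} {q : N} (hu : ContDiffAt ℝ ∞ u q) :
    ContDiffAt ℝ ∞ (fderiv ℝ u) q :=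
  hu.fderiv_right (by simp)

theorem fderiv_fderiv_symm {u : N → F} {q : N} (hu : ContDiffAt ℝ ∞ u q) (a b : N) :
    fderiv ℝ (fderiv ℝ u) q a b = fderiv ℝ (fderiv ℝ u) q b a :=
  hu.isSymmSndFDerivAt (by simpa using WithTop.coe_le_coe.2 (le_top : (2 : ℕ∞) ≤ ⊤)) a b

theorem smoothAt_diff {u : N → F} {q : N} (hu : ContDiffAt ℝ ∞ u q) : DifferentiableAt ℝ u q :=
  hu.differentiableAt (by simp)

theorem fderiv_congr_apply {u v : N → F} {q : N} (h : u =ᶠ[𝓝 q] v) (a : N) :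
    fderiv ℝ u q a = fderiv ℝ v q a := by rw [h.fderiv_eq]

end Calculus

/-! ### The Levi-Civita connection of a metric on an open set. -/

section MetricBasics

variable {F : Type*} [NormedAddCommGroup F] [NormedSpace ℝ F] [FiniteDimensional ℝ F]

/-- `g` is a smooth Riemannian metric on the open set `U`. -/
structure IsMetricOn (U : Set F) (g : F → F →L[ℝ] F →L[ℝ] ℝ) : Prop where
  isOpen : IsOpen U
  smooth : ContDiffOn ℝ ∞ g U
  symm : ∀ x ∈ U, ∀ v w, g x v w = g x w v
  pos : ∀ x ∈ U, ∀ v, v ≠ 0 → 0 < g x v v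

/-- A nondegenerate bilinear form on a finite-dimensional space is invertible. -/
theorem isInvertible_of_pos {b : F →L[ℝ] F →L[ℝ] ℝ} (hb : ∀ v, v ≠ 0 → 0 < b v v) :
    b.IsInvertible := by
  have hinj : Function.Injective (b : F →ₗ[ℝ] F →L[ℝ] ℝ) := by
    rw [injective_iff_map_eq_zero]
    intro v hv
    by_contra h
    have := hb v h
    have h2 : b v = 0 := hv
    rw [h2] at this
    simp at this
  have hd : Module.finrank ℝ F = Module.finrank ℝ (F →L[ℝ] ℝ) := by
    rw [← (LinearMap.toContinuousLinearMap (𝕜 := ℝ) (E := F) (F' := ℝ)).finrank_eq]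
    exact (Subspace.dual_finrank_eq (K := ℝ) (V := F)).symm
  exact ⟨(LinearEquiv.ofInjectiveOfFinrankEq _ hinj hd).toContinuousLinearEquiv, by ext; rfl⟩

namespace IsMetricOn

variable {U : Set F} {g : F → F →L[ℝ] F →L[ℝ] ℝ} {x : F}

theorem smoothAt (hg : IsMetricOn U g) (hx : x ∈ U) : ContDiffAt ℝ ∞ g x :=
  hg.smooth.contDiffAt (hg.isOpen.mem_nhds hx)

theorem isInvertible (hg : IsMetricOn U g) (hx : x ∈ U) : (g x).IsInvertible :=
  isInvertible_of_pos (hg.pos x hx)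

theorem apply_inverse (hg : IsMetricOn U g) (hx : x ∈ U) (α : F →L[ℝ] ℝ) :
    g x ((g x).inverse α) = α := (hg.isInvertible hx).self_apply_inverse α

theorem ext (hg : IsMetricOn U g) (hx : x ∈ U) {v w : F} (h : ∀ z, g x v z = g x w z) : v = w :=
  (hg.isInvertible hx).injective (ContinuousLinearMap.ext h)

theorem smoothAt_inverse (hg : IsMetricOn U g) (hx : x ∈ U) :
    ContDiffAt ℝ ∞ (fun y => (g y).inverse) x := by
  obtain ⟨e, he⟩ := hg.isInvertible hx
  have := contDiffAt_map_inverse (n := ∞) e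
  rw [he] at this
  have : CompleteSpace F := FiniteDimensional.complete ℝ F
  exact ContDiffAt.comp x (by assumption) (hg.smoothAt hx)

theorem christoffel_inner (hg : IsMetricOn U g) (hx : x ∈ U) (X Y Z : F) :
    g x (christoffel g x X Y) Z =
      (1 / 2) * (fderiv ℝ g x X Y Z + fderiv ℝ g x Y X Z - fderiv ℝ g x Z X Y) := by
  rw [christoffel_apply, hg.apply_inverse hx, christoffelFirst_apply]

theorem fderiv_symm (hg : IsMetricOn U g) (hx : x ∈ U) (X Y Z : F) :
    fderiv ℝ g x X Y Z = fderiv ℝ g x X Z Y := by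
  have hd := smoothAt_diff (hg.smoothAt hx)
  have h1 : (fun y => g y Y Z) =ᶠ[𝓝 x] (fun y => g y Z Y) := by
    filter_upwards [hg.isOpen.mem_nhds hx] with y hy using hg.symm y hy Y Z
  have := fderiv_congr_apply h1 X
  rwa [fderiv_clm_apply_const (hd.clm_apply (differentiableAt_const Y)),
    fderiv_clm_apply_const (hd.clm_apply (differentiableAt_const Z)),
    fderiv_clm_apply_const hd, fderiv_clm_apply_const hd] at this

theorem christoffel_symm (hg : IsMetricOn U g) (hx : x ∈ U) (X Y : F) :
    christoffel g x X Y = christoffel g x Y X := by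
  refine hg.ext hx fun Z => ?_
  rw [hg.christoffel_inner hx, hg.christoffel_inner hx, hg.fderiv_symm hx Z X Y]; ring

/-- The Levi-Civita connection is metric. -/
theorem fderiv_metric (hg : IsMetricOn U g) (hx : x ∈ U) (X Y Z : F) :
    fderiv ℝ g x X Y Z = g x (christoffel g x X Y) Z + g x Y (christoffel g x X Z) := by
  rw [hg.symm x hx Y, hg.christoffel_inner hx, hg.christoffel_inner hx, hg.fderiv_symm hx X Z Y]
  rw [hg.fderiv_symm hx Z X Y, hg.fderiv_symm hx Y X Z, hg.fderiv_symm hx Z Y X]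
  ring

/-- Uniqueness of the Levi-Civita connection at a point. -/
theorem christoffel_unique (hg : IsMetricOn U g) (hx : x ∈ U) (C : F → F → F)
    (hs : ∀ X Y, C X Y = C Y X)
    (hC : ∀ X Y Z, fderiv ℝ g x X Y Z = g x (C X Y) Z + g x Y (C X Z)) (X Y : F) :
    christoffel g x X Y = C X Y := by
  refine hg.ext hx fun Z => ?_
  -- Koszul's formula: with `hC` inserted for the three derivatives, the symmetry of `C` cancels all
  -- but `C X Y`.
  rw [hg.christoffel_inner hx, hC X Y Z, hC Y X Z, hC Z X Y, hs Y X, hs Z X, hs Z Y,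
    hg.symm x hx X (C Y Z), hg.symm x hx (C X Z) Y, hg.symm x hx (C Y Z) X]
  have := hg.symm x hx X (C Y Z)
  rw [this]; ring

theorem smoothAt_christoffel (hg : IsMetricOn U g) (hx : x ∈ U) :
    ContDiffAt ℝ ∞ (christoffel g) x := by
  have h1 := smoothAt_fderiv (hg.smoothAt hx)
  have h2 : ContDiffAt ℝ ∞ (christoffelFirst g) x := by
    unfold christoffelFirst
    have hf : ContDiffAt ℝ ∞ (fun y => (fderiv ℝ g y).flip) x :=
      (ContinuousLinearMap.flipₗᵢ ℝ F F (F →L[ℝ] ℝ)).contDiff.contDiffAt.comp x h1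
    exact ((h1.add hf).sub (contDiffAt_const.clm_comp hf)).const_smul _
  unfold christoffel
  exact ((ContinuousLinearMap.compL ℝ F (F →L[ℝ] ℝ) F).contDiff.contDiffAt.comp x
    (hg.smoothAt_inverse hx)).clm_comp h2

end IsMetricOn

end MetricBasics

/-! ### The pull-back of the Levi-Civita connection by a map -/

section Pullback

variable {N : Type*} [NormedAddCommGroup N] [NormedSpace ℝ N]
variable {F : Type*} [NormedAddCommGroup F] [NormedSpace ℝ F] [FiniteDimensional ℝ F]

/-- The curvature tensor as a continuous multilinear map. -/
def curvEnd (g : F → F →L[ℝ] F →L[ℝ] ℝ) (x : F) : F →L[ℝ] F →L[ℝ] F →L[ℝ] F :=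
  -(fderiv ℝ (christoffel g) x - (fderiv ℝ (christoffel g) x).flip
    + ((ContinuousLinearMap.compL ℝ F F F).bilinearComp (christoffel g x) (christoffel g x)
      - ((ContinuousLinearMap.compL ℝ F F F).bilinearComp
          (christoffel g x) (christoffel g x)).flip))

theorem end_mul_apply (A B : F →L[ℝ] F) (v : F) : (A * B) v = A (B v) := rfl

theorem curvEnd_eq (g : F → F →L[ℝ] F →L[ℝ] ℝ) (x X Y : F) :
    curvEnd g x X Y = -(fderiv ℝ (christoffel g) x X Y - fderiv ℝ (christoffel g) x Y X
      + (christoffel g x X * christoffel g x Y - christoffel g x Y * christoffel g x X)) := rfl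

theorem curvature_eq_curvEnd (g : F → F →L[ℝ] F →L[ℝ] ℝ) (x X Y Z : F) :
    curvature g x X Y Z = curvEnd g x X Y Z := by
  rw [curvEnd_eq]; simp [curvature, add_sub_assoc]

theorem curvEnd_skew (g : F → F →L[ℝ] F →L[ℝ] ℝ) (x X Y : F) :
    curvEnd g x X Y = -curvEnd g x Y X := by
  rw [curvEnd_eq, curvEnd_eq]; abel

theorem IsMetricOn.smoothAt_curvEnd {U : Set F} {g : F → F →L[ℝ] F →L[ℝ] ℝ} {x : F}
    (hg : IsMetricOn U g) (hx : x ∈ U) : ContDiffAt ℝ ∞ (curvEnd g) x := by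
  have h1 := hg.smoothAt_christoffel hx
  have h2 := smoothAt_fderiv h1
  have hf : ContDiffAt ℝ ∞ (fun y => (fderiv ℝ (christoffel g) y).flip) x :=
    (ContinuousLinearMap.flipₗᵢ ℝ F F (F →L[ℝ] F)).contDiff.contDiffAt.comp x h2
  have h3 : ContDiffAt ℝ ∞ (fun y => (ContinuousLinearMap.compL ℝ F F F).bilinearComp
      (christoffel g y) (christoffel g y)) x := by
    have h5 : ContDiffAt ℝ ∞ (fun y => ((ContinuousLinearMap.compL ℝ F F F) ∘L
        christoffel g y).flip) x :=
      (ContinuousLinearMap.flipₗᵢ ℝ F (F →L[ℝ] F) (F →L[ℝ] F)).contDiff.contDiffAt.comp x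
        (contDiffAt_const.clm_comp h1)
    exact (ContinuousLinearMap.flipₗᵢ ℝ F F (F →L[ℝ] F)).contDiff.contDiffAt.comp x
      (h5.clm_comp h1)
  have h4 : ContDiffAt ℝ ∞ (fun y => ((ContinuousLinearMap.compL ℝ F F F).bilinearComp
      (christoffel g y) (christoffel g y)).flip) x :=
    (ContinuousLinearMap.flipₗᵢ ℝ F F (F →L[ℝ] F)).contDiff.contDiffAt.comp x h3
  exact ((h2.sub hf).add (h3.sub h4)).neg

/-- The connection form of the pull-back of the Levi-Civita connection of `g` by `f`. -/
def connForm (g : F → F →L[ℝ] F →L[ℝ] ℝ) (f : N → F) (q a : N) : F →L[ℝ] F :=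
  christoffel g (f q) (fderiv ℝ f q a)

/-- The covariant derivative of the vector field `Y` along `f`. -/
def covVec (g : F → F →L[ℝ] F →L[ℝ] ℝ) (f : N → F) (Y : N → F) (q a : N) : F :=
  fderiv ℝ Y q a + connForm g f q a (Y q)

/-- The covariant derivative of the field of endomorphisms `A` along `f`. -/
def covEnd (g : F → F →L[ℝ] F →L[ℝ] ℝ) (f : N → F) (A : N → F →L[ℝ] F) (q a : N) : F →L[ℝ] F :=
  fderiv ℝ A q a + (connForm g f q a * A q - A q * connForm g f q a)

theorem smoothAt_connForm {U : Set F} {g : F → F →L[ℝ] F →L[ℝ] ℝ} (hg : IsMetricOn U g)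
    {f : N → F} {q : N} (hf : ContDiffAt ℝ ∞ f q) (hq : f q ∈ U) (a : N) :
    ContDiffAt ℝ ∞ (fun y => connForm g f y a) q :=
  ((hg.smoothAt_christoffel hq).comp q hf).clm_apply
    ((smoothAt_fderiv hf).clm_apply contDiffAt_const)

section Leibniz

variable {g : F → F →L[ℝ] F →L[ℝ] ℝ} {f : N → F} {q : N}

theorem covVec_congr {Y Z : N → F} (h : Y =ᶠ[𝓝 q] Z) (a : N) :
    covVec g f Y q a = covVec g f Z q a := by
  rw [covVec, covVec, fderiv_congr_apply h, h.eq_of_nhds]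

theorem covEnd_congr {A B : N → F →L[ℝ] F} (h : A =ᶠ[𝓝 q] B) (a : N) :
    covEnd g f A q a = covEnd g f B q a := by
  rw [covEnd, covEnd, fderiv_congr_apply h, h.eq_of_nhds]

theorem covVec_apply {A : N → F →L[ℝ] F} {Y : N → F} (hA : DifferentiableAt ℝ A q)
    (hY : DifferentiableAt ℝ Y q) (a : N) :
    covVec g f (fun y => A y (Y y)) q a = covEnd g f A q a (Y q) + A q (covVec g f Y q a) := by
  simp only [covVec, covEnd, fderiv_clm_apply_apply hA hY, add_apply,
    sub_apply, end_mul_apply, map_add]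
  abel

theorem covVec_add {Y Z : N → F} (hY : DifferentiableAt ℝ Y q) (hZ : DifferentiableAt ℝ Z q)
    (a : N) : covVec g f (fun y => Y y + Z y) q a = covVec g f Y q a + covVec g f Z q a := by
  simp only [covVec, fderiv_fun_add hY hZ, add_apply, map_add]
  abel

theorem covEnd_add {A B : N → F →L[ℝ] F} (hA : DifferentiableAt ℝ A q)
    (hB : DifferentiableAt ℝ B q) (a : N) :
    covEnd g f (fun y => A y + B y) q a = covEnd g f A q a + covEnd g f B q a := by
  simp only [covEnd, fderiv_fun_add hA hB, add_apply]
  noncomm_ring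

theorem covEnd_sub {A B : N → F →L[ℝ] F} (hA : DifferentiableAt ℝ A q)
    (hB : DifferentiableAt ℝ B q) (a : N) :
    covEnd g f (fun y => A y - B y) q a = covEnd g f A q a - covEnd g f B q a := by
  simp only [covEnd, fderiv_fun_sub hA hB, sub_apply]
  noncomm_ring

theorem covEnd_smul {A : N → F →L[ℝ] F} (hA : DifferentiableAt ℝ A q) (c : ℝ) (a : N) :
    covEnd g f (fun y => c • A y) q a = c • covEnd g f A q a := by
  simp only [covEnd, fderiv_fun_const_smul hA, smul_apply, mul_smul_comm,
    smul_mul_assoc, smul_add, smul_sub]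

theorem covEnd_mul {A B : N → F →L[ℝ] F} (hA : DifferentiableAt ℝ A q)
    (hB : DifferentiableAt ℝ B q) (a : N) :
    covEnd g f (fun y => A y * B y) q a = covEnd g f A q a * B q + A q * covEnd g f B q a := by
  simp only [covEnd, fderiv_end_mul_apply hA hB]
  noncomm_ring

/-- Invariance of `G` under the adjoint action, by cyclicity of the trace. It makes `G` parallel for
every connection form, metric or not. -/
theorem endForm_commutator (w P Q : F →L[ℝ] F) :
    endForm F (w * P - P * w) Q + endForm F P (w * Q - Q * w) = 0 := by
  have e1 : endForm F (w * P - P * w) Q = -(1 / (Module.finrank ℝ F : ℝ)) *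
      (LinearMap.trace ℝ F (w * P * Q : F →L[ℝ] F) -
        LinearMap.trace ℝ F (P * w * Q : F →L[ℝ] F)) := by
    rw [endForm_apply, ← map_sub]; congr 2
  have e2 : endForm F P (w * Q - Q * w) = -(1 / (Module.finrank ℝ F : ℝ)) *
      (LinearMap.trace ℝ F (P * w * Q : F →L[ℝ] F) -
        LinearMap.trace ℝ F (P * Q * w : F →L[ℝ] F)) := by
    rw [endForm_apply, ← map_sub]; congr 2
    ext v; simp
  have e3 : LinearMap.trace ℝ F (P * Q * w : F →L[ℝ] F) =
      LinearMap.trace ℝ F (w * P * Q : F →L[ℝ] F) :=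
    LinearMap.trace_mul_comm ℝ ((P * Q : F →L[ℝ] F) : F →ₗ[ℝ] F) (w : F →ₗ[ℝ] F)
  rw [e1, e2, e3]; ring

theorem endForm_symm (P Q : F →L[ℝ] F) : endForm F P Q = endForm F Q P := by
  rw [endForm_apply, endForm_apply]
  congr 1
  exact LinearMap.trace_mul_comm ℝ (P : F →ₗ[ℝ] F) (Q : F →ₗ[ℝ] F)

theorem fderiv_endForm {A B : N → F →L[ℝ] F} (hA : DifferentiableAt ℝ A q)
    (hB : DifferentiableAt ℝ B q) (a : N) :
    fderiv ℝ (fun y => endForm F (A y) (B y)) q a =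
      endForm F (covEnd g f A q a) (B q) + endForm F (A q) (covEnd g f B q a) := by
  have h := fderiv_bilin_apply (differentiableAt_const (endForm F)) hA hB a
  rw [h]
  have := endForm_commutator (connForm g f q a) (A q) (B q)
  simp only [covEnd, map_add, add_apply, fderiv_fun_const,
    Pi.zero_apply, zero_apply, zero_add]
  linear_combination -this

variable {U : Set F}

theorem fderiv_metric_along (hg : IsMetricOn U g) (hf : DifferentiableAt ℝ f q) (hq : f q ∈ U)
    {Y Z : N → F} (hY : DifferentiableAt ℝ Y q) (hZ : DifferentiableAt ℝ Z q) (a : N) :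
    fderiv ℝ (fun y => g (f y) (Y y) (Z y)) q a =
      g (f q) (covVec g f Y q a) (Z q) + g (f q) (Y q) (covVec g f Z q a) := by
  have hgd := smoothAt_diff (hg.smoothAt hq)
  rw [fderiv_bilin_apply (b := fun y => g (f y)) (hgd.comp q hf) hY hZ,
    fderiv_comp_apply hgd hf, hg.fderiv_metric hq]
  simp only [covVec, connForm, map_add, add_apply]
  ring

/-- The covariant derivative of a skew-symmetric endomorphism is skew-symmetric. -/
theorem covEnd_skew (hg : IsMetricOn U g) (hfd : DifferentiableAt ℝ f q)
    (hq : f q ∈ U) {A : N → F →L[ℝ] F} (hA : DifferentiableAt ℝ A q)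
    (h : ∀ᶠ y in 𝓝 q, ∀ v w, g (f y) (A y v) w = -g (f y) v (A y w)) (a : N) (v w : F) :
    g (f q) (covEnd g f A q a v) w = -g (f q) v (covEnd g f A q a w) := by
  have hv := differentiableAt_const (𝕜 := ℝ) (E := N) (x := q) v
  have hw := differentiableAt_const (𝕜 := ℝ) (E := N) (x := q) w
  have e : (fun y => g (f y) (A y v) w) =ᶠ[𝓝 q] fun y => -g (f y) v (A y w) := by
    filter_upwards [h] with y hy using hy v w
  have h1 := fderiv_congr_apply e a
  rw [fderiv_fun_neg, neg_apply,
    fderiv_metric_along hg hfd hq (hA.clm_apply hv) hw,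
    fderiv_metric_along hg hfd hq hv (hA.clm_apply hw), covVec_apply hA hv,
    covVec_apply hA hw] at h1
  have h2 := h.self_of_nhds
  simp only [map_add, add_apply, h2] at h1
  linarith

end Leibniz

section Ricci

variable {U : Set F} {g : F → F →L[ℝ] F →L[ℝ] ℝ} {f : N → F} {q : N}

theorem fderiv_connForm (hg : IsMetricOn U g) (hf : ContDiffAt ℝ ∞ f q) (hq : f q ∈ U) (a b : N) :
    fderiv ℝ (fun y => connForm g f y b) q a =
      fderiv ℝ (christoffel g) (f q) (fderiv ℝ f q a) (fderiv ℝ f q b)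
        + christoffel g (f q) (fderiv ℝ (fderiv ℝ f) q a b) := by
  have h1 := smoothAt_diff (hg.smoothAt_christoffel hq)
  have h2 := smoothAt_diff hf
  have h3 := smoothAt_diff (smoothAt_fderiv hf)
  unfold connForm
  rw [fderiv_clm_apply_apply (c := fun y => christoffel g (f y)) (h1.comp q h2)
    (h3.clm_apply (differentiableAt_const b)), fderiv_comp_apply h1 h2, fderiv_clm_apply_const h3]

/-- Cartan's structure equation for the pulled-back connection. The second derivatives of `f` cancel
by symmetry; the minus sign is the sign convention of `curvature`. -/
theorem curvature_connForm (hg : IsMetricOn U g) (hf : ContDiffAt ℝ ∞ f q) (hq : f q ∈ U)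
    (a b : N) :
    fderiv ℝ (fun y => connForm g f y b) q a - fderiv ℝ (fun y => connForm g f y a) q b
      + (connForm g f q a * connForm g f q b - connForm g f q b * connForm g f q a) =
      -curvEnd g (f q) (fderiv ℝ f q a) (fderiv ℝ f q b) := by
  rw [fderiv_connForm hg hf hq, fderiv_connForm hg hf hq, fderiv_fderiv_symm hf a b, curvEnd_eq]
  simp only [connForm]; abel

theorem smoothAt_covVec (hg : IsMetricOn U g) (hf : ContDiffAt ℝ ∞ f q) (hq : f q ∈ U)
    {Y : N → F} (hY : ContDiffAt ℝ ∞ Y q) (a : N) :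
    ContDiffAt ℝ ∞ (fun y => covVec g f Y y a) q :=
  ((smoothAt_fderiv hY).clm_apply contDiffAt_const).add
    ((smoothAt_connForm hg hf hq a).clm_apply hY)

theorem smoothAt_covEnd (hg : IsMetricOn U g) (hf : ContDiffAt ℝ ∞ f q) (hq : f q ∈ U)
    {A : N → F →L[ℝ] F} (hA : ContDiffAt ℝ ∞ A q) (a : N) :
    ContDiffAt ℝ ∞ (fun y => covEnd g f A y a) q :=
  ((smoothAt_fderiv hA).clm_apply contDiffAt_const).add
    (((smoothAt_connForm hg hf hq a).clm_comp hA).sub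
      (hA.clm_comp (smoothAt_connForm hg hf hq a)))

/-- The Ricci identity for vector fields along a map. -/
theorem covVec_comm (hg : IsMetricOn U g) (hf : ContDiffAt ℝ ∞ f q) (hq : f q ∈ U)
    {Y : N → F} (hY : ContDiffAt ℝ ∞ Y q) (a b : N) :
    covVec g f (fun y => covVec g f Y y b) q a - covVec g f (fun y => covVec g f Y y a) q b =
      -curvEnd g (f q) (fderiv ℝ f q a) (fderiv ℝ f q b) (Y q) := by
  have e : ∀ a b, fderiv ℝ (fun y => covVec g f Y y b) q a =
      fderiv ℝ (fderiv ℝ Y) q a b + (fderiv ℝ (fun y => connForm g f y b) q a (Y q)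
        + connForm g f q b (fderiv ℝ Y q a)) := by
    intro a b
    unfold covVec
    have h1 := smoothAt_diff (smoothAt_connForm hg hf hq b)
    have h2 := smoothAt_diff (smoothAt_fderiv hY)
    rw [fderiv_fun_add (h2.clm_apply (differentiableAt_const b)) (h1.clm_apply (smoothAt_diff hY)),
      add_apply, fderiv_clm_apply_const h2,
      fderiv_clm_apply_apply h1 (smoothAt_diff hY)]
  rw [← neg_apply, ← curvature_connForm hg hf hq]
  have E : ∀ a b, covVec g f (fun y => covVec g f Y y b) q a =
      fderiv ℝ (fun y => covVec g f Y y b) q a + connForm g f q a (covVec g f Y q b) :=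
    fun _ _ => rfl
  rw [E a b, E b a, e a b, e b a, fderiv_fderiv_symm hY a b]
  simp only [covVec, map_add, add_apply, sub_apply,
    end_mul_apply]
  abel

/-- The Ricci identity for fields of endomorphisms along a map. -/
theorem covEnd_comm (hg : IsMetricOn U g) (hf : ContDiffAt ℝ ∞ f q) (hq : f q ∈ U)
    {A : N → F →L[ℝ] F} (hA : ContDiffAt ℝ ∞ A q) (a b : N) :
    covEnd g f (fun y => covEnd g f A y b) q a - covEnd g f (fun y => covEnd g f A y a) q b =
      -(curvEnd g (f q) (fderiv ℝ f q a) (fderiv ℝ f q b) * A q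
        - A q * curvEnd g (f q) (fderiv ℝ f q a) (fderiv ℝ f q b)) := by
  have e : ∀ a b, fderiv ℝ (fun y => covEnd g f A y b) q a =
      fderiv ℝ (fderiv ℝ A) q a b + ((fderiv ℝ (fun y => connForm g f y b) q a * A q
        + connForm g f q b * fderiv ℝ A q a) - (fderiv ℝ A q a * connForm g f q b
        + A q * fderiv ℝ (fun y => connForm g f y b) q a)) := by
    intro a b
    unfold covEnd
    have h1 := smoothAt_diff (smoothAt_connForm hg hf hq b)
    have h2 := smoothAt_diff (smoothAt_fderiv hA)
    have h3 := smoothAt_diff hA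
    have h4 : DifferentiableAt ℝ (fun y => connForm g f y b * A y) q := h1.clm_comp h3
    have h5 : DifferentiableAt ℝ (fun y => A y * connForm g f y b) q := h3.clm_comp h1
    rw [fderiv_fun_add (h2.clm_apply (differentiableAt_const b)) (h4.fun_sub h5),
      add_apply, fderiv_clm_apply_const h2, fderiv_fun_sub h4 h5,
      sub_apply, fderiv_end_mul_apply h1 h3, fderiv_end_mul_apply h3 h1]
  have hc := curvature_connForm hg hf hq a b
  have hR : curvEnd g (f q) (fderiv ℝ f q a) (fderiv ℝ f q b) =
      -(fderiv ℝ (fun y => connForm g f y b) q a - fderiv ℝ (fun y => connForm g f y a) q b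
      + (connForm g f q a * connForm g f q b - connForm g f q b * connForm g f q a)) := by
    rw [hc, neg_neg]
  have E : ∀ a b, covEnd g f (fun y => covEnd g f A y b) q a =
      fderiv ℝ (fun y => covEnd g f A y b) q a + (connForm g f q a * covEnd g f A q b
        - covEnd g f A q b * connForm g f q a) := fun _ _ => rfl
  rw [hR, E a b, E b a, e a b, e b a, fderiv_fderiv_symm hA a b]
  simp only [covEnd]
  noncomm_ring

/-- Absence of torsion, in the form that survives pulling back by a map. -/
theorem covVec_fderiv_symm (hg : IsMetricOn U g) (hf : ContDiffAt ℝ ∞ f q) (hq : f q ∈ U)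
    (a b : N) : covVec g f (fun y => fderiv ℝ f y b) q a =
      covVec g f (fun y => fderiv ℝ f y a) q b := by
  have h := smoothAt_diff (smoothAt_fderiv hf)
  rw [covVec, covVec, fderiv_clm_apply_const h, fderiv_clm_apply_const h,
    fderiv_fderiv_symm hf a b, connForm, connForm, hg.christoffel_symm hq]

end Ricci

end Pullback

/-! ### Identities of the curvature tensor -/

section CurvatureIdentities

variable {F : Type*} [NormedAddCommGroup F] [NormedSpace ℝ F] [FiniteDimensional ℝ F]
variable {U : Set F} {g : F → F →L[ℝ] F →L[ℝ] ℝ} {x : F}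

/-- Ordinary covariant differentiation is covariant differentiation along the identity map, so a
single calculus serves for fields on an open set and for fields along a map. -/
theorem connForm_id (g : F → F →L[ℝ] F →L[ℝ] ℝ) (x X : F) :
    connForm g (fun y => y) x X = christoffel g x X := by simp [connForm]

theorem covVec_const (g : F → F →L[ℝ] F →L[ℝ] ℝ) (x X Z : F) :
    covVec g (fun y => y) (fun _ => Z) x X = christoffel g x X Z := by simp [covVec, connForm_id]

namespace IsMetricOn

/-- The curvature endomorphisms are skew-symmetric. -/
theorem curvEnd_metric (hg : IsMetricOn U g) (hx : x ∈ U) (X Y Z W : F) :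
    g x (curvEnd g x X Y Z) W = -g x Z (curvEnd g x X Y W) := by
  have hid : ∀ y : F, ContDiffAt ℝ ∞ (fun y : F => y) y := fun y => contDiffAt_id
  have hidd : ∀ y : F, DifferentiableAt ℝ (fun y : F => y) y := fun y => differentiableAt_id
  have hc : ∀ (y Z : F), DifferentiableAt ℝ (fun _ : F => Z) y := fun y Z => differentiableAt_const Z
  have hcs : ∀ (y Z : F), ContDiffAt ℝ ∞ (fun _ : F => Z) y := fun y Z => contDiffAt_const
  have hs : ContDiffAt ℝ ∞ (fun y => g y Z W) x :=
    ((hg.smoothAt hx).clm_apply contDiffAt_const).clm_apply contDiffAt_const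
  have hv : ∀ Z Y, DifferentiableAt ℝ (fun y => covVec g (fun y => y) (fun _ => Z) y Y) x :=
    fun Z Y => smoothAt_diff (smoothAt_covVec hg (hid x) hx (hcs x Z) Y)
  -- The second derivative of `g(Z, W)`, for constant `Z` and `W`, is symmetric in `X` and `Y`. The
  -- two mixed terms are exchanged with each other, so antisymmetrizing leaves the Ricci identity
  -- for `Z` and for `W`.
  have key : ∀ X Y, fderiv ℝ (fderiv ℝ (fun y => g y Z W)) x X Y =
      (g x (covVec g (fun y => y) (fun y => covVec g (fun y => y) (fun _ => Z) y Y) x X) W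
      + g x (covVec g (fun y => y) (fun _ => Z) x Y) (covVec g (fun y => y) (fun _ => W) x X))
      + (g x (covVec g (fun y => y) (fun _ => Z) x X) (covVec g (fun y => y) (fun _ => W) x Y)
      + g x Z (covVec g (fun y => y) (fun y => covVec g (fun y => y) (fun _ => W) y Y) x X)) := by
    intro X Y
    rw [← fderiv_clm_apply_const (smoothAt_diff (smoothAt_fderiv hs))]
    have e : (fun y => fderiv ℝ (fun y => g y Z W) y Y) =ᶠ[𝓝 x] fun y =>
        g y (covVec g (fun y => y) (fun _ => Z) y Y) W
        + g y Z (covVec g (fun y => y) (fun _ => W) y Y) := by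
      filter_upwards [hg.isOpen.mem_nhds hx] with y hy
      exact fderiv_metric_along hg (hidd y) hy (hc y Z) (hc y W) Y
    have hgd := smoothAt_diff (hg.smoothAt hx)
    rw [fderiv_congr_apply e, fderiv_fun_add ((hgd.clm_apply (hv Z Y)).clm_apply (hc x W))
      ((hgd.clm_apply (hc x Z)).clm_apply (hv W Y)), add_apply,
      fderiv_metric_along hg (hidd x) hx (hv Z Y) (hc x W) X,
      fderiv_metric_along hg (hidd x) hx (hc x Z) (hv W Y) X]
  have h1 := fderiv_fderiv_symm hs X Y
  rw [key X Y, key Y X] at h1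
  have c1 := covVec_comm hg (hid x) hx (hcs x Z) X Y
  have c2 := covVec_comm hg (hid x) hx (hcs x W) X Y
  simp only [fderiv_fun_id, ContinuousLinearMap.id_apply] at c1 c2
  have d1 := congrArg (fun v => g x v W) c1
  have d2 := congrArg (fun v => g x Z v) c2
  simp only [map_sub, map_neg, sub_apply, neg_apply] at d1 d2
  linarith

theorem fderiv_christoffel_symm (hg : IsMetricOn U g) (hx : x ∈ U) (X Y Z : F) :
    fderiv ℝ (christoffel g) x X Y Z = fderiv ℝ (christoffel g) x X Z Y := by
  have hd := smoothAt_diff (hg.smoothAt_christoffel hx)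
  have h1 : (fun y => christoffel g y Y Z) =ᶠ[𝓝 x] (fun y => christoffel g y Z Y) := by
    filter_upwards [hg.isOpen.mem_nhds hx] with y hy using hg.christoffel_symm hy Y Z
  have := fderiv_congr_apply h1 X
  rwa [fderiv_clm_apply_const (hd.clm_apply (differentiableAt_const Y)),
    fderiv_clm_apply_const (hd.clm_apply (differentiableAt_const Z)),
    fderiv_clm_apply_const hd, fderiv_clm_apply_const hd] at this

/-- The first Bianchi identity. -/
theorem curvEnd_bianchi (hg : IsMetricOn U g) (hx : x ∈ U) (X Y Z : F) :
    curvEnd g x X Y Z + curvEnd g x Y Z X + curvEnd g x Z X Y = 0 := by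
  simp only [curvEnd_eq, neg_apply, add_apply, sub_apply, end_mul_apply]
  rw [hg.fderiv_christoffel_symm hx X Y Z, hg.fderiv_christoffel_symm hx Y Z X,
    hg.fderiv_christoffel_symm hx Z X Y, hg.christoffel_symm hx Y Z, hg.christoffel_symm hx X Z,
    hg.christoffel_symm hx X Y]
  abel

/-- The pair symmetry of the curvature tensor. -/
theorem curvEnd_pair (hg : IsMetricOn U g) (hx : x ∈ U) (X Y Z W : F) :
    g x (curvEnd g x X Y Z) W = g x (curvEnd g x Z W X) Y := by
  have b : ∀ X Y Z W, g x (curvEnd g x X Y Z) W + g x (curvEnd g x Y Z X) W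
      + g x (curvEnd g x Z X Y) W = 0 := fun X Y Z W => by
    have := congrArg (fun v => g x v W) (hg.curvEnd_bianchi hx X Y Z)
    simpa using this
  have s : ∀ X Y Z W, g x (curvEnd g x X Y Z) W = -g x (curvEnd g x X Y W) Z := fun X Y Z W => by
    rw [hg.curvEnd_metric hx, hg.symm x hx]
  have k : ∀ X Y Z W, g x (curvEnd g x X Y Z) W = -g x (curvEnd g x Y X Z) W := fun X Y Z W => by
    rw [curvEnd_skew g x X Y]; simp
  -- The classical octahedron argument: four Bianchi identities, each leaving a different argument
  -- out of the cycle, combine through the two skew-symmetries.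
  have b1 := b X Y Z W
  have b2 := b Y Z W X
  have b3 := b Z W X Y
  have b4 := b W X Y Z
  linarith [s X Y Z W, s Y Z X W, s Z X Y W, s Y Z W X, s Z W Y X, s W Y Z X, s Z W X Y,
    s W X Z Y, s X Z W Y, s W X Y Z, s X Y W Z, s Y W X Z, k X Y Z W, k Y Z X W, k Z X Y W,
    k Y Z W X, k Z W Y X, k W Y Z X, k Z W X Y, k W X Z Y, k X Z W Y, k W X Y Z, k X Y W Z,
    k Y W X Z]

end IsMetricOn

/-- The covariant derivative `(∇_X R)(Y, Z)` of the curvature tensor. -/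
def nablaCurv (g : F → F →L[ℝ] F →L[ℝ] ℝ) (x X Y Z : F) : F →L[ℝ] F :=
  fderiv ℝ (curvEnd g) x X Y Z
    + (christoffel g x X * curvEnd g x Y Z - curvEnd g x Y Z * christoffel g x X)
    - curvEnd g x (christoffel g x X Y) Z - curvEnd g x Y (christoffel g x X Z)

/-- Prepares the second Bianchi identity, which is verified in coordinates as an identity between
the Christoffel symbols and their first two derivatives. -/
theorem IsMetricOn.fderiv_curvEnd (hg : IsMetricOn U g) (hx : x ∈ U) (X Y Z : F) :
    fderiv ℝ (curvEnd g) x X Y Z =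
      -(fderiv ℝ (fderiv ℝ (christoffel g)) x X Y Z - fderiv ℝ (fderiv ℝ (christoffel g)) x X Z Y
      + (fderiv ℝ (christoffel g) x X Y * christoffel g x Z
          + christoffel g x Y * fderiv ℝ (christoffel g) x X Z
        - (fderiv ℝ (christoffel g) x X Z * christoffel g x Y
          + christoffel g x Z * fderiv ℝ (christoffel g) x X Y))) := by
  have hR := smoothAt_diff (hg.smoothAt_curvEnd hx)
  have hG := smoothAt_diff (hg.smoothAt_christoffel hx)
  have hG2 := smoothAt_diff (smoothAt_fderiv (hg.smoothAt_christoffel hx))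
  have hc : ∀ Z : F, DifferentiableAt ℝ (fun _ : F => Z) x := fun Z => differentiableAt_const Z
  have h0 : fderiv ℝ (fun y => curvEnd g y Y Z) x X = fderiv ℝ (curvEnd g) x X Y Z := by
    rw [fderiv_clm_apply_const (hR.clm_apply (hc Y)), fderiv_clm_apply_const hR]
  have hGY : ∀ Y, DifferentiableAt ℝ (fun y => christoffel g y Y) x := fun Y => hG.clm_apply (hc Y)
  have hdG : ∀ Y Z, DifferentiableAt ℝ (fun y => fderiv ℝ (christoffel g) y Y Z) x :=
    fun Y Z => (hG2.clm_apply (hc Y)).clm_apply (hc Z)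
  have hm : ∀ Y Z, DifferentiableAt ℝ (fun y => christoffel g y Y * christoffel g y Z) x :=
    fun Y Z => (hGY Y).clm_comp (hGY Z)
  rw [← h0]
  simp only [curvEnd_eq]
  rw [fderiv_fun_neg, fderiv_fun_add ((hdG Y Z).fun_sub (hdG Z Y)) ((hm Y Z).fun_sub (hm Z Y)),
    fderiv_fun_sub (hdG Y Z) (hdG Z Y), fderiv_fun_sub (hm Y Z) (hm Z Y)]
  simp only [neg_apply, add_apply, sub_apply]
  rw [fderiv_end_mul_apply (hGY Y) (hGY Z), fderiv_end_mul_apply (hGY Z) (hGY Y),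
    fderiv_clm_apply_const (hG2.clm_apply (hc Y)), fderiv_clm_apply_const (hG2.clm_apply (hc Z)),
    fderiv_clm_apply_const hG2, fderiv_clm_apply_const hG2, fderiv_clm_apply_const hG,
    fderiv_clm_apply_const hG]

/-- The second Bianchi identity. -/
theorem IsMetricOn.nablaCurv_bianchi (hg : IsMetricOn U g) (hx : x ∈ U) (X Y Z : F) :
    nablaCurv g x X Y Z + nablaCurv g x Y Z X + nablaCurv g x Z X Y = 0 := by
  have hs := fun X Y => fderiv_fderiv_symm (hg.smoothAt_christoffel hx) X Y
  unfold nablaCurv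
  rw [hg.christoffel_symm hx Y X, hg.christoffel_symm hx Z X, hg.christoffel_symm hx Z Y,
    curvEnd_skew g x Z X, curvEnd_skew g x Z (christoffel g x X Y),
    curvEnd_skew g x X (christoffel g x Y Z),
    curvEnd_skew g x (christoffel g x X Z) Y,
    hg.fderiv_curvEnd hx, hg.fderiv_curvEnd hx, hg.fderiv_curvEnd hx, hs Y X, hs Z X, hs Z Y]
  -- After the curvatures are expanded, the symmetry of the second derivatives and of the
  -- Christoffel symbols has already been used; what is left is a cyclic sum of commutators that
  -- cancels formally.
  have e1 := curvEnd_eq g x X Y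
  have e2 := curvEnd_eq g x Y Z
  have e3 := curvEnd_eq g x X Z
  rw [e1, e2, e3]
  noncomm_ring

theorem nablaCurv_skew (hg : IsMetricOn U g) (hx : x ∈ U) (X Y Z : F) :
    nablaCurv g x X Y Z = -nablaCurv g x X Z Y := by
  unfold nablaCurv
  rw [hg.fderiv_curvEnd hx, hg.fderiv_curvEnd hx, curvEnd_skew g x Z Y,
    curvEnd_skew g x (christoffel g x X Z) Y, curvEnd_skew g x Z (christoffel g x X Y)]
  noncomm_ring

/-! ### The curvature operator -/

/-- The curvature operator on endomorphisms: `g(𝓡(Φ)X, Z) = G(R(X, Z), Φ)`. -/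
def curvOp (g : F → F →L[ℝ] F →L[ℝ] ℝ) (x : F) : (F →L[ℝ] F) →L[ℝ] (F →L[ℝ] F) :=
  (ContinuousLinearMap.compL ℝ F (F →L[ℝ] ℝ) F (g x).inverse) ∘L
    ((ContinuousLinearMap.compL ℝ F (F →L[ℝ] (F →L[ℝ] F)) (F →L[ℝ] ℝ)).flip (curvEnd g x)) ∘L
      (ContinuousLinearMap.compL ℝ F (F →L[ℝ] F) ℝ) ∘L endForm F

theorem IsMetricOn.curvOp_inner (hg : IsMetricOn U g) (hx : x ∈ U) (Φ : F →L[ℝ] F) (X Z : F) :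
    g x (curvOp g x Φ X) Z = endForm F (curvEnd g x X Z) Φ := by
  have : curvOp g x Φ X = (g x).inverse ((endForm F Φ) ∘L (curvEnd g x X)) := rfl
  rw [this, hg.apply_inverse hx, endForm_symm]; rfl

theorem IsMetricOn.smoothAt_curvOp (hg : IsMetricOn U g) (hx : x ∈ U) :
    ContDiffAt ℝ ∞ (curvOp g) x := by
  have h1 := (ContinuousLinearMap.compL ℝ F (F →L[ℝ] ℝ) F).contDiff.contDiffAt.comp x
    (hg.smoothAt_inverse hx)
  have h2 : ContDiffAt ℝ ∞ (fun y => (ContinuousLinearMap.compL ℝ F (F →L[ℝ] (F →L[ℝ] F))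
      (F →L[ℝ] ℝ)).flip (curvEnd g y)) x := contDiffAt_const.clm_apply (hg.smoothAt_curvEnd hx)
  exact h1.clm_comp (h2.clm_comp contDiffAt_const)

theorem IsMetricOn.curvOp_skew (hg : IsMetricOn U g) (hx : x ∈ U) (Φ : F →L[ℝ] F) (X Z : F) :
    g x (curvOp g x Φ X) Z = -g x X (curvOp g x Φ Z) := by
  rw [hg.symm x hx X, hg.curvOp_inner hx, hg.curvOp_inner hx, curvEnd_skew g x X Z]; simp

/-- The covariant derivative of the curvature operator. -/
def nablaOp (g : F → F →L[ℝ] F →L[ℝ] ℝ) (x X : F) (Φ : F →L[ℝ] F) : F →L[ℝ] F :=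
  fderiv ℝ (curvOp g) x X Φ
    + (christoffel g x X * curvOp g x Φ - curvOp g x Φ * christoffel g x X)
    - curvOp g x (christoffel g x X * Φ - Φ * christoffel g x X)

theorem nablaOp_smul (x X : F) (c : ℝ) (Φ : F →L[ℝ] F) :
    nablaOp g x X (c • Φ) = c • nablaOp g x X Φ := by
  simp only [nablaOp, map_smul, mul_smul_comm, smul_mul_assoc, smul_add, smul_sub, map_sub]

/-- The relation defining `curvOp` is differentiated; as `g` and `G` are parallel, only the
derivatives of the curvature remain. This carries the second Bianchi identity over to `nablaOp`. -/
theorem IsMetricOn.nablaOp_inner (hg : IsMetricOn U g) (hx : x ∈ U) (X Y Z : F) (Φ : F →L[ℝ] F) :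
    g x (nablaOp g x X Φ Y) Z = endForm F (nablaCurv g x X Y Z) Φ := by
  have hidd : DifferentiableAt ℝ (fun y : F => y) x := differentiableAt_id
  have hc : ∀ Z : F, DifferentiableAt ℝ (fun _ : F => Z) x := fun Z => differentiableAt_const Z
  have hR := smoothAt_diff (hg.smoothAt_curvEnd hx)
  have hO := smoothAt_diff (hg.smoothAt_curvOp hx)
  have hOP : DifferentiableAt ℝ (fun y => curvOp g y Φ) x :=
    hO.clm_apply (differentiableAt_const Φ)
  have e : (fun y => g y (curvOp g y Φ Y) Z) =ᶠ[𝓝 x] fun y => endForm F (curvEnd g y Y Z) Φ := by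
    filter_upwards [hg.isOpen.mem_nhds hx] with y hy using hg.curvOp_inner hy Φ Y Z
  have h1 := fderiv_congr_apply e X
  have hRYZ : DifferentiableAt ℝ (fun y => curvEnd g y Y Z) x :=
    (hR.clm_apply (hc Y)).clm_apply (hc Z)
  rw [fderiv_metric_along hg hidd hx (hOP.clm_apply (hc Y)) (hc Z) X,
    fderiv_bilin_apply (differentiableAt_const (endForm F)) hRYZ (differentiableAt_const Φ),
    fderiv_clm_apply_const (hR.clm_apply (hc Y)), fderiv_clm_apply_const hR, covVec_const,
    covVec, fderiv_clm_apply_const hOP, fderiv_clm_apply_const hO, connForm_id,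
    hg.curvOp_inner hx] at h1
  have h2 := endForm_commutator (christoffel g x X) (curvEnd g x Y Z) Φ
  simp only [nablaOp, nablaCurv, add_apply, sub_apply, end_mul_apply, map_add, map_sub,
    hg.curvOp_inner hx, fderiv_fun_const, Pi.zero_apply, zero_apply, map_zero] at h1 h2 ⊢
  linarith

theorem covEnd_curvOp {N : Type*} [NormedAddCommGroup N] [NormedSpace ℝ N] {f : N → F} {q : N}
    (hg : IsMetricOn U g) (hf : DifferentiableAt ℝ f q) (hq : f q ∈ U) {A : N → F →L[ℝ] F}
    (hA : DifferentiableAt ℝ A q) (a : N) :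
    covEnd g f (fun y => curvOp g (f y) (A y)) q a =
      nablaOp g (f q) (fderiv ℝ f q a) (A q) + curvOp g (f q) (covEnd g f A q a) := by
  have hO := smoothAt_diff (hg.smoothAt_curvOp hq)
  rw [covEnd, fderiv_clm_apply_apply (c := fun y => curvOp g (f y)) (hO.comp q hf) hA,
    fderiv_comp_apply hO hf]
  simp only [nablaOp, covEnd, connForm, map_add, map_sub]
  abel

end CurvatureIdentities

/-! ### Orthonormal bases and traces -/

section Orthonormal

variable {F : Type*} [NormedAddCommGroup F] [NormedSpace ℝ F] [FiniteDimensional ℝ F]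
variable {b : F →L[ℝ] F →L[ℝ] ℝ}

theorem exists_orthonormal_basis (hs : ∀ v w, b v w = b w v) (hp : ∀ v, v ≠ 0 → 0 < b v v) :
    ∃ e : Module.Basis (Fin (Module.finrank ℝ F)) ℝ F,
      ∀ i j, b (e i) (e j) = if i = j then 1 else 0 := by
  let B : LinearMap.BilinForm ℝ F := ContinuousLinearMap.coeLM ℝ ∘ₗ (b : F →ₗ[ℝ] F →L[ℝ] ℝ)
  have hB : ∀ v w, B v w = b v w := fun _ _ => rfl
  obtain ⟨v, hv⟩ := LinearMap.BilinForm.exists_orthogonal_basis (B := B) ⟨fun v w => hs v w⟩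
  have hpos : ∀ i, 0 < b (v i) (v i) := fun i => hp _ (v.ne_zero i)
  refine ⟨v.isUnitSMul (w := fun i => (Real.sqrt (b (v i) (v i)))⁻¹)
    (fun i => (inv_ne_zero (Real.sqrt_pos.2 (hpos i)).ne').isUnit), fun i j => ?_⟩
  simp only [Module.Basis.isUnitSMul_apply, map_smul, smul_apply, smul_eq_mul]
  split_ifs with h
  · subst h
    have := Real.mul_self_sqrt (hpos i).le
    have h2 := (Real.sqrt_pos.2 (hpos i)).ne'
    field_simp
    rw [sq, this]
  · have : b (v i) (v j) = 0 := hv h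
    rw [this]; simp

theorem repr_orthonormal {ι : Type*} [Fintype ι] [DecidableEq ι] {e : Module.Basis ι ℝ F}
    (he : ∀ i j, b (e i) (e j) = if i = j then 1 else 0) (v : F) (i : ι) :
    e.repr v i = b v (e i) := by
  have h := congrArg (fun w => b w (e i)) (e.sum_repr v)
  simp only [map_sum, map_smul, sum_apply, smul_apply, he, smul_eq_mul, mul_ite, mul_one, mul_zero,
    Finset.sum_ite_eq', Finset.mem_univ, if_true] at h
  exact h

theorem trace_orthonormal {ι : Type*} [Fintype ι] [DecidableEq ι] {e : Module.Basis ι ℝ F}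
    (he : ∀ i j, b (e i) (e j) = if i = j then 1 else 0) (A : F →L[ℝ] F) :
    LinearMap.trace ℝ F (A : F →ₗ[ℝ] F) = ∑ i, b (A (e i)) (e i) := by
  rw [LinearMap.trace_eq_matrix_trace ℝ e, Matrix.trace]
  refine Finset.sum_congr rfl fun i _ => ?_
  rw [Matrix.diag_apply, LinearMap.toMatrix_apply, repr_orthonormal he]; rfl

/-- For skew `V`, the number `-Trace V²` is the sum of the squared lengths of the vectors `V (e i)`.
-/
theorem endForm_pos (hs : ∀ v w, b v w = b w v) (hp : ∀ v, v ≠ 0 → 0 < b v v) {V : F →L[ℝ] F}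
    (hV : ∀ v w, b (V v) w = -b v (V w)) (h0 : V ≠ 0) : 0 < endForm F V V := by
  obtain ⟨e, he⟩ := exists_orthonormal_basis hs hp
  have hnn : ∀ v, 0 ≤ b v v := fun v => by
    by_cases h : v = 0
    · simp [h]
    · exact (hp v h).le
  rw [endForm_apply, trace_orthonormal he]
  have e1 : ∀ i, b ((V ∘L V) (e i)) (e i) = -b (V (e i)) (V (e i)) := fun i => hV _ _
  simp only [e1, Finset.sum_neg_distrib, neg_mul_neg]
  obtain ⟨i, hi⟩ : ∃ i, V (e i) ≠ 0 := by
    by_contra! h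
    exact h0 (ContinuousLinearMap.coe_injective (e.ext fun i => h i))
  have hn : 0 < (Module.finrank ℝ F : ℝ) := by
    have := i.pos; exact_mod_cast this
  refine mul_pos (by positivity) ?_
  exact Finset.sum_pos' (fun j _ => hnn _) ⟨i, Finset.mem_univ i, hp _ hi⟩

end Orthonormal

/-! ### The Levi-Civita connection of the twistor space -/

section TwistorConnection

variable {N : Type*} [NormedAddCommGroup N] [NormedSpace ℝ N] [FiniteDimensional ℝ N]
variable {F : Type*} [NormedAddCommGroup F] [NormedSpace ℝ F] [FiniteDimensional ℝ F]

/-- The vertical space at `(x, I)`: the skew-symmetric endomorphisms that anti-commute with `I`. -/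
structure IsVertical (b : F →L[ℝ] F →L[ℝ] ℝ) (I V : F →L[ℝ] F) : Prop where
  anti : V * I = -(I * V)
  skew : ∀ v w, b (V v) w = -b v (V w)

theorem anticommute_mul_comm {I A B : F →L[ℝ] F} (hA : A * I = -(I * A)) (hB : B * I = -(I * B)) :
    (A * B + B * A) * I = I * (A * B + B * A) := by
  rw [add_mul, mul_assoc, mul_assoc, hB, hA, mul_neg, mul_neg, ← mul_assoc, ← mul_assoc, hA, hB,
    mul_add, neg_mul, neg_mul, neg_neg, neg_neg, mul_assoc, mul_assoc]

/-- The horizontal component of the differential of `φ`, projected to the base. -/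
def horiz (φ : N → F × (F →L[ℝ] F)) (q : N) : N →L[ℝ] F :=
  ContinuousLinearMap.fst ℝ F (F →L[ℝ] F) ∘L fderiv ℝ φ q

/-- The vertical component of the differential of `φ`. -/
def vert (g : F → F →L[ℝ] F →L[ℝ] ℝ) (φ : N → F × (F →L[ℝ] F)) (q : N) : N →L[ℝ] (F →L[ℝ] F) :=
  verticalPart g (φ q) ∘L fderiv ℝ φ q

/-- `φ` is an immersion of the open set `Ω` into the twistor space of `(U, g)`. -/
structure IsTwistorMap (U : Set F) (g : F → F →L[ℝ] F →L[ℝ] ℝ) (Ω : Set N)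
    (φ : N → F × (F →L[ℝ] F)) : Prop where
  metric : IsMetricOn U g
  isOpen : IsOpen Ω
  smooth : ContDiffOn ℝ ∞ φ Ω
  mapsTo : Set.MapsTo φ Ω (twistorSet U g)
  inj : ∀ q ∈ Ω, Function.Injective (fderiv ℝ φ q)

/-- `φ` parametrizes smoothly, near the points of `Ω`, an open subset of the twistor space of
`(U, g)`. -/
structure IsTwistorChart (U : Set F) (g : F → F →L[ℝ] F →L[ℝ] ℝ) (Ω : Set N)
    (φ : N → F × (F →L[ℝ] F)) : Prop extends IsTwistorMap U g Ω φ where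
  surj : ∀ q ∈ Ω, ∀ X V, IsVertical (g (φ q).1) (φ q).2 V →
    ∃ a, horiz φ q a = X ∧ vert g φ q a = V

/-- The operator `K_B = (t / 2) 𝓡([I, B])`. -/
def kOp (g : F → F →L[ℝ] F →L[ℝ] ℝ) (t : ℝ) (z : F × (F →L[ℝ] F)) (B : F →L[ℝ] F) : F →L[ℝ] F :=
  (t / 2) • curvOp g z.1 (z.2 * B - B * z.2)

theorem kOp_add (g : F → F →L[ℝ] F →L[ℝ] ℝ) (t : ℝ) (z : F × (F →L[ℝ] F)) (A B : F →L[ℝ] F) :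
    kOp g t z (A + B) = kOp g t z A + kOp g t z B := by
  simp only [kOp, mul_add, add_mul, ← smul_add, ← map_add]; congr 2; abel

theorem kOp_smul (g : F → F →L[ℝ] F →L[ℝ] ℝ) (t : ℝ) (z : F × (F →L[ℝ] F)) (c : ℝ)
    (A : F →L[ℝ] F) : kOp g t z (c • A) = c • kOp g t z A := by
  simp only [kOp, mul_smul_comm, smul_mul_assoc, ← smul_sub, map_smul, smul_comm c]

theorem kOp_zero (g : F → F →L[ℝ] F →L[ℝ] ℝ) (t : ℝ) (z : F × (F →L[ℝ] F)) :
    kOp g t z 0 = 0 := by simp [kOp]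

theorem kOp_sub (g : F → F →L[ℝ] F →L[ℝ] ℝ) (t : ℝ) (z : F × (F →L[ℝ] F)) (A B : F →L[ℝ] F) :
    kOp g t z (A - B) = kOp g t z A - kOp g t z B := by
  rw [sub_eq_add_neg, kOp_add, ← neg_one_smul ℝ B, kOp_smul]; simp [sub_eq_add_neg]

namespace IsTwistorMap

variable {U : Set F} {g : F → F →L[ℝ] F →L[ℝ] ℝ} {Ω : Set N} {φ : N → F × (F →L[ℝ] F)} {q : N}

theorem smoothAt (h : IsTwistorMap U g Ω φ) (hq : q ∈ Ω) : ContDiffAt ℝ ∞ φ q :=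
  h.smooth.contDiffAt (h.isOpen.mem_nhds hq)

theorem smoothAt_fst (h : IsTwistorMap U g Ω φ) (hq : q ∈ Ω) :
    ContDiffAt ℝ ∞ (fun y => (φ y).1) q := contDiffAt_fst.comp q (h.smoothAt hq)

theorem smoothAt_snd (h : IsTwistorMap U g Ω φ) (hq : q ∈ Ω) :
    ContDiffAt ℝ ∞ (fun y => (φ y).2) q := contDiffAt_snd.comp q (h.smoothAt hq)

theorem mem (h : IsTwistorMap U g Ω φ) (hq : q ∈ Ω) : (φ q).1 ∈ U := (h.mapsTo hq).1

theorem eventually_mem (h : IsTwistorMap U g Ω φ) (hq : q ∈ Ω) : ∀ᶠ y in 𝓝 q, y ∈ Ω :=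
  h.isOpen.mem_nhds hq

theorem fderiv_fst (h : IsTwistorMap U g Ω φ) (hq : q ∈ Ω) :
    fderiv ℝ (fun y => (φ y).1) q = horiz φ q :=
  (hasFDerivAt_fst.comp q (smoothAt_diff (h.smoothAt hq)).hasFDerivAt).fderiv

theorem fderiv_snd_apply (h : IsTwistorMap U g Ω φ) (hq : q ∈ Ω) (a : N) :
    fderiv ℝ (fun y => (φ y).2) q a = (fderiv ℝ φ q a).2 :=
  congrArg (fun L => L a)
    (hasFDerivAt_snd.comp q (smoothAt_diff (h.smoothAt hq)).hasFDerivAt).fderiv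

/-- The vertical component is the covariant derivative of `I` along the base map. Hence all
computations on the twistor space are done with the calculus along maps. -/
theorem vert_eq (h : IsTwistorMap U g Ω φ) (hq : q ∈ Ω) (a : N) :
    vert g φ q a = covEnd g (fun y => (φ y).1) (fun y => (φ y).2) q a := by
  rw [covEnd, connForm, h.fderiv_fst hq, h.fderiv_snd_apply hq]
  exact verticalPart_apply g (φ q) (fderiv ℝ φ q a)

theorem smoothAt_horiz (h : IsTwistorMap U g Ω φ) (hq : q ∈ Ω) :
    ContDiffAt ℝ ∞ (horiz φ) q := contDiffAt_const.clm_comp (smoothAt_fderiv (h.smoothAt hq))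

theorem smoothAt_vert (h : IsTwistorMap U g Ω φ) (hq : q ∈ Ω) :
    ContDiffAt ℝ ∞ (vert g φ) q := by
  have h1 : ContDiffAt ℝ ∞ (fun y => (ContinuousLinearMap.compL ℝ F F F).flip (φ y).2) q :=
    contDiffAt_const.clm_apply (h.smoothAt_snd hq)
  have h2 : ContDiffAt ℝ ∞ (fun y => ContinuousLinearMap.compL ℝ F F F (φ y).2) q :=
    contDiffAt_const.clm_apply (h.smoothAt_snd hq)
  have h3 : ContDiffAt ℝ ∞ (fun y => christoffel g (φ y).1) q :=
    ContDiffAt.comp q (g := christoffel g) (h.metric.smoothAt_christoffel (h.mem hq))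
      (h.smoothAt_fst hq)
  exact (contDiffAt_const.add ((h1.sub h2).clm_comp
    (h3.clm_comp contDiffAt_const))).clm_comp (smoothAt_fderiv (h.smoothAt hq))

theorem sq (h : IsTwistorMap U g Ω φ) (hq : q ∈ Ω) : (φ q).2 * (φ q).2 = -1 :=
  ContinuousLinearMap.ext (h.mapsTo hq).2.1

theorem skew (h : IsTwistorMap U g Ω φ) (hq : q ∈ Ω) (v w : F) :
    g (φ q).1 ((φ q).2 v) w = -g (φ q).1 v ((φ q).2 w) := by
  have := (h.mapsTo hq).2.2 v ((φ q).2 w)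
  rw [(h.mapsTo hq).2.1] at this
  rw [← this]; simp

/-- The vertical component of a tangent vector is vertical. -/
theorem isVertical (h : IsTwistorMap U g Ω φ) (hq : q ∈ Ω) (a : N) :
    IsVertical (g (φ q).1) (φ q).2 (vert g φ q a) := by
  have hd := smoothAt_diff (h.smoothAt_snd hq)
  rw [h.vert_eq hq]
  refine ⟨?_, covEnd_skew h.metric (smoothAt_diff (h.smoothAt_fst hq)) (h.mem hq) hd ?_ a⟩
  · have e : (fun y => (φ y).2 * (φ y).2) =ᶠ[𝓝 q] fun _ => (-1 : F →L[ℝ] F) := by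
      filter_upwards [h.eventually_mem hq] with y hy using h.sq hy
    have h1 := covEnd_congr (g := g) (f := fun y => (φ y).1) e a
    rw [covEnd_mul hd hd] at h1
    have h2 : covEnd g (fun y => (φ y).1) (fun _ => (-1 : F →L[ℝ] F)) q a = 0 := by simp [covEnd]
    rw [h2] at h1
    exact eq_neg_of_add_eq_zero_left h1
  · filter_upwards [h.eventually_mem hq] with y hy using h.skew hy

theorem eq_of_horiz_vert (h : IsTwistorMap U g Ω φ) (hq : q ∈ Ω) {a b : N}
    (h1 : horiz φ q a = horiz φ q b) (h2 : vert g φ q a = vert g φ q b) : a = b := by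
  refine h.inj q hq (Prod.ext h1 ?_)
  have e : ∀ a, (fderiv ℝ φ q a).2 = vert g φ q a - (christoffel g (φ q).1 (horiz φ q a) ∘L (φ q).2
      - (φ q).2 ∘L christoffel g (φ q).1 (horiz φ q a)) := fun a =>
    eq_sub_of_add_eq (verticalPart_apply g (φ q) (fderiv ℝ φ q a)).symm
  rw [e a, e b, h1, h2]

end IsTwistorMap

namespace IsTwistorChart

variable {U : Set F} {g : F → F →L[ℝ] F →L[ℝ] ℝ} {Ω : Set N} {φ : N → F × (F →L[ℝ] F)} {q : N}

variable {t : ℝ}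

theorem metric_apply (φ : N → F × (F →L[ℝ] F)) (q a b : N) :
    pullbackMetric (twistorMetric g t) φ q a b =
      g (φ q).1 (horiz φ q a) (horiz φ q b) + t * endForm F (vert g φ q a) (vert g φ q b) := by
  rw [pullbackMetric, ContinuousLinearMap.bilinearComp_apply, twistorMetric_apply]; rfl

theorem isMetricOn (h : IsTwistorChart U g Ω φ) (ht : 0 < t) :
    IsMetricOn Ω (pullbackMetric (twistorMetric g t) φ) where
  isOpen := h.isOpen
  smooth := by
    intro q hq
    have e : pullbackMetric (twistorMetric g t) φ = fun q =>
        ((g (φ q).1).bilinearComp (horiz φ q) (horiz φ q)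
        + t • (endForm F).bilinearComp (vert g φ q) (vert g φ q)) := by
      ext q a b
      rw [metric_apply]; simp
    have hb : ∀ {E E' : Type _} [NormedAddCommGroup E] [NormedSpace ℝ E] [NormedAddCommGroup E']
        [NormedSpace ℝ E'] {b : N → E →L[ℝ] E →L[ℝ] ℝ} {L : N → N →L[ℝ] E},
        ContDiffAt ℝ ∞ b q → ContDiffAt ℝ ∞ L q →
        ContDiffAt ℝ ∞ (fun y => (b y).bilinearComp (L y) (L y)) q := by
      intro E E' _ _ _ _ b L hb hL
      have h5 : ContDiffAt ℝ ∞ (fun y => (b y ∘L L y).flip) q :=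
        (ContinuousLinearMap.flipₗᵢ ℝ N E ℝ).contDiff.contDiffAt.comp q (hb.clm_comp hL)
      exact (ContinuousLinearMap.flipₗᵢ ℝ N N ℝ).contDiff.contDiffAt.comp q (h5.clm_comp hL)
    have hgf : ContDiffAt ℝ ∞ (fun y => g (φ y).1) q :=
      (h.metric.smoothAt (h.mem hq)).comp q (h.smoothAt_fst hq)
    rw [e]
    exact ((hb (E' := ℝ) hgf (h.smoothAt_horiz hq)).add
      ((hb (E' := ℝ) contDiffAt_const (h.smoothAt_vert hq)).const_smul t)).contDiffWithinAt
  symm q hq a b := by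
    rw [metric_apply, metric_apply, h.metric.symm _ (h.mem hq), endForm_symm]
  pos q hq a ha := by
    rw [metric_apply]
    have hx := h.mem hq
    -- If the horizontal component vanishes, the injectivity of the differential makes the vertical
    -- one non-zero, and `G` is positive definite on skew endomorphisms.
    by_cases h1 : horiz φ q a = 0
    · have h2 : vert g φ q a ≠ 0 := fun h2 => ha
        (h.eq_of_horiz_vert hq (by simp [h1]) (by simp [h2]))
      have := endForm_pos (h.metric.symm _ hx) (h.metric.pos _ hx) (h.isVertical hq a).skew h2
      rw [h1]; simp; positivity
    · have h3 := h.metric.pos _ hx _ h1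
      have h4 : 0 ≤ endForm F (vert g φ q a) (vert g φ q a) := by
        by_cases h2 : vert g φ q a = 0
        · simp [h2]
        · exact (endForm_pos (h.metric.symm _ hx) (h.metric.pos _ hx) (h.isVertical hq a).skew
            h2).le
      positivity

/-- An endomorphism commuting with `I` is orthogonal to one anti-commuting with `I`. -/
theorem _root_.Twistor.endForm_eq_zero {I P V : F →L[ℝ] F} (hI : I * I = -1) (hP : P * I = I * P)
    (hV : V * I = -(I * V)) : endForm F P V = 0 := by
  -- The invariance of `G` is applied with `V I` because `[I, P] = 0` and `[I, V I] = 2 V`.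
  have h := endForm_commutator I P (V * I)
  have e1 : I * P - P * I = 0 := by rw [hP, sub_self]
  have e2 : I * (V * I) - V * I * I = (2 : ℝ) • V := by
    rw [two_smul, mul_assoc V, hI, hV, mul_neg, ← mul_assoc, hI]; simp
  rw [e1, e2] at h
  simpa using h

section LeviCivita

/-- Both summands of `h_t` are parallel for the pulled-back connection, so the derivative falls on
the horizontal and vertical components only. -/
theorem fderiv_pullback (h : IsTwistorChart U g Ω φ) (ht : 0 < t) (hq : q ∈ Ω) (a b c : N) :
    fderiv ℝ (pullbackMetric (twistorMetric g t) φ) q a b c =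
      g (φ q).1 (covVec g (fun y => (φ y).1) (fun y => horiz φ y b) q a) (horiz φ q c)
      + g (φ q).1 (horiz φ q b) (covVec g (fun y => (φ y).1) (fun y => horiz φ y c) q a)
      + t * (endForm F (covEnd g (fun y => (φ y).1) (fun y => vert g φ y b) q a) (vert g φ q c)
      + endForm F (vert g φ q b) (covEnd g (fun y => (φ y).1) (fun y => vert g φ y c) q a)) := by
  have hm := smoothAt_diff ((h.isMetricOn ht).smoothAt hq)
  have hf := smoothAt_diff (h.smoothAt_fst hq)
  have hh : ∀ b, DifferentiableAt ℝ (fun y => horiz φ y b) q := fun b =>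
    (smoothAt_diff (h.smoothAt_horiz hq)).clm_apply (differentiableAt_const b)
  have hv : ∀ b, DifferentiableAt ℝ (fun y => vert g φ y b) q := fun b =>
    (smoothAt_diff (h.smoothAt_vert hq)).clm_apply (differentiableAt_const b)
  have hgf : DifferentiableAt ℝ (fun y => g (φ y).1) q :=
    (smoothAt_diff (h.metric.smoothAt (h.mem hq))).comp q hf
  rw [← fderiv_clm_apply_const hm, ← fderiv_clm_apply_const (hm.clm_apply (differentiableAt_const b))]
  simp only [metric_apply]
  have h1 : DifferentiableAt ℝ (fun y => g (φ y).1 (horiz φ y b) (horiz φ y c)) q :=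
    (hgf.clm_apply (hh b)).clm_apply (hh c)
  have h2 : DifferentiableAt ℝ (fun y => endForm F (vert g φ y b) (vert g φ y c)) q :=
    ((differentiableAt_const (endForm F)).clm_apply (hv b)).clm_apply (hv c)
  rw [fderiv_fun_add h1 (h2.const_mul t), add_apply,
    fderiv_metric_along h.metric hf (h.mem hq) (hh b) (hh c), fderiv_const_mul h2, smul_apply,
    fderiv_endForm (g := g) (f := fun y => (φ y).1) (hv b) (hv c), smul_eq_mul]

theorem covVec_horiz_symm (h : IsTwistorChart U g Ω φ) (hq : q ∈ Ω) (a b : N) :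
    covVec g (fun y => (φ y).1) (fun y => horiz φ y b) q a =
      covVec g (fun y => (φ y).1) (fun y => horiz φ y a) q b := by
  have e : ∀ b, (fun y => horiz φ y b) =ᶠ[𝓝 q] fun y => fderiv ℝ (fun y => (φ y).1) y b := by
    intro b
    filter_upwards [h.eventually_mem hq] with y hy using by rw [h.fderiv_fst hy]
  rw [covVec_congr (e b), covVec_congr (e a), covVec_fderiv_symm h.metric (h.smoothAt_fst hq)
    (h.mem hq)]

/-- The vertical component is `∇I`, so its lack of symmetry is the Ricci identity for `I`. This is
the torsion that the Levi-Civita connection of `h_t` has to correct. -/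
theorem covEnd_vert_comm (h : IsTwistorChart U g Ω φ) (hq : q ∈ Ω) (a b : N) :
    covEnd g (fun y => (φ y).1) (fun y => vert g φ y b) q a
      - covEnd g (fun y => (φ y).1) (fun y => vert g φ y a) q b =
      -(curvEnd g (φ q).1 (horiz φ q a) (horiz φ q b) * (φ q).2
        - (φ q).2 * curvEnd g (φ q).1 (horiz φ q a) (horiz φ q b)) := by
  have e : ∀ b, (fun y => vert g φ y b) =ᶠ[𝓝 q]
      fun y => covEnd g (fun y => (φ y).1) (fun y => (φ y).2) y b := by
    intro b
    filter_upwards [h.eventually_mem hq] with y hy using h.vert_eq hy b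
  rw [covEnd_congr (e b), covEnd_congr (e a),
    covEnd_comm h.metric (h.smoothAt_fst hq) (h.mem hq) (h.smoothAt_snd hq), h.fderiv_fst hq]

/-- `K_B` is the metric dual of the pairing of `B` with the torsion `[R(X, Z), I]`, which is how
that torsion enters the horizontal part of Koszul's formula. -/
theorem kOp_inner (h : IsTwistorChart U g Ω φ) (hq : q ∈ Ω) (B : F →L[ℝ] F) (X Z : F) :
    g (φ q).1 (kOp g t (φ q) B X) Z = t / 2 *
      endForm F B (curvEnd g (φ q).1 X Z * (φ q).2 - (φ q).2 * curvEnd g (φ q).1 X Z) := by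
  have h1 := h.metric.curvOp_inner (h.mem hq) ((φ q).2 * B - B * (φ q).2) X Z
  have h2 := endForm_commutator (φ q).2 (curvEnd g (φ q).1 X Z) B
  simp only [kOp, smul_apply, map_smul, smul_eq_mul, h1]
  rw [endForm_symm B]
  have h3 : curvEnd g (φ q).1 X Z * (φ q).2 - (φ q).2 * curvEnd g (φ q).1 X Z =
    -((φ q).2 * curvEnd g (φ q).1 X Z - curvEnd g (φ q).1 X Z * (φ q).2) := by abel
  rw [h3, map_neg, neg_apply]
  linear_combination (t / 2) * h2

theorem kOp_skew (h : IsTwistorChart U g Ω φ) (hq : q ∈ Ω) (B : F →L[ℝ] F) (X Z : F) :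
    g (φ q).1 (kOp g t (φ q) B X) Z = -g (φ q).1 X (kOp g t (φ q) B Z) := by
  simp only [kOp, smul_apply, map_smul, smul_eq_mul, h.metric.curvOp_skew (h.mem hq)]; ring

/-- The vertical part of the difference between the connection of the bundle of endomorphisms and
the Levi-Civita connection of the twistor space. -/
def _root_.Twistor.vertDefect (g : F → F →L[ℝ] F →L[ℝ] ℝ) (φ : N → F × (F →L[ℝ] F)) (q a b : N) :
    F →L[ℝ] F :=
  (1 / 2 : ℝ) • ((vert g φ q a * vert g φ q b + vert g φ q b * vert g φ q a) * (φ q).2)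
    - (1 / 2 : ℝ) • (curvEnd g (φ q).1 (horiz φ q a) (horiz φ q b) * (φ q).2
        - (φ q).2 * curvEnd g (φ q).1 (horiz φ q a) (horiz φ q b))

/-- The horizontal part of this difference. -/
def _root_.Twistor.horizDefect (g : F → F →L[ℝ] F →L[ℝ] ℝ) (t : ℝ) (φ : N → F × (F →L[ℝ] F))
    (q a b : N) : F :=
  kOp g t (φ q) (vert g φ q a) (horiz φ q b) + kOp g t (φ q) (vert g φ q b) (horiz φ q a)

/-- Differentiating `B I + I B = 0` along `a` shows that `∇B` fails to anti-commute with `I` exactly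
by its component `½ (AB + BA) I`, which commutes with `I`. The curvature term `[R, I]` of
`vertDefect` is itself vertical, so subtracting it does no harm. -/
theorem isVertical_covEnd_sub (h : IsTwistorChart U g Ω φ) (hq : q ∈ Ω) (a b : N) :
    IsVertical (g (φ q).1) (φ q).2
      (covEnd g (fun y => (φ y).1) (fun y => vert g φ y b) q a - vertDefect g φ q a b) := by
  have hA := h.isVertical hq a
  have hB := h.isVertical hq b
  have hI := h.sq hq
  have hIs := h.skew hq
  have hRs := h.metric.curvEnd_metric (h.mem hq) (horiz φ q a) (horiz φ q b)
  have hv : DifferentiableAt ℝ (fun y => vert g φ y b) q :=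
    (smoothAt_diff (h.smoothAt_vert hq)).clm_apply (differentiableAt_const b)
  have hnI : covEnd g (fun y => (φ y).1) (fun y => vert g φ y b) q a * (φ q).2
      + vert g φ q b * vert g φ q a = -(vert g φ q a * vert g φ q b
        + (φ q).2 * covEnd g (fun y => (φ y).1) (fun y => vert g φ y b) q a) := by
    have hd := smoothAt_diff (h.smoothAt_snd hq)
    have e : (fun y => vert g φ y b * (φ y).2) =ᶠ[𝓝 q]
        fun y => (-1 : ℝ) • ((φ y).2 * vert g φ y b) := by
      filter_upwards [h.eventually_mem hq] with y hy
      rw [(h.isVertical hy b).anti]; simp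
    have h1 := covEnd_congr (g := g) (f := fun y => (φ y).1) e a
    rw [covEnd_mul hv hd, covEnd_smul (A := fun y => (φ y).2 * vert g φ y b) (hd.clm_comp hv), covEnd_mul hd hv, ← h.vert_eq hq] at h1
    rw [h1, neg_one_smul]
  have hns := covEnd_skew h.metric (smoothAt_diff (h.smoothAt_fst hq)) (h.mem hq) hv
    (by filter_upwards [h.eventually_mem hq] with y hy using (h.isVertical hy b).skew) a
  unfold vertDefect
  set A := vert g φ q a
  set B := vert g φ q b
  set I := (φ q).2
  set n := covEnd g (fun y => (φ y).1) (fun y => vert g φ y b) q a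
  set R := curvEnd g (φ q).1 (horiz φ q a) (horiz φ q b)
  constructor
  · have e1 : n * I = -(A * B + I * n) - B * A := eq_sub_of_add_eq hnI
    have e2 : I * (A * B + B * A) = (A * B + B * A) * I :=
      (anticommute_mul_comm hA.anti hB.anti).symm
    have e3 : (A * B + B * A) * I * I = -(A * B + B * A) := by rw [mul_assoc, hI]; simp
    have e4 : I * ((A * B + B * A) * I) = -(A * B + B * A) := by rw [← mul_assoc, e2, e3]
    have e5 : (R * I - I * R) * I = -(I * (R * I - I * R)) := by
      simp only [sub_mul, mul_sub, mul_assoc, hI]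
      simp only [← mul_assoc, hI]
      simp [sub_eq_add_neg]
    simp only [sub_mul, mul_sub, smul_mul_assoc, mul_smul_comm, e1, e3, e4] at e5 ⊢
    rw [e5]
    module
  · intro v w
    have hA' := hA.skew
    have hB' := hB.skew
    have hABI : ∀ v w, g (φ q).1 (((A * B + B * A) * I) v) w =
        -g (φ q).1 v ((I * (A * B + B * A)) w) := by
      intro v w
      simp only [add_mul, mul_add, add_apply, end_mul_apply, map_add, hA', hB', hIs]
      ring
    have e2 : I * (A * B + B * A) = (A * B + B * A) * I :=
      (anticommute_mul_comm hA.anti hB.anti).symm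
    rw [e2] at hABI
    have hRI : ∀ v w, g (φ q).1 ((R * I - I * R) v) w = -g (φ q).1 v ((R * I - I * R) w) := by
      intro v w
      simp only [sub_apply, end_mul_apply, map_sub, hRs, hIs]
      ring
    simp only [sub_apply, smul_apply, map_sub, map_smul, smul_eq_mul] at hABI hRI ⊢
    rw [hns v w, hABI, hRI]
    ring

/-- The Levi-Civita connection of the twistor space. -/
theorem christoffel_eq (h : IsTwistorChart U g Ω φ) (ht : 0 < t) (hq : q ∈ Ω) (a b : N) :
    horiz φ q (christoffel (pullbackMetric (twistorMetric g t) φ) q a b) =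
        covVec g (fun y => (φ y).1) (fun y => horiz φ y b) q a - horizDefect g t φ q a b ∧
      vert g φ q (christoffel (pullbackMetric (twistorMetric g t) φ) q a b) =
        covEnd g (fun y => (φ y).1) (fun y => vert g φ y b) q a - vertDefect g φ q a b := by
  -- The chart being onto horizontal and vertical vectors, there is a vector with the claimed
  -- components; Koszul's formula then identifies it with the Christoffel symbol.
  obtain ⟨c₀, hc1, hc2⟩ := h.surj q hq
    (covVec g (fun y => (φ y).1) (fun y => horiz φ y b) q a - horizDefect g t φ q a b) _
    (h.isVertical_covEnd_sub hq a b)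
  suffices christoffel (pullbackMetric (twistorMetric g t) φ) q a b = c₀ by
    rw [this]; exact ⟨hc1, hc2⟩
  have hm := h.isMetricOn ht
  refine hm.ext hq fun c => ?_
  rw [hm.christoffel_inner hq, h.fderiv_pullback ht hq, h.fderiv_pullback ht hq,
    h.fderiv_pullback ht hq, metric_apply, hc1, hc2, h.covVec_horiz_symm hq c a,
    h.covVec_horiz_symm hq c b, h.covVec_horiz_symm hq b a]
  have cab := h.covEnd_vert_comm hq a b
  have cac := h.covEnd_vert_comm hq a c
  have cbc := h.covEnd_vert_comm hq b c
  have k1 := h.kOp_inner (t := t) hq (vert g φ q b) (horiz φ q a) (horiz φ q c)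
  have k2 := h.kOp_inner (t := t) hq (vert g φ q a) (horiz φ q b) (horiz φ q c)
  -- The component of `∇B` normal to the fibre is `G`-orthogonal to vertical vectors, so Koszul's
  -- formula does not see it.
  have z : endForm F ((vert g φ q a * vert g φ q b + vert g φ q b * vert g φ q a) * (φ q).2)
      (vert g φ q c) = 0 := by
    refine endForm_eq_zero (h.sq hq) ?_ (h.isVertical hq c).anti
    have c := anticommute_mul_comm (h.isVertical hq a).anti (h.isVertical hq b).anti
    rw [c, mul_assoc, c]
  rw [← neg_eq_iff_eq_neg] at cab cac cbc
  unfold horizDefect vertDefect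
  rw [← cab]
  rw [← cac] at k1
  rw [← cbc] at k2
  have s := h.metric.symm _ (h.mem hq)
  have es := endForm_symm (F := F)
  simp only [map_sub, map_add, map_smul, map_neg, sub_apply, add_apply, smul_apply, neg_apply,
    smul_eq_mul, k1, k2, z]
  rw [s (horiz φ q a) (covVec g (fun y => (φ y).1) (fun y => horiz φ y c) q b),
    s (horiz φ q b) (covVec g (fun y => (φ y).1) (fun y => horiz φ y c) q a)]
  rw [es (covEnd g (fun y => (φ y).1) (fun y => vert g φ y a) q c) (vert g φ q b)]
  ring

/-- The Leibniz rule for the horizontal component. -/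
theorem covVec_horiz (h : IsTwistorChart U g Ω φ) (ht : 0 < t) (hq : q ∈ Ω)
    {v : N → N} (hv : DifferentiableAt ℝ v q) (a : N) :
    covVec g (fun y => (φ y).1) (fun y => horiz φ y (v y)) q a =
      horiz φ q (fderiv ℝ v q a + christoffel (pullbackMetric (twistorMetric g t) φ) q a (v q))
        + horizDefect g t φ q a (v q) := by
  have hh := smoothAt_diff (h.smoothAt_horiz hq)
  rw [map_add, (h.christoffel_eq ht hq a (v q)).1, covVec, covVec, fderiv_clm_apply_apply hh hv,
    fderiv_clm_apply_const hh]
  abel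

/-- The Leibniz rule for the vertical component. -/
theorem covEnd_vert (h : IsTwistorChart U g Ω φ) (ht : 0 < t) (hq : q ∈ Ω)
    {v : N → N} (hv : DifferentiableAt ℝ v q) (a : N) :
    covEnd g (fun y => (φ y).1) (fun y => vert g φ y (v y)) q a =
      vert g φ q (fderiv ℝ v q a + christoffel (pullbackMetric (twistorMetric g t) φ) q a (v q))
        + vertDefect g φ q a (v q) := by
  have hh := smoothAt_diff (h.smoothAt_vert hq)
  rw [map_add, (h.christoffel_eq ht hq a (v q)).2, covEnd, covEnd, fderiv_clm_apply_apply hh hv,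
    fderiv_clm_apply_const hh]
  abel

end LeviCivita

end IsTwistorChart

end TwistorConnection

/-! ### Almost complex structures as maps to the twistor space -/

/-- Eliminating `S` turns `T - S J` into `½ (T + J T J)`, the component of `T` that anti-commutes
with `J`. -/
theorem sub_mul_eq_zero_iff {A : Type*} [Ring A] [Algebra ℝ A] {T S J : A} (hI : J * J = -1)
    (h : T * J + J * T + (2 : ℝ) • S = 0) : T - S * J = 0 ↔ T * J = J * T := by
  have h4 : S = -((1 / 2 : ℝ) • (T * J + J * T)) := by
    have : (2 : ℝ) • S = -(T * J + J * T) := eq_neg_of_add_eq_zero_right h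
    have h5 : S = (1 / 2 : ℝ) • ((2 : ℝ) • S) := by rw [smul_smul]; norm_num
    rw [h5, this, smul_neg]
  have h5 : T - S * J = (1 / 2 : ℝ) • (T + J * T * J) := by
    rw [h4, neg_mul, smul_mul_assoc, add_mul, mul_assoc T, hI, mul_neg, mul_one]
    module
  have h6 : (T + J * T * J) * J = T * J - J * T := by
    rw [add_mul, mul_assoc (J * T), hI, mul_neg, mul_one, sub_eq_add_neg]
  rw [h5]
  constructor
  · intro h7
    have h8 : T + J * T * J = 0 := (smul_eq_zero.1 h7).resolve_left (by norm_num)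
    rw [h8, zero_mul] at h6
    exact (sub_eq_zero.1 h6.symm)
  · intro h7
    have h8 : J * T * J = -T := by rw [← h7, mul_assoc, hI, mul_neg, mul_one]
    rw [h8, add_neg_cancel, smul_zero]

/-! ### Second covariant derivatives of an almost complex structure, and the second fundamental form
of the map it defines. -/

section SecondDerivative

variable {F : Type*} [NormedAddCommGroup F] [NormedSpace ℝ F] [FiniteDimensional ℝ F]
variable {U : Set F} {g : F → F →L[ℝ] F →L[ℝ] ℝ} {x : F}

theorem curvEnd_self (g : F → F →L[ℝ] F →L[ℝ] ℝ) (x X : F) : curvEnd g x X X = 0 := by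
  have h := eq_neg_iff_add_eq_zero.1 (curvEnd_skew g x X X)
  rw [← two_smul ℝ] at h
  exact (smul_eq_zero.1 h).resolve_left two_ne_zero

/-- The covariant derivative of a field of endomorphisms. -/
def nablaEnd (g : F → F →L[ℝ] F →L[ℝ] ℝ) (J : F → F →L[ℝ] F) (x X : F) : F →L[ℝ] F :=
  covEnd g (fun y => y) J x X

/-- The second covariant derivative of a field of endomorphisms. -/
def nablaTwo (g : F → F →L[ℝ] F →L[ℝ] ℝ) (J : F → F →L[ℝ] F) (x X Y : F) : F →L[ℝ] F :=
  covEnd g (fun y => y) (fun y => nablaEnd g J y Y) x X - nablaEnd g J x (christoffel g x X Y)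

theorem nablaEnd_eq (g : F → F →L[ℝ] F →L[ℝ] ℝ) (J : F → F →L[ℝ] F) (x X : F) :
    nablaEnd g J x X = fderiv ℝ J x X + (christoffel g x X * J x - J x * christoffel g x X) := by
  rw [nablaEnd, covEnd, connForm_id]

theorem nablaEnd_add (g : F → F →L[ℝ] F →L[ℝ] ℝ) (J : F → F →L[ℝ] F) (x X Y : F) :
    nablaEnd g J x (X + Y) = nablaEnd g J x X + nablaEnd g J x Y := by
  simp only [nablaEnd_eq, map_add, add_mul, mul_add]; abel

theorem nablaEnd_smul (g : F → F →L[ℝ] F →L[ℝ] ℝ) (J : F → F →L[ℝ] F) (x : F) (c : ℝ) (X : F) :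
    nablaEnd g J x (c • X) = c • nablaEnd g J x X := by
  simp only [nablaEnd_eq, map_smul, smul_mul_assoc, mul_smul_comm, smul_add, smul_sub]

theorem smoothAt_nablaEnd (hg : IsMetricOn U g) (hx : x ∈ U) {J : F → F →L[ℝ] F}
    (hJ : ContDiffAt ℝ ∞ J x) (X : F) : ContDiffAt ℝ ∞ (fun y => nablaEnd g J y X) x :=
  smoothAt_covEnd hg contDiffAt_id hx hJ X

/-- The second covariant derivative as a bilinear map. -/
def nablaTwoBilin (hg : IsMetricOn U g) (hx : x ∈ U) {J : F → F →L[ℝ] F}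
    (hJ : ContDiffAt ℝ ∞ J x) : F →ₗ[ℝ] F →ₗ[ℝ] (F →L[ℝ] F) :=
  LinearMap.mk₂ ℝ (nablaTwo g J x)
    (fun X X' Y => by
      simp only [nablaTwo, covEnd, connForm_id, map_add, add_apply, nablaEnd_add, add_mul, mul_add]
      abel)
    (fun c X Y => by
      simp only [nablaTwo, covEnd, connForm_id, map_smul, smul_apply, nablaEnd_smul,
        smul_mul_assoc, mul_smul_comm, smul_add, smul_sub])
    (fun X Y Y' => by
      have h := fun Y => smoothAt_diff (smoothAt_nablaEnd hg hx hJ Y)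
      simp only [nablaTwo, map_add, nablaEnd_add]
      rw [covEnd_add (h Y) (h Y')]
      abel)
    (fun c X Y => by
      have h := fun Y => smoothAt_diff (smoothAt_nablaEnd hg hx hJ Y)
      simp only [nablaTwo, map_smul, nablaEnd_smul]
      rw [covEnd_smul (h Y), smul_sub])

/-- The difference between the second covariant derivative and the vertical part of the second
fundamental form, as a bilinear map. -/
def defectBilin (g : F → F →L[ℝ] F →L[ℝ] ℝ) (J : F → F →L[ℝ] F) (x : F) :
    F →ₗ[ℝ] F →ₗ[ℝ] (F →L[ℝ] F) :=
  LinearMap.mk₂ ℝ (fun X Y => ((1 / 2 : ℝ) • ((nablaEnd g J x X * nablaEnd g J x Y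
        + nablaEnd g J x Y * nablaEnd g J x X) * J x)
      - (1 / 2 : ℝ) • (curvEnd g x X Y * J x - J x * curvEnd g x X Y)))
    (fun X X' Y => by
      simp only [nablaEnd_add, map_add, add_apply, add_mul, mul_add, smul_add, smul_sub]; abel)
    (fun c X Y => by
      simp only [nablaEnd_smul, map_smul, smul_apply, smul_mul_assoc, mul_smul_comm, ← smul_add,
        ← smul_sub, smul_comm c])
    (fun X X' Y => by
      simp only [nablaEnd_add, map_add, add_mul, mul_add, smul_add, smul_sub]; abel)
    (fun c X Y => by
      simp only [nablaEnd_smul, map_smul, smul_mul_assoc, mul_smul_comm, ← smul_add,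
        ← smul_sub, smul_comm c])

theorem nablaEnd_metric_skew (hg : IsMetricOn U g) (hx : x ∈ U) {J : F → F →L[ℝ] F}
    (hJ : ContDiffAt ℝ ∞ J x) (hs : ∀ᶠ y in 𝓝 x, ∀ v w, g y (J y v) w = -g y v (J y w))
    (X v w : F) : g x (nablaEnd g J x X v) w = -g x v (nablaEnd g J x X w) :=
  covEnd_skew hg differentiableAt_id hx (smoothAt_diff hJ) hs X v w

theorem nablaTwo_metric_skew (hg : IsMetricOn U g) (hx : x ∈ U) {J : F → F →L[ℝ] F}
    (hJ : ∀ᶠ y in 𝓝 x, ContDiffAt ℝ ∞ J y)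
    (hs : ∀ᶠ y in 𝓝 x, ∀ v w, g y (J y v) w = -g y v (J y w))
    (X Y v w : F) : g x (nablaTwo g J x X Y v) w = -g x v (nablaTwo g J x X Y w) := by
  have h1 := covEnd_skew (f := fun y => y) hg differentiableAt_id hx
    (smoothAt_diff (smoothAt_nablaEnd hg hx hJ.self_of_nhds Y)) (by
      filter_upwards [hJ, hs.eventually_nhds, hg.isOpen.mem_nhds hx] with y h1 h2 h3
      exact nablaEnd_metric_skew hg h3 h1 h2 Y) X v w
  have h2 := nablaEnd_metric_skew hg hx hJ.self_of_nhds hs (christoffel g x X Y) v w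
  simp only [nablaTwo, sub_apply, map_sub]
  rw [h1, h2]; ring

/-- The second derivative of the equation `J² = -1`. -/
theorem nablaTwo_anticommute (hg : IsMetricOn U g) (hx : x ∈ U) {J : F → F →L[ℝ] F}
    (hJ : ∀ᶠ y in 𝓝 x, ContDiffAt ℝ ∞ J y) (hs : ∀ᶠ y in 𝓝 x, J y * J y = -1) (X : F) :
    nablaTwo g J x X X * J x + J x * nablaTwo g J x X X
      + (2 : ℝ) • (nablaEnd g J x X * nablaEnd g J x X) = 0 := by
  have hm1 : ∀ y X, covEnd g (fun y => y) (fun _ => (-1 : F →L[ℝ] F)) y X = 0 := by simp [covEnd]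
  have h0 : ∀ᶠ y in 𝓝 x, ∀ X, nablaEnd g J y X * J y + J y * nablaEnd g J y X = 0 := by
    filter_upwards [hJ, hs.eventually_nhds] with y h1 h2 X
    have h3 := covEnd_congr (g := g) (f := fun y => y) (show (fun y => J y * J y) =ᶠ[𝓝 y] _ from h2) X
    rwa [covEnd_mul (smoothAt_diff h1) (smoothAt_diff h1), hm1] at h3
  have hJd := smoothAt_diff hJ.self_of_nhds
  have hn := smoothAt_diff (smoothAt_nablaEnd hg hx hJ.self_of_nhds X)
  have e : (fun y => nablaEnd g J y X * J y + J y * nablaEnd g J y X) =ᶠ[𝓝 x] fun _ => 0 := by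
    filter_upwards [h0] with y hy using hy X
  have h1 := covEnd_congr (g := g) (f := fun y => y) e X
  rw [covEnd_add (A := fun y => nablaEnd g J y X * J y) (B := fun y => J y * nablaEnd g J y X) (hn.clm_comp hJd) (hJd.clm_comp hn),
    covEnd_mul hn hJd, covEnd_mul hJd hn] at h1
  have h2 : covEnd g (fun y => y) (fun _ => (0 : F →L[ℝ] F)) x X = 0 := by simp [covEnd]
  rw [h2] at h1
  have h3 := h0.self_of_nhds (christoffel g x X X)
  rw [nablaTwo, sub_mul, mul_sub]
  change _ * J x + nablaEnd g J x X * nablaEnd g J x X + (nablaEnd g J x X * nablaEnd g J x X + _) = _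
    at h1
  rw [two_smul]
  calc _ = (covEnd g (fun y => y) (fun y => nablaEnd g J y X) x X * J x
        + nablaEnd g J x X * nablaEnd g J x X + (nablaEnd g J x X * nablaEnd g J x X
        + J x * covEnd g (fun y => y) (fun y => nablaEnd g J y X) x X))
        - (nablaEnd g J x (christoffel g x X X) * J x + J x * nablaEnd g J x (christoffel g x X X)) := by
        abel
    _ = 0 := by rw [h1, h3, sub_zero]

variable {D : Type*} [NormedAddCommGroup D] [NormedSpace ℝ D] [FiniteDimensional ℝ D]

/-- The vertical part of the second fundamental form of an almost complex structure. -/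
theorem vert_secondFundamentalForm {t : ℝ} (ht : 0 < t) {J : F → F →L[ℝ] F} {Ω : Set D}
    {Ψ : D → F × (F →L[ℝ] F)} (h : IsTwistorChart U g Ω Ψ) {u : F → D}
    (hu : ContDiffAt ℝ ∞ u x) (hux : u x ∈ Ω) (hJ : ContDiffAt ℝ ∞ J x)
    (he : ∀ᶠ y in 𝓝 x, Ψ (u y) = (y, J y)) (X Y : F) :
    vert g Ψ (u x) (secondFundamentalForm g (pullbackMetric (twistorMetric g t) Ψ) u x X Y) =
      nablaTwo g J x X Y
      - ((1 / 2 : ℝ) • ((nablaEnd g J x X * nablaEnd g J x Y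
            + nablaEnd g J x Y * nablaEnd g J x X) * J x)
        - (1 / 2 : ℝ) • (curvEnd g x X Y * J x - J x * curvEnd g x X Y)) := by
  have hx0 := he.self_of_nhds
  have hx1 : (Ψ (u x)).1 = x := by rw [hx0]
  have hx2 : (Ψ (u x)).2 = J x := by rw [hx0]
  have hΩ : ∀ᶠ y in 𝓝 x, u y ∈ Ω := hu.continuousAt.eventually (h.isOpen.mem_nhds hux)
  have hud : ∀ᶠ y in 𝓝 x, DifferentiableAt ℝ u y := by
    filter_upwards [(hu.of_le (m := 1) (by simp)).eventually (by simp)] with y hy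
    exact hy.differentiableAt (by simp)
  have hJd : ∀ᶠ y in 𝓝 x, DifferentiableAt ℝ J y := by
    filter_upwards [(hJ.of_le (m := 1) (by simp)).eventually (by simp)] with y hy
    exact hy.differentiableAt (by simp)
  -- `u` is the section `y ↦ (y, J y)` read in `Ψ`. Its differential has horizontal component `Y`
  -- and vertical component `∇_Y J`.
  have hd : ∀ᶠ y in 𝓝 x, ∀ Y, fderiv ℝ Ψ (u y) (fderiv ℝ u y Y) = (Y, fderiv ℝ J y Y) := by
    filter_upwards [he.eventually_nhds, hΩ, hud, hJd] with y h1 h2 h3 h4 Y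
    have h5 := fderiv_congr_apply (show (fun y => Ψ (u y)) =ᶠ[𝓝 y] _ from h1) Y
    rw [fderiv_comp_apply (smoothAt_diff (h.smoothAt h2)) h3] at h5
    rw [h5, DifferentiableAt.fderiv_prodMk differentiableAt_fun_id h4]
    simp
  have hh : ∀ᶠ y in 𝓝 x, ∀ Y, horiz Ψ (u y) (fderiv ℝ u y Y) = Y := by
    filter_upwards [hd] with y hy Y
    simp [horiz, hy Y]
  have hv : ∀ᶠ y in 𝓝 x, ∀ Y, vert g Ψ (u y) (fderiv ℝ u y Y) = nablaEnd g J y Y := by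
    filter_upwards [hd, he] with y hy h2 Y
    simp only [vert, ContinuousLinearMap.comp_apply, hy Y, verticalPart_apply, h2]
    rw [nablaEnd_eq]; rfl
  have hvs := smoothAt_diff (h.smoothAt_vert hux)
  have hus := smoothAt_diff hu
  have hus2 := smoothAt_diff (smoothAt_fderiv hu)
  have e : (fun y => vert g Ψ (u y) (fderiv ℝ u y Y)) =ᶠ[𝓝 x] fun y => nablaEnd g J y Y := by
    filter_upwards [hv] with y hy using hy Y
  have h1 := fderiv_congr_apply e X
  rw [fderiv_clm_apply_apply (c := fun y => vert g Ψ (u y)) (hvs.comp x hus)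
    (hus2.clm_apply (differentiableAt_const Y)), fderiv_comp_apply hvs hus,
    fderiv_clm_apply_const hus2] at h1
  have h2 := (h.christoffel_eq ht hux (fderiv ℝ u x X) (fderiv ℝ u x Y)).2
  rw [covEnd, connForm, h.fderiv_fst hux, hh.self_of_nhds, fderiv_clm_apply_const hvs,
    hv.self_of_nhds, vertDefect, hv.self_of_nhds, hv.self_of_nhds, hh.self_of_nhds,
    hh.self_of_nhds, hx1, hx2] at h2
  -- `h1` contains the Hessian of `u` and `h2` the Christoffel symbols of the target. In their sum
  -- the derivative of `vert g Ψ`, which depends on the coordinates, cancels.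
  rw [secondFundamentalForm, map_sub, map_add, h2, hv.self_of_nhds, nablaTwo, covEnd, connForm_id,
    ← h1]
  abel

end SecondDerivative

/-! ### The vertical trace as a commutator with the rough Laplacian. -/

section MetricTrace

variable {n : ℕ} {W : Type*} [AddCommGroup W] [Module ℝ W]

theorem sum_single_coord (v : Coord n) :
    ∑ i, v i • (EuclideanSpace.single i 1 : Coord n) = v := by
  ext j
  simp [Pi.single_apply]

/-- The metric trace is the sum over an orthonormal basis. -/
theorem metricTrace_eq_sum {h : Coord n →L[ℝ] Coord n →L[ℝ] ℝ}
    (hp : ∀ v, v ≠ 0 → 0 < h v v)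
    {ι : Type*} [Fintype ι] [DecidableEq ι] {e : Module.Basis ι ℝ (Coord n)}
    (he : ∀ i j, h (e i) (e j) = if i = j then 1 else 0)
    (L : Coord n →ₗ[ℝ] Coord n →ₗ[ℝ] W) {B : Coord n → Coord n → W} (hB : ∀ v w, B v w = L v w) :
    metricTrace h B = ∑ k, B (e k) (e k) := by
  -- The metric dual of a coordinate functional has, in an orthonormal basis, the values of that
  -- functional as components.
  have hinv : ∀ i : Fin n, h.inverse (EuclideanSpace.proj i) = ∑ k, (e k) i • e k := by
    intro i
    apply (isInvertible_of_pos hp).injective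
    rw [(isInvertible_of_pos hp).self_apply_inverse]
    refine ContinuousLinearMap.coe_injective (e.ext fun j => ?_)
    simp [he]
  simp only [metricTrace, hinv, hB, map_sum, map_smul]
  rw [Finset.sum_comm]
  refine Finset.sum_congr rfl fun k _ => ?_
  have hk := congrArg (fun v => L v (e k)) (sum_single_coord (e k))
  simpa using hk

variable {d : ℕ}

/-- The vertical part of `Trace ∇̃J_*` vanishes if and only if the rough Laplacian of `J` commutes
with `J`. -/
theorem verticalTrace_eq_zero_iff {U : Set (Coord n)} {h : Coord n → Coord n →L[ℝ] Coord n →L[ℝ] ℝ}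
    {x : Coord n} (hx : x ∈ U) {t : ℝ} (ht : 0 < t) {J : Coord n → Coord n →L[ℝ] Coord n}
    {Ω : Set (Coord d)} {Ψ : Coord d → Coord n × (Coord n →L[ℝ] Coord n)}
    (hΨ : IsTwistorChart U h Ω Ψ) {u : Coord n → Coord d}
    (hu : ContDiffAt ℝ ∞ u x) (hux : u x ∈ Ω) (hJ : ∀ᶠ y in 𝓝 x, ContDiffAt ℝ ∞ J y)
    (hJ2 : ∀ᶠ y in 𝓝 x, J y * J y = -1)
    (he : ∀ᶠ y in 𝓝 x, Ψ (u y) = (y, J y))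
    {ι : Type*} [Fintype ι] [DecidableEq ι] {e : Module.Basis ι ℝ (Coord n)}
    (hon : ∀ i j, h x (e i) (e j) = if i = j then 1 else 0) :
    verticalTrace h t Ψ u x = 0 ↔
      (∑ k, nablaTwo h J x (e k) (e k)) * J x = J x * ∑ k, nablaTwo h J x (e k) (e k) := by
  have hm := hΨ.metric
  have hJx := hJ.self_of_nhds
  have h1 : verticalTrace h t Ψ u x = metricTrace (h x) (fun X Y => nablaTwo h J x X Y
      - ((1 / 2 : ℝ) • ((nablaEnd h J x X * nablaEnd h J x Y
            + nablaEnd h J x Y * nablaEnd h J x X) * J x)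
        - (1 / 2 : ℝ) • (curvEnd h x X Y * J x - J x * curvEnd h x X Y))) := by
    have : verticalTrace h t Ψ u x = vert h Ψ (u x) (metricTrace (h x)
      (secondFundamentalForm h (pullbackMetric (twistorMetric h t) Ψ) u x)) := rfl
    rw [this]
    simp only [metricTrace, map_sum, vert_secondFundamentalForm ht hΨ hu hux hJx he]
  have h2 : metricTrace (h x) (fun X Y => nablaTwo h J x X Y
      - ((1 / 2 : ℝ) • ((nablaEnd h J x X * nablaEnd h J x Y
            + nablaEnd h J x Y * nablaEnd h J x X) * J x)
        - (1 / 2 : ℝ) • (curvEnd h x X Y * J x - J x * curvEnd h x X Y))) =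
      ∑ k, nablaTwo h J x (e k) (e k)
        - (∑ k, nablaEnd h J x (e k) * nablaEnd h J x (e k)) * J x := by
    rw [metricTrace_eq_sum (hm.pos x hx) hon
      (nablaTwoBilin hm hx hJx - defectBilin h J x)
      (B := fun X Y => nablaTwo h J x X Y
      - ((1 / 2 : ℝ) • ((nablaEnd h J x X * nablaEnd h J x Y
            + nablaEnd h J x Y * nablaEnd h J x X) * J x)
        - (1 / 2 : ℝ) • (curvEnd h x X Y * J x - J x * curvEnd h x X Y))) (fun v w => rfl),
      Finset.sum_mul, ← Finset.sum_sub_distrib]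
    refine Finset.sum_congr rfl fun k _ => ?_
    -- On the diagonal the curvature term is zero and the symmetrized product is a square.
    rw [curvEnd_self, ← two_smul ℝ]
    simp [smul_smul]
  rw [h1, h2]
  refine sub_mul_eq_zero_iff hJ2.self_of_nhds ?_
  rw [Finset.sum_mul, Finset.mul_sum, Finset.smul_sum, ← Finset.sum_add_distrib,
    ← Finset.sum_add_distrib]
  exact Finset.sum_eq_zero fun k _ => nablaTwo_anticommute hm hx hJ hJ2 (e k)

end MetricTrace

/-! ### The almost complex structures of the twistor space -/

section TwistorStructure

variable {N : Type*} [NormedAddCommGroup N] [NormedSpace ℝ N] [FiniteDimensional ℝ N]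
variable {F : Type*} [NormedAddCommGroup F] [NormedSpace ℝ F] [FiniteDimensional ℝ F]

theorem smoothAt_bilinearComp {E E' G : Type*} [NormedAddCommGroup E] [NormedSpace ℝ E]
    [NormedAddCommGroup E'] [NormedSpace ℝ E'] [NormedAddCommGroup G] [NormedSpace ℝ G]
    {b : N → E →L[ℝ] E' →L[ℝ] G} {L : N → N →L[ℝ] E} {L' : N → N →L[ℝ] E'} {q : N}
    (hb : ContDiffAt ℝ ∞ b q) (hL : ContDiffAt ℝ ∞ L q) (hL' : ContDiffAt ℝ ∞ L' q) :
    ContDiffAt ℝ ∞ (fun y => (b y).bilinearComp (L y) (L' y)) q := by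
  have h5 : ContDiffAt ℝ ∞ (fun y => (b y ∘L L y).flip) q :=
    (ContinuousLinearMap.flipₗᵢ ℝ N E' G).contDiff.contDiffAt.comp q (hb.clm_comp hL)
  exact (ContinuousLinearMap.flipₗᵢ ℝ N N G).contDiff.contDiffAt.comp q (h5.clm_comp hL')

/-- `J` is the almost complex structure of the twistor space in the coordinates `φ`, equal to the
lift of `I` on horizontal vectors and to `V ↦ ε I ∘ V` on vertical ones. -/
structure IsTwistorACS (g : F → F →L[ℝ] F →L[ℝ] ℝ) (ε : ℝ) (Ω : Set N)
    (φ : N → F × (F →L[ℝ] F)) (J : N → N →L[ℝ] N) : Prop where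
  horiz_apply : ∀ q ∈ Ω, ∀ a, horiz φ q (J q a) = (φ q).2 (horiz φ q a)
  vert_apply : ∀ q ∈ Ω, ∀ a, vert g φ q (J q a) = ε • ((φ q).2 * vert g φ q a)

/-- The operator `Q_A = A + [I, K_A]`. -/
def qOp (g : F → F →L[ℝ] F →L[ℝ] ℝ) (t : ℝ) (z : F × (F →L[ℝ] F)) (A : F →L[ℝ] F) : F →L[ℝ] F :=
  A + (z.2 * kOp g t z A - kOp g t z A * z.2)

/-- The operator `L_B = I ∘ K_B - ε K_{IB}`. -/
def lOp (g : F → F →L[ℝ] F →L[ℝ] ℝ) (t ε : ℝ) (z : F × (F →L[ℝ] F)) (B : F →L[ℝ] F) :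
    F →L[ℝ] F :=
  z.2 * kOp g t z B - ε • kOp g t z (z.2 * B)

/-- The operator `C(X, Y) = ½ [R(X, IY), I] - ½ ε I ∘ [R(X, Y), I]`. -/
def cOp (g : F → F →L[ℝ] F →L[ℝ] ℝ) (ε : ℝ) (z : F × (F →L[ℝ] F)) (X Y : F) : F →L[ℝ] F :=
  (1 / 2 : ℝ) • (curvEnd g z.1 X (z.2 Y) * z.2 - z.2 * curvEnd g z.1 X (z.2 Y))
    - (ε / 2) • (z.2 * (curvEnd g z.1 X Y * z.2 - z.2 * curvEnd g z.1 X Y))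

/-- The part of the derivative of `K_B` that comes from the derivatives of the curvature and
of `I`. -/
def dkOp (g : F → F →L[ℝ] F →L[ℝ] ℝ) (t : ℝ) (z : F × (F →L[ℝ] F)) (X : F) (A B : F →L[ℝ] F) :
    F →L[ℝ] F :=
  (t / 2) • (nablaOp g z.1 X (z.2 * B - B * z.2) + curvOp g z.1 (A * B - B * A))

variable {g : F → F →L[ℝ] F →L[ℝ] ℝ} {z : F × (F →L[ℝ] F)}

theorem qOp_add (t : ℝ) (A B : F →L[ℝ] F) : qOp g t z (A + B) = qOp g t z A + qOp g t z B := by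
  simp only [qOp, kOp_add, mul_add, add_mul]; abel

theorem lOp_add (t ε : ℝ) (A B : F →L[ℝ] F) :
    lOp g t ε z (A + B) = lOp g t ε z A + lOp g t ε z B := by
  simp only [lOp, kOp_add, mul_add, smul_add]; abel

theorem endForm_mul_left (A B I : F →L[ℝ] F) (hA : A * I = -(I * A)) :
    endForm F (I * A) B = -endForm F A (I * B) := by
  have e1 : endForm F (I * A) B = -endForm F (A * I) B := by rw [hA]; simp
  have e2 : endForm F (A * I) B = endForm F A (I * B) := by
    rw [endForm_apply, endForm_apply]; rfl
  rw [e1, e2]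

/-- The terms quadratic in `A` and `B` add up to `½ ε [A, B]` on either side of the subtraction and
cancel for every `ε`. The fibre alone thus contributes nothing to `∇𝒥`; only curvature does. -/
theorem vert_algebra {ε : ℝ} {I A B R R' : F →L[ℝ] F} (hI : I * I = -1) (hA : A * I = -(I * A))
    (hB : B * I = -(I * B)) :
    ε • (A * B + I * ((1 / 2 : ℝ) • ((A * B + B * A) * I) - (1 / 2 : ℝ) • (R * I - I * R)))
      - ((1 / 2 : ℝ) • ((A * (ε • (I * B)) + ε • (I * B) * A) * I)
        - (1 / 2 : ℝ) • (R' * I - I * R')) =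
      (1 / 2 : ℝ) • (R' * I - I * R') - (ε / 2) • (I * (R * I - I * R)) := by
  have c := anticommute_mul_comm hA hB
  have e1 : I * ((A * B + B * A) * I) = -(A * B + B * A) := by
    rw [c, ← mul_assoc, hI, neg_one_mul]
  have e2 : A * (I * B) * I = A * B := by
    rw [mul_assoc, mul_assoc, hB, mul_neg, ← mul_assoc I, hI]; simp
  have e3 : I * B * A * I = -(B * A) := by
    rw [mul_assoc, hA, mul_assoc I, mul_neg, mul_neg, ← mul_assoc B, hB, neg_mul, mul_neg, neg_neg,
      ← mul_assoc, ← mul_assoc, hI]; simp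
  have e4 : (A * (ε • (I * B)) + ε • (I * B) * A) * I = ε • (A * B - B * A) := by
    rw [mul_smul_comm, smul_mul_assoc, ← smul_add, smul_mul_assoc, add_mul, e2, e3, sub_eq_add_neg]
  rw [e4, mul_sub, mul_smul_comm, mul_smul_comm, e1]
  module

namespace IsTwistorChart

variable {U : Set F} {Ω : Set N} {φ : N → F × (F →L[ℝ] F)} {q : N} {t ε : ℝ}

/-- The bilinear form `(a, b) ↦ h_t(𝒥 a, b)`. -/
def _root_.Twistor.acsForm (g : F → F →L[ℝ] F →L[ℝ] ℝ) (t ε : ℝ) (φ : N → F × (F →L[ℝ] F)) (q : N) :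
    N →L[ℝ] N →L[ℝ] ℝ :=
  (g (φ q).1).bilinearComp ((φ q).2 ∘L horiz φ q) (horiz φ q)
    + t • (endForm F).bilinearComp
        (ε • ((ContinuousLinearMap.compL ℝ F F F (φ q).2) ∘L vert g φ q)) (vert g φ q)

/-- The almost complex structure of the twistor space in coordinates. -/
def _root_.Twistor.acs (g : F → F →L[ℝ] F →L[ℝ] ℝ) (t ε : ℝ) (φ : N → F × (F →L[ℝ] F)) (q : N) :
    N →L[ℝ] N :=
  (pullbackMetric (twistorMetric g t) φ q).inverse ∘L acsForm g t ε φ q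

theorem isVertical_mul (h : IsTwistorChart U g Ω φ) (hq : q ∈ Ω) {V : F →L[ℝ] F} (c : ℝ)
    (hV : IsVertical (g (φ q).1) (φ q).2 V) :
    IsVertical (g (φ q).1) (φ q).2 (c • ((φ q).2 * V)) := by
  constructor
  · rw [smul_mul_assoc, mul_assoc, hV.anti, mul_neg, mul_smul_comm, smul_neg]
  · intro v w
    have h1 : (φ q).2 (V w) = -V ((φ q).2 w) := by
      have := congrArg (fun L => L w) hV.anti
      simp only [end_mul_apply, neg_apply] at this
      rw [this, neg_neg]
    simp only [smul_apply, end_mul_apply, map_smul, smul_eq_mul]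
    rw [h.skew hq, hV.skew, h1, map_neg]
    ring

theorem smoothAt_acs (h : IsTwistorChart U g Ω φ) (ht : 0 < t) (hq : q ∈ Ω) :
    ContDiffAt ℝ ∞ (acs g t ε φ) q := by
  have hgf : ContDiffAt ℝ ∞ (fun y => g (φ y).1) q :=
    (h.metric.smoothAt (h.mem hq)).comp q (h.smoothAt_fst hq)
  have h1 : ContDiffAt ℝ ∞ (fun y => ContinuousLinearMap.compL ℝ F F F (φ y).2) q :=
    contDiffAt_const.clm_apply (h.smoothAt_snd hq)
  exact ((h.isMetricOn ht).smoothAt_inverse hq).clm_comp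
    ((smoothAt_bilinearComp hgf ((h.smoothAt_snd hq).clm_comp (h.smoothAt_horiz hq))
      (h.smoothAt_horiz hq)).add ((smoothAt_bilinearComp contDiffAt_const
        ((h1.clm_comp (h.smoothAt_vert hq)).const_smul ε) (h.smoothAt_vert hq)).const_smul t))

theorem isTwistorACS_acs (h : IsTwistorChart U g Ω φ) (ht : 0 < t) :
    IsTwistorACS g ε Ω φ (acs g t ε φ) := by
  have key : ∀ q ∈ Ω, ∀ a, horiz φ q (acs g t ε φ q a) = (φ q).2 (horiz φ q a) ∧
      vert g φ q (acs g t ε φ q a) = ε • ((φ q).2 * vert g φ q a) := by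
    intro q hq a
    obtain ⟨c, hc1, hc2⟩ := h.surj q hq ((φ q).2 (horiz φ q a)) _
      (h.isVertical_mul hq ε (h.isVertical hq a))
    suffices acs g t ε φ q a = c by rw [this]; exact ⟨hc1, hc2⟩
    refine (h.isMetricOn ht).ext hq fun b => ?_
    rw [acs, ContinuousLinearMap.comp_apply, (h.isMetricOn ht).apply_inverse hq, metric_apply, hc1,
      hc2]
    rfl
  exact ⟨fun q hq a => (key q hq a).1, fun q hq a => (key q hq a).2⟩

variable {J : N → N →L[ℝ] N}

theorem acs_unique (h : IsTwistorChart U g Ω φ) (hJ : IsTwistorACS g ε Ω φ J) (ht : 0 < t)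
    (hq : q ∈ Ω) : J q = acs g t ε φ q := by
  ext1 a
  have h2 := h.isTwistorACS_acs (ε := ε) ht
  exact h.eq_of_horiz_vert hq (by rw [hJ.horiz_apply q hq, h2.horiz_apply q hq])
    (by rw [hJ.vert_apply q hq, h2.vert_apply q hq])

/-- `J` is prescribed pointwise. It must coincide with `acs`, which is built smoothly by inverting
the metric; the parameter of this auxiliary metric is irrelevant and is set to `1`. -/
theorem smoothAt_twistorACS (h : IsTwistorChart U g Ω φ) (hJ : IsTwistorACS g ε Ω φ J)
    (hq : q ∈ Ω) : ContDiffAt ℝ ∞ J q := by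
  refine (h.smoothAt_acs (t := 1) (ε := ε) one_pos hq).congr_of_eventuallyEq ?_
  filter_upwards [h.eventually_mem hq] with y hy using h.acs_unique hJ one_pos hy

theorem twistorACS_sq (h : IsTwistorChart U g Ω φ) (hJ : IsTwistorACS g ε Ω φ J) (hε : ε * ε = 1)
    (hq : q ∈ Ω) : J q * J q = -1 := by
  ext1 a
  have hI := h.sq hq
  refine h.eq_of_horiz_vert hq ?_ ?_
  · rw [end_mul_apply, hJ.horiz_apply q hq, hJ.horiz_apply q hq, ← end_mul_apply, hI]; simp
  · rw [end_mul_apply, hJ.vert_apply q hq, hJ.vert_apply q hq, mul_smul_comm, smul_smul, hε,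
      ← mul_assoc, hI]; simp

theorem twistorACS_skew (h : IsTwistorChart U g Ω φ) (hJ : IsTwistorACS g ε Ω φ J)
    (hq : q ∈ Ω) (a b : N) :
    pullbackMetric (twistorMetric g t) φ q (J q a) b =
      -pullbackMetric (twistorMetric g t) φ q a (J q b) := by
  rw [metric_apply, metric_apply, hJ.horiz_apply q hq, hJ.horiz_apply q hq, hJ.vert_apply q hq,
    hJ.vert_apply q hq, h.skew hq, map_smul, smul_apply,
    endForm_mul_left _ _ _ (h.isVertical hq a).anti, map_smul]
  simp only [smul_eq_mul]
  ring

/-- The identity `horiz (𝒥 b) = I (horiz b)` is differentiated. The derivative of `I` along `a` is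
`vert a`, and the terms of `horizDefect` fail to commute with `𝒥`; together they form `qOp` and
`lOp`. -/
theorem horiz_nablaEnd (h : IsTwistorChart U g Ω φ) (hJ : IsTwistorACS g ε Ω φ J) (ht : 0 < t)
    (hq : q ∈ Ω) (a b : N) :
    horiz φ q (nablaEnd (pullbackMetric (twistorMetric g t) φ) J q a b) =
      qOp g t (φ q) (vert g φ q a) (horiz φ q b)
        + lOp g t ε (φ q) (vert g φ q b) (horiz φ q a) := by
  have hJd := smoothAt_diff (h.smoothAt_twistorACS hJ hq)
  have hv : DifferentiableAt ℝ (fun y => J y b) q := hJd.clm_apply (differentiableAt_const b)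
  have hhb : DifferentiableAt ℝ (fun y => horiz φ y b) q :=
    (smoothAt_diff (h.smoothAt_horiz hq)).clm_apply (differentiableAt_const b)
  have h1 := h.covVec_horiz ht hq hv a
  have h2 := h.covVec_horiz ht hq (differentiableAt_const b) a
  have e : (fun y => horiz φ y (J y b)) =ᶠ[𝓝 q] fun y => (φ y).2 (horiz φ y b) := by
    filter_upwards [h.eventually_mem hq] with y hy using hJ.horiz_apply y hy b
  rw [covVec_congr e, covVec_apply (smoothAt_diff (h.smoothAt_snd hq)) hhb, ← h.vert_eq hq, h2,
    fderiv_clm_apply_const hJd] at h1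
  have h3 : horiz φ q (nablaEnd (pullbackMetric (twistorMetric g t) φ) J q a b) =
      horiz φ q (fderiv ℝ J q a b + christoffel (pullbackMetric (twistorMetric g t) φ) q a (J q b))
      - (φ q).2 (horiz φ q (christoffel (pullbackMetric (twistorMetric g t) φ) q a b)) := by
    rw [nablaEnd_eq, ← hJ.horiz_apply q hq, ← map_sub]
    simp only [add_apply, sub_apply, end_mul_apply]
    congr 1; abel
  rw [h3, eq_sub_of_add_eq h1.symm]
  simp only [fderiv_fun_const, Pi.zero_apply, zero_apply, zero_add, map_add, horizDefect,
    hJ.horiz_apply q hq, hJ.vert_apply q hq, kOp_smul, qOp, lOp, add_apply, sub_apply, smul_apply,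
    end_mul_apply]
  abel

/-- The same derivation applied to `vert (𝒥 b) = ε I (vert b)`; by `vert_algebra` only the curvature
of the two horizontal components survives. -/
theorem vert_nablaEnd (h : IsTwistorChart U g Ω φ) (hJ : IsTwistorACS g ε Ω φ J) (ht : 0 < t)
    (hq : q ∈ Ω) (a b : N) :
    vert g φ q (nablaEnd (pullbackMetric (twistorMetric g t) φ) J q a b) =
      cOp g ε (φ q) (horiz φ q a) (horiz φ q b) := by
  have hJd := smoothAt_diff (h.smoothAt_twistorACS hJ hq)
  have hId := smoothAt_diff (h.smoothAt_snd hq)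
  have hv : DifferentiableAt ℝ (fun y => J y b) q := hJd.clm_apply (differentiableAt_const b)
  have hhb : DifferentiableAt ℝ (fun y => vert g φ y b) q :=
    (smoothAt_diff (h.smoothAt_vert hq)).clm_apply (differentiableAt_const b)
  have h1 := h.covEnd_vert ht hq hv a
  have h2 := h.covEnd_vert ht hq (differentiableAt_const b) a
  have e : (fun y => vert g φ y (J y b)) =ᶠ[𝓝 q] fun y => ε • ((φ y).2 * vert g φ y b) := by
    filter_upwards [h.eventually_mem hq] with y hy using hJ.vert_apply y hy b
  rw [covEnd_congr e, covEnd_smul (A := fun y => (φ y).2 * vert g φ y b) (hId.clm_comp hhb),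
    covEnd_mul hId hhb, ← h.vert_eq hq, h2, fderiv_clm_apply_const hJd] at h1
  have h3 : vert g φ q (nablaEnd (pullbackMetric (twistorMetric g t) φ) J q a b) =
      vert g φ q (fderiv ℝ J q a b + christoffel (pullbackMetric (twistorMetric g t) φ) q a (J q b))
      - ε • ((φ q).2 * vert g φ q (christoffel (pullbackMetric (twistorMetric g t) φ) q a b)) := by
    rw [nablaEnd_eq, ← hJ.vert_apply q hq, ← map_sub]
    simp only [add_apply, sub_apply, end_mul_apply]
    congr 1; abel
  have h4 := vert_algebra (ε := ε) (R := curvEnd g (φ q).1 (horiz φ q a) (horiz φ q b))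
    (R' := curvEnd g (φ q).1 (horiz φ q a) ((φ q).2 (horiz φ q b))) (h.sq hq)
    (h.isVertical hq a).anti (h.isVertical hq b).anti
  rw [h3, eq_sub_of_add_eq h1.symm, cOp, ← h4]
  simp only [fderiv_fun_const, Pi.zero_apply, zero_apply, zero_add, vertDefect,
    hJ.horiz_apply q hq, hJ.vert_apply q hq, mul_add, smul_add]
  abel

theorem covEnd_kOp (h : IsTwistorChart U g Ω φ) (hq : q ∈ Ω) {B : N → F →L[ℝ] F}
    (hB : DifferentiableAt ℝ B q) (a : N) :
    covEnd g (fun y => (φ y).1) (fun y => kOp g t (φ y) (B y)) q a =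
      dkOp g t (φ q) (horiz φ q a) (vert g φ q a) (B q)
        + kOp g t (φ q) (covEnd g (fun y => (φ y).1) B q a) := by
  have hId := smoothAt_diff (h.smoothAt_snd hq)
  have hIB : DifferentiableAt ℝ (fun y => (φ y).2 * B y) q := hId.clm_comp hB
  have hBI : DifferentiableAt ℝ (fun y => B y * (φ y).2) q := hB.clm_comp hId
  have hO : DifferentiableAt ℝ (fun y => curvOp g (φ y).1 ((φ y).2 * B y - B y * (φ y).2)) q :=
    ((smoothAt_diff (h.metric.smoothAt_curvOp (h.mem hq))).comp q
      (smoothAt_diff (h.smoothAt_fst hq))).clm_apply (hIB.sub hBI)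
  unfold kOp
  rw [covEnd_smul hO, covEnd_curvOp (A := fun y => (φ y).2 * B y - B y * (φ y).2) h.metric
    (smoothAt_diff (h.smoothAt_fst hq)) (h.mem hq) (hIB.sub hBI), covEnd_sub hIB hBI,
    covEnd_mul hId hB, covEnd_mul hB hId, ← h.vert_eq hq, h.fderiv_fst hq, dkOp, ← smul_add,
    add_assoc, ← map_add]
  congr 3
  abel_nf

theorem diff_kOp (h : IsTwistorChart U g Ω φ) (hq : q ∈ Ω) {B : N → F →L[ℝ] F}
    (hB : DifferentiableAt ℝ B q) : DifferentiableAt ℝ (fun y => kOp g t (φ y) (B y)) q := by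
  have hId := smoothAt_diff (h.smoothAt_snd hq)
  have hIB : DifferentiableAt ℝ (fun y => (φ y).2 * B y) q := hId.clm_comp hB
  have hBI : DifferentiableAt ℝ (fun y => B y * (φ y).2) q := hB.clm_comp hId
  exact (((smoothAt_diff (h.metric.smoothAt_curvOp (h.mem hq))).comp q
      (smoothAt_diff (h.smoothAt_fst hq))).clm_apply (hIB.sub hBI)).const_smul (t / 2)

theorem covEnd_qOp (h : IsTwistorChart U g Ω φ) (hq : q ∈ Ω) {B : N → F →L[ℝ] F}
    (hB : DifferentiableAt ℝ B q) (a : N) :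
    covEnd g (fun y => (φ y).1) (fun y => qOp g t (φ y) (B y)) q a =
      qOp g t (φ q) (covEnd g (fun y => (φ y).1) B q a)
        + (vert g φ q a * kOp g t (φ q) (B q) - kOp g t (φ q) (B q) * vert g φ q a)
        + ((φ q).2 * dkOp g t (φ q) (horiz φ q a) (vert g φ q a) (B q)
          - dkOp g t (φ q) (horiz φ q a) (vert g φ q a) (B q) * (φ q).2) := by
  have hId := smoothAt_diff (h.smoothAt_snd hq)
  have hK := h.diff_kOp (t := t) hq hB
  have h1 : DifferentiableAt ℝ (fun y => (φ y).2 * kOp g t (φ y) (B y)) q := hId.clm_comp hK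
  have h2 : DifferentiableAt ℝ (fun y => kOp g t (φ y) (B y) * (φ y).2) q := hK.clm_comp hId
  unfold qOp
  rw [covEnd_add hB (h1.fun_sub h2), covEnd_sub h1 h2, covEnd_mul hId hK, covEnd_mul hK hId,
    h.covEnd_kOp hq hB, ← h.vert_eq hq]
  noncomm_ring

theorem covEnd_lOp (h : IsTwistorChart U g Ω φ) (hq : q ∈ Ω) {B : N → F →L[ℝ] F}
    (hB : DifferentiableAt ℝ B q) (a : N) :
    covEnd g (fun y => (φ y).1) (fun y => lOp g t ε (φ y) (B y)) q a =
      lOp g t ε (φ q) (covEnd g (fun y => (φ y).1) B q a)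
        + (vert g φ q a * kOp g t (φ q) (B q) - ε • kOp g t (φ q) (vert g φ q a * B q))
        + ((φ q).2 * dkOp g t (φ q) (horiz φ q a) (vert g φ q a) (B q)
          - ε • dkOp g t (φ q) (horiz φ q a) (vert g φ q a) ((φ q).2 * B q)) := by
  have hId := smoothAt_diff (h.smoothAt_snd hq)
  have hIB : DifferentiableAt ℝ (fun y => (φ y).2 * B y) q := hId.clm_comp hB
  have hK := h.diff_kOp (t := t) hq hB
  have hK2 := h.diff_kOp (t := t) hq hIB
  have h1 : DifferentiableAt ℝ (fun y => (φ y).2 * kOp g t (φ y) (B y)) q := hId.clm_comp hK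
  unfold lOp
  rw [covEnd_sub h1 (hK2.fun_const_smul ε), covEnd_mul hId hK, covEnd_smul hK2,
    h.covEnd_kOp hq hB, h.covEnd_kOp hq hIB, ← h.vert_eq hq, covEnd_mul hId hB, ← h.vert_eq hq,
    kOp_add, mul_add, smul_add, smul_add]
  abel

/-- The horizontal part of the second covariant derivative of the almost complex structure. -/
theorem horiz_nablaTwo (h : IsTwistorChart U g Ω φ) (hJ : IsTwistorACS g ε Ω φ J) (ht : 0 < t)
    (hq : q ∈ Ω) (a a' b : N) :
    horiz φ q (nablaTwo (pullbackMetric (twistorMetric g t) φ) J q a a' b) =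
      (qOp g t (φ q) (vertDefect g φ q a a')
        + (vert g φ q a * kOp g t (φ q) (vert g φ q a')
          - kOp g t (φ q) (vert g φ q a') * vert g φ q a)
        + ((φ q).2 * dkOp g t (φ q) (horiz φ q a) (vert g φ q a) (vert g φ q a')
          - dkOp g t (φ q) (horiz φ q a) (vert g φ q a) (vert g φ q a') * (φ q).2)) (horiz φ q b)
      + qOp g t (φ q) (vert g φ q a') (horizDefect g t φ q a b)
      + (lOp g t ε (φ q) (vertDefect g φ q a b)
        + (vert g φ q a * kOp g t (φ q) (vert g φ q b)
          - ε • kOp g t (φ q) (vert g φ q a * vert g φ q b))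
        + ((φ q).2 * dkOp g t (φ q) (horiz φ q a) (vert g φ q a) (vert g φ q b)
          - ε • dkOp g t (φ q) (horiz φ q a) (vert g φ q a) ((φ q).2 * vert g φ q b)))
          (horiz φ q a')
      + lOp g t ε (φ q) (vert g φ q b) (horizDefect g t φ q a a')
      - (kOp g t (φ q) (vert g φ q a) (qOp g t (φ q) (vert g φ q a') (horiz φ q b)
            + lOp g t ε (φ q) (vert g φ q b) (horiz φ q a'))
        + kOp g t (φ q) (cOp g ε (φ q) (horiz φ q a') (horiz φ q b)) (horiz φ q a)) := by
  have hm := h.isMetricOn ht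
  set H := pullbackMetric (twistorMetric g t) φ with hH
  have hns := smoothAt_nablaEnd hm hq (h.smoothAt_twistorACS hJ hq) a'
  have hv : DifferentiableAt ℝ (fun y => nablaEnd H J y a' b) q :=
    (smoothAt_diff hns).clm_apply (differentiableAt_const b)
  have hh : ∀ b, DifferentiableAt ℝ (fun y => horiz φ y b) q := fun b =>
    (smoothAt_diff (h.smoothAt_horiz hq)).clm_apply (differentiableAt_const b)
  have hw : ∀ b, DifferentiableAt ℝ (fun y => vert g φ y b) q := fun b =>
    (smoothAt_diff (h.smoothAt_vert hq)).clm_apply (differentiableAt_const b)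
  have hId := smoothAt_diff (h.smoothAt_snd hq)
  have hQ : DifferentiableAt ℝ (fun y => qOp g t (φ y) (vert g φ y a')) q :=
    (hw a').add ((hId.clm_comp (h.diff_kOp hq (hw a'))).sub
      ((h.diff_kOp hq (hw a')).clm_comp hId))
  have hIB : DifferentiableAt ℝ (fun y => (φ y).2 * vert g φ y b) q := hId.clm_comp (hw b)
  have hL : DifferentiableAt ℝ (fun y => lOp g t ε (φ y) (vert g φ y b)) q :=
    (hId.clm_comp (h.diff_kOp hq (hw b))).sub ((h.diff_kOp hq hIB).const_smul ε)
  have h1 := h.covVec_horiz ht hq hv a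
  have e : (fun y => horiz φ y (nablaEnd H J y a' b)) =ᶠ[𝓝 q] fun y =>
      qOp g t (φ y) (vert g φ y a') (horiz φ y b)
        + lOp g t ε (φ y) (vert g φ y b) (horiz φ y a') := by
    filter_upwards [h.eventually_mem hq] with y hy using h.horiz_nablaEnd hJ ht hy a' b
  -- The formula of `horiz_nablaEnd` is differentiated for constant `a'` and `b`. The Christoffel
  -- terms that appear are those which the definition of `nablaTwo` subtracts, so only the two
  -- defects and the derivatives of the operators are left.
  have ch : ∀ b, covVec g (fun y => (φ y).1) (fun y => horiz φ y b) q a =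
      horiz φ q (christoffel H q a b) + horizDefect g t φ q a b := fun b => by
    rw [h.covVec_horiz ht hq (differentiableAt_const b) a]; simp [hH]
  have cv : ∀ b, covEnd g (fun y => (φ y).1) (fun y => vert g φ y b) q a =
      vert g φ q (christoffel H q a b) + vertDefect g φ q a b := fun b => by
    rw [h.covEnd_vert ht hq (differentiableAt_const b) a]; simp [hH]
  rw [covVec_congr e, covVec_add (hQ.clm_apply (hh b)) (hL.clm_apply (hh a')),
    covVec_apply hQ (hh b), covVec_apply hL (hh a'), h.covEnd_qOp hq (hw a'),
    h.covEnd_lOp hq (hw b), ch, ch, cv, cv, fderiv_clm_apply_const (smoothAt_diff hns)] at h1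
  have h3 : fderiv ℝ (fun y => nablaEnd H J y a') q a b + christoffel H q a (nablaEnd H J q a' b) =
      nablaTwo H J q a a' b + nablaEnd H J q (christoffel H q a a') b
        + nablaEnd H J q a' (christoffel H q a b) := by
    simp only [nablaTwo, covEnd, connForm_id, add_apply, sub_apply, end_mul_apply]
    abel
  have hn : ∀ a b, horiz φ q (nablaEnd H J q a b) =
      qOp g t (φ q) (vert g φ q a) (horiz φ q b)
        + lOp g t ε (φ q) (vert g φ q b) (horiz φ q a) := h.horiz_nablaEnd hJ ht hq
  have hvn : ∀ a b, vert g φ q (nablaEnd H J q a b) =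
      cOp g ε (φ q) (horiz φ q a) (horiz φ q b) := h.vert_nablaEnd hJ ht hq
  rw [h3, map_add (horiz φ q), map_add (horiz φ q), hn, hn] at h1
  simp only [horizDefect, hn, hvn] at h1
  rw [← sub_eq_iff_eq_add, ← sub_eq_iff_eq_add, ← sub_eq_iff_eq_add] at h1
  rw [← h1]
  simp only [horizDefect, qOp_add, lOp_add, add_apply, map_add]
  abel

end IsTwistorChart

end TwistorStructure

/-! ### Quaternionic triples -/

section QuatAlgebra

/-- Three anti-commuting complex structures with the relations of the quaternions. -/
structure QuatRel {A : Type*} [Ring A] (i j k : A) : Prop where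
  ii : i * i = -1
  jj : j * j = -1
  kk : k * k = -1
  ij : i * j = k
  ji : j * i = -k
  jk : j * k = i
  kj : k * j = -i
  ki : k * i = j
  ik : i * k = -j

theorem QuatRel.of {A : Type*} [Ring A] {i j k : A} (hi : i * i = -1) (hj : j * j = -1)
    (hij : i * j = k) (hji : j * i = -k) : QuatRel i j k where
  ii := hi
  jj := hj
  kk := by rw [← hij, mul_assoc, ← mul_assoc j, hji, ← hij, neg_mul, mul_assoc, hj]; simp [hi]
  ij := hij
  ji := hji
  jk := by rw [← neg_eq_iff_eq_neg.2 hji, mul_neg, ← mul_assoc, hj]; simp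
  kj := by rw [← hij, mul_assoc, hj]; simp
  ki := by rw [← neg_eq_iff_eq_neg.2 hji, neg_mul, mul_assoc, hi]; simp
  ik := by rw [← hij, ← mul_assoc, hi]; simp

theorem QuatRel.rotate {A : Type*} [Ring A] {i j k : A} (h : QuatRel i j k) : QuatRel j k i :=
  ⟨h.jj, h.kk, h.ii, h.jk, h.kj, h.ki, h.ik, h.ij, h.ji⟩

/-- The horizontal block of the rough Laplacian of the almost complex structure, up to a factor. -/
def lapBlock {A : Type*} [Ring A] [Algebra ℝ A] (ε : ℝ) (i j k K L : A) : A :=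
  (j * K - K * j) + (k * L - L * k) + (i * (K * K + L * L) + (K * K + L * L) * i)
    - (K * i * K + L * i * L) + ε • (K * L - L * K) - i

/-- `p` and `r` commute with the triple and contribute to `lapBlock` only terms that commute with
`i`. The commutator with `i` is therefore a computation with quaternions, and it lies in the span of
`j` and `k`. -/
theorem lapBlock_comm {A : Type*} [Ring A] [Algebra ℝ A] {i j k p r : A} (h : QuatRel i j k)
    (pi : p * i = i * p) (pj : p * j = j * p) (pk : p * k = k * p)
    (ri : r * i = i * r) (rj : r * j = j * r) (rk : r * k = k * r)
    (ε α₁ α₂ α₃ β₁ β₂ β₃ : ℝ) :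
    lapBlock ε i j k (α₁ • i + α₂ • j + α₃ • k + p) (β₁ • i + β₂ • j + β₃ • k + r) * i
      - i * lapBlock ε i j k (α₁ • i + α₂ • j + α₃ • k + p) (β₁ • i + β₂ • j + β₃ • k + r) =
      (-4 * (β₁ + (α₁ * α₂ + β₁ * β₂) + ε * (α₃ * β₁ - α₁ * β₃))) • k
        + (4 * (-α₁ + (α₁ * α₃ + β₁ * β₃) + ε * (α₁ * β₂ - α₂ * β₁))) • j := by
  have a1 : ∀ x : A, i * (i * x) = -x := fun x => by rw [← mul_assoc, h.ii, neg_one_mul]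
  have a4 : ∀ x : A, i * (j * x) = k * x := fun x => by rw [← mul_assoc, h.ij]
  have a5 : ∀ x : A, j * (i * x) = -(k * x) := fun x => by rw [← mul_assoc, h.ji, neg_mul]
  have a8 : ∀ x : A, k * (i * x) = j * x := fun x => by rw [← mul_assoc, h.ki]
  have a9 : ∀ x : A, i * (k * x) = -(j * x) := fun x => by rw [← mul_assoc, h.ik, neg_mul]
  have p1 : ∀ x : A, p * (i * x) = i * (p * x) := fun x => by rw [← mul_assoc, pi, mul_assoc]
  have r1 : ∀ x : A, r * (i * x) = i * (r * x) := fun x => by rw [← mul_assoc, ri, mul_assoc]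
  unfold lapBlock
  simp only [mul_add, add_mul, mul_sub, sub_mul, smul_mul_assoc, mul_smul_comm, mul_assoc, mul_neg,
    neg_mul, smul_add, smul_sub, smul_neg, h.ii, h.jj, h.kk, h.ij, h.ji, h.jk, h.kj, h.ki, h.ik,
    a1, a4, a5, a8, a9, pi, pj, pk, ri, rj, rk, p1, r1, mul_one, one_mul]
  module

end QuatAlgebra

/-! ### Quaternionic triples in a Euclidean space of dimension four. -/

section QuatBasis

variable {F : Type*} [NormedAddCommGroup F] [NormedSpace ℝ F] [FiniteDimensional ℝ F]

/-- A quaternionic triple of skew-symmetric endomorphisms of a four-dimensional Euclidean space,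
such that all skew-symmetric endomorphisms are sums of an element of the span of the triple and of
an endomorphism commuting with the triple. -/
structure QuatTriple (b : F →L[ℝ] F →L[ℝ] ℝ) (i j k : F →L[ℝ] F) : Prop where
  rel : QuatRel i j k
  skew_i : ∀ v w, b (i v) w = -b v (i w)
  skew_j : ∀ v w, b (j v) w = -b v (j w)
  skew_k : ∀ v w, b (k v) w = -b v (k w)
  dim : Module.finrank ℝ F = 4
  decomp : ∀ K : F →L[ℝ] F, (∀ v w, b (K v) w = -b v (K w)) → ∃ P : F →L[ℝ] F,
    K = endForm F K i • i + endForm F K j • j + endForm F K k • k + P ∧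
    P * i = i * P ∧ P * j = j * P ∧ P * k = k * P

namespace QuatTriple

variable {b : F →L[ℝ] F →L[ℝ] ℝ} {i j k : F →L[ℝ] F}

theorem rotate (h : QuatTriple b i j k) : QuatTriple b j k i where
  rel := h.rel.rotate
  skew_i := h.skew_j
  skew_j := h.skew_k
  skew_k := h.skew_i
  dim := h.dim
  decomp K hK := by
    obtain ⟨P, h1, h2, h3, h4⟩ := h.decomp K hK
    refine ⟨P, ?_, h3, h4, h2⟩
    conv_lhs => rw [h1]
    abel

theorem endForm_self (h : QuatTriple b i j k) : endForm F i i = 1 := by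
  have h1 : ((i ∘L i : F →L[ℝ] F) : F →ₗ[ℝ] F) = -LinearMap.id := by
    have : i ∘L i = -1 := h.rel.ii
    rw [this]; ext; simp
  rw [endForm_apply, h1, map_neg, LinearMap.trace_id, h.dim]
  norm_num

theorem endForm_ij (h : QuatTriple b i j k) : endForm F i j = 0 := by
  refine endForm_eq_zero (I := i) h.rel.ii rfl ?_
  rw [h.rel.ji, h.rel.ij]

theorem endForm_ik (h : QuatTriple b i j k) : endForm F i k = 0 := by
  refine endForm_eq_zero (I := i) h.rel.ii rfl ?_
  rw [h.rel.ki, h.rel.ik, neg_neg]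

theorem isVertical_j (h : QuatTriple b i j k) : IsVertical b i j :=
  ⟨by rw [h.rel.ji, h.rel.ij], h.skew_j⟩

theorem isVertical_k (h : QuatTriple b i j k) : IsVertical b i k :=
  ⟨by rw [h.rel.ki, h.rel.ik, neg_neg], h.skew_k⟩

/-- The vertical space at `i` is spanned by `j` and `k`. -/
theorem vertical_eq (h : QuatTriple b i j k) {V : F →L[ℝ] F} (hV : IsVertical b i V) :
    V = endForm F V j • j + endForm F V k • k := by
  obtain ⟨P, h1, h2, -, -⟩ := h.decomp V hV.skew
  have h0 : endForm F V i = 0 := by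
    rw [endForm_symm]; exact endForm_eq_zero h.rel.ii rfl hV.anti
  rw [h0, zero_smul, zero_add] at h1
  have h3 := hV.anti
  have h4 : (endForm F V j • j + endForm F V k • k + P) * i =
      -(i * (endForm F V j • j + endForm F V k • k + P)) := by rw [← h1]; exact h3
  simp only [add_mul, mul_add, smul_mul_assoc, mul_smul_comm, h.rel.ji, h.rel.ij, h.rel.ki,
    h.rel.ik, h2, smul_neg, neg_add, neg_neg] at h4
  have h5 : i * P = -(i * P) := add_left_cancel h4
  have h6 : i * P = 0 := by
    have := eq_neg_iff_add_eq_zero.1 h5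
    rw [← two_smul ℝ] at this
    exact (smul_eq_zero.1 this).resolve_left two_ne_zero
  have h7 : P = 0 := by
    have := congrArg (fun Q => i * Q) h6
    simp only [← mul_assoc, h.rel.ii, mul_zero, neg_one_mul, neg_eq_zero] at this
    exact this
  rw [h7, add_zero] at h1
  exact h1

theorem smul_add_eq_zero (h : QuatTriple b i j k) {c d : ℝ} (hcd : c • k + d • j = 0) :
    c = 0 ∧ d = 0 := by
  have h1 := congrArg (fun V => endForm F V j) hcd
  have h2 := congrArg (fun V => endForm F V k) hcd
  simp only [map_add, map_smul, add_apply, smul_apply, smul_eq_mul, map_zero, zero_apply,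
    h.rotate.endForm_self, h.rotate.rotate.endForm_self, h.rotate.rotate.endForm_ik,
    h.rotate.endForm_ij] at h1 h2
  constructor <;> linarith

end QuatTriple

/-- The complex structure with `e₀ ↦ e_a`, `e_b ↦ -e_c` for a basis `e₀, e_a, e_b, e_c`. -/
def quatOf (e : Module.Basis (Fin 4) ℝ F) (w : Fin 4 → F) : F →L[ℝ] F :=
  LinearMap.toContinuousLinearMap (e.constr ℝ w)

theorem quatOf_apply (e : Module.Basis (Fin 4) ℝ F) (w : Fin 4 → F) (m : Fin 4) :
    quatOf e w (e m) = w m := by simp [quatOf]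

/-- The endomorphism of the bivector `e₀ ∧ e₁ - e₂ ∧ e₃`. -/
def sOne (e : Module.Basis (Fin 4) ℝ F) : F →L[ℝ] F := quatOf e ![e 1, -e 0, -e 3, e 2]

/-- The endomorphism of the bivector `e₀ ∧ e₂ - e₃ ∧ e₁`. -/
def sTwo (e : Module.Basis (Fin 4) ℝ F) : F →L[ℝ] F := quatOf e ![e 2, e 3, -e 0, -e 1]

/-- The endomorphism of the bivector `e₀ ∧ e₃ - e₁ ∧ e₂`. -/
def sThree (e : Module.Basis (Fin 4) ℝ F) : F →L[ℝ] F := quatOf e ![e 3, -e 2, e 1, -e 0]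

section

variable (e : Module.Basis (Fin 4) ℝ F)

theorem sOne_0 : sOne e (e 0) = e 1 := quatOf_apply e _ 0
theorem sOne_1 : sOne e (e 1) = -e 0 := quatOf_apply e _ 1
theorem sOne_2 : sOne e (e 2) = -e 3 := quatOf_apply e _ 2
theorem sOne_3 : sOne e (e 3) = e 2 := quatOf_apply e _ 3
theorem sTwo_0 : sTwo e (e 0) = e 2 := quatOf_apply e _ 0
theorem sTwo_1 : sTwo e (e 1) = e 3 := quatOf_apply e _ 1
theorem sTwo_2 : sTwo e (e 2) = -e 0 := quatOf_apply e _ 2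
theorem sTwo_3 : sTwo e (e 3) = -e 1 := quatOf_apply e _ 3
theorem sThree_0 : sThree e (e 0) = e 3 := quatOf_apply e _ 0
theorem sThree_1 : sThree e (e 1) = -e 2 := quatOf_apply e _ 1
theorem sThree_2 : sThree e (e 2) = e 1 := quatOf_apply e _ 2
theorem sThree_3 : sThree e (e 3) = -e 0 := quatOf_apply e _ 3

theorem end_ext_four {A B : F →L[ℝ] F} (h0 : A (e 0) = B (e 0)) (h1 : A (e 1) = B (e 1))
    (h2 : A (e 2) = B (e 2)) (h3 : A (e 3) = B (e 3)) : A = B := by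
  refine ContinuousLinearMap.coe_injective (e.ext fun m => ?_)
  fin_cases m
  exacts [h0, h1, h2, h3]

/-- The order matters: the product of `sOne` and `sTwo` is `-sThree`, so the role of `j` falls to
`sThree` and that of `k` to `sTwo`. -/
theorem quatRel_s : QuatRel (sOne e) (sThree e) (sTwo e) := by
  refine QuatRel.of ?_ ?_ ?_ ?_ <;> apply end_ext_four e <;>
  simp [sOne_0, sOne_1, sOne_2, sOne_3, sTwo_0, sTwo_1, sTwo_2, sTwo_3, sThree_0,
    sThree_1, sThree_2, sThree_3]

end

variable {b : F →L[ℝ] F →L[ℝ] ℝ} {e : Module.Basis (Fin 4) ℝ F}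

theorem sum_orthonormal (he : ∀ m n, b (e m) (e n) = if m = n then 1 else 0) (v : F) :
    v = b v (e 0) • e 0 + b v (e 1) • e 1 + b v (e 2) • e 2 + b v (e 3) • e 3 := by
  conv_lhs => rw [← e.sum_repr v]
  simp only [Fin.sum_univ_four, repr_orthonormal he]

theorem finrank_of_basis_four (e : Module.Basis (Fin 4) ℝ F) : Module.finrank ℝ F = 4 := by
  simpa using Module.finrank_eq_card_basis e

/-- The form `G` in an orthonormal basis. -/
theorem endForm_orthonormal (he : ∀ m n, b (e m) (e n) = if m = n then 1 else 0)
    (K S : F →L[ℝ] F) : endForm F K S = -(1 / 4) * (b (K (S (e 0))) (e 0) + b (K (S (e 1))) (e 1)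
      + b (K (S (e 2))) (e 2) + b (K (S (e 3))) (e 3)) := by
  rw [endForm_apply, trace_orthonormal he, finrank_of_basis_four e, Fin.sum_univ_four]
  simp

theorem endForm_sOne (hs : ∀ v w, b v w = b w v)
    (he : ∀ m n, b (e m) (e n) = if m = n then 1 else 0) {K : F →L[ℝ] F}
    (hK : ∀ v w, b (K v) w = -b v (K w)) :
    endForm F K (sOne e) = (1 / 2) * (b (K (e 0)) (e 1) - b (K (e 2)) (e 3)) := by
  rw [endForm_orthonormal he, sOne_0, sOne_1, sOne_2, sOne_3]
  simp only [map_neg, neg_apply]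
  rw [hK (e 1) (e 0), hK (e 3) (e 2), hs (e 1), hs (e 3)]; ring

theorem endForm_sTwo (hs : ∀ v w, b v w = b w v)
    (he : ∀ m n, b (e m) (e n) = if m = n then 1 else 0) {K : F →L[ℝ] F}
    (hK : ∀ v w, b (K v) w = -b v (K w)) :
    endForm F K (sTwo e) = (1 / 2) * (b (K (e 0)) (e 2) - b (K (e 3)) (e 1)) := by
  rw [endForm_orthonormal he, sTwo_0, sTwo_1, sTwo_2, sTwo_3]
  simp only [map_neg, neg_apply]
  rw [hK (e 2) (e 0), hK (e 3) (e 1), hs (e 2), hs (e 3)]; ring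

theorem endForm_sThree (hs : ∀ v w, b v w = b w v)
    (he : ∀ m n, b (e m) (e n) = if m = n then 1 else 0) {K : F →L[ℝ] F}
    (hK : ∀ v w, b (K v) w = -b v (K w)) :
    endForm F K (sThree e) = (1 / 2) * (b (K (e 0)) (e 3) - b (K (e 1)) (e 2)) := by
  rw [endForm_orthonormal he, sThree_0, sThree_1, sThree_2, sThree_3]
  simp only [map_neg, neg_apply]
  rw [hK (e 3) (e 0), hK (e 2) (e 1), hs (e 3), hs (e 2)]; ring

theorem skew_of_basis {K : F →L[ℝ] F} (h : ∀ m n, b (K (e m)) (e n) = -b (e m) (K (e n))) (v w : F) :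
    b (K v) w = -b v (K w) := by
  have h1 : ∀ m w, b (K (e m)) w = -b (e m) (K w) := by
    intro m w
    have : b (K (e m)) = -(b (e m) ∘L K) :=
      ContinuousLinearMap.coe_injective (e.ext fun n => h m n)
    rw [this]; rfl
  have h2 : b ∘L K = -((ContinuousLinearMap.precomp ℝ K) ∘L b) :=
    ContinuousLinearMap.coe_injective (e.ext fun m => ContinuousLinearMap.ext fun w => h1 m w)
  have := congrArg (fun L => L v w) h2
  simpa using this

/-- The decomposition is the splitting of the skew endomorphisms of a Euclidean four-space into two
commuting ideals, spanned by anti-self-dual and self-dual bivectors: removing the projection to the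
triple leaves an element of the other ideal. -/
theorem quatTriple_s (hs : ∀ v w, b v w = b w v)
    (he : ∀ m n, b (e m) (e n) = if m = n then 1 else 0) :
    QuatTriple b (sOne e) (sThree e) (sTwo e) where
  rel := quatRel_s e
  skew_i := by
    refine skew_of_basis (e := e) fun m n => ?_
    fin_cases m <;> fin_cases n <;> simp [sOne_0, sOne_1, sOne_2, sOne_3, he]
  skew_j := by
    refine skew_of_basis (e := e) fun m n => ?_
    fin_cases m <;> fin_cases n <;> simp [sThree_0, sThree_1, sThree_2, sThree_3, he]
  skew_k := by
    refine skew_of_basis (e := e) fun m n => ?_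
    fin_cases m <;> fin_cases n <;> simp [sTwo_0, sTwo_1, sTwo_2, sTwo_3, he]
  dim := finrank_of_basis_four e
  decomp := by
    intro K hK
    refine ⟨K - (endForm F K (sOne e) • sOne e + endForm F K (sThree e) • sThree e
      + endForm F K (sTwo e) • sTwo e), by abel, ?_⟩
    have k : ∀ m n, b (K (e m)) (e n) = -b (K (e n)) (e m) := fun m n => by rw [hK, hs]
    have kz : ∀ m, b (K (e m)) (e m) = 0 := fun m => by linarith [k m m]
    have e0 := sum_orthonormal he (K (e 0))
    have e1 := sum_orthonormal he (K (e 1))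
    have e2 := sum_orthonormal he (K (e 2))
    have e3 := sum_orthonormal he (K (e 3))
    rw [kz] at e0 e1 e2 e3
    rw [k 1 0] at e1
    rw [k 2 0, k 2 1] at e2
    rw [k 3 0, k 3 1, k 3 2] at e3
    rw [endForm_sOne hs he hK, endForm_sTwo hs he hK, endForm_sThree hs he hK, k 3 1]
    -- `K` is now given by its six independent entries, and commutation is a linear identity on each
    -- basis vector.
    generalize b (K (e 0)) (e 1) = k₀₁ at *
    generalize b (K (e 0)) (e 2) = k₀₂ at *
    generalize b (K (e 0)) (e 3) = k₀₃ at *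
    generalize b (K (e 1)) (e 2) = k₁₂ at *
    generalize b (K (e 1)) (e 3) = k₁₃ at *
    generalize b (K (e 2)) (e 3) = k₂₃ at *
    refine ⟨?_, ?_, ?_⟩ <;> apply end_ext_four e <;>
    simp only [end_mul_apply, sub_apply, add_apply, smul_apply, map_sub, map_add, map_smul, map_neg,
      sOne_0, sOne_1, sOne_2, sOne_3, sTwo_0, sTwo_1, sTwo_2, sTwo_3, sThree_0, sThree_1, sThree_2,
      sThree_3, e0, e1, e2, e3] <;> module

end QuatBasis

/-! ### The rough Laplacian of the almost complex structures of the twistor space -/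

section RoughLaplacian

variable {N : Type*} [NormedAddCommGroup N] [NormedSpace ℝ N] [FiniteDimensional ℝ N]
variable {F : Type*} [NormedAddCommGroup F] [NormedSpace ℝ F] [FiniteDimensional ℝ F]

/-- The divergence of the curvature operator, computed in the basis `e`. -/
def divOp (g : F → F →L[ℝ] F →L[ℝ] ℝ) (x : F) (e : Module.Basis (Fin 4) ℝ F) (Φ : F →L[ℝ] F) : F :=
  ∑ m, nablaOp g x (e m) Φ (e m)

/-- Expansion of `A Y` in the basis. It turns sums of curvature terms over the horizontal directions
into products of endomorphisms. -/
theorem sum_skew {b : F →L[ℝ] F →L[ℝ] ℝ} {e : Module.Basis (Fin 4) ℝ F}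
    (hs : ∀ v w, b v w = b w v) (he : ∀ m n, b (e m) (e n) = if m = n then 1 else 0)
    {A : F →L[ℝ] F} (hA : ∀ v w, b (A v) w = -b v (A w)) (B : F →L[ℝ] F) (Y : F) :
    ∑ m, b (A (e m)) Y • B (e m) = -(B (A Y)) := by
  have h1 : A Y = ∑ m, b (A Y) (e m) • e m := by
    conv_lhs => rw [← e.sum_repr (A Y)]
    simp only [repr_orthonormal he]
  conv_rhs => rw [h1]
  rw [map_sum, ← Finset.sum_neg_distrib]
  refine Finset.sum_congr rfl fun m _ => ?_
  rw [hA, hs (e m), map_smul, neg_smul]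

variable {g : F → F →L[ℝ] F →L[ℝ] ℝ} {z : F × (F →L[ℝ] F)}

theorem qOp_zero (t : ℝ) : qOp g t z 0 = 0 := by simp [qOp, kOp_zero]

theorem lOp_zero (t ε : ℝ) : lOp g t ε z 0 = 0 := by simp [lOp, kOp_zero]

theorem nablaOp_zero_left (x : F) (Φ : F →L[ℝ] F) : nablaOp g x 0 Φ = 0 := by simp [nablaOp]

theorem nablaOp_zero_right (x X : F) : nablaOp g x X 0 = 0 := by simp [nablaOp]

namespace IsTwistorChart

variable {U : Set F} {Ω : Set N} {φ : N → F × (F →L[ℝ] F)} {q : N} {t ε : ℝ}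
variable {J : N → N →L[ℝ] N} {j k : F →L[ℝ] F} {e : Module.Basis (Fin 4) ℝ F}

/-- An orthonormal basis of the tangent space of the twistor space. -/
theorem exists_adapted_basis (h : IsTwistorChart U g Ω φ) (ht : 0 < t) (hq : q ∈ Ω)
    (hT : QuatTriple (g (φ q).1) (φ q).2 j k)
    (he : ∀ m n, g (φ q).1 (e m) (e n) = if m = n then 1 else 0) :
    ∃ f : Module.Basis (Fin 4 ⊕ Fin 2) ℝ N,
      (∀ r s, pullbackMetric (twistorMetric g t) φ q (f r) (f s) = if r = s then 1 else 0) ∧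
      (∀ m, horiz φ q (f (Sum.inl m)) = e m ∧ vert g φ q (f (Sum.inl m)) = 0) ∧
      (∀ m, horiz φ q (f (Sum.inr m)) = 0) ∧
      vert g φ q (f (Sum.inr 0)) = (Real.sqrt t)⁻¹ • j ∧
      vert g φ q (f (Sum.inr 1)) = (Real.sqrt t)⁻¹ • k := by
  have hz : IsVertical (g (φ q).1) (φ q).2 0 := ⟨by simp, by simp⟩
  have hsm : ∀ {V}, IsVertical (g (φ q).1) (φ q).2 V →
      IsVertical (g (φ q).1) (φ q).2 ((Real.sqrt t)⁻¹ • V) := fun {V} hV =>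
    ⟨by rw [smul_mul_assoc, hV.anti, mul_smul_comm, smul_neg], fun v w => by
      simp only [smul_apply, map_smul, hV.skew, smul_neg]⟩
  choose l hl1 hl2 using fun m => h.surj q hq (e m) 0 hz
  obtain ⟨a, ha1, ha2⟩ := h.surj q hq 0 _ (hsm hT.isVertical_j)
  obtain ⟨b, hb1, hb2⟩ := h.surj q hq 0 _ (hsm hT.isVertical_k)
  let f : Fin 4 ⊕ Fin 2 → N := Sum.elim l ![a, b]
  have hs := Real.mul_self_sqrt ht.le
  have hs0 := (Real.sqrt_pos.2 ht).ne'
  -- The endomorphisms `j` and `k` have length one for `G`, hence length `√t` for `t G`; this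
  -- explains the factor in the vertical vectors of the basis.
  have hs1 : t * ((Real.sqrt t)⁻¹ * (Real.sqrt t)⁻¹) = 1 := by
    rw [← mul_inv, hs, mul_inv_cancel₀ ht.ne']
  have jj : endForm F j j = 1 := hT.rotate.endForm_self
  have kk : endForm F k k = 1 := hT.rotate.rotate.endForm_self
  have jk : endForm F j k = 0 := hT.rotate.endForm_ij
  have kj : endForm F k j = 0 := by rw [endForm_symm, jk]
  have hon : ∀ r s, pullbackMetric (twistorMetric g t) φ q (f r) (f s) = if r = s then 1 else 0 := by
    intro r s
    rw [metric_apply]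
    rcases r with r | r <;> rcases s with s | s
    · simp [f, hl1, hl2, he]
    · fin_cases s <;> simp [f, hl2, ha1, hb1]
    · fin_cases r <;> simp [f, hl2, ha1, hb1]
    · fin_cases r <;> fin_cases s <;>
        simp [f, ha1, hb1, ha2, hb2, jj, kk, jk, kj, hs1]
  have hli : LinearIndependent ℝ f := by
    rw [Fintype.linearIndependent_iff]
    intro c hc s
    have h1 := congrArg (fun v => pullbackMetric (twistorMetric g t) φ q v (f s)) hc
    simp only [map_sum, map_smul, sum_apply, smul_apply, hon, smul_eq_mul, mul_ite, mul_one,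
      mul_zero, Finset.sum_ite_eq', Finset.mem_univ, if_true, map_zero, zero_apply] at h1
    exact h1
  have hsp : ⊤ ≤ Submodule.span ℝ (Set.range f) := by
    intro v _
    have hv := hT.vertical_eq (h.isVertical hq v)
    have e1 : v = (∑ m, g (φ q).1 (horiz φ q v) (e m) • f (Sum.inl m))
        + ((Real.sqrt t * endForm F (vert g φ q v) j) • f (Sum.inr 0)
        + (Real.sqrt t * endForm F (vert g φ q v) k) • f (Sum.inr 1)) := by
      refine h.eq_of_horiz_vert hq ?_ ?_
      · conv_lhs => rw [← e.sum_repr (horiz φ q v)]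
        simp [f, hl1, ha1, hb1, repr_orthonormal he]
      · conv_lhs => rw [hv]
        simp [f, hl2, ha2, hb2, smul_smul, mul_comm, hs0]
    rw [e1]
    have hm : ∀ r, f r ∈ Submodule.span ℝ (Set.range f) := fun r =>
      Submodule.subset_span ⟨r, rfl⟩
    exact Submodule.add_mem _ (Submodule.sum_mem _ fun m _ => Submodule.smul_mem _ _ (hm _))
      (Submodule.add_mem _ (Submodule.smul_mem _ _ (hm _)) (Submodule.smul_mem _ _ (hm _)))
  refine ⟨Module.Basis.mk hli hsp, ?_, ?_, ?_, ?_, ?_⟩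
  · simpa [Module.Basis.mk_apply] using hon
  · intro m; simp [f, hl1, hl2]
  · intro m; fin_cases m <;> simp [f, ha1, hb1]
  · simp [f, ha2]
  · simp [f, hb2]

/-- The diagonal second derivative is evaluated according to type. The first letter of the suffix
tells whether the direction of differentiation is horizontal or vertical, the second does so for the
argument. -/
theorem horiz_nablaTwo_hh (h : IsTwistorChart U g Ω φ) (hJ : IsTwistorACS g ε Ω φ J) (ht : 0 < t)
    (hq : q ∈ Ω) {a b : N} (ha : vert g φ q a = 0) (hb : vert g φ q b = 0) :
    horiz φ q (nablaTwo (pullbackMetric (twistorMetric g t) φ) J q a a b) =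
      lOp g t ε (φ q) (-((1 / 2 : ℝ) • (curvEnd g (φ q).1 (horiz φ q a) (horiz φ q b) * (φ q).2
          - (φ q).2 * curvEnd g (φ q).1 (horiz φ q a) (horiz φ q b)))) (horiz φ q a)
        - kOp g t (φ q) (cOp g ε (φ q) (horiz φ q a) (horiz φ q b)) (horiz φ q a) := by
  rw [h.horiz_nablaTwo hJ ht hq]
  simp [vertDefect, horizDefect, ha, hb, curvEnd_self, qOp_zero, lOp_zero, kOp_zero, dkOp,
    nablaOp_zero_right]

theorem horiz_nablaTwo_vh (h : IsTwistorChart U g Ω φ) (hJ : IsTwistorACS g ε Ω φ J) (ht : 0 < t)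
    (hq : q ∈ Ω) {a b : N} (ha : horiz φ q a = 0) (hb : vert g φ q b = 0) :
    horiz φ q (nablaTwo (pullbackMetric (twistorMetric g t) φ) J q a a b) =
      (qOp g t (φ q) (vert g φ q a * vert g φ q a * (φ q).2)
        + (vert g φ q a * kOp g t (φ q) (vert g φ q a) - kOp g t (φ q) (vert g φ q a) * vert g φ q a)
        + (qOp g t (φ q) (vert g φ q a) * kOp g t (φ q) (vert g φ q a)
          - kOp g t (φ q) (vert g φ q a) * qOp g t (φ q) (vert g φ q a))) (horiz φ q b) := by
  rw [h.horiz_nablaTwo hJ ht hq]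
  have e : (1 / 2 : ℝ) • ((vert g φ q a * vert g φ q a + vert g φ q a * vert g φ q a) * (φ q).2) =
      vert g φ q a * vert g φ q a * (φ q).2 := by
    rw [← two_smul ℝ, smul_mul_assoc, smul_smul]; norm_num
  simp only [vertDefect, horizDefect, ha, hb, lOp_zero, kOp_zero, dkOp,
    nablaOp_zero_left, e, map_zero, zero_apply, sub_self, zero_mul, mul_zero, smul_zero, add_zero,
    sub_zero, add_apply, sub_apply, end_mul_apply]
  abel

theorem horiz_nablaTwo_hv (h : IsTwistorChart U g Ω φ) (hJ : IsTwistorACS g ε Ω φ J) (ht : 0 < t)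
    (hq : q ∈ Ω) {a b : N} (ha : vert g φ q a = 0) (hb : horiz φ q b = 0) :
    horiz φ q (nablaTwo (pullbackMetric (twistorMetric g t) φ) J q a a b) =
      ((φ q).2 * dkOp g t (φ q) (horiz φ q a) 0 (vert g φ q b)
        - ε • dkOp g t (φ q) (horiz φ q a) 0 ((φ q).2 * vert g φ q b)) (horiz φ q a) := by
  rw [h.horiz_nablaTwo hJ ht hq]
  simp [vertDefect, horizDefect, ha, hb, qOp_zero, lOp_zero, kOp_zero, cOp]

theorem horiz_nablaTwo_vv (h : IsTwistorChart U g Ω φ) (hJ : IsTwistorACS g ε Ω φ J) (ht : 0 < t)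
    (hq : q ∈ Ω) {a b : N} (ha : horiz φ q a = 0) (hb : horiz φ q b = 0) :
    horiz φ q (nablaTwo (pullbackMetric (twistorMetric g t) φ) J q a a b) = 0 := by
  rw [h.horiz_nablaTwo hJ ht hq]
  simp [horizDefect, ha, hb]

theorem kOp_j (hT : QuatTriple (g (φ q).1) (φ q).2 j k) :
    kOp g t (φ q) j = t • curvOp g (φ q).1 k := by
  rw [kOp, hT.rel.ij, hT.rel.ji, sub_neg_eq_add, ← two_smul ℝ k, map_smul, smul_smul]
  congr 1; ring

theorem kOp_k (hT : QuatTriple (g (φ q).1) (φ q).2 j k) :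
    kOp g t (φ q) k = (-t) • curvOp g (φ q).1 j := by
  rw [kOp, hT.rel.ik, hT.rel.ki, ← neg_add', ← two_smul ℝ j, map_neg, map_smul, smul_neg, smul_smul,
    neg_smul]
  congr 2; ring

/-- The commutator of the curvature with `I`. -/
theorem curvEnd_commutator (h : IsTwistorChart U g Ω φ) (ht : 0 < t) (hq : q ∈ Ω)
    (hT : QuatTriple (g (φ q).1) (φ q).2 j k) (X Y : F) :
    curvEnd g (φ q).1 X Y * (φ q).2 - (φ q).2 * curvEnd g (φ q).1 X Y =
      (2 / t * g (φ q).1 (kOp g t (φ q) j X) Y) • j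
        + (2 / t * g (φ q).1 (kOp g t (φ q) k X) Y) • k := by
  have hR := h.metric.curvEnd_metric (h.mem hq) X Y
  have hv : IsVertical (g (φ q).1) (φ q).2
      (curvEnd g (φ q).1 X Y * (φ q).2 - (φ q).2 * curvEnd g (φ q).1 X Y) := by
    constructor
    · have hI := h.sq hq
      simp only [sub_mul, mul_sub, mul_assoc, hI]
      simp only [← mul_assoc, hI]
      simp [sub_eq_add_neg]
    · intro v w
      simp only [sub_apply, end_mul_apply, map_sub, hR, h.skew hq]
      ring
  rw [h.kOp_inner hq, h.kOp_inner hq, endForm_symm j, endForm_symm k, ← mul_assoc, ← mul_assoc]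
  have e : 2 / t * (t / 2) = 1 := by field_simp
  rw [e, one_mul, one_mul]
  exact hT.vertical_eq hv

/-- The rough Laplacian of `J`, summed over the basis `f`. -/
def _root_.Twistor.roughLap (H : N → N →L[ℝ] N →L[ℝ] ℝ) (J : N → N →L[ℝ] N) (q : N)
    (f : Module.Basis (Fin 4 ⊕ Fin 2) ℝ N) : N →L[ℝ] N :=
  ∑ r, nablaTwo H J q (f r) (f r)

/-- The block of the Laplacian from horizontal to horizontal vectors. The horizontal directions give
products of curvatures, which `sum_skew` turns into products of `K_j` and `K_k`; the vertical
directions give the terms linear in these operators, the term in `I`, and more quadratic terms. -/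
theorem horiz_roughLap_of_vert_eq_zero (h : IsTwistorChart U g Ω φ)
    (hJ : IsTwistorACS g ε Ω φ J) (ht : 0 < t) (hq : q ∈ Ω)
    (hT : QuatTriple (g (φ q).1) (φ q).2 j k)
    (he : ∀ m n, g (φ q).1 (e m) (e n) = if m = n then 1 else 0)
    {f : Module.Basis (Fin 4 ⊕ Fin 2) ℝ N}
    (hf : ∀ m, horiz φ q (f (Sum.inl m)) = e m ∧ vert g φ q (f (Sum.inl m)) = 0)
    (hf' : ∀ m, horiz φ q (f (Sum.inr m)) = 0)
    (hf0 : vert g φ q (f (Sum.inr 0)) = (Real.sqrt t)⁻¹ • j)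
    (hf1 : vert g φ q (f (Sum.inr 1)) = (Real.sqrt t)⁻¹ • k) {b : N} (hb : vert g φ q b = 0) :
    horiz φ q (roughLap (pullbackMetric (twistorMetric g t) φ) J q f b) =
      ((2 / t) • lapBlock ε (φ q).2 j k (kOp g t (φ q) j) (kOp g t (φ q) k)) (horiz φ q b) := by
  have hs := h.metric.symm _ (h.mem hq)
  have hst : (Real.sqrt t)⁻¹ * (Real.sqrt t)⁻¹ = 1 / t := by
    rw [← mul_inv, Real.mul_self_sqrt ht.le, one_div]
  rw [roughLap, Fintype.sum_sum_type, Fin.sum_univ_two, add_apply, sum_apply, map_add, map_sum,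
    add_apply, map_add]
  have hK : ∀ B v w, g (φ q).1 (kOp g t (φ q) B v) w = -g (φ q).1 v (kOp g t (φ q) B w) :=
    fun B => h.kOp_skew hq B
  -- Each commutator `[R(X, Y), I]` is written in the basis `j, k`, with coefficients that are inner
  -- products with `K_j X` and `K_k X`. This is the shape required by `sum_skew`.
  have e1 : ∀ m, horiz φ q (nablaTwo (pullbackMetric (twistorMetric g t) φ) J q
      (f (Sum.inl m)) (f (Sum.inl m)) b) =
      -(1 / t) • (g (φ q).1 (kOp g t (φ q) j (e m)) (horiz φ q b) •
          ((φ q).2 * kOp g t (φ q) j) (e m))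
      - (1 / t) • (g (φ q).1 (kOp g t (φ q) k (e m)) (horiz φ q b) •
          ((φ q).2 * kOp g t (φ q) k) (e m))
      + (2 * ε / t) • (g (φ q).1 (kOp g t (φ q) j (e m)) (horiz φ q b) • kOp g t (φ q) k (e m))
      - (2 * ε / t) • (g (φ q).1 (kOp g t (φ q) k (e m)) (horiz φ q b) • kOp g t (φ q) j (e m))
      - (1 / t) • (g (φ q).1 (kOp g t (φ q) j (e m)) ((φ q).2 (horiz φ q b)) •
          kOp g t (φ q) j (e m))
      - (1 / t) • (g (φ q).1 (kOp g t (φ q) k (e m)) ((φ q).2 (horiz φ q b)) •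
          kOp g t (φ q) k (e m)) := by
    intro m
    rw [h.horiz_nablaTwo_hh hJ ht hq (hf m).2 hb, (hf m).1, cOp, h.curvEnd_commutator ht hq hT,
      h.curvEnd_commutator ht hq hT]
    have n : ∀ B, kOp g t (φ q) (-B) = -kOp g t (φ q) B := fun B => by
      rw [← neg_one_smul ℝ B, kOp_smul, neg_one_smul]
    simp only [lOp, mul_add, mul_smul_comm, hT.rel.ij, hT.rel.ik, kOp_add, kOp_smul, kOp_sub, n,
      mul_neg, smul_neg, smul_add, neg_apply, sub_apply, add_apply, smul_apply, end_mul_apply]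
    module
  simp only [e1, Finset.sum_add_distrib, Finset.sum_sub_distrib, ← Finset.smul_sum,
    sum_skew hs he (hK _), h.horiz_nablaTwo_vh hJ ht hq (hf' _) hb, hf0, hf1]
  have sj : ((Real.sqrt t)⁻¹ • j * (Real.sqrt t)⁻¹ • j) * (φ q).2 = -(1 / t) • (φ q).2 := by
    rw [smul_mul_smul_comm, hst, hT.rel.jj]; simp
  have sk : ((Real.sqrt t)⁻¹ • k * (Real.sqrt t)⁻¹ • k) * (φ q).2 = -(1 / t) • (φ q).2 := by
    rw [smul_mul_smul_comm, hst, hT.rel.kk]; simp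
  have qi : qOp g t (φ q) (-(1 / t) • (φ q).2) = -(1 / t) • (φ q).2 := by
    simp [qOp, kOp]
  rw [sj, sk, qi]
  set Y := horiz φ q b
  set I := (φ q).2
  have e2 : ∀ B : F →L[ℝ] F, (Real.sqrt t)⁻¹ • B * kOp g t (φ q) ((Real.sqrt t)⁻¹ • B)
        - kOp g t (φ q) ((Real.sqrt t)⁻¹ • B) * (Real.sqrt t)⁻¹ • B
      = (1 / t) • (B * kOp g t (φ q) B - kOp g t (φ q) B * B) := fun B => by
    rw [kOp_smul, smul_mul_smul_comm, smul_mul_smul_comm, hst, smul_sub]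
  have e3 : ∀ B : F →L[ℝ] F, qOp g t (φ q) ((Real.sqrt t)⁻¹ • B) * kOp g t (φ q) ((Real.sqrt t)⁻¹ • B)
        - kOp g t (φ q) ((Real.sqrt t)⁻¹ • B) * qOp g t (φ q) ((Real.sqrt t)⁻¹ • B)
      = (1 / t) • (qOp g t (φ q) B * kOp g t (φ q) B - kOp g t (φ q) B * qOp g t (φ q) B) := by
    intro B
    have : qOp g t (φ q) ((Real.sqrt t)⁻¹ • B) = (Real.sqrt t)⁻¹ • qOp g t (φ q) B := by
      simp only [qOp, kOp_smul, mul_smul_comm, smul_mul_assoc, smul_add, smul_sub]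
    rw [this, kOp_smul, smul_mul_smul_comm, smul_mul_smul_comm, hst, smul_sub]
  rw [e2, e2, e3, e3]
  unfold qOp lapBlock
  set K := kOp g t (φ q) j
  set L := kOp g t (φ q) k
  have : ∀ v, (φ q).2 v = I v := fun _ => rfl
  simp only [this, mul_add, add_mul, mul_sub, sub_mul, mul_assoc, add_apply, sub_apply, smul_apply,
    end_mul_apply]
  module

theorem dkOp_j (hT : QuatTriple (g (φ q).1) (φ q).2 j k) (X : F) :
    dkOp g t (φ q) X 0 j = t • nablaOp g (φ q).1 X k := by
  rw [dkOp, hT.rel.ij, hT.rel.ji, sub_neg_eq_add, ← two_smul ℝ k, nablaOp_smul]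
  simp [smul_smul]

theorem dkOp_k (hT : QuatTriple (g (φ q).1) (φ q).2 j k) (X : F) :
    dkOp g t (φ q) X 0 k = (-t) • nablaOp g (φ q).1 X j := by
  have : -j - j = (-2 : ℝ) • j := by module
  rw [dkOp, hT.rel.ik, hT.rel.ki, this, nablaOp_smul]
  simp [smul_smul]

/-- The block from vertical to horizontal vectors. Vertical directions contribute nothing, and
horizontal ones only through the derivative of the curvature, hence the divergence in what follows.
-/
theorem horiz_roughLap_of_vert_eq (h : IsTwistorChart U g Ω φ)
    (hJ : IsTwistorACS g ε Ω φ J) (ht : 0 < t) (hq : q ∈ Ω)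
    {f : Module.Basis (Fin 4 ⊕ Fin 2) ℝ N}
    (hf : ∀ m, horiz φ q (f (Sum.inl m)) = e m ∧ vert g φ q (f (Sum.inl m)) = 0)
    (hf' : ∀ m, horiz φ q (f (Sum.inr m)) = 0) {b : N} (hb : horiz φ q b = 0) :
    horiz φ q (roughLap (pullbackMetric (twistorMetric g t) φ) J q f b) =
      ∑ m, ((φ q).2 * dkOp g t (φ q) (e m) 0 (vert g φ q b)
        - ε • dkOp g t (φ q) (e m) 0 ((φ q).2 * vert g φ q b)) (e m) := by
  rw [roughLap, Fintype.sum_sum_type, Fin.sum_univ_two, add_apply, sum_apply, map_add, map_sum,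
    add_apply, map_add, h.horiz_nablaTwo_vv hJ ht hq (hf' _) hb,
    h.horiz_nablaTwo_vv hJ ht hq (hf' _) hb, add_zero, add_zero]
  refine Finset.sum_congr rfl fun m _ => ?_
  rw [h.horiz_nablaTwo_hv hJ ht hq (hf m).2 hb, (hf m).1]

theorem dkOp_smul (X : F) (c : ℝ) (B : F →L[ℝ] F) :
    dkOp g t z X 0 (c • B) = c • dkOp g t z X 0 B := by
  simp only [dkOp, mul_smul_comm, smul_mul_assoc, ← smul_sub, nablaOp_smul, zero_mul,
    mul_zero, sub_self, smul_zero, map_zero, add_zero, smul_comm c]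

theorem horiz_roughLap_j (h : IsTwistorChart U g Ω φ)
    (hJ : IsTwistorACS g ε Ω φ J) (ht : 0 < t) (hq : q ∈ Ω)
    (hT : QuatTriple (g (φ q).1) (φ q).2 j k) {f : Module.Basis (Fin 4 ⊕ Fin 2) ℝ N}
    (hf : ∀ m, horiz φ q (f (Sum.inl m)) = e m ∧ vert g φ q (f (Sum.inl m)) = 0)
    (hf' : ∀ m, horiz φ q (f (Sum.inr m)) = 0) {b : N} (hb : horiz φ q b = 0) {c : ℝ}
    (hc : vert g φ q b = c • j) :
    horiz φ q (roughLap (pullbackMetric (twistorMetric g t) φ) J q f b) =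
      (t * c) • ((φ q).2 (divOp g (φ q).1 e k) + ε • divOp g (φ q).1 e j) := by
  rw [h.horiz_roughLap_of_vert_eq hJ ht hq hf hf' hb, hc, divOp, divOp]
  simp only [mul_smul_comm, hT.rel.ij, dkOp_smul, dkOp_j hT, dkOp_k hT, map_sum, Finset.smul_sum,
    ← Finset.sum_add_distrib, sub_apply, smul_apply, smul_add, end_mul_apply]
  refine Finset.sum_congr rfl fun m _ => ?_
  module

/-- Because `ε² = 1`, the value on `k` is `-ε I` times the value on `j`; both directions of the
fibre lead to the same divergence condition. -/
theorem horiz_roughLap_k (h : IsTwistorChart U g Ω φ)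
    (hJ : IsTwistorACS g ε Ω φ J) (hε : ε * ε = 1) (ht : 0 < t) (hq : q ∈ Ω)
    (hT : QuatTriple (g (φ q).1) (φ q).2 j k) {f : Module.Basis (Fin 4 ⊕ Fin 2) ℝ N}
    (hf : ∀ m, horiz φ q (f (Sum.inl m)) = e m ∧ vert g φ q (f (Sum.inl m)) = 0)
    (hf' : ∀ m, horiz φ q (f (Sum.inr m)) = 0) {b : N} (hb : horiz φ q b = 0) {c : ℝ}
    (hc : vert g φ q b = c • k) :
    horiz φ q (roughLap (pullbackMetric (twistorMetric g t) φ) J q f b) =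
      -(t * c * ε) • (φ q).2 ((φ q).2 (divOp g (φ q).1 e k) + ε • divOp g (φ q).1 e j) := by
  have hII : ∀ v, (φ q).2 ((φ q).2 v) = -v := (h.mapsTo hq).2.1
  have hik : (φ q).2 * c • k = (-c) • j := by rw [mul_smul_comm, hT.rel.ik, smul_neg, neg_smul]
  rw [h.horiz_roughLap_of_vert_eq hJ ht hq hf hf' hb, hc, map_add, hII, map_smul, divOp, divOp, hik]
  simp only [dkOp_smul, dkOp_j hT, dkOp_k hT, map_sum, Finset.smul_sum,
    ← Finset.sum_neg_distrib, ← Finset.sum_add_distrib, sub_apply, smul_apply,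
    end_mul_apply]
  refine Finset.sum_congr rfl fun m _ => ?_
  rw [map_smul, map_smul]
  match_scalars
  · linear_combination (t * c) * hε
  · ring

/-- By skewness, the vanishing of the horizontal components of `Ξ` leaves only the block from
vertical to vertical vectors. On a plane a skew endomorphism is a multiple of `𝒥`, and it cannot
anti-commute with `𝒥` unless it vanishes. The application is to the commutator of the Laplacian with
`𝒥`. -/
theorem eq_zero_of_skew_of_horiz_eq_zero (h : IsTwistorChart U g Ω φ)
    (hJ : IsTwistorACS g ε Ω φ J) (hε : ε * ε = 1) (ht : 0 < t) (hq : q ∈ Ω)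
    (hT : QuatTriple (g (φ q).1) (φ q).2 j k)
    {f : Module.Basis (Fin 4 ⊕ Fin 2) ℝ N}
    (hf : ∀ m, vert g φ q (f (Sum.inl m)) = 0)
    (hf' : ∀ m, horiz φ q (f (Sum.inr m)) = 0)
    (hf0 : vert g φ q (f (Sum.inr 0)) = (Real.sqrt t)⁻¹ • j)
    (hf1 : vert g φ q (f (Sum.inr 1)) = (Real.sqrt t)⁻¹ • k) {Ξ : N →L[ℝ] N}
    (hs : ∀ a b, pullbackMetric (twistorMetric g t) φ q (Ξ a) b =
      -pullbackMetric (twistorMetric g t) φ q a (Ξ b))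
    (hΞJ : ∀ a, Ξ (J q a) = -J q (Ξ a)) (hh : ∀ s, horiz φ q (Ξ (f s)) = 0) : Ξ = 0 := by
  have hm := h.isMetricOn ht
  have hJs := h.twistorACS_skew (t := t) hJ hq
  have hJf : J q (f (Sum.inr 0)) = ε • f (Sum.inr 1) := by
    refine h.eq_of_horiz_vert hq ?_ ?_
    · rw [hJ.horiz_apply q hq, map_smul, hf', hf']; simp
    · rw [hJ.vert_apply q hq, map_smul, hf0, hf1, mul_smul_comm, hT.rel.ij]
  have hinl : ∀ a m, pullbackMetric (twistorMetric g t) φ q (Ξ (f a)) (f (Sum.inl m)) = 0 :=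
    fun a m => by rw [metric_apply, hh, hf m]; simp
  generalize pullbackMetric (twistorMetric g t) φ = H at *
  have hself : ∀ a, H q (Ξ a) a = 0 := fun a => by
    have h3 := hs a a
    rw [hm.symm q hq a] at h3
    linarith
  have h01 : H q (Ξ (f (Sum.inr 0))) (f (Sum.inr 1)) = 0 := by
    have h4 : H q (Ξ (J q (f (Sum.inr 0)))) (f (Sum.inr 0)) =
        H q (Ξ (f (Sum.inr 0))) (J q (f (Sum.inr 0))) := by
      rw [hΞJ, map_neg, neg_apply, hJs, neg_neg]
    rw [hJf, map_smul, map_smul, smul_apply, map_smul, hs (f (Sum.inr 1)),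
      hm.symm q hq (f (Sum.inr 1))] at h4
    simp only [smul_eq_mul] at h4
    have : ε ≠ 0 := fun h0 => by simp [h0] at hε
    have h5 : ε * H q (Ξ (f (Sum.inr 0))) (f (Sum.inr 1)) = 0 := by linarith
    exact (mul_eq_zero.1 h5).resolve_left this
  have key : ∀ a s, H q (Ξ (f a)) (f s) = 0 := by
    intro a s
    rcases s with m | m
    · exact hinl a m
    · rcases a with n | n
      · rw [hs, hm.symm q hq, hinl, neg_zero]
      · fin_cases m <;> fin_cases n
        · exact hself _
        · change H q (Ξ (f (Sum.inr 1))) (f (Sum.inr 0)) = 0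
          rw [hs, hm.symm q hq, h01, neg_zero]
        · exact h01
        · exact hself _
  refine ContinuousLinearMap.coe_injective (f.ext fun a => ?_)
  refine hm.ext hq fun v => ?_
  have : H q (Ξ (f a)) = 0 := ContinuousLinearMap.coe_injective (f.ext fun s => key a s)
  change H q (Ξ (f a)) v = H q 0 v
  rw [this]; simp

/-- The rough Laplacian of `𝒥` commutes with `𝒥` if and only if a condition on the curvature and a
condition on its divergence hold. -/
theorem roughLap_comm_iff (h : IsTwistorChart U g Ω φ)
    (hJ : IsTwistorACS g ε Ω φ J) (hε : ε * ε = 1) (ht : 0 < t) (hq : q ∈ Ω)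
    (hT : QuatTriple (g (φ q).1) (φ q).2 j k)
    (he : ∀ m n, g (φ q).1 (e m) (e n) = if m = n then 1 else 0)
    {f : Module.Basis (Fin 4 ⊕ Fin 2) ℝ N}
    (hf : ∀ m, horiz φ q (f (Sum.inl m)) = e m ∧ vert g φ q (f (Sum.inl m)) = 0)
    (hf' : ∀ m, horiz φ q (f (Sum.inr m)) = 0)
    (hf0 : vert g φ q (f (Sum.inr 0)) = (Real.sqrt t)⁻¹ • j)
    (hf1 : vert g φ q (f (Sum.inr 1)) = (Real.sqrt t)⁻¹ • k) :
    roughLap (pullbackMetric (twistorMetric g t) φ) J q f * J q =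
        J q * roughLap (pullbackMetric (twistorMetric g t) φ) J q f ↔
      (lapBlock ε (φ q).2 j k (kOp g t (φ q) j) (kOp g t (φ q) k) * (φ q).2 =
        (φ q).2 * lapBlock ε (φ q).2 j k (kOp g t (φ q) j) (kOp g t (φ q) k) ∧
      (φ q).2 (divOp g (φ q).1 e k) + ε • divOp g (φ q).1 e j = 0) := by
  have hm := h.isMetricOn ht
  have hP := fun b (hb : vert g φ q b = 0) =>
    h.horiz_roughLap_of_vert_eq_zero hJ ht hq hT he hf hf' hf0 hf1 hb
  have hTj := fun c b (hb : horiz φ q b = 0) (hc : vert g φ q b = c • j) =>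
    h.horiz_roughLap_j hJ ht hq hT hf hf' hb hc
  have hTk := fun c b (hb : horiz φ q b = 0) (hc : vert g φ q b = c • k) =>
    h.horiz_roughLap_k hJ hε ht hq hT hf hf' hb hc
  have hTs : ∀ a b, pullbackMetric (twistorMetric g t) φ q
      (roughLap (pullbackMetric (twistorMetric g t) φ) J q f a) b =
      -pullbackMetric (twistorMetric g t) φ q a
        (roughLap (pullbackMetric (twistorMetric g t) φ) J q f b) := by
    intro a b
    simp only [roughLap, sum_apply, map_sum, ← Finset.sum_neg_distrib]
    refine Finset.sum_congr rfl fun r _ => ?_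
    refine nablaTwo_metric_skew hm hq ?_ ?_ _ _ _ _
    · filter_upwards [h.eventually_mem hq] with y hy using h.smoothAt_twistorACS hJ hy
    · filter_upwards [h.eventually_mem hq] with y hy using h.twistorACS_skew hJ hy
  have hJs := h.twistorACS_skew (t := t) hJ hq
  have hJ2 : ∀ v, J q (J q v) = -v := fun v =>
    congrArg (fun L => L v) (h.twistorACS_sq hJ hε hq)
  have hJh := hJ.horiz_apply q hq
  have hJv := hJ.vert_apply q hq
  have hII : ∀ v, (φ q).2 ((φ q).2 v) = -v := (h.mapsTo hq).2.1
  have hz := fun Ξ => h.eq_zero_of_skew_of_horiz_eq_zero (Ξ := Ξ) hJ hε ht hq hT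
    (fun m => (hf m).2) hf' hf0 hf1
  have hr0 : 0 < (Real.sqrt t)⁻¹ := inv_pos.2 (Real.sqrt_pos.2 ht)
  generalize roughLap (pullbackMetric (twistorMetric g t) φ) J q f = T at *
  generalize lapBlock ε (φ q).2 j k (kOp g t (φ q) j) (kOp g t (φ q) k) = P at *
  generalize (φ q).2 (divOp g (φ q).1 e k) + ε • divOp g (φ q).1 e j = w at *
  generalize (Real.sqrt t)⁻¹ = r at *
  constructor
  · intro hc
    have hc' : ∀ b, T (J q b) = J q (T b) := fun b => congrArg (fun L => L b) hc
    constructor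
    · refine ContinuousLinearMap.coe_injective (e.ext fun m => ?_)
      have h1 := congrArg (horiz φ q) (hc' (f (Sum.inl m)))
      rw [hP _ (by rw [hJv, (hf m).2]; simp), hJh, hJh, hP _ (hf m).2, (hf m).1] at h1
      simp only [smul_apply, map_smul] at h1
      exact smul_right_injective F (r := 2 / t) (by positivity) h1
    -- `𝒥` takes the unit vector along `j` to `ε` times the one along `k`. As the values of the
    -- Laplacian on them differ by `-ε I`, commutation reads `-I w = I w`.
    · have h1 := congrArg (horiz φ q) (hc' (f (Sum.inr 0)))
      rw [hJh, hTj r _ (hf' 0) hf0, hTk (ε * r) _ (by rw [hJh, hf' 0, map_zero])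
        (by rw [hJv, hf0, mul_smul_comm, hT.rel.ij, smul_smul]), map_smul] at h1
      have h2 : (t * (ε * r) * ε) = t * r := by linear_combination t * r * hε
      rw [h2] at h1
      have h3 : (2 * (t * r)) • (φ q).2 w = 0 := by
        rw [mul_smul, two_smul]
        nth_rewrite 1 [← h1]; module
      have h4 := (smul_eq_zero.1 h3).resolve_left (by positivity)
      have := hII w
      rwa [h4, map_zero, eq_comm, neg_eq_zero] at this
  · rintro ⟨h1, h2⟩
    rw [← sub_eq_zero]
    -- The commutator of two skew endomorphisms is skew, and it anti-commutes with `𝒥` because `𝒥² =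
    -- -1`; it suffices to look at horizontal components.
    refine hz _ ?_ ?_ ?_
    · intro a b
      simp only [sub_apply, end_mul_apply, map_sub, hTs, hJs]; ring
    · intro a
      simp only [sub_apply, end_mul_apply, map_sub, hJ2, map_neg]; abel
    · intro s
      have hs : horiz φ q ((T * J q - J q * T) (f s)) =
          horiz φ q (T (J q (f s))) - (φ q).2 (horiz φ q (T (f s))) := by
        rw [← hJh, ← map_sub]; rfl
      rw [hs]
      rcases s with m | m
      · rw [hP _ (by rw [hJv, (hf m).2]; simp), hP _ (hf m).2, hJh, (hf m).1]
        have := congrArg (fun L => L (e m)) h1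
        simp only [end_mul_apply] at this
        simp only [smul_apply, map_smul, this, sub_self]
      · fin_cases m
        · change horiz φ q (T (J q (f (Sum.inr 0)))) - (φ q).2 (horiz φ q (T (f (Sum.inr 0)))) = 0
          rw [hTj r _ (hf' 0) hf0, hTk (ε * r) _ (by rw [hJh, hf' 0, map_zero])
            (by rw [hJv, hf0, mul_smul_comm, hT.rel.ij, smul_smul]), h2]
          simp
        · change horiz φ q (T (J q (f (Sum.inr 1)))) - (φ q).2 (horiz φ q (T (f (Sum.inr 1)))) = 0
          rw [hTk r _ (hf' 1) hf1, hTj (-(ε * r)) _ (by rw [hJh, hf' 1, map_zero])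
            (by rw [hJv, hf1, mul_smul_comm, hT.rel.ik, smul_smul, smul_neg, neg_smul]), h2]
          simp

end IsTwistorChart

end RoughLaplacian

/-! ### Curvature algebra in dimension four -/

section CurvatureComponents

/-- The symmetries of the components of the curvature tensor in an orthonormal basis. -/
structure IsCurvTensor (r : Fin 4 → Fin 4 → Fin 4 → Fin 4 → ℝ) : Prop where
  skew : ∀ m n p q, r m n p q = -r n m p q
  skew' : ∀ m n p q, r m n p q = -r m n q p
  pair : ∀ m n p q, r m n p q = r p q m n
  bianchi : ∀ m n p q, r m n p q + r n p m q + r p m n q = 0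

/-- The components of the Ricci tensor. -/
def ricciComp (r : Fin 4 → Fin 4 → Fin 4 → Fin 4 → ℝ) (m n : Fin 4) : ℝ :=
  r m 0 n 0 + r m 1 n 1 + r m 2 n 2 + r m 3 n 3

/-- The scalar curvature in components. -/
def scalarComp (r : Fin 4 → Fin 4 → Fin 4 → Fin 4 → ℝ) : ℝ :=
  ricciComp r 0 0 + ricciComp r 1 1 + ricciComp r 2 2 + ricciComp r 3 3

/-- The components of the Weyl tensor. -/
def weylComp (r : Fin 4 → Fin 4 → Fin 4 → Fin 4 → ℝ) (m n p q : Fin 4) : ℝ :=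
  r m n p q
    - scalarComp r / 6 * ((1 / 2) * ((if m = p then 1 else 0) * (if n = q then 1 else 0)
        - (if m = q then 1 else 0) * (if n = p then 1 else 0)))
    - ((1 / 2) * (ricciComp r m p * (if n = q then 1 else 0)
          - ricciComp r m q * (if n = p then 1 else 0)
          + (if m = p then 1 else 0) * ricciComp r n q
          - (if m = q then 1 else 0) * ricciComp r n p)
        - scalarComp r / 2 * ((1 / 2) * ((if m = p then 1 else 0) * (if n = q then 1 else 0)
          - (if m = q then 1 else 0) * (if n = p then 1 else 0))))

theorem IsCurvTensor.weylComp_skew {r : Fin 4 → Fin 4 → Fin 4 → Fin 4 → ℝ} (h : IsCurvTensor r)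
    (m n p q : Fin 4) : weylComp r m n p q = -weylComp r m n q p := by
  rw [weylComp, weylComp, h.skew' m n p q]; ring

theorem IsCurvTensor.weylComp_self {r : Fin 4 → Fin 4 → Fin 4 → Fin 4 → ℝ} (h : IsCurvTensor r)
    (m n p : Fin 4) : weylComp r m n p p = 0 := by
  linarith [h.weylComp_skew m n p p]

set_option linter.unusedSimpArgs false in
set_option maxHeartbeats 1000000 in
/-- The vanishing of the Weyl tensor on `Λ²₋` in components. -/
theorem IsCurvTensor.weylComp_eq_zero_iff {r : Fin 4 → Fin 4 → Fin 4 → Fin 4 → ℝ}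
    (h : IsCurvTensor r) :
    (∀ p q, weylComp r 0 1 p q - weylComp r 2 3 p q = 0 ∧
      weylComp r 0 2 p q - weylComp r 3 1 p q = 0 ∧
      weylComp r 0 3 p q - weylComp r 1 2 p q = 0) ↔
    (r 0 2 0 1 - r 0 2 2 3 - r 3 1 0 1 + r 3 1 2 3 = 0 ∧
      r 0 3 0 1 - r 0 3 2 3 - r 1 2 0 1 + r 1 2 2 3 = 0 ∧
      r 0 3 0 2 - r 0 3 3 1 - r 1 2 0 2 + r 1 2 3 1 = 0 ∧
      r 0 1 0 1 - r 0 1 2 3 - r 2 3 0 1 + r 2 3 2 3 = scalarComp r / 6 ∧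
      r 0 2 0 2 - r 0 2 3 1 - r 3 1 0 2 + r 3 1 3 1 = scalarComp r / 6 ∧
      r 0 3 0 3 - r 0 3 1 2 - r 1 2 0 3 + r 1 2 1 2 = scalarComp r / 6) := by
  have z : ∀ m p q, r m m p q = 0 := fun m p q => by linarith [h.skew m m p q]
  have z' : ∀ m n p, r m n p p = 0 := fun m n p => by linarith [h.skew' m n p p]
  -- All components are brought to pairs of increasing indices in a fixed order. A single Bianchi
  -- relation between them is left, and both implications become linear arithmetic.
  have s10 : ∀ p q, r 1 0 p q = -r 0 1 p q := fun p q => h.skew 1 0 p q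
  have s20 : ∀ p q, r 2 0 p q = -r 0 2 p q := fun p q => h.skew 2 0 p q
  have s30 : ∀ p q, r 3 0 p q = -r 0 3 p q := fun p q => h.skew 3 0 p q
  have s21 : ∀ p q, r 2 1 p q = -r 1 2 p q := fun p q => h.skew 2 1 p q
  have s31 : ∀ p q, r 3 1 p q = -r 1 3 p q := fun p q => h.skew 3 1 p q
  have s32 : ∀ p q, r 3 2 p q = -r 2 3 p q := fun p q => h.skew 3 2 p q
  have t10 : ∀ p q, r p q 1 0 = -r p q 0 1 := fun p q => h.skew' p q 1 0
  have t20 : ∀ p q, r p q 2 0 = -r p q 0 2 := fun p q => h.skew' p q 2 0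
  have t30 : ∀ p q, r p q 3 0 = -r p q 0 3 := fun p q => h.skew' p q 3 0
  have t21 : ∀ p q, r p q 2 1 = -r p q 1 2 := fun p q => h.skew' p q 2 1
  have t31 : ∀ p q, r p q 3 1 = -r p q 1 3 := fun p q => h.skew' p q 3 1
  have t32 : ∀ p q, r p q 3 2 = -r p q 2 3 := fun p q => h.skew' p q 3 2
  have p1 := h.pair 0 2 0 1
  have p2 := h.pair 0 3 0 1
  have p3 := h.pair 1 2 0 1
  have p4 := h.pair 1 3 0 1
  have p5 := h.pair 2 3 0 1
  have p6 := h.pair 0 3 0 2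
  have p7 := h.pair 1 2 0 2
  have p8 := h.pair 1 3 0 2
  have p9 := h.pair 2 3 0 2
  have p10 := h.pair 1 2 0 3
  have p11 := h.pair 1 3 0 3
  have p12 := h.pair 2 3 0 3
  have p13 := h.pair 1 3 1 2
  have p14 := h.pair 2 3 1 2
  have p15 := h.pair 2 3 1 3
  have b := h.bianchi 0 1 2 3
  simp only [s20, p10] at b
  constructor
  · intro hw
    have w01 := hw 0 1
    have w02 := hw 0 2
    have w03 := hw 0 3
    have w12 := hw 1 2
    have w13 := hw 1 3
    have w23 := hw 2 3
    simp [weylComp, scalarComp, ricciComp, z, z', s10, s20, s30, s21, s31, s32, t10, t20, t30, t21,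
      t31, t32, p1, p2, p3, p4, p5, p6, p7, p8, p9, p10, p11, p12, p13, p14, p15] at w01 w02 w03 w12 w13 w23 ⊢
    refine ⟨?_, ?_, ?_, ?_, ?_, ?_⟩ <;> linarith only [b, w01.1, w01.2.1, w01.2.2, w02.1, w02.2.1,
      w02.2.2, w03.1, w03.2.1, w03.2.2, w12.1, w12.2.1, w12.2.2, w13.1, w13.2.1, w13.2.2, w23.1,
      w23.2.1, w23.2.2]
  · rintro ⟨h1, h2, h3, h4, h5, h6⟩
    simp only [scalarComp, ricciComp, z, z', s10, s20, s30, s21, s31, s32, t10, t20, t30, t21,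
      t31, t32, p1, p2, p3, p4, p5, p6, p7, p8, p9, p10, p11, p12, p13, p14, p15] at h1 h2 h3 h4 h5 h6
    have key : ∀ p q : Fin 4, p < q → weylComp r 0 1 p q - weylComp r 2 3 p q = 0 ∧
        weylComp r 0 2 p q - weylComp r 3 1 p q = 0 ∧
        weylComp r 0 3 p q - weylComp r 1 2 p q = 0 := by
      intro p q hpq
      fin_cases p <;> fin_cases q <;> first
      | exact absurd hpq (by decide)
      | (simp [weylComp, scalarComp, ricciComp, z, z', s10, s20, s30, s21, s31, s32, t10, t20, t30,
          t21, t31, t32, p1, p2, p3, p4, p5, p6, p7, p8, p9, p10, p11, p12, p13, p14, p15]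
         refine ⟨?_, ?_, ?_⟩ <;> linarith only [b, h1, h2, h3, h4, h5, h6])
    intro p q
    rcases lt_trichotomy p q with hpq | rfl | hpq
    · exact key p q hpq
    · simp only [h.weylComp_self, sub_self, and_self]
    · obtain ⟨k1, k2, k3⟩ := key q p hpq
      simp only [h.weylComp_skew _ _ p q]
      exact ⟨by linarith, by linarith, by linarith⟩

end CurvatureComponents

/-! ### The curvature operator on anti-self-dual bivectors -/

section AntiSelfDual

variable {F : Type*} [NormedAddCommGroup F] [NormedSpace ℝ F] [FiniteDimensional ℝ F]
variable {U : Set F} {g : F → F →L[ℝ] F →L[ℝ] ℝ} {x : F} {e : Module.Basis (Fin 4) ℝ F}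

/-- The components of the curvature tensor in the basis `e`. -/
def curvComp (g : F → F →L[ℝ] F →L[ℝ] ℝ) (x : F) (e : Module.Basis (Fin 4) ℝ F)
    (m n p q : Fin 4) : ℝ :=
  g x (curvEnd g x (e m) (e n) (e p)) (e q)

theorem IsMetricOn.isCurvTensor (hg : IsMetricOn U g) (hx : x ∈ U) :
    IsCurvTensor (curvComp g x e) where
  skew m n p q := by rw [curvComp, curvComp, curvEnd_skew g x (e m) (e n)]; simp
  skew' m n p q := by rw [curvComp, curvComp, hg.curvEnd_metric hx, hg.symm x hx]
  pair m n p q := hg.curvEnd_pair hx _ _ _ _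
  bianchi m n p q := by
    have := congrArg (fun v => g x v (e q)) (hg.curvEnd_bianchi hx (e m) (e n) (e p))
    simpa [curvComp] using this

theorem curvOp_sOne_inner (hg : IsMetricOn U g) (hx : x ∈ U)
    (he : ∀ m n, g x (e m) (e n) = if m = n then 1 else 0) (m n : Fin 4) :
    g x (curvOp g x (sOne e) (e m)) (e n) =
      (1 / 2) * (curvComp g x e m n 0 1 - curvComp g x e m n 2 3) := by
  rw [hg.curvOp_inner hx, endForm_sOne (hg.symm x hx) he (hg.curvEnd_metric hx _ _)]; rfl

theorem curvOp_sTwo_inner (hg : IsMetricOn U g) (hx : x ∈ U)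
    (he : ∀ m n, g x (e m) (e n) = if m = n then 1 else 0) (m n : Fin 4) :
    g x (curvOp g x (sTwo e) (e m)) (e n) =
      (1 / 2) * (curvComp g x e m n 0 2 - curvComp g x e m n 3 1) := by
  rw [hg.curvOp_inner hx, endForm_sTwo (hg.symm x hx) he (hg.curvEnd_metric hx _ _)]; rfl

theorem curvOp_sThree_inner (hg : IsMetricOn U g) (hx : x ∈ U)
    (he : ∀ m n, g x (e m) (e n) = if m = n then 1 else 0) (m n : Fin 4) :
    g x (curvOp g x (sThree e) (e m)) (e n) =
      (1 / 2) * (curvComp g x e m n 0 3 - curvComp g x e m n 1 2) := by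
  rw [hg.curvOp_inner hx, endForm_sThree (hg.symm x hx) he (hg.curvEnd_metric hx _ _)]; rfl

/-- The curvature operator as a bilinear form on endomorphisms. -/
def curvForm (g : F → F →L[ℝ] F →L[ℝ] ℝ) (x : F) (Φ Ψ : F →L[ℝ] F) : ℝ :=
  endForm F (curvOp g x Φ) Ψ

theorem curvForm_add_left (Φ Φ' Ψ : F →L[ℝ] F) :
    curvForm g x (Φ + Φ') Ψ = curvForm g x Φ Ψ + curvForm g x Φ' Ψ := by simp [curvForm]

theorem curvForm_add_right (Φ Ψ Ψ' : F →L[ℝ] F) :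
    curvForm g x Φ (Ψ + Ψ') = curvForm g x Φ Ψ + curvForm g x Φ Ψ' := by simp [curvForm]

theorem curvForm_smul_left (c : ℝ) (Φ Ψ : F →L[ℝ] F) :
    curvForm g x (c • Φ) Ψ = c * curvForm g x Φ Ψ := by simp [curvForm]

theorem curvForm_smul_right (c : ℝ) (Φ Ψ : F →L[ℝ] F) :
    curvForm g x Φ (c • Ψ) = c * curvForm g x Φ Ψ := by simp [curvForm]

/-- The symmetry of the curvature operator. -/
theorem IsMetricOn.curvForm_symm (hg : IsMetricOn U g) (hx : x ∈ U) {Φ Ψ : F →L[ℝ] F}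
    (he : ∀ m n, g x (e m) (e n) = if m = n then 1 else 0) :
    curvForm g x Φ Ψ = curvForm g x Ψ Φ := by
  -- With both traces expanded, the form is a double sum in which exchanging `Φ` and `Ψ` is the pair
  -- symmetry of the curvature.
  have key : ∀ Φ Ψ : F →L[ℝ] F, curvForm g x Φ Ψ = (1 / 16) *
      ∑ m, ∑ n, g x (curvEnd g x (Ψ (e m)) (e m) (Φ (e n))) (e n) := by
    intro Φ Ψ
    have h1 : ∀ m, g x (curvOp g x Φ (Ψ (e m))) (e m) = -(1 / 4) *
        ∑ n, g x (curvEnd g x (Ψ (e m)) (e m) (Φ (e n))) (e n) := fun m => by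
      rw [hg.curvOp_inner hx, endForm_orthonormal he, Fin.sum_univ_four]
    rw [curvForm, endForm_orthonormal he, h1, h1, h1, h1]
    simp only [Fin.sum_univ_four]
    ring
  rw [key, key, Finset.sum_comm]
  congr 1
  refine Finset.sum_congr rfl fun m _ => Finset.sum_congr rfl fun n _ => ?_
  rw [hg.curvEnd_pair hx]

/-- The commutation condition on the horizontal block of the rough Laplacian. -/
theorem lapBlock_curvOp_comm_iff (hg : IsMetricOn U g) (hx : x ∈ U) {i j k : F →L[ℝ] F}
    (hT : QuatTriple (g x) i j k) {t ε : ℝ} (ht : 0 < t) :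
    lapBlock ε i j k (t • curvOp g x k) ((-t) • curvOp g x j) * i =
        i * lapBlock ε i j k (t • curvOp g x k) ((-t) • curvOp g x j) ↔
      -curvForm g x j i + t * (curvForm g x k i * curvForm g x k j
          + curvForm g x j i * curvForm g x j j)
        + ε * t * (curvForm g x k i * curvForm g x j k - curvForm g x k k * curvForm g x j i) = 0 ∧
      -curvForm g x k i + t * (curvForm g x k i * curvForm g x k k
          + curvForm g x j i * curvForm g x j k)
        + ε * t * (curvForm g x k j * curvForm g x j i - curvForm g x k i * curvForm g x j j) = 0 := by
  obtain ⟨P, hP, pi, pj, pk⟩ := hT.decomp _ (hg.curvOp_skew hx k)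
  obtain ⟨R, hR, ri, rj, rk⟩ := hT.decomp _ (hg.curvOp_skew hx j)
  have eK : t • curvOp g x k = (t * curvForm g x k i) • i + (t * curvForm g x k j) • j
      + (t * curvForm g x k k) • k + t • P := by
    conv_lhs => rw [hP]
    simp only [curvForm, smul_add, smul_smul]
  have eL : (-t) • curvOp g x j = (-t * curvForm g x j i) • i + (-t * curvForm g x j j) • j
      + (-t * curvForm g x j k) • k + (-t) • R := by
    conv_lhs => rw [hR]
    simp only [curvForm, smul_add, smul_smul]
  have cm : ∀ {Q S : F →L[ℝ] F} (c : ℝ), Q * S = S * Q → (c • Q) * S = S * (c • Q) :=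
    fun c h => by rw [smul_mul_assoc, mul_smul_comm, h]
  have key := lapBlock_comm hT.rel (cm t pi) (cm t pj) (cm t pk) (cm (-t) ri) (cm (-t) rj)
    (cm (-t) rk) ε (t * curvForm g x k i) (t * curvForm g x k j) (t * curvForm g x k k)
    (-t * curvForm g x j i) (-t * curvForm g x j j) (-t * curvForm g x j k)
  rw [eK, eL, ← sub_eq_zero, key]
  constructor
  · intro h
    obtain ⟨h1, h2⟩ := hT.smul_add_eq_zero h
    -- The coefficients of `k` and `j` in `lapBlock_comm` are `-4 t` and `4 t` times the two
    -- expressions in question.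
    constructor
    · refine (mul_eq_zero.1 (?_ : (-4 * t) * _ = 0)).resolve_left (by positivity)
      linear_combination h1
    · refine (mul_eq_zero.1 (?_ : (4 * t) * _ = 0)).resolve_left (by positivity)
      linear_combination h2
  · rintro ⟨h1, h2⟩
    have e1 : -4 * (-t * curvForm g x j i + (t * curvForm g x k i * (t * curvForm g x k j)
        + -t * curvForm g x j i * (-t * curvForm g x j j))
        + ε * (t * curvForm g x k k * (-t * curvForm g x j i)
          - t * curvForm g x k i * (-t * curvForm g x j k))) = 0 := by
      linear_combination (-4 * t) * h1
    have e2 : 4 * (-(t * curvForm g x k i) + (t * curvForm g x k i * (t * curvForm g x k k)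
        + -t * curvForm g x j i * (-t * curvForm g x j k))
        + ε * (t * curvForm g x k i * (-t * curvForm g x j j)
          - t * curvForm g x k j * (-t * curvForm g x j i))) = 0 := by
      linear_combination (4 * t) * h2
    rw [e1, e2]; simp

/-! ### Change of frame -/

theorem exists_basis_of_orthonormal {b : F →L[ℝ] F →L[ℝ] ℝ} (e : Module.Basis (Fin 4) ℝ F)
    {v : Fin 4 → F} (hv : ∀ m n, b (v m) (v n) = if m = n then 1 else 0) :
    ∃ e' : Module.Basis (Fin 4) ℝ F, ∀ m, e' m = v m := by
  have hli : LinearIndependent ℝ v := by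
    rw [Fintype.linearIndependent_iff]
    intro c hc s
    have h1 := congrArg (fun w => b w (v s)) hc
    simp only [map_sum, map_smul, sum_apply, smul_apply, hv, smul_eq_mul, mul_ite, mul_one,
      mul_zero, Finset.sum_ite_eq', Finset.mem_univ, if_true, map_zero, zero_apply] at h1
    exact h1
  refine ⟨basisOfLinearIndependentOfCardEqFinrank hli ?_, fun m => ?_⟩
  · rw [finrank_of_basis_four e]; simp
  · simp

/-- An orthonormal basis of positive orientation. -/
structure IsFrame (b : F →L[ℝ] F →L[ℝ] ℝ) (o : Orientation ℝ F (Fin 4))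
    (e : Module.Basis (Fin 4) ℝ F) : Prop where
  orthonormal : ∀ m n, b (e m) (e n) = if m = n then 1 else 0
  orientation : e.orientation = o

/-- A rotation in the plane of `e 1` and `e 3` acts on the triple as the rotation by the same angle
in the plane of `sOne` and `sThree`, with `sTwo` fixed. -/
theorem IsFrame.exists_rotate {b : F →L[ℝ] F →L[ℝ] ℝ} {o : Orientation ℝ F (Fin 4)}
    (h : IsFrame b o e) {c s : ℝ} (hcs : c * c + s * s = 1) :
    ∃ e', IsFrame b o e' ∧ sOne e' = c • sOne e + s • sThree e ∧
      sThree e' = (-s) • sOne e + c • sThree e ∧ sTwo e' = sTwo e := by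
  let v : Fin 4 → F := ![e 0, c • e 1 + s • e 3, e 2, (-s) • e 1 + c • e 3]
  have hv : ∀ m n, b (v m) (v n) = if m = n then 1 else 0 := by
    intro m n
    fin_cases m <;> fin_cases n <;> simp [v, h.orthonormal] <;> linarith
  obtain ⟨e', he'⟩ := exists_basis_of_orthonormal e hv
  have e0 : e' 0 = e 0 := he' 0
  have e1 : e' 1 = c • e 1 + s • e 3 := he' 1
  have e2 : e' 2 = e 2 := he' 2
  have e3 : e' 3 = (-s) • e 1 + c • e 3 := he' 3
  have r0 : (c * c) • e 0 + (s * s) • e 0 = e 0 := by rw [← add_smul, hcs, one_smul]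
  have r2 : (c * c) • e 2 + (s * s) • e 2 = e 2 := by rw [← add_smul, hcs, one_smul]
  refine ⟨e', ⟨fun m n => by rw [he', he']; exact hv m n, ?_⟩, ?_, ?_, ?_⟩
  · rw [← h.orientation, eq_comm, Module.Basis.orientation_eq_iff_det_pos, Module.Basis.det_apply]
    have hM : e.toMatrix e' = !![1, 0, 0, 0; 0, c, 0, -s; 0, 0, 1, 0; 0, s, 0, c] := by
      ext m n
      rw [Module.Basis.toMatrix_apply, he']
      fin_cases m <;> fin_cases n <;> simp [v]
    rw [hM]
    simp [Matrix.det_succ_row_zero, Fin.sum_univ_succ, Fin.succAbove]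
    nlinarith
  · apply end_ext_four e'
    · rw [sOne_0, e1, e0]; simp [sOne_0, sThree_0]
    · rw [sOne_1, e1, e0]
      simp only [add_apply, smul_apply, map_add, map_smul, sOne_1, sOne_3, sThree_1, sThree_3]
      nth_rewrite 1 [← r0]; module
    · rw [sOne_2, e3, e2]; simp only [add_apply, smul_apply, sOne_2, sThree_2]; module
    · rw [sOne_3, e3, e2]
      simp only [add_apply, smul_apply, map_add, map_smul, sOne_1, sOne_3, sThree_1, sThree_3]
      nth_rewrite 1 [← r2]; module
  · apply end_ext_four e'
    · rw [sThree_0, e3, e0]; simp [sOne_0, sThree_0]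
    · rw [sThree_1, e1, e2]
      simp only [add_apply, smul_apply, map_add, map_smul, sOne_1, sOne_3, sThree_1, sThree_3]
      nth_rewrite 1 [← r2]; module
    · rw [sThree_2, e1, e2]; simp only [add_apply, smul_apply, sOne_2, sThree_2]; module
    · rw [sThree_3, e3, e0]
      simp only [add_apply, smul_apply, map_add, map_smul, sOne_1, sOne_3, sThree_1, sThree_3]
      nth_rewrite 1 [← r0]; module
  · apply end_ext_four e'
    · rw [sTwo_0, e2, e0, sTwo_0]
    · rw [sTwo_1, e3, e1]; simp only [map_add, map_smul, sTwo_1, sTwo_3]; module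
    · rw [sTwo_2, e0, e2, sTwo_2]
    · rw [sTwo_3, e3, e1]; simp only [map_add, map_smul, sTwo_1, sTwo_3]; module

/-- A cyclic permutation of `e 1, e 2, e 3` is even, so the orientation is kept while the triple is
permuted cyclically. The last clause serves for traces over the basis, such as gradients and
divergences. -/
theorem IsFrame.exists_cycle {b : F →L[ℝ] F →L[ℝ] ℝ} {o : Orientation ℝ F (Fin 4)}
    (h : IsFrame b o e) :
    ∃ e', IsFrame b o e' ∧ sOne e' = sThree e ∧ sThree e' = sTwo e ∧ sTwo e' = sOne e ∧
      (∀ f : F → F → F, f (e' 0) (e' 0) + f (e' 1) (e' 1) + f (e' 2) (e' 2) + f (e' 3) (e' 3) =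
        f (e 0) (e 0) + f (e 1) (e 1) + f (e 2) (e 2) + f (e 3) (e 3)) := by
  let v : Fin 4 → F := ![e 0, e 3, e 1, e 2]
  have hv : ∀ m n, b (v m) (v n) = if m = n then 1 else 0 := by
    intro m n
    fin_cases m <;> fin_cases n <;> simp [v, h.orthonormal]
  obtain ⟨e', he'⟩ := exists_basis_of_orthonormal e hv
  have e0 : e' 0 = e 0 := he' 0
  have e1 : e' 1 = e 3 := he' 1
  have e2 : e' 2 = e 1 := he' 2
  have e3 : e' 3 = e 2 := he' 3
  refine ⟨e', ⟨fun m n => by rw [he', he']; exact hv m n, ?_⟩, ?_, ?_, ?_, ?_⟩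
  · rw [← h.orientation, eq_comm, Module.Basis.orientation_eq_iff_det_pos, Module.Basis.det_apply]
    have hM : e.toMatrix e' = !![1, 0, 0, 0; 0, 0, 1, 0; 0, 0, 0, 1; 0, 1, 0, 0] := by
      ext m n
      rw [Module.Basis.toMatrix_apply, he']
      fin_cases m <;> fin_cases n <;> simp [v]
    rw [hM]
    simp [Matrix.det_succ_row_zero, Fin.sum_univ_succ, Fin.succAbove]
  · apply end_ext_four e'
    · rw [sOne_0, e0, e1, sThree_0]
    · rw [sOne_1, e1, e0, sThree_3]
    · rw [sOne_2, e2, e3, sThree_1]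
    · rw [sOne_3, e3, e2, sThree_2]
  · apply end_ext_four e'
    · rw [sThree_0, e0, e3, sTwo_0]
    · rw [sThree_1, e1, e2, sTwo_3]
    · rw [sThree_2, e1, e2, sTwo_1]
    · rw [sThree_3, e0, e3, sTwo_2]
  · apply end_ext_four e'
    · rw [sTwo_0, e0, e2, sOne_0]
    · rw [sTwo_1, e1, e3, sOne_3]
    · rw [sTwo_2, e0, e2, sOne_1]
    · rw [sTwo_3, e1, e3, sOne_2]
  · intro f
    rw [e0, e1, e2, e3]; abel

end AntiSelfDual

/-! ### Isotropy of the curvature operator on anti-self-dual bivectors -/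

section Isotropy

variable {F : Type*} [NormedAddCommGroup F] [NormedSpace ℝ F] [FiniteDimensional ℝ F]
variable {U : Set F} {g : F → F →L[ℝ] F →L[ℝ] ℝ} {x : F} {e : Module.Basis (Fin 4) ℝ F}

/-- The curvature operator is a multiple `c` of the identity on the triple of the frame `e`. -/
structure CurvIsotropic (g : F → F →L[ℝ] F →L[ℝ] ℝ) (x : F) (e : Module.Basis (Fin 4) ℝ F)
    (c : ℝ) : Prop where
  one : curvForm g x (sOne e) (sOne e) = c
  two : curvForm g x (sTwo e) (sTwo e) = c
  three : curvForm g x (sThree e) (sThree e) = c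
  one_two : curvForm g x (sOne e) (sTwo e) = 0
  one_three : curvForm g x (sOne e) (sThree e) = 0
  two_three : curvForm g x (sTwo e) (sThree e) = 0

/-- `A`, `B`, `C` are the entries of a symmetric 2 × 2 matrix, and `h'` is `h` in a basis rotated by
the angle `θ` with cosine `3/5` and sine `4/5`. With `D = B - A`, the product `C D` becomes `cos 4θ
· C D + ¼ sin 4θ · (D² - 4 C²)`. As `sin 4θ ≠ 0`, both equations force `D² = 4 C²` and `C D = 0`. -/
theorem isotropic_of_rotations {A B C : ℝ} (h : C * (B - A) = 0)
    (h' : ((3 / 5) * (3 / 5) * C - (4 / 5) * (4 / 5) * C + (3 / 5) * (4 / 5) * (B - A))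
      * (((4 / 5) * (4 / 5) * A - 2 * ((3 / 5) * (4 / 5)) * C + (3 / 5) * (3 / 5) * B)
        - ((3 / 5) * (3 / 5) * A + 2 * ((3 / 5) * (4 / 5)) * C + (4 / 5) * (4 / 5) * B)) = 0) :
    C = 0 ∧ A = B := by
  have h1 : C ^ 2 * 4 = (B - A) ^ 2 := by nlinarith
  rcases mul_eq_zero.1 h with h2 | h2
  · rw [h2] at h1
    have : (B - A) = 0 := by
      have : (B - A) ^ 2 = 0 := by linarith
      exact pow_eq_zero_iff (two_ne_zero) |>.1 this
    exact ⟨h2, by linarith⟩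
  · rw [h2] at h1
    have : C ^ 2 = 0 := by linarith
    exact ⟨pow_eq_zero_iff (two_ne_zero) |>.1 this, by linarith⟩

/-- If the horizontal condition holds for all frames of an orientation, the curvature operator is
isotropic. -/
theorem IsMetricOn.curvIsotropic_of_comm (hg : IsMetricOn U g) (hx : x ∈ U) {t ε : ℝ} (ht : 0 < t)
    {o : Orientation ℝ F (Fin 4)}
    (h : ∀ e, IsFrame (g x) o e → lapBlock ε (sOne e) (sThree e) (sTwo e) (t • curvOp g x (sTwo e))
        ((-t) • curvOp g x (sThree e)) * sOne e = sOne e * lapBlock ε (sOne e) (sThree e) (sTwo e)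
        (t • curvOp g x (sTwo e)) ((-t) • curvOp g x (sThree e)))
    (he : IsFrame (g x) o e) : ∃ c, CurvIsotropic g x e c := by
  have k1 : ∀ e, IsFrame (g x) o e → curvForm g x (sOne e) (sThree e) *
      (curvForm g x (sThree e) (sThree e) - curvForm g x (sOne e) (sOne e)) = 0 := by
    intro e he
    have hs := fun Φ Ψ => hg.curvForm_symm (Φ := Φ) (Ψ := Ψ) hx he.orthonormal
    obtain ⟨e', he', h1, h2, h3, -⟩ := he.exists_cycle
    have a := ((lapBlock_curvOp_comm_iff hg hx (quatTriple_s (hg.symm x hx) he.orthonormal) ht).1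
      (h e he)).1
    have b := ((lapBlock_curvOp_comm_iff hg hx (quatTriple_s (hg.symm x hx) he'.orthonormal) ht).1
      (h e' he')).2
    rw [h1, h2, h3] at b
    rw [hs (sThree e) (sOne e), hs (sThree e) (sTwo e), hs (sTwo e) (sOne e)] at a
    rw [hs (sTwo e) (sOne e)] at b
    refine (mul_eq_zero.1 (?_ : t * _ = 0)).resolve_left ht.ne'
    -- `a` is the first equation in the frame `e`, and `b` the second one in the permuted frame.
    -- They have the same linear term, the same `ε`-terms and the same mixed quadratic term, so the
    -- difference does not involve `ε`.
    linear_combination a - b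
  have k2 : ∀ e, IsFrame (g x) o e → curvForm g x (sOne e) (sThree e) = 0 ∧
      curvForm g x (sOne e) (sOne e) = curvForm g x (sThree e) (sThree e) := by
    intro e he
    obtain ⟨e', he', h1, h2, h3⟩ := he.exists_rotate (c := 3 / 5) (s := 4 / 5) (by norm_num)
    have hs := hg.curvForm_symm (Φ := sThree e) (Ψ := sOne e) hx he.orthonormal
    refine isotropic_of_rotations (k1 e he) ?_
    have h4 := k1 e' he'
    rw [h1, h2] at h4
    simp only [curvForm_add_left, curvForm_add_right, curvForm_smul_left, curvForm_smul_right, hs]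
      at h4
    linear_combination h4
  -- The frame and its two cyclic permutations cover the three pairs of elements of the triple.
  obtain ⟨e', he', h1, h2, h3, -⟩ := he.exists_cycle
  obtain ⟨e'', he'', h1', h2', h3', -⟩ := he'.exists_cycle
  have a := k2 e he
  have b := k2 e' he'
  have c := k2 e'' he''
  rw [h1', h2', h2, h3] at c
  rw [h1, h2] at b
  have hs := fun Φ Ψ => hg.curvForm_symm (Φ := Φ) (Ψ := Ψ) hx he.orthonormal
  exact ⟨_, rfl, by linarith [c.2], by linarith [a.2], by rw [hs, c.1], a.1, by rw [hs, b.1]⟩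

/-- If the curvature operator is isotropic, the horizontal condition holds. -/
theorem CurvIsotropic.comm {c : ℝ} (h : CurvIsotropic g x e c) (hg : IsMetricOn U g) (hx : x ∈ U)
    (he : ∀ m n, g x (e m) (e n) = if m = n then 1 else 0) {t ε : ℝ} (ht : 0 < t) :
    lapBlock ε (sOne e) (sThree e) (sTwo e) (t • curvOp g x (sTwo e))
        ((-t) • curvOp g x (sThree e)) * sOne e = sOne e * lapBlock ε (sOne e) (sThree e) (sTwo e)
        (t • curvOp g x (sTwo e)) ((-t) • curvOp g x (sThree e)) := by
  have hs := fun Φ Ψ => hg.curvForm_symm (Φ := Φ) (Ψ := Ψ) hx he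
  rw [lapBlock_curvOp_comm_iff hg hx (quatTriple_s (hg.symm x hx) he) ht,
    hs (sThree e) (sOne e), hs (sTwo e) (sOne e), hs (sThree e) (sTwo e), h.one_two, h.one_three,
    h.two_three]
  simp

/-- The isotropy constant is a multiple of the scalar curvature. -/
theorem CurvIsotropic.const_eq {c : ℝ} (h : CurvIsotropic g x e c) (hg : IsMetricOn U g)
    (hx : x ∈ U) (he : ∀ m n, g x (e m) (e n) = if m = n then 1 else 0) :
    c = scalarComp (curvComp g x e) / 24 := by
  have hr := hg.isCurvTensor (e := e) hx
  have o := h.one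
  have w := h.two
  have r := h.three
  rw [curvForm, endForm_sOne (hg.symm x hx) he (hg.curvOp_skew hx _), curvOp_sOne_inner hg hx he,
    curvOp_sOne_inner hg hx he] at o
  rw [curvForm, endForm_sTwo (hg.symm x hx) he (hg.curvOp_skew hx _), curvOp_sTwo_inner hg hx he,
    curvOp_sTwo_inner hg hx he] at w
  rw [curvForm, endForm_sThree (hg.symm x hx) he (hg.curvOp_skew hx _),
    curvOp_sThree_inner hg hx he, curvOp_sThree_inner hg hx he] at r
  -- The sum of the three diagonal entries: the mixed components cancel by the Bianchi identity, and
  -- the sectional terms add up to half of the scalar curvature, so `3 c = ¼ · s / 2`.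
  have b := hr.bianchi 0 1 2 3
  have z : ∀ m p q, curvComp g x e m m p q = 0 := fun m p q => by linarith [hr.skew m m p q]
  have d : ∀ m n, curvComp g x e m n m n = curvComp g x e n m n m := fun m n => by
    rw [hr.skew, hr.skew', neg_neg]
  have p1 := hr.pair 2 3 0 1
  have p2 := hr.pair 3 1 0 2
  have p3 := hr.pair 1 2 0 3
  have q1 := hr.skew 2 0 1 3
  have q2 := hr.skew' 0 2 1 3
  simp only [scalarComp, ricciComp, z]
  linarith [d 1 0, d 2 0, d 3 0, d 2 1, d 3 1, d 3 2]

end Isotropy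

/-! ### The Weyl tensor in an orthonormal basis -/

section Weyl

variable {g : Coord 4 → Coord 4 →L[ℝ] Coord 4 →L[ℝ] ℝ} {U : Set (Coord 4)} {x : Coord 4}
  {e : Module.Basis (Fin 4) ℝ (Coord 4)}

/-- An expression free of coordinates, which may then be evaluated in an orthonormal basis. -/
theorem ricci_eq_trace {n : ℕ} (g : Coord n → Coord n →L[ℝ] Coord n →L[ℝ] ℝ) (x Y Z : Coord n) :
    ricci g x Y Z =
      LinearMap.trace ℝ (Coord n) (((curvEnd g x Y).flip Z : Coord n →L[ℝ] Coord n) :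
        Coord n →ₗ[ℝ] Coord n) := by
  rw [LinearMap.trace_eq_matrix_trace ℝ (EuclideanSpace.basisFun (Fin n) ℝ).toBasis, Matrix.trace,
    ricci]
  refine Finset.sum_congr rfl fun i _ => ?_
  rw [Matrix.diag_apply, LinearMap.toMatrix_apply, curvature_eq_curvEnd]
  simp

/-- The Ricci tensor as a bilinear map. -/
def ricciBilin {n : ℕ} (g : Coord n → Coord n →L[ℝ] Coord n →L[ℝ] ℝ) (x : Coord n) :
    Coord n →ₗ[ℝ] Coord n →ₗ[ℝ] ℝ :=
  LinearMap.mk₂ ℝ (ricci g x)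
    (fun Y Y' Z => by
      simp only [ricci, curvature_eq_curvEnd, map_add, add_apply, PiLp.add_apply,
        Finset.sum_add_distrib])
    (fun c Y Z => by
      simp only [ricci, curvature_eq_curvEnd, map_smul, smul_apply, PiLp.smul_apply,
        Finset.smul_sum])
    (fun Y Z Z' => by
      simp only [ricci, curvature_eq_curvEnd, map_add, PiLp.add_apply,
        Finset.sum_add_distrib])
    (fun c Y Z => by
      simp only [ricci, curvature_eq_curvEnd, map_smul, PiLp.smul_apply,
        Finset.smul_sum])

theorem ricci_eq_ricciComp (he : ∀ m n, g x (e m) (e n) = if m = n then 1 else 0) (m n : Fin 4) :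
    ricci g x (e m) (e n) = ricciComp (curvComp g x e) m n := by
  rw [ricci_eq_trace, trace_orthonormal he, Fin.sum_univ_four]; rfl

theorem scalar_eq_scalarComp (hg : IsMetricOn U g) (hx : x ∈ U)
    (he : ∀ m n, g x (e m) (e n) = if m = n then 1 else 0) :
    scalar g x = scalarComp (curvComp g x e) := by
  rw [scalar, metricTrace_eq_sum (hg.pos x hx) he (ricciBilin g x) (B := ricci g x) (fun _ _ => rfl),
    Fin.sum_univ_four]
  simp only [ricci_eq_ricciComp he, scalarComp]

theorem weyl_eq_weylComp (hg : IsMetricOn U g) (hx : x ∈ U)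
    (he : ∀ m n, g x (e m) (e n) = if m = n then 1 else 0) (m n p q : Fin 4) :
    weyl g x (e m) (e n) (e p) (e q) = weylComp (curvComp g x e) m n p q := by
  simp only [weyl, weylComp, ricci_eq_ricciComp he, scalar_eq_scalarComp hg hx he, he,
    curvature_eq_curvEnd, curvComp]

/-- The Weyl tensor as a bilinear map of its last two arguments. -/
def weylBilin (g : Coord 4 → Coord 4 →L[ℝ] Coord 4 →L[ℝ] ℝ) (x X Y : Coord 4) :
    Coord 4 →ₗ[ℝ] Coord 4 →ₗ[ℝ] ℝ :=
  LinearMap.mk₂ ℝ (weyl g x X Y)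
    (fun Z Z' T => by
      have r : ∀ Y, ricci g x Y (Z + Z') = ricci g x Y Z + ricci g x Y Z' :=
        fun Y => (ricciBilin g x Y).map_add Z Z'
      simp only [weyl, r, curvature_eq_curvEnd, map_add, add_apply]; ring)
    (fun c Z T => by
      have r : ∀ Y, ricci g x Y (c • Z) = c * ricci g x Y Z :=
        fun Y => (ricciBilin g x Y).map_smul c Z
      simp only [weyl, r, curvature_eq_curvEnd, map_smul, smul_apply, smul_eq_mul]; ring)
    (fun Z T T' => by
      have r : ∀ Y, ricci g x Y (T + T') = ricci g x Y T + ricci g x Y T' :=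
        fun Y => (ricciBilin g x Y).map_add T T'
      simp only [weyl, r, map_add]; ring)
    (fun c Z T => by
      have r : ∀ Y, ricci g x Y (c • T) = c * ricci g x Y T :=
        fun Y => (ricciBilin g x Y).map_smul c T
      simp only [weyl, r, map_smul, smul_eq_mul]; ring)

/-- The Weyl tensor vanishes on anti-self-dual bivectors if and only if the curvature operator is
isotropic. -/
theorem weyl_eq_zero_iff (hg : IsMetricOn U g) (hx : x ∈ U)
    (he : ∀ m n, g x (e m) (e n) = if m = n then 1 else 0) :
    (∀ Z T, weyl g x (e 0) (e 1) Z T - weyl g x (e 2) (e 3) Z T = 0 ∧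
      weyl g x (e 0) (e 2) Z T - weyl g x (e 3) (e 1) Z T = 0 ∧
      weyl g x (e 0) (e 3) Z T - weyl g x (e 1) (e 2) Z T = 0) ↔
    CurvIsotropic g x e (scalar g x / 24) := by
  have h1 : (∀ Z T, weyl g x (e 0) (e 1) Z T - weyl g x (e 2) (e 3) Z T = 0 ∧
      weyl g x (e 0) (e 2) Z T - weyl g x (e 3) (e 1) Z T = 0 ∧
      weyl g x (e 0) (e 3) Z T - weyl g x (e 1) (e 2) Z T = 0) ↔
      (∀ p q, weyl g x (e 0) (e 1) (e p) (e q) - weyl g x (e 2) (e 3) (e p) (e q) = 0 ∧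
      weyl g x (e 0) (e 2) (e p) (e q) - weyl g x (e 3) (e 1) (e p) (e q) = 0 ∧
      weyl g x (e 0) (e 3) (e p) (e q) - weyl g x (e 1) (e 2) (e p) (e q) = 0) := by
    constructor
    · exact fun h p q => h _ _
    · intro h
      have key : ∀ X Y X' Y', (∀ p q, weyl g x X Y (e p) (e q) - weyl g x X' Y' (e p) (e q) = 0) →
          ∀ Z T, weyl g x X Y Z T - weyl g x X' Y' Z T = 0 := by
        intro X Y X' Y' h Z T
        have : weylBilin g x X Y - weylBilin g x X' Y' = 0 :=
          e.ext fun p => e.ext fun q => h p q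
        exact congrArg (fun L => L Z T) this
      exact fun Z T => ⟨key _ _ _ _ (fun p q => (h p q).1) Z T,
        key _ _ _ _ (fun p q => (h p q).2.1) Z T, key _ _ _ _ (fun p q => (h p q).2.2) Z T⟩
  have hs := hg.symm x hx
  rw [h1]
  simp only [weyl_eq_weylComp hg hx he]
  rw [(hg.isCurvTensor hx).weylComp_eq_zero_iff, ← scalar_eq_scalarComp hg hx he]
  have e11 : curvForm g x (sOne e) (sOne e) = _ := endForm_sOne hs he (hg.curvOp_skew hx _)
  have e12 : curvForm g x (sOne e) (sTwo e) = _ := endForm_sTwo hs he (hg.curvOp_skew hx _)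
  have e13 : curvForm g x (sOne e) (sThree e) = _ := endForm_sThree hs he (hg.curvOp_skew hx _)
  have e22 : curvForm g x (sTwo e) (sTwo e) = _ := endForm_sTwo hs he (hg.curvOp_skew hx _)
  have e23 : curvForm g x (sTwo e) (sThree e) = _ := endForm_sThree hs he (hg.curvOp_skew hx _)
  have e33 : curvForm g x (sThree e) (sThree e) = _ := endForm_sThree hs he (hg.curvOp_skew hx _)
  simp only [curvOp_sOne_inner hg hx he, curvOp_sTwo_inner hg hx he,
    curvOp_sThree_inner hg hx he] at e11 e12 e13 e22 e23 e33
  constructor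
  · rintro ⟨a, b, c, d, f, k⟩
    exact ⟨by linarith, by linarith, by linarith, by linarith, by linarith, by linarith⟩
  · rintro ⟨a, b, c, d, f, k⟩
    exact ⟨by linarith, by linarith, by linarith, by linarith, by linarith, by linarith⟩

end Weyl

/-! ### The divergence of an isotropic curvature operator -/

section Divergence

variable {N : Type*} [NormedAddCommGroup N] [NormedSpace ℝ N] [FiniteDimensional ℝ N]
variable {F : Type*} [NormedAddCommGroup F] [NormedSpace ℝ F] [FiniteDimensional ℝ F]
variable {U : Set F} {g : F → F →L[ℝ] F →L[ℝ] ℝ} {x : F} {e : Module.Basis (Fin 4) ℝ F}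
variable {Ω : Set N} {φ : N → F × (F →L[ℝ] F)} {q : N}

/-- Along a horizontal direction `I` is parallel, so the derivative of its curvature form involves
only the curvature operator and `B`. -/
theorem IsTwistorChart.fderiv_curvForm (h : IsTwistorChart U g Ω φ) (hq : q ∈ Ω)
    {B : N → F →L[ℝ] F} (hB : DifferentiableAt ℝ B q) {a : N} (ha : vert g φ q a = 0) :
    fderiv ℝ (fun y => curvForm g (φ y).1 (φ y).2 (B y)) q a =
      endForm F (nablaOp g (φ q).1 (horiz φ q a) (φ q).2) (B q)
        + curvForm g (φ q).1 (φ q).2 (covEnd g (fun y => (φ y).1) B q a) := by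
  have hf := smoothAt_diff (h.smoothAt_fst hq)
  have hI := smoothAt_diff (h.smoothAt_snd hq)
  have hO : DifferentiableAt ℝ (fun y => curvOp g (φ y).1 (φ y).2) q :=
    ((smoothAt_diff (h.metric.smoothAt_curvOp (h.mem hq))).comp q hf).clm_apply hI
  unfold curvForm
  rw [fderiv_endForm (g := g) (f := fun y => (φ y).1) hO hB,
    covEnd_curvOp h.metric hf (h.mem hq) hI, ← h.vert_eq hq, ha, h.fderiv_fst hq]
  simp

/-- The derivative of the curvature operator in the direction of `I`. -/
theorem IsTwistorChart.endForm_nablaOp_self (h : IsTwistorChart U g Ω φ) (hq : q ∈ Ω) {s : F → ℝ}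
    (hs : DifferentiableAt ℝ s (φ q).1)
    (hc : ∀ᶠ y in 𝓝 q, curvForm g (φ y).1 (φ y).2 (φ y).2 = s (φ y).1) (X : F) :
    endForm F (nablaOp g (φ q).1 X (φ q).2) (φ q).2 = fderiv ℝ s (φ q).1 X := by
  obtain ⟨a, rfl, h2⟩ := h.surj q hq X 0 ⟨by simp, by simp⟩
  have h3 := h.fderiv_curvForm hq (smoothAt_diff (h.smoothAt_snd hq)) h2
  rw [fderiv_congr_apply (v := fun y => s (φ y).1) hc,
    fderiv_comp_apply (f := fun y => (φ y).1) hs (smoothAt_diff (h.smoothAt_fst hq)), h.fderiv_fst hq, ← h.vert_eq hq,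
    h2] at h3
  rw [h3]; simp [curvForm]

/-- `V` is extended to the field of vertical components of a constant coordinate vector. Its
derivative along a horizontal direction is again vertical, since `vertDefect` vanishes there, so
differentiating `curvForm I V = 0` leaves only the derivative of the curvature. -/
theorem IsTwistorChart.endForm_nablaOp_vertical (h : IsTwistorChart U g Ω φ) (hq : q ∈ Ω)
    (hc : ∀ᶠ y in 𝓝 q, ∀ V, IsVertical (g (φ y).1) (φ y).2 V →
      curvForm g (φ y).1 (φ y).2 V = 0) (X : F)
    {V : F →L[ℝ] F} (hV : IsVertical (g (φ q).1) (φ q).2 V) :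
    endForm F (nablaOp g (φ q).1 X (φ q).2) V = 0 := by
  obtain ⟨a, rfl, h2⟩ := h.surj q hq X 0 ⟨by simp, by simp⟩
  obtain ⟨b, h3, h4⟩ := h.surj q hq 0 V hV
  have hw : DifferentiableAt ℝ (fun y => vert g φ y b) q :=
    (smoothAt_diff (h.smoothAt_vert hq)).clm_apply (differentiableAt_const b)
  have h5 := h.fderiv_curvForm hq hw h2
  have hz : (fun y => curvForm g (φ y).1 (φ y).2 (vert g φ y b)) =ᶠ[𝓝 q] fun _ => 0 := by
    filter_upwards [hc, h.eventually_mem hq] with y h1 h2 using h1 _ (h.isVertical h2 b)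
  rw [fderiv_congr_apply hz, h.covEnd_vert one_pos hq (differentiableAt_const b), curvForm_add_right,
    hc.self_of_nhds _ (h.isVertical hq _)] at h5
  have h6 : vertDefect g φ q a b = 0 := by simp [vertDefect, h2, h3]
  rw [h6, h4] at h5
  simpa [curvForm] using h5.symm

theorem IsMetricOn.nablaOp_skew (hg : IsMetricOn U g) (hx : x ∈ U) (X Y Z : F) (Φ : F →L[ℝ] F) :
    g x (nablaOp g x X Φ Y) Z = -g x Y (nablaOp g x X Φ Z) := by
  rw [hg.symm x hx Y, hg.nablaOp_inner hx, hg.nablaOp_inner hx, nablaCurv_skew hg hx X Y Z]; simp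

/-- The second Bianchi identity determines the divergence of the curvature operator. -/
theorem IsMetricOn.divOp_sOne (hg : IsMetricOn U g) (hx : x ∈ U)
    (he : ∀ m n, g x (e m) (e n) = if m = n then 1 else 0) {d : Fin 4 → ℝ}
    (h1 : ∀ m, endForm F (nablaOp g x (e m) (sOne e)) (sOne e) = d m)
    (h2 : ∀ m, endForm F (nablaOp g x (e m) (sOne e)) (sTwo e) = 0)
    (h3 : ∀ m, endForm F (nablaOp g x (e m) (sOne e)) (sThree e) = 0) :
    divOp g x e (sOne e) =
      (2 : ℝ) • sOne e (d 0 • e 0 + d 1 • e 1 + d 2 • e 2 + d 3 • e 3) := by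
  have hs := hg.symm x hx
  -- The identity says that the curvature two-form paired with `sOne`, differentiated covariantly,
  -- is closed. Its self-dual and anti-self-dual parts then have equal divergences, whence the
  -- factor 2; by `h1`, `h2`, `h3` the anti-self-dual part of the derivative is `d` times `sOne`.
  have b : ∀ m n p, g x (nablaOp g x (e m) (sOne e) (e n)) (e p)
      + g x (nablaOp g x (e n) (sOne e) (e p)) (e m)
      + g x (nablaOp g x (e p) (sOne e) (e m)) (e n) = 0 := fun m n p => by
    rw [hg.nablaOp_inner hx, hg.nablaOp_inner hx, hg.nablaOp_inner hx, ← add_apply, ← map_add,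
      ← add_apply, ← map_add, hg.nablaCurv_bianchi hx]
    simp
  have k : ∀ m n p, g x (nablaOp g x (e m) (sOne e) (e n)) (e p) =
      -g x (nablaOp g x (e m) (sOne e) (e p)) (e n) := fun m n p => by
    rw [hg.nablaOp_skew hx, hs]
  have a1 : ∀ m, _ = d m := fun m =>
    (endForm_sOne hs he (fun v w => hg.nablaOp_skew hx (e m) v w (sOne e))).symm.trans (h1 m)
  have a2 : ∀ m, _ = (0 : ℝ) := fun m =>
    (endForm_sTwo hs he (fun v w => hg.nablaOp_skew hx (e m) v w (sOne e))).symm.trans (h2 m)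
  have a3 : ∀ m, _ = (0 : ℝ) := fun m =>
    (endForm_sThree hs he (fun v w => hg.nablaOp_skew hx (e m) v w (sOne e))).symm.trans (h3 m)
  have z : ∀ m n, g x (nablaOp g x (e m) (sOne e) (e n)) (e n) = 0 := fun m n => by
    linarith [k m n n]
  rw [sum_orthonormal he (divOp g x e (sOne e)), divOp, Fin.sum_univ_four]
  simp only [map_add, map_smul, sOne_0, sOne_1, sOne_2, sOne_3, add_apply, z]
  have c0 := b 1 2 3
  have c1 := b 0 2 3
  have c2 := b 0 1 3
  have c3 := b 0 1 2
  have f0 : 0 + g x (nablaOp g x (e 1) (sOne e) (e 1)) (e 0)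
      + g x (nablaOp g x (e 2) (sOne e) (e 2)) (e 0)
      + g x (nablaOp g x (e 3) (sOne e) (e 3)) (e 0) = -2 * d 1 := by
    linarith [a1 1, a2 2, a3 3, k 1 1 0, k 2 2 0, k 3 3 0, k 2 3 1]
  have f1 : g x (nablaOp g x (e 0) (sOne e) (e 0)) (e 1) + 0
      + g x (nablaOp g x (e 2) (sOne e) (e 2)) (e 1)
      + g x (nablaOp g x (e 3) (sOne e) (e 3)) (e 1) = 2 * d 0 := by
    linarith [a1 0, a2 3, a3 2, k 2 2 1, k 3 0 2, k 2 0 3]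
  have f2 : g x (nablaOp g x (e 0) (sOne e) (e 0)) (e 2)
      + g x (nablaOp g x (e 1) (sOne e) (e 1)) (e 2) + 0
      + g x (nablaOp g x (e 3) (sOne e) (e 3)) (e 2) = 2 * d 3 := by
    linarith [a1 3, a2 0, a3 1, k 3 3 2, k 1 3 0, k 3 0 1, k 0 1 3]
  have f3 : g x (nablaOp g x (e 0) (sOne e) (e 0)) (e 3)
      + g x (nablaOp g x (e 1) (sOne e) (e 1)) (e 3)
      + g x (nablaOp g x (e 2) (sOne e) (e 2)) (e 3) + 0 = -2 * d 2 := by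
    linarith [a1 2, a2 1, a3 0, k 1 3 1, k 2 2 3, k 1 2 0, k 2 0 1]
  rw [f0, f1, f2, f3]
  module

/-- The part of the twistor space of `(U, g)` that is determined by the orientations `o`: the complex
structures `e₀ ↦ e₁, e₂ ↦ -e₃` for oriented orthonormal bases `e`. -/
def frameTwistorSet (U : Set F) (g : F → F →L[ℝ] F →L[ℝ] ℝ) (o : F → Orientation ℝ F (Fin 4)) :
    Set (F × (F →L[ℝ] F)) :=
  {z | z.1 ∈ U ∧ ∃ e, IsFrame (g z.1) (o z.1) e ∧ sOne e = z.2}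

/-- Every point of `S` lies in the image of a chart of the twistor space with image in `S`. -/
def HasTwistorCharts (N : Type*) [NormedAddCommGroup N] [NormedSpace ℝ N] [FiniteDimensional ℝ N]
    (U : Set F) (g : F → F →L[ℝ] F →L[ℝ] ℝ) (S : Set (F × (F →L[ℝ] F))) : Prop :=
  ∀ z ∈ S, ∃ (Ω : Set N) (φ : N → F × (F →L[ℝ] F)) (q : N),
    IsTwistorChart U g Ω φ ∧ q ∈ Ω ∧ φ q = z ∧ Set.MapsTo φ Ω S

theorem CurvIsotropic.curvForm_vertical {c : ℝ} (h : CurvIsotropic g x e c) (hg : IsMetricOn U g)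
    (hx : x ∈ U) (he : ∀ m n, g x (e m) (e n) = if m = n then 1 else 0) {V : F →L[ℝ] F}
    (hV : IsVertical (g x) (sOne e) V) : curvForm g x (sOne e) V = 0 := by
  rw [(quatTriple_s (hg.symm x hx) he).vertical_eq hV, curvForm_add_right, curvForm_smul_right,
    curvForm_smul_right, h.one_two, h.one_three]
  simp

/-- Isotropy is needed in a whole chart of the twistor space, not just at one point, because the
identities expressing it are differentiated there. -/
theorem IsMetricOn.divOp_sOne_of_isotropic (hg : IsMetricOn U g) (hx : x ∈ U)
    {o : F → Orientation ℝ F (Fin 4)} (hch : HasTwistorCharts N U g (frameTwistorSet U g o))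
    {s : F → ℝ} (hiso : ∀ y ∈ U, ∀ e, IsFrame (g y) (o y) e → CurvIsotropic g y e (s y))
    (hs : DifferentiableAt ℝ s x) (he : IsFrame (g x) (o x) e) :
    divOp g x e (sOne e) = (2 : ℝ) • sOne e (fderiv ℝ s x (e 0) • e 0 + fderiv ℝ s x (e 1) • e 1
      + fderiv ℝ s x (e 2) • e 2 + fderiv ℝ s x (e 3) • e 3) := by
  obtain ⟨Ω, φ, q, hφ, hq, hz, hmap⟩ := hch (x, sOne e) ⟨hx, e, he, rfl⟩
  have hz1 : (φ q).1 = x := by rw [hz]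
  have hz2 : (φ q).2 = sOne e := by rw [hz]
  have hT := quatTriple_s (hg.symm x hx) he.orthonormal
  have h1 : ∀ᶠ y in 𝓝 q, curvForm g (φ y).1 (φ y).2 (φ y).2 = s (φ y).1 := by
    filter_upwards [hφ.eventually_mem hq] with y hy
    obtain ⟨hyU, e', he', h'⟩ := hmap hy
    rw [← h']; exact (hiso _ hyU e' he').one
  have h2 : ∀ᶠ y in 𝓝 q, ∀ V, IsVertical (g (φ y).1) (φ y).2 V →
      curvForm g (φ y).1 (φ y).2 V = 0 := by
    filter_upwards [hφ.eventually_mem hq] with y hy V hV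
    obtain ⟨hyU, e', he', h'⟩ := hmap hy
    rw [← h'] at hV ⊢
    exact (hiso _ hyU e' he').curvForm_vertical hg hyU he'.orthonormal hV
  refine hg.divOp_sOne hx he.orthonormal (d := fun m => fderiv ℝ s x (e m)) (fun m => ?_)
    (fun m => ?_) (fun m => ?_)
  · have := hφ.endForm_nablaOp_self hq (by rwa [hz1]) h1 (e m)
    rwa [hz1, hz2] at this
  · have := hφ.endForm_nablaOp_vertical hq h2 (e m) (V := sTwo e)
      (by rw [hz1, hz2]; exact hT.isVertical_k)
    rwa [hz1, hz2] at this
  · have := hφ.endForm_nablaOp_vertical hq h2 (e m) (V := sThree e)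
      (by rw [hz1, hz2]; exact hT.isVertical_j)
    rwa [hz1, hz2] at this

/-- The divergence term for an isotropic curvature operator. -/
theorem IsMetricOn.divTerm_of_isotropic (hg : IsMetricOn U g) (hx : x ∈ U)
    {o : F → Orientation ℝ F (Fin 4)} (hch : HasTwistorCharts N U g (frameTwistorSet U g o))
    {s : F → ℝ} (hiso : ∀ y ∈ U, ∀ e, IsFrame (g y) (o y) e → CurvIsotropic g y e (s y))
    (hs : DifferentiableAt ℝ s x) (he : IsFrame (g x) (o x) e) (ε : ℝ) :
    sOne e (divOp g x e (sTwo e)) + ε • divOp g x e (sThree e) =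
      (2 * (ε - 1)) • sThree e (fderiv ℝ s x (e 0) • e 0 + fderiv ℝ s x (e 1) • e 1
      + fderiv ℝ s x (e 2) • e 2 + fderiv ℝ s x (e 3) • e 3) := by
  obtain ⟨e', he', h1, h2, h3, h4⟩ := he.exists_cycle
  obtain ⟨e'', he'', h1', -, -, h4'⟩ := he'.exists_cycle
  have a := hg.divOp_sOne_of_isotropic hx hch hiso hs he'
  have b := hg.divOp_sOne_of_isotropic hx hch hiso hs he''
  have d : ∀ Φ, divOp g x e' Φ = divOp g x e Φ := fun Φ => by
    simpa only [divOp, Fin.sum_univ_four] using h4 (fun u v => nablaOp g x u Φ v)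
  have d' : ∀ Φ, divOp g x e'' Φ = divOp g x e' Φ := fun Φ => by
    simpa only [divOp, Fin.sum_univ_four] using h4' (fun u v => nablaOp g x u Φ v)
  rw [h1, d, h4 (fun u v => fderiv ℝ s x u • v)] at a
  rw [h1', h2, d', d, h4' (fun u v => fderiv ℝ s x u • v),
    h4 (fun u v => fderiv ℝ s x u • v)] at b
  -- With `grad s` the gradient of `s`, the relation `i k = -j` makes the first term `-2 j (grad
  -- s)`, against `2 ε j (grad s)` for the second. This is where the two almost complex structures
  -- part ways.
  have c : ∀ v, sOne e (sTwo e v) = -sThree e v := fun v =>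
    congrArg (fun L => L v) (quatRel_s e).ik
  rw [a, b, map_smul, c]
  module

end Divergence

/-! ### The vanishing of the vertical trace at a point, in terms of the curvature. -/

section LocalCriterion

variable {n d : ℕ} {U : Set (Coord 4)} {g : Coord 4 → Coord 4 →L[ℝ] Coord 4 →L[ℝ] ℝ}
  {Ω : Set (Coord n)} {φ : Coord n → Coord 4 × (Coord 4 →L[ℝ] Coord 4)} {q : Coord n}
  {e : Module.Basis (Fin 4) ℝ (Coord 4)} {J : Coord n → Coord n →L[ℝ] Coord n} {t t' ε : ℝ}

/-- The vertical part of `Trace ∇̃𝒥_*` vanishes at a point if and only if two conditions on the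
curvature hold. -/
theorem IsTwistorChart.verticalTrace_iff (h : IsTwistorChart U g Ω φ)
    (hJ : IsTwistorACS g ε Ω φ J) (hε : ε * ε = 1) (ht : 0 < t) (ht' : 0 < t') (hq : q ∈ Ω)
    (he : ∀ m n, g (φ q).1 (e m) (e n) = if m = n then 1 else 0) (hI : sOne e = (φ q).2)
    {Ω' : Set (Coord d)} {Ψ : Coord d → Coord n × (Coord n →L[ℝ] Coord n)} {u : Coord n → Coord d}
    (hΨ : IsTwistorChart Ω (pullbackMetric (twistorMetric g t) φ) Ω' Ψ)
    (hu : ContDiffAt ℝ ∞ u q) (huq : u q ∈ Ω') (hJu : ∀ᶠ y in 𝓝 q, Ψ (u y) = (y, J y)) :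
    verticalTrace (pullbackMetric (twistorMetric g t) φ) t' Ψ u q = 0 ↔
      (lapBlock ε (sOne e) (sThree e) (sTwo e) (t • curvOp g (φ q).1 (sTwo e))
        ((-t) • curvOp g (φ q).1 (sThree e)) * sOne e =
        sOne e * lapBlock ε (sOne e) (sThree e) (sTwo e) (t • curvOp g (φ q).1 (sTwo e))
          ((-t) • curvOp g (φ q).1 (sThree e)) ∧
      sOne e (divOp g (φ q).1 e (sTwo e)) + ε • divOp g (φ q).1 e (sThree e) = 0) := by
  have hT := quatTriple_s (h.metric.symm _ (h.mem hq)) he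
  rw [hI] at hT
  obtain ⟨f, hon, hf, hf', hf0, hf1⟩ := h.exists_adapted_basis ht hq hT he
  rw [verticalTrace_eq_zero_iff hq ht' hΨ hu huq
    (by filter_upwards [h.eventually_mem hq] with y hy using h.smoothAt_twistorACS hJ hy)
    (by filter_upwards [h.eventually_mem hq] with y hy using h.twistorACS_sq hJ hε hy)
    hJu hon]
  have := h.roughLap_comm_iff hJ hε ht hq hT he hf hf' hf0 hf1
  rw [kOp_j hT, kOp_k hT] at this
  rw [hI]
  exact this

end LocalCriterion

/-! ### The dimension of the vertical space -/

section VerticalDimension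

variable {F : Type*} [NormedAddCommGroup F] [NormedSpace ℝ F] [FiniteDimensional ℝ F]
variable {b : F →L[ℝ] F →L[ℝ] ℝ} {J : F →L[ℝ] F}

/-- A unitary family for the hermitian structure given by the scalar product `b` and the complex
structure `J`. -/
structure IsUnitaryFamily (b : F →L[ℝ] F →L[ℝ] ℝ) (J : F →L[ℝ] F) {m : ℕ} (v : Fin m → F) :
    Prop where
  orthonormal : ∀ i j, b (v i) (v j) = if i = j then 1 else 0
  isotropic : ∀ i j, b (v i) (J (v j)) = 0

theorem exists_isUnitaryFamily (hs : ∀ v w, b v w = b w v) (hp : ∀ v, v ≠ 0 → 0 < b v v)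
    (hJ : ∀ v w, b (J v) w = -b v (J w)) (m : ℕ) (hm : 2 * m ≤ Module.finrank ℝ F) :
    ∃ v : Fin m → F, IsUnitaryFamily b J v := by
  induction m with
  | zero => exact ⟨Fin.elim0, ⟨fun i => i.elim0, fun i => i.elim0⟩⟩
  | succ m ih =>
    obtain ⟨v, hv⟩ := ih (by omega)
    -- The next vector has to be orthogonal to all `v i` and `J (v i)`. These are `2 m` linear
    -- conditions, fewer than the dimension.
    let T : F →ₗ[ℝ] (Fin m ⊕ Fin m → ℝ) :=
      LinearMap.pi (Sum.elim (fun i => (b (v i) : F →ₗ[ℝ] ℝ)) fun i => (b (J (v i)) : F →ₗ[ℝ] ℝ))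
    have hT : LinearMap.ker T ≠ ⊥ := LinearMap.ker_ne_bot_of_finrank_lt (by simp; omega)
    obtain ⟨w, hw, hw0⟩ := Submodule.exists_mem_ne_zero_of_ne_bot hT
    have h1 : ∀ i, b (v i) w = 0 := fun i => congrFun (LinearMap.mem_ker.1 hw) (Sum.inl i)
    have h2 : ∀ i, b (J (v i)) w = 0 := fun i => congrFun (LinearMap.mem_ker.1 hw) (Sum.inr i)
    have hpos := hp w hw0
    have hself : ∀ x, b x (J x) = 0 := fun x => by
      have := hJ x x; rw [hs] at this; linarith
    set c := (√(b w w))⁻¹ with hc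
    have hcc : c * (c * b w w) = 1 := by
      have : √(b w w) * √(b w w) = b w w := Real.mul_self_sqrt hpos.le
      have h0 : √(b w w) ≠ 0 := (Real.sqrt_pos.2 hpos).ne'
      rw [hc]; field_simp; nlinarith
    refine ⟨Fin.snoc v (c • w), ⟨fun i j => ?_, fun i j => ?_⟩⟩
    · induction i using Fin.lastCases with
      | last => induction j using Fin.lastCases with
        | last => simp [hcc]
        | cast j => simp [hs w, h1, (Fin.castSucc_lt_last j).ne']
      | cast i => induction j using Fin.lastCases with
        | last => simp [h1, (Fin.castSucc_lt_last i).ne]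
        | cast j => simp [hv.orthonormal]
    · induction i using Fin.lastCases with
      | last => induction j using Fin.lastCases with
        | last => simp [hself]
        | cast j => simp [hs w, h2]
      | cast i => induction j using Fin.lastCases with
        | last =>
          have := hJ (v i) w
          rw [h2] at this
          simp [neg_eq_zero.1 this.symm]
        | cast j => simp [hv.isotropic]

namespace IsUnitaryFamily

variable {m : ℕ} {v : Fin m → F}

theorem apply_acs (h : IsUnitaryFamily b J v) (hJ : ∀ v w, b (J v) w = -b v (J w))
    (hJJ : ∀ v, J (J v) = -v) (i j : Fin m) : b (J (v i)) (J (v j)) = if i = j then 1 else 0 := by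
  rw [hJ, hJJ, map_neg, neg_neg, h.orthonormal]

theorem apply_acs_left (h : IsUnitaryFamily b J v) (hJ : ∀ v w, b (J v) w = -b v (J w))
    (i j : Fin m) : b (J (v i)) (v j) = 0 := by
  rw [hJ, h.isotropic, neg_zero]

theorem apply_sum (h : IsUnitaryFamily b J v) (hJ : ∀ v w, b (J v) w = -b v (J w))
    (hJJ : ∀ v, J (J v) = -v) (c : Fin m ⊕ Fin m → ℝ) (i : Fin m ⊕ Fin m) :
    b (Sum.elim v (fun i => J (v i)) i) (∑ k, c k • Sum.elim v (fun i => J (v i)) k) = c i := by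
  rw [Fintype.sum_sum_type]
  rcases i with i | i <;>
    simp [h.orthonormal, h.apply_acs hJ hJJ, h.isotropic, h.apply_acs_left hJ, -map_neg, map_sum]

/-- A unitary family with `dim F / 2` elements is a basis over the complex numbers. -/
theorem ext (h : IsUnitaryFamily b J v) (hJ : ∀ v w, b (J v) w = -b v (J w))
    (hJJ : ∀ v, J (J v) = -v) (hm : Module.finrank ℝ F = 2 * m) {x : F}
    (h1 : ∀ i, b (v i) x = 0) (h2 : ∀ i, b (J (v i)) x = 0) : x = 0 := by
  have hli : LinearIndependent ℝ (Sum.elim v fun i => J (v i)) := by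
    rw [Fintype.linearIndependent_iff]
    intro c hc i
    rw [← h.apply_sum hJ hJJ c i, hc, map_zero]
  have hspan : Submodule.span ℝ (Set.range (Sum.elim v fun i => J (v i))) = ⊤ :=
    hli.span_eq_top_of_card_eq_finrank' (by simp [hm]; omega)
  have hx : x ∈ Submodule.span ℝ (Set.range (Sum.elim v fun i => J (v i))) :=
    hspan ▸ Submodule.mem_top
  obtain ⟨c, rfl⟩ := (Submodule.mem_span_range_iff_exists_fun ℝ).1 hx
  have key : ∀ i, c i = 0 := fun i => by
    rw [← h.apply_sum hJ hJJ c i]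
    rcases i with i | i
    · exact h1 i
    · exact h2 i
  exact Finset.sum_eq_zero fun i _ => by rw [key i, zero_smul]

end IsUnitaryFamily

/-- The vertical space as a subspace of the endomorphisms. -/
def verticalSpace (b : F →L[ℝ] F →L[ℝ] ℝ) (J : F →L[ℝ] F) : Submodule ℝ (F →L[ℝ] F) where
  carrier := {V | IsVertical b J V}
  zero_mem' := ⟨by simp, by simp⟩
  add_mem' {A B} hA hB := ⟨by rw [add_mul, mul_add, hA.anti, hB.anti, neg_add],
    fun v w => by simp only [add_apply, map_add, hA.skew, hB.skew, neg_add]⟩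
  smul_mem' c A hA := ⟨by rw [smul_mul_assoc, mul_smul_comm, hA.anti, smul_neg],
    fun v w => by simp only [smul_apply, map_smul, hA.skew, smul_neg]⟩

/-- The vertical vector `c ⊗ a - a ⊗ c - Jc ⊗ Ja + Ja ⊗ Jc`. -/
def verticalWedge (b : F →L[ℝ] F →L[ℝ] ℝ) (J : F →L[ℝ] F) (a c : F) : F →L[ℝ] F :=
  (b a).smulRight c - (b c).smulRight a - (b (J a)).smulRight (J c) + (b (J c)).smulRight (J a)

theorem verticalWedge_apply (a c x : F) : verticalWedge b J a c x =
    b a x • c - b c x • a - b (J a) x • J c + b (J c) x • J a := rfl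

theorem isVertical_verticalWedge (hs : ∀ v w, b v w = b w v) (hJ : ∀ v w, b (J v) w = -b v (J w))
    (hJJ : ∀ v, J (J v) = -v) (a c : F) : IsVertical b J (verticalWedge b J a c) where
  anti := by
    ext x
    have e : ∀ u, b u (J x) = -b (J u) x := fun u => by rw [hJ, neg_neg]
    simp only [end_mul_apply, neg_apply, verticalWedge_apply, e, hJJ, map_add, map_sub, map_smul,
      map_neg, neg_apply]
    module
  skew x y := by
    simp only [verticalWedge_apply, map_add, map_sub, map_smul, add_apply, sub_apply, smul_apply,
      smul_eq_mul, hs x]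
    ring

/-- A vertical endomorphism is antilinear for `J` and skew, that is, a skew complex matrix of size
`m` in a unitary family. Its entries above the diagonal are free and determine it. -/
theorem finrank_verticalSpace (hs : ∀ v w, b v w = b w v) (hp : ∀ v, v ≠ 0 → 0 < b v v)
    (hJ : ∀ v w, b (J v) w = -b v (J w)) (hJJ : ∀ v, J (J v) = -v) {m : ℕ}
    (hm : Module.finrank ℝ F = 2 * m) :
    Module.finrank ℝ (verticalSpace b J) =
      2 * Fintype.card {p : Fin m × Fin m // p.1 < p.2} := by
  obtain ⟨v, hv⟩ := exists_isUnitaryFamily hs hp hJ m hm.ge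
  let ι := {p : Fin m × Fin m // p.1 < p.2}
  let Λ : verticalSpace b J →ₗ[ℝ] (ι → ℝ × ℝ) :=
    { toFun := fun V p => (b (V.1 (v p.1.1)) (v p.1.2), b (V.1 (v p.1.1)) (J (v p.1.2)))
      map_add' := fun V W => by ext p <;> simp
      map_smul' := fun c V => by ext p <;> simp }
  have hinj : Function.Injective Λ := by
    rw [← LinearMap.ker_eq_bot, LinearMap.ker_eq_bot']
    rintro ⟨V, hV⟩ h0
    have hV' : IsVertical b J V := hV
    have h1 : ∀ p : ι, b (V (v p.1.1)) (v p.1.2) = 0 := fun p => congrArg Prod.fst (congrFun h0 p)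
    have h2 : ∀ p : ι, b (V (v p.1.1)) (J (v p.1.2)) = 0 :=
      fun p => congrArg Prod.snd (congrFun h0 p)
    have anti : ∀ x, V (J x) = -J (V x) := fun x => congrArg (fun A => A x) hV'.anti
    have a1 : ∀ x y, b (V x) y = -b (V y) x := fun x y => by rw [hV'.skew, hs]
    have a2 : ∀ x y, b (V x) (J y) = -b (V y) (J x) := fun x y => by
      rw [hV'.skew, anti, hs x, map_neg, neg_apply, hJ, neg_neg]
    have k1 : ∀ i j, b (V (v i)) (v j) = 0 := fun i j => by
      rcases lt_trichotomy i j with h | h | h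
      · exact h1 ⟨(i, j), h⟩
      · subst h; linarith [a1 (v i) (v i)]
      · rw [a1, h1 ⟨(j, i), h⟩, neg_zero]
    have k2 : ∀ i j, b (V (v i)) (J (v j)) = 0 := fun i j => by
      rcases lt_trichotomy i j with h | h | h
      · exact h2 ⟨(i, j), h⟩
      · subst h; linarith [a2 (v i) (v i)]
      · rw [a2, h2 ⟨(j, i), h⟩, neg_zero]
    have k3 : ∀ x, V x = 0 := fun x =>
      hv.ext hJ hJJ hm (fun i => by rw [hs, a1, hs]; exact neg_eq_zero.2 (by
        have : V (v i) = 0 := hv.ext hJ hJJ hm (fun j => by rw [hs, k1]) fun j => by rw [hs, k2]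
        rw [this, map_zero])) fun i => by
        have : V (v i) = 0 := hv.ext hJ hJJ hm (fun j => by rw [hs, k1]) fun j => by rw [hs, k2]
        rw [hs, hV'.skew, anti, this, map_zero, neg_zero, map_zero, neg_zero]
    exact Subtype.ext (ContinuousLinearMap.ext k3)
  have hsurj : Function.Surjective Λ := by
    intro f
    -- The wedges with `v p.1.2` and with `J (v p.1.2)` realize the real and the imaginary part of
    -- one entry and leave the other entries zero.
    let T : ι → F →L[ℝ] F := fun p => (f p).1 • verticalWedge b J (v p.1.1) (v p.1.2)
      + (f p).2 • verticalWedge b J (v p.1.1) (J (v p.1.2))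
    refine ⟨⟨∑ p, T p, Submodule.sum_mem _ fun p _ => Submodule.add_mem _
      (Submodule.smul_mem _ _ (isVertical_verticalWedge hs hJ hJJ _ _))
      (Submodule.smul_mem _ _ (isVertical_verticalWedge hs hJ hJJ _ _))⟩, ?_⟩
    funext p
    have hne : ∀ p q : ι, ¬ (q.1.2 = p.1.1 ∧ q.1.1 = p.1.2) := fun p q ⟨h1, h2⟩ => by
      have := p.2; have := q.2; omega
    have hT : ∀ q, (b (T q (v p.1.1)) (v p.1.2), b (T q (v p.1.1)) (J (v p.1.2))) =
        if q = p then f q else 0 := by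
      intro q
      have e1 : q = p ↔ q.1.1 = p.1.1 ∧ q.1.2 = p.1.2 := by
        rw [Subtype.ext_iff, Prod.ext_iff]
      have e2 := hne p q
      simp only [T, add_apply, smul_apply, verticalWedge_apply, hv.orthonormal, hv.isotropic, hJJ,
        hv.apply_acs hJ hJJ, hv.apply_acs_left hJ, map_add, map_sub, map_smul, map_neg, neg_apply,
        sub_apply, smul_eq_mul, e1]
      ext
      · by_cases h1 : q.1.1 = p.1.1 <;> by_cases h2 : q.1.2 = p.1.2 <;>
          by_cases h3 : q.1.2 = p.1.1 <;> by_cases h4 : q.1.1 = p.1.2 <;> simp_all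
      · by_cases h1 : q.1.1 = p.1.1 <;> by_cases h2 : q.1.2 = p.1.2 <;>
          by_cases h3 : q.1.2 = p.1.1 <;> by_cases h4 : q.1.1 = p.1.2 <;> simp_all
    have : (Λ ⟨∑ p, T p, Submodule.sum_mem _ fun p _ => Submodule.add_mem _
      (Submodule.smul_mem _ _ (isVertical_verticalWedge hs hJ hJJ _ _))
      (Submodule.smul_mem _ _ (isVertical_verticalWedge hs hJ hJJ _ _))⟩ : ι → ℝ × ℝ) p =
        ∑ q, (b (T q (v p.1.1)) (v p.1.2), b (T q (v p.1.1)) (J (v p.1.2))) := by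
      ext
      · simp [Λ, Prod.fst_sum, sum_apply]
      · simp [Λ, Prod.snd_sum, sum_apply]
    rw [this, Finset.sum_congr rfl fun q _ => hT q]
    simp
  rw [(LinearEquiv.ofBijective Λ ⟨hinj, hsurj⟩).finrank_eq]
  rw [Module.finrank_pi_fintype]
  simp [ι, mul_comm]

theorem finrank_verticalSpace_four (hs : ∀ v w, b v w = b w v) (hp : ∀ v, v ≠ 0 → 0 < b v v)
    (hJ : ∀ v w, b (J v) w = -b v (J w)) (hJJ : ∀ v, J (J v) = -v)
    (hm : Module.finrank ℝ F = 4) : Module.finrank ℝ (verticalSpace b J) = 2 := by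
  rw [finrank_verticalSpace hs hp hJ hJJ (m := 2) hm]; rfl

theorem finrank_verticalSpace_six (hs : ∀ v w, b v w = b w v) (hp : ∀ v, v ≠ 0 → 0 < b v v)
    (hJ : ∀ v w, b (J v) w = -b v (J w)) (hJJ : ∀ v, J (J v) = -v)
    (hm : Module.finrank ℝ F = 6) : Module.finrank ℝ (verticalSpace b J) = 6 := by
  rw [finrank_verticalSpace hs hp hJ hJJ (m := 3) hm]; rfl

end VerticalDimension

/-! ### Local parametrizations and charts of the twistor space. -/

section LocalParam

variable {N : Type*} [NormedAddCommGroup N] [NormedSpace ℝ N] [FiniteDimensional ℝ N]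
variable {F : Type*} [NormedAddCommGroup F] [NormedSpace ℝ F] [FiniteDimensional ℝ F]

theorem skew_of_orthogonal {b : F →L[ℝ] F →L[ℝ] ℝ} {I : F →L[ℝ] F} (hI : ∀ v, I (I v) = -v)
    (h : ∀ v w, b (I v) (I w) = b v w) (v w : F) : b (I v) w = -b v (I w) := by
  rw [← h v (I w), hI]; simp

/-- A local parametrization of an open subset of the twistor space, by an open subset of a space of
the right dimension, is a chart. -/
theorem IsLocalParam.isTwistorChart {U : Set F} {g : F → F →L[ℝ] F →L[ℝ] ℝ}
    {S : Set (F × (F →L[ℝ] F))} {Ω : Set N} {φ : N → F × (F →L[ℝ] F)} (h : IsLocalParam S Ω φ)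
    (hS : S ⊆ twistorSet U g) (hg : IsMetricOn U g)
    (hd : ∀ z ∈ twistorSet U g, Module.finrank ℝ N =
      Module.finrank ℝ F + Module.finrank ℝ (verticalSpace (g z.1) z.2)) :
    IsTwistorChart U g Ω φ := by
  have hm : IsTwistorMap U g Ω φ :=
    ⟨hg, h.isOpen, h.contDiffOn, fun q hq => hS (h.mapsTo hq), h.injective_fderiv⟩
  refine ⟨hm, fun q hq X V hV => ?_⟩
  -- Horizontal and vertical components determine a tangent vector; by equality of dimensions they
  -- can be prescribed arbitrarily.
  let T : N →ₗ[ℝ] F × verticalSpace (g (φ q).1) (φ q).2 :=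
    LinearMap.prod (horiz φ q : N →ₗ[ℝ] F)
      (LinearMap.codRestrict _ (vert g φ q : N →ₗ[ℝ] (F →L[ℝ] F)) fun a => hm.isVertical hq a)
  have hinj : Function.Injective T := fun a b hab =>
    hm.eq_of_horiz_vert hq (congrArg Prod.fst hab :) (congrArg (fun p => p.2.1) hab :)
  have hsurj : Function.Surjective T :=
    (LinearMap.injective_iff_surjective_of_finrank_eq_finrank
      (by rw [Module.finrank_prod]; exact hd _ (hS (h.mapsTo hq)))).1 hinj
  obtain ⟨a, ha⟩ := hsurj (X, ⟨V, hV⟩)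
  exact ⟨a, congrArg Prod.fst ha, congrArg (fun p => p.2.1) ha⟩

variable {F' : Type*} [NormedAddCommGroup F'] [NormedSpace ℝ F']

/-- A map with a smooth left inverse that is a right inverse on `S` is a local parametrization of
`S`. -/
theorem exists_isLocalParam {S : Set F'} {φ : N → F'} {ρ : F' → N} {q₀ : N}
    (hφ : ∀ᶠ q in 𝓝 q₀, ContDiffAt ℝ ∞ φ q ∧ φ q ∈ S ∧ ρ (φ q) = q)
    (hρ : ∀ᶠ z in 𝓝 (φ q₀), ContDiffAt ℝ ∞ ρ z ∧ (z ∈ S → φ (ρ z) = z)) :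
    ∃ Ω, q₀ ∈ Ω ∧ IsLocalParam S Ω φ := by
  have h0 := hφ.self_of_nhds
  have h1 := h0.1.continuousAt.eventually (eventually_eventually_nhds.2 hρ)
  obtain ⟨Ω, hΩ, ho, hq⟩ := eventually_nhds_iff.1 (hφ.and h1)
  refine ⟨Ω, hq, ho, fun q hq => (hΩ q hq).1.1.contDiffWithinAt, fun q hq => (hΩ q hq).1.2.1,
    fun q hq => ?_, fun q hq => le_antisymm ?_ ?_⟩
  · have a1 := smoothAt_diff (hΩ q hq).1.1
    have a2 := smoothAt_diff (hΩ q hq).2.self_of_nhds.1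
    have e : (fun y => ρ (φ y)) =ᶠ[𝓝 q] id := by
      filter_upwards [ho.mem_nhds hq] with y hy using (hΩ y hy).1.2.2
    have e' : fderiv ℝ ρ (φ q) ∘L fderiv ℝ φ q = ContinuousLinearMap.id ℝ N := by
      rw [← fderiv_comp q a2 a1]
      exact e.fderiv_eq.trans fderiv_id
    intro a b hab
    have := congrArg (fderiv ℝ ρ (φ q)) hab
    rwa [← ContinuousLinearMap.comp_apply, ← ContinuousLinearMap.comp_apply, e'] at this
  · refine tendsto_nhdsWithin_iff.2 ⟨(hΩ q hq).1.1.continuousAt, ?_⟩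
    filter_upwards [ho.mem_nhds hq] with y hy using (hΩ y hy).1.2.1
  -- Openness in `S`: a point `z` of `S` near `φ q` equals `φ (ρ z)`, and `ρ z` is close to `q`.
  · intro s hs
    have a2 := (hΩ q hq).2.self_of_nhds.1.continuousAt
    rw [ContinuousAt, (hΩ q hq).1.2.2] at a2
    have := a2.eventually (mem_map.1 hs)
    filter_upwards [nhdsWithin_le_nhds this, nhdsWithin_le_nhds (hΩ q hq).2, self_mem_nhdsWithin]
      with z hz hz' hzS
    rw [← hz'.2 hzS]; exact hz

end LocalParam

/-! ### Local parametrizations of the twistor space -/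

section Cayley

/-- A smooth square root near the unit of a Banach algebra. -/
theorem exists_smooth_sqrt (R : Type*) [NormedRing R] [NormedAlgebra ℝ R] [CompleteSpace R] :
    ∃ σ : R → R, σ 1 = 1 ∧ (∀ᶠ B in 𝓝 1, ContDiffAt ℝ ∞ σ B ∧ σ B * σ B = B) ∧
      ∀ᶠ A in 𝓝 1, σ (A * A) = A := by
  let f : R → R := fun A => A * A
  have hf : ContDiffAt ℝ ω f 1 := (contDiff_id.mul contDiff_id).contDiffAt
  -- The derivative of `A ↦ A²` at the unit is multiplication by 2, and the inverse function theorem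
  -- applies.
  let f' : R ≃L[ℝ] R := ContinuousLinearEquiv.smulLeft (Units.mk0 (2 : ℝ) two_ne_zero)
  have hf' : HasFDerivAt f (f' : R →L[ℝ] R) 1 := by
    have := (hasFDerivAt_id (𝕜 := ℝ) (1 : R)).mul' (hasFDerivAt_id (𝕜 := ℝ) (1 : R))
    refine this.congr_fderiv ?_
    ext x
    simp [f', Units.smul_def, two_smul]
  have hn : (ω : WithTop ℕ∞) ≠ 0 := by simp
  have h1 : f 1 = 1 := mul_one 1
  have hs := hf.to_localInverse hf' hn
  rw [h1] at hs
  refine ⟨hf.localInverse hf' hn, ?_, ?_, ?_⟩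
  · have := hf.localInverse_apply_image hf' hn
    rwa [h1] at this
  · have e := (hf.hasStrictFDerivAt' hf' hn).eventually_right_inverse
    rw [h1] at e
    filter_upwards [hs.eventually (by simp), e] with B hB hB'
    exact ⟨hB.of_le le_top, hB'⟩
  · exact (hf.hasStrictFDerivAt' hf' hn).eventually_left_inverse

variable {R : Type*} [Ring R] {J V C : R}

/-- The conjugate of the complex structure `J` by `1 + V`. -/
def cayley (J V : R) : R := (1 + V) * J * Ring.inverse (1 + V)

/-- The inverse of `V ↦ cayley J V` on the elements anti-commuting with `J`. -/
def cayleyInv (J C : R) : R := (1 + J * C) * Ring.inverse (1 - J * C)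

theorem cayley_mul_self (hJ : J * J = -1) (hu : IsUnit (1 + V)) :
    cayley J V * cayley J V = -1 := by
  have h1 := Ring.inverse_mul_cancel _ hu
  have h2 := Ring.mul_inverse_cancel _ hu
  rw [cayley]
  calc (1 + V) * J * Ring.inverse (1 + V) * ((1 + V) * J * Ring.inverse (1 + V))
      = (1 + V) * J * (Ring.inverse (1 + V) * (1 + V)) * J * Ring.inverse (1 + V) := by noncomm_ring
    _ = (1 + V) * (J * J) * Ring.inverse (1 + V) := by rw [h1, mul_one, mul_assoc (1 + V)]
    _ = -1 := by rw [hJ, mul_neg, mul_one, neg_mul, h2]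

/-- As `V` anti-commutes with `J`, the element `-J * cayley J V` is the classical Cayley transform
`(1 - V)(1 + V)⁻¹`, and it is inverted by the usual formula. -/
theorem cayleyInv_cayley [Algebra ℝ R] (hJ : J * J = -1) (hV : V * J = -(J * V))
    (hu : IsUnit (1 + V)) : cayleyInv J (cayley J V) = V := by
  have h1 := Ring.inverse_mul_cancel _ hu
  have h2 := Ring.mul_inverse_cancel _ hu
  generalize hi : Ring.inverse (1 + V) = i at *
  have e : J * cayley J V = -((1 - V) * i) := by
    have : J * (1 + V) * J = -(1 - V) := by
      rw [mul_assoc, add_mul, one_mul, hV, mul_add, mul_neg, ← mul_assoc, hJ]; noncomm_ring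
    rw [cayley, hi, ← mul_assoc, ← mul_assoc, this, neg_mul]
  have e1 : 1 - J * cayley J V = (2 : ℝ) • i := by
    rw [e, two_smul]; nth_rewrite 1 [← h2]; noncomm_ring
  have e2 : 1 + J * cayley J V = (2 : ℝ) • (V * i) := by
    rw [e, two_smul]; nth_rewrite 1 [← h2]; noncomm_ring
  have e3 : Ring.inverse ((2 : ℝ) • i) = (2⁻¹ : ℝ) • (1 + V) := by
    let w : Rˣ := ⟨(2 : ℝ) • i, (2⁻¹ : ℝ) • (1 + V),
      by rw [smul_mul_smul_comm, h1]; norm_num, by rw [smul_mul_smul_comm, h2]; norm_num⟩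
    exact Ring.inverse_unit w
  rw [cayleyInv, e1, e2, e3, smul_mul_smul_comm, mul_assoc, h1]
  norm_num

theorem one_add_cayleyInv [Algebra ℝ R] (hu : IsUnit (1 - J * C)) :
    1 + cayleyInv J C = (2 : ℝ) • Ring.inverse (1 - J * C) := by
  have h2 := Ring.mul_inverse_cancel _ hu
  rw [cayleyInv, two_smul]; nth_rewrite 1 [← h2]; noncomm_ring

theorem inverse_one_add_cayleyInv [Algebra ℝ R] (hu : IsUnit (1 - J * C)) :
    Ring.inverse (1 + cayleyInv J C) = (2⁻¹ : ℝ) • (1 - J * C) := by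
  rw [one_add_cayleyInv hu]
  let w : Rˣ := ⟨(2 : ℝ) • Ring.inverse (1 - J * C), (2⁻¹ : ℝ) • (1 - J * C),
    by rw [smul_mul_smul_comm, Ring.inverse_mul_cancel _ hu]; norm_num,
    by rw [smul_mul_smul_comm, Ring.mul_inverse_cancel _ hu]; norm_num⟩
  exact Ring.inverse_unit w

theorem cayley_cayleyInv [Algebra ℝ R] (hJ : J * J = -1) (hC : C * C = -1)
    (hu : IsUnit (1 - J * C)) : cayley J (cayleyInv J C) = C := by
  have h1 := Ring.inverse_mul_cancel _ hu
  have e : J * (1 - J * C) = (1 - J * C) * C := by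
    rw [mul_sub, sub_mul, ← mul_assoc, hJ, mul_assoc, hC]; noncomm_ring
  rw [cayley, inverse_one_add_cayleyInv hu, one_add_cayleyInv hu, smul_mul_assoc,
    smul_mul_smul_comm, mul_assoc, e, ← mul_assoc, h1]
  norm_num

theorem cayleyInv_anti [Algebra ℝ R] (hJ : J * J = -1) (hC : C * C = -1)
    (hu : IsUnit (1 - J * C)) : cayleyInv J C * J = -(J * cayleyInv J C) := by
  have h1 := Ring.inverse_mul_cancel _ hu
  have h2 := Ring.mul_inverse_cancel _ hu
  have e0 : cayleyInv J C = (2 : ℝ) • Ring.inverse (1 - J * C) - 1 :=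
    eq_sub_of_add_eq' (one_add_cayleyInv hu)
  generalize Ring.inverse (1 - J * C) = i at *
  -- Multiplying by the inverse `i` of `1 - J C` on both sides gives `i J + J i = J`, which says
  -- that `2 i - 1` anti-commutes with `J`.
  have e : J * (1 - J * C) + (1 - J * C) * J = (1 - J * C) * J * (1 - J * C) := by
    have a : J * (1 - J * C) = J + C := by rw [mul_sub, ← mul_assoc, hJ]; noncomm_ring
    rw [mul_assoc (1 - J * C), a, mul_add, sub_mul 1 (J * C) C, mul_assoc J C C, hC]
    noncomm_ring
  have e' : i * J + J * i = J := by
    calc i * J + J * i = i * (J * (1 - J * C) + (1 - J * C) * J) * i := by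
          rw [mul_add, add_mul, ← mul_assoc, ← mul_assoc, h1, mul_assoc (i * J), h2]; noncomm_ring
      _ = (i * (1 - J * C)) * J * ((1 - J * C) * i) := by rw [e]; noncomm_ring
      _ = J := by rw [h1, h2]; noncomm_ring
  rw [e0, eq_neg_iff_add_eq_zero, sub_mul, mul_sub, one_mul, mul_one, smul_mul_assoc,
    mul_smul_comm]
  have : (2 : ℝ) • (i * J) - J + ((2 : ℝ) • (J * i) - J) = (2 : ℝ) • (i * J + J * i - J) := by
    module
  rw [this, e', sub_self, smul_zero]

end Cayley

/-! ### Parametrization of the twistor space by the base and one vertical space. -/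

section TwistorParam

variable {F : Type*} [NormedAddCommGroup F] [NormedSpace ℝ F] [FiniteDimensional ℝ F]
variable {b : F →L[ℝ] F →L[ℝ] ℝ} {J V C : F →L[ℝ] F}

theorem isUnit_one_add_of_skew (hp : ∀ v, v ≠ 0 → 0 < b v v)
    (hV : ∀ v w, b (V v) w = -b v (V w)) : IsUnit (1 + V) := by
  rw [ContinuousLinearMap.isUnit_iff_bijective]
  have hinj : Function.Injective (1 + V : F →L[ℝ] F) := by
    rw [injective_iff_map_eq_zero]
    intro v hv
    by_contra h
    have h1 := hp v h
    have h2 : V v = -v := eq_neg_of_add_eq_zero_right hv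
    have h3 := hV v v
    rw [h2, map_neg, map_neg, neg_apply, neg_neg] at h3
    linarith
  exact ⟨hinj, (LinearMap.injective_iff_surjective (f := ((1 + V : F →L[ℝ] F) : F →ₗ[ℝ] F))).1 hinj⟩

theorem cayley_orthogonal (hp : ∀ v, v ≠ 0 → 0 < b v v)
    (hJ : ∀ v w, b (J v) (J w) = b v w) (hV : IsVertical b J V) (v w : F) :
    b (cayley J V v) (cayley J V w) = b v w := by
  have hu := isUnit_one_add_of_skew hp hV.skew
  have h2 := Ring.mul_inverse_cancel _ hu
  have e : ∀ x, (1 + V) (Ring.inverse (1 + V) x) = x := fun x => congrArg (fun A => A x) h2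
  have k : ∀ x y, b ((1 + V) x) ((1 + V) y) = b x y - b x (V (V y)) := fun x y => by
    simp only [add_apply, one_apply_eq_self, map_add, hV.skew]; ring
  have c : ∀ x, V (V (J x)) = J (V (V x)) := fun x => by
    have h : ∀ x, V (J x) = -J (V x) := fun x => congrArg (fun A => A x) hV.anti
    rw [h, map_neg, h, neg_neg]
  nth_rewrite 2 [← e v, ← e w]
  simp only [cayley, end_mul_apply, k, c, hJ]

theorem cayleyInv_skew (hJ : ∀ v w, b (J v) (J w) = b v w) (hC : ∀ v w, b (C v) (C w) = b v w)
    (hu : IsUnit (1 - J * C)) (v w : F) :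
    b (cayleyInv J C v) w = -b v (cayleyInv J C w) := by
  have h2 := Ring.mul_inverse_cancel _ hu
  have e : ∀ x, (1 - J * C) (Ring.inverse (1 - J * C) x) = x := fun x => congrArg (fun A => A x) h2
  nth_rewrite 2 [← e v]
  nth_rewrite 1 [← e w]
  simp only [cayleyInv, end_mul_apply, add_apply, sub_apply, one_apply_eq_self, map_add,
    map_sub, hJ, hC]
  ring

/-- Near `x₀` there is a smooth field of isomorphisms that takes the metric to its value at `x₀`. -/
theorem IsMetricOn.exists_isometry {U : Set F} {g : F → F →L[ℝ] F →L[ℝ] ℝ} (hg : IsMetricOn U g)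
    {x₀ : F} (hx : x₀ ∈ U) : ∃ P : F → F →L[ℝ] F, P x₀ = 1 ∧ ∀ᶠ x in 𝓝 x₀,
      ContDiffAt ℝ ∞ P x ∧ IsUnit (P x) ∧ ∀ v w, g x v w = g x₀ (P x v) (P x w) := by
  have : CompleteSpace F := FiniteDimensional.complete ℝ F
  obtain ⟨σ, hσ1, hσ, hσ'⟩ := exists_smooth_sqrt (F →L[ℝ] F)
  -- `B x` is the self-adjoint operator that represents `g x` in the scalar product `g x₀`. Its
  -- square root near the unit is the isometry sought.
  let B : F → F →L[ℝ] F := fun x => (g x₀).inverse ∘L g x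
  have hB : ∀ x ∈ U, ContDiffAt ℝ ∞ B x := fun x hx =>
    contDiffAt_const.clm_comp (hg.smoothAt hx)
  have hB0 : B x₀ = 1 := by
    ext v; exact (hg.isInvertible hx).inverse_apply_self v
  have hBi : ∀ x v w, g x₀ (B x v) w = g x v w := fun x v w =>
    congrArg (fun A => A w) (hg.apply_inverse hx (g x v))
  -- The adjoint for `g x₀`. The adjoint of `σ (B x)` is another square root of `B x` near the unit,
  -- so local uniqueness makes `σ (B x)` self-adjoint.
  let τ : (F →L[ℝ] F) → (F →L[ℝ] F) := fun A => (g x₀).inverse ∘L (g x₀ ∘L A).flip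
  have hτ : ∀ A v w, g x₀ (τ A v) w = g x₀ (A w) v := fun A v w =>
    congrArg (fun A => A w) (hg.apply_inverse hx ((g x₀ ∘L A).flip v))
  have hτ1 : τ 1 = 1 := by
    ext v
    exact hg.ext hx fun w => by rw [hτ, hg.symm _ hx]; rfl
  have hτc : Continuous τ := by
    have : Continuous fun A : F →L[ℝ] F => (g x₀ ∘L A).flip :=
      (ContinuousLinearMap.flipₗᵢ ℝ F F ℝ).continuous.comp (continuous_const.clm_comp continuous_id)
    exact continuous_const.clm_comp this
  have hBc : Tendsto B (𝓝 x₀) (𝓝 1) := by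
    have := (hB x₀ hx).continuousAt.tendsto; rwa [hB0] at this
  have hσc : Tendsto σ (𝓝 1) (𝓝 1) := by
    have := hσ.self_of_nhds.1.continuousAt.tendsto; rwa [hσ1] at this
  have hτt : Tendsto τ (𝓝 1) (𝓝 1) := by
    have := hτc.continuousAt (x := 1).tendsto; rwa [hτ1] at this
  have hunit : ∀ᶠ A in 𝓝 (1 : F →L[ℝ] F), IsUnit A := Units.isOpen.mem_nhds isUnit_one
  refine ⟨fun x => σ (B x), (congrArg σ hB0).trans hσ1, ?_⟩
  filter_upwards [hg.isOpen.mem_nhds hx, hBc.eventually hσ,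
    (hσc.comp hBc).eventually hσ', (hτt.comp (hσc.comp hBc)).eventually hσ',
    (hσc.comp hBc).eventually hunit] with x hxU h1 h2 h3 h4
  refine ⟨ContDiffAt.comp x h1.1 (hB x hxU), h4, ?_⟩
  have hsq : ∀ v, σ (B x) (σ (B x) v) = B x v := fun v => congrArg (fun A => A v) h1.2
  have hττ : τ (σ (B x)) * τ (σ (B x)) = B x := by
    ext v
    refine hg.ext hx fun w => ?_
    rw [end_mul_apply, hτ, hg.symm _ hx, hτ, hsq, hBi, hBi, hg.symm _ hxU]
  have hself : τ (σ (B x)) = σ (B x) := by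
    simp only [Function.comp_apply] at h3
    rw [← h3, hττ]
  intro v w
  rw [hg.symm _ hx, ← hτ, hself, hsq, hBi]

/-- The twistor space near a point `(x₀, J)` is parametrized by `F` times the vertical space. -/
theorem IsMetricOn.exists_vertical_param {U : Set F} {g : F → F →L[ℝ] F →L[ℝ] ℝ}
    (hg : IsMetricOn U g) {z₀ : F × (F →L[ℝ] F)} (hz : z₀ ∈ twistorSet U g) :
    ∃ (φ : F × verticalSpace (g z₀.1) z₀.2 → F × (F →L[ℝ] F))
      (ρ : F × (F →L[ℝ] F) → F × verticalSpace (g z₀.1) z₀.2), φ (z₀.1, 0) = z₀ ∧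
      (∀ᶠ q in 𝓝 (z₀.1, 0), ContDiffAt ℝ ∞ φ q ∧ φ q ∈ twistorSet U g ∧ ρ (φ q) = q) ∧
      (∀ᶠ z in 𝓝 z₀, ContDiffAt ℝ ∞ ρ z ∧ (z ∈ twistorSet U g → φ (ρ z) = z)) := by
  have : CompleteSpace F := FiniteDimensional.complete ℝ F
  obtain ⟨x₀, J⟩ := z₀
  obtain ⟨hx, hJ, hJo⟩ := hz
  dsimp only at hx hJ hJo ⊢
  have hJJ : J * J = -1 := ContinuousLinearMap.ext hJ
  obtain ⟨P, hP0, hP⟩ := hg.exists_isometry hx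
  -- A linear projection to the vertical space lets `ρ` be defined and smooth on a full
  -- neighbourhood, not only on the twistor space.
  obtain ⟨pr, hpr⟩ := (verticalSpace (g x₀) J).subtype.exists_leftInverse_of_injective
    (Submodule.ker_subtype _)
  have hpr' : ∀ V (hV : IsVertical (g x₀) J V), pr V = ⟨V, hV⟩ := fun V hV =>
    congrArg (fun A => A ⟨V, hV⟩) hpr
  let prc := LinearMap.toContinuousLinearMap pr
  have hinv : ∀ A : F →L[ℝ] F, IsUnit A → ContDiffAt ℝ ∞ Ring.inverse A := fun A ⟨u, hu⟩ =>
    hu ▸ contDiffAt_ringInverse ℝ u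
  -- The Cayley transform parametrizes the complex structures of the fibre over `x₀` near `J`;
  -- conjugation by `P` carries them to the neighbouring fibres.
  let φ : F × verticalSpace (g x₀) J → F × (F →L[ℝ] F) := fun q =>
    (q.1, Ring.inverse (P q.1) * cayley J q.2.1 * P q.1)
  let ρ : F × (F →L[ℝ] F) → F × verticalSpace (g x₀) J := fun z =>
    (z.1, prc (cayleyInv J (P z.1 * z.2 * Ring.inverse (P z.1))))
  have hV1 : ∀ V : verticalSpace (g x₀) J, IsUnit (1 + V.1) := fun V =>
    isUnit_one_add_of_skew (hg.pos _ hx) V.2.skew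
  have hunit : ∀ᶠ z in 𝓝 (x₀, J), IsUnit (1 - J * (P z.1 * z.2 * Ring.inverse (P z.1))) := by
    have hc : ContinuousAt (fun z : F × (F →L[ℝ] F) =>
        1 - J * (P z.1 * z.2 * Ring.inverse (P z.1))) (x₀, J) := by
      have c1 : ContinuousAt (fun z : F × (F →L[ℝ] F) => P z.1) (x₀, J) :=
        ContinuousAt.comp (f := Prod.fst) hP.self_of_nhds.1.continuousAt continuousAt_fst
      have c2 : ContinuousAt (fun z : F × (F →L[ℝ] F) => Ring.inverse (P z.1)) (x₀, J) :=
        ContinuousAt.comp (g := Ring.inverse) (f := fun z : F × (F →L[ℝ] F) => P z.1)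
          (hinv _ hP.self_of_nhds.2.1).continuousAt c1
      exact continuousAt_const.sub (continuousAt_const.mul ((c1.mul continuousAt_snd).mul c2))
    refine hc.eventually (Units.isOpen.mem_nhds ?_)
    -- At the base point the element to be inverted is `1 - J J = 2`.
    simp only [hP0, Ring.inverse_one, one_mul, mul_one, hJJ, sub_neg_eq_add]
    let w : (F →L[ℝ] F)ˣ := ⟨1 + 1, (2⁻¹ : ℝ) • 1, by
      rw [← two_smul ℝ, smul_mul_smul_comm]; norm_num, by
      rw [← two_smul ℝ, smul_mul_smul_comm]; norm_num⟩
    exact w.isUnit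
  have hPi : ∀ x, IsUnit (P x) → ∀ A, P x * (Ring.inverse (P x) * A * P x) * Ring.inverse (P x) = A :=
    fun x hx A => by
      rw [mul_assoc, mul_assoc, Ring.mul_inverse_cancel _ hx, mul_one, ← mul_assoc,
        Ring.mul_inverse_cancel _ hx, one_mul]
  have hPi' : ∀ x, IsUnit (P x) → ∀ A, Ring.inverse (P x) * (P x * A * Ring.inverse (P x)) * P x = A :=
    fun x hx A => by
      rw [mul_assoc, mul_assoc, Ring.inverse_mul_cancel _ hx, mul_one, ← mul_assoc,
        Ring.inverse_mul_cancel _ hx, one_mul]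
  refine ⟨φ, ρ, ?_, ?_, ?_⟩
  · simp [φ, hP0, cayley]
  · have hPe := (continuous_fst (X := F) (Y := verticalSpace (g x₀) J)).continuousAt
      (x := (x₀, 0)).eventually (hP.and (hg.isOpen.mem_nhds hx))
    filter_upwards [hPe] with ⟨x, V⟩ ⟨⟨h1, h2, h3⟩, h4⟩
    have hPP : ∀ v, P x (Ring.inverse (P x) v) = v := fun v =>
      congrArg (fun A => A v) (Ring.mul_inverse_cancel _ h2)
    refine ⟨?_, ⟨h4, ?_, ?_⟩, ?_⟩
    · have c1 : ContDiffAt ℝ ∞ (fun q : F × verticalSpace (g x₀) J => P q.1) (x, V) :=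
        ContDiffAt.comp (x, V) (f := Prod.fst) h1 contDiffAt_fst
      have c2 : ContDiffAt ℝ ∞ (fun q : F × verticalSpace (g x₀) J => Ring.inverse (P q.1)) (x, V) :=
        ContDiffAt.comp (x, V) (f := fun q : F × verticalSpace (g x₀) J => P q.1) (hinv _ h2) c1
      have c3 : ContDiffAt ℝ ∞ (fun q : F × verticalSpace (g x₀) J => 1 + q.2.1) (x, V) :=
        contDiffAt_const.add
          (((verticalSpace (g x₀) J).subtypeL.contDiff.comp contDiff_snd).contDiffAt)
      have c4 : ContDiffAt ℝ ∞ (fun q : F × verticalSpace (g x₀) J => Ring.inverse (1 + q.2.1))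
          (x, V) :=
        ContDiffAt.comp (x, V) (f := fun q : F × verticalSpace (g x₀) J => 1 + q.2.1)
          (hinv _ (hV1 V)) c3
      exact contDiffAt_fst.prodMk ((c2.mul ((c3.mul contDiffAt_const).mul c4)).mul c1)
    · have e : ∀ v, cayley J V.1 (cayley J V.1 v) = -v := fun v =>
        congrArg (fun A => A v) (cayley_mul_self hJJ (hV1 V))
      intro v
      simp only [φ, end_mul_apply, hPP, e, map_neg]
      exact congrArg (fun A => -(A v)) (Ring.inverse_mul_cancel _ h2)
    · intro v w
      simp only [φ, end_mul_apply, h3, hPP,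
        cayley_orthogonal (hg.pos _ hx) hJo V.2]
    · simp only [φ, ρ, hPi x h2, cayleyInv_cayley hJJ V.2.anti (hV1 V)]
      exact Prod.ext rfl (hpr' V.1 V.2)
  · have hPe := (continuous_fst (X := F) (Y := F →L[ℝ] F)).continuousAt
      (x := (x₀, J)).eventually hP
    filter_upwards [hPe, hunit] with ⟨x, I⟩ ⟨h1, h2, h3⟩ hu
    have hPP : ∀ v, P x (Ring.inverse (P x) v) = v := fun v =>
      congrArg (fun A => A v) (Ring.mul_inverse_cancel _ h2)
    have hPP' : ∀ v, Ring.inverse (P x) (P x v) = v := fun v =>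
      congrArg (fun A => A v) (Ring.inverse_mul_cancel _ h2)
    constructor
    · have c1 : ContDiffAt ℝ ∞ (fun q : F × (F →L[ℝ] F) => P q.1) (x, I) :=
        ContDiffAt.comp (x, I) (f := Prod.fst) h1 contDiffAt_fst
      have c2 : ContDiffAt ℝ ∞ (fun q : F × (F →L[ℝ] F) => Ring.inverse (P q.1)) (x, I) :=
        ContDiffAt.comp (x, I) (f := fun q : F × (F →L[ℝ] F) => P q.1) (hinv _ h2) c1
      have c3 : ContDiffAt ℝ ∞ (fun q : F × (F →L[ℝ] F) =>
          J * (P q.1 * q.2 * Ring.inverse (P q.1))) (x, I) :=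
        contDiffAt_const.mul ((c1.mul contDiffAt_snd).mul c2)
      have c4 : ContDiffAt ℝ ∞ (fun q : F × (F →L[ℝ] F) =>
          Ring.inverse (1 - J * (P q.1 * q.2 * Ring.inverse (P q.1)))) (x, I) :=
        ContDiffAt.comp (x, I) (f := fun q : F × (F →L[ℝ] F) =>
          1 - J * (P q.1 * q.2 * Ring.inverse (P q.1))) (hinv _ hu) (contDiffAt_const.sub c3)
      exact contDiffAt_fst.prodMk
        (prc.contDiff.contDiffAt.comp (x, I) ((contDiffAt_const.add c3).mul c4))
    · rintro ⟨-, hI, hIo⟩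
      dsimp only at hI hIo hu
      have hC : (P x * I * Ring.inverse (P x)) * (P x * I * Ring.inverse (P x)) = -1 := by
        ext v
        simp only [end_mul_apply, hPP', hI, map_neg, hPP, neg_apply, one_apply_eq_self]
      have hCo : ∀ v w, g x₀ ((P x * I * Ring.inverse (P x)) v) ((P x * I * Ring.inverse (P x)) w) =
          g x₀ v w := fun v w => by
        simp only [end_mul_apply, ← h3, hIo]
        rw [h3, hPP, hPP]
      have hv : IsVertical (g x₀) J (cayleyInv J (P x * I * Ring.inverse (P x))) :=
        ⟨cayleyInv_anti hJJ hC hu, cayleyInv_skew hJo hCo hu⟩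
      have hr : ρ (x, I) = (x, ⟨_, hv⟩) := Prod.ext rfl (hpr' _ hv)
      rw [hr]
      simp only [φ, cayley_cayleyInv hJJ hC hu, hPi' x h2]

/-- Every open subset of the twistor space has local parametrizations around its points. -/
theorem IsMetricOn.exists_isLocalParam {N : Type*} [NormedAddCommGroup N] [NormedSpace ℝ N]
    [FiniteDimensional ℝ N] {U : Set F} {g : F → F →L[ℝ] F →L[ℝ] ℝ} (hg : IsMetricOn U g)
    {S : Set (F × (F →L[ℝ] F))} (hS : S ⊆ twistorSet U g) {z₀ : F × (F →L[ℝ] F)} (hz : z₀ ∈ S)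
    (hSn : S ∈ 𝓝[twistorSet U g] z₀) (hd : Module.finrank ℝ N =
      Module.finrank ℝ F + Module.finrank ℝ (verticalSpace (g z₀.1) z₀.2)) :
    ∃ (Ω : Set N) (φ : N → F × (F →L[ℝ] F)) (ρ : F × (F →L[ℝ] F) → N), ρ z₀ ∈ Ω ∧
      IsLocalParam S Ω φ ∧ φ (ρ z₀) = z₀ ∧
      ContDiffAt ℝ ∞ ρ z₀ ∧ ∀ᶠ z in 𝓝 z₀, z ∈ S → φ (ρ z) = z := by
  obtain ⟨φ, ρ, h0, h1, h2⟩ := hg.exists_vertical_param (hS hz)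
  let L : N ≃L[ℝ] F × verticalSpace (g z₀.1) z₀.2 :=
    ContinuousLinearEquiv.ofFinrankEq (by rw [hd, Module.finrank_prod])
  have hρ0 : ρ z₀ = (z₀.1, 0) := by have := h1.self_of_nhds.2.2; rwa [h0] at this
  have hL : ContinuousAt L (L.symm (ρ z₀)) := L.continuous.continuousAt
  have hLe : L (L.symm (ρ z₀)) = (z₀.1, 0) := by rw [L.apply_symm_apply, hρ0]
  rw [ContinuousAt, hLe] at hL
  have hφS : ∀ᶠ q in 𝓝 (z₀.1, 0), φ q ∈ S := by
    have hc := h1.self_of_nhds.1.continuousAt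
    rw [ContinuousAt, h0] at hc
    exact (tendsto_nhdsWithin_iff.2 ⟨hc, h1.mono fun q hq => hq.2.1⟩).eventually hSn
  have e0 : φ (L (L.symm (ρ z₀))) = z₀ := by rw [hLe, h0]
  obtain ⟨Ω, hΩ, hp⟩ := Twistor.exists_isLocalParam (S := S) (φ := fun q => φ (L q))
    (ρ := fun z => L.symm (ρ z)) (q₀ := L.symm (ρ z₀)) (by
      filter_upwards [hL.eventually h1, hL.eventually hφS] with q hq hq'
      exact ⟨ContDiffAt.comp q hq.1 L.contDiff.contDiffAt, hq', by
        rw [hq.2.2, L.symm_apply_apply]⟩) (by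
      rw [e0]
      filter_upwards [h2] with z hz
      exact ⟨L.symm.contDiff.contDiffAt.comp z hz.1, fun hzS => by
        rw [L.apply_symm_apply, hz.2 (hS hzS)]⟩)
  refine ⟨Ω, _, _, hΩ, hp, e0, L.symm.contDiff.contDiffAt.comp z₀ h2.self_of_nhds.1, ?_⟩
  filter_upwards [h2] with z hz hzS
  rw [Function.comp_apply, L.apply_symm_apply, hz.2 (hS hzS)]

end TwistorParam

/-! ### Isometries preserve the curvature -/

section Isometry

variable {F : Type*} [NormedAddCommGroup F] [NormedSpace ℝ F] [FiniteDimensional ℝ F]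
variable {U U' : Set F} {g g' : F → F →L[ℝ] F →L[ℝ] ℝ} {τ : F → F} {x : F}

/-- `τ` is a smooth map, isometric for the metrics `g` and `g'`, near `x ∈ U`. -/
structure IsIsometryAt (U U' : Set F) (g g' : F → F →L[ℝ] F →L[ℝ] ℝ) (τ : F → F) (x : F) :
    Prop where
  metric : IsMetricOn U g
  metric' : IsMetricOn U' g'
  mem : x ∈ U
  mem' : τ x ∈ U'
  smooth : ContDiffAt ℝ ∞ τ x
  isometry : ∀ᶠ y in 𝓝 x, ∀ v w, g y v w = g' (τ y) (fderiv ℝ τ y v) (fderiv ℝ τ y w)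

namespace IsIsometryAt

theorem apply_eq (h : IsIsometryAt U U' g g' τ x) (v w : F) :
    g' (τ x) (fderiv ℝ τ x v) (fderiv ℝ τ x w) = g x v w :=
  (h.isometry.self_of_nhds v w).symm

theorem injective (h : IsIsometryAt U U' g g' τ x) : Function.Injective (fderiv ℝ τ x) := by
  rw [injective_iff_map_eq_zero]
  intro v hv
  by_contra h0
  have := h.metric.pos x h.mem v h0
  rw [← h.apply_eq, hv] at this
  simp at this

theorem surjective (h : IsIsometryAt U U' g g' τ x) : Function.Surjective (fderiv ℝ τ x) :=
  (LinearMap.injective_iff_surjective (f := (fderiv ℝ τ x : F →ₗ[ℝ] F))).1 h.injective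

/-- The connection pulled back by an isometry is metric and torsion-free, so it is the Levi-Civita
connection by uniqueness. -/
theorem fderiv_christoffel (h : IsIsometryAt U U' g g' τ x) (X Y : F) :
    fderiv ℝ τ x (christoffel g x X Y) = covVec g' τ (fun y => fderiv ℝ τ y Y) x X := by
  choose C hC using fun X Y => h.surjective (covVec g' τ (fun y => fderiv ℝ τ y Y) x X)
  have hd := smoothAt_diff (smoothAt_fderiv h.smooth)
  rw [h.metric.christoffel_unique h.mem C (fun X Y => h.injective ?_) (fun X Y Z => ?_), hC]
  · rw [hC, hC, covVec_fderiv_symm h.metric' h.smooth h.mem']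
  · have hgd := smoothAt_diff (h.metric.smoothAt h.mem)
    have e : (fun y => g y Y Z) =ᶠ[𝓝 x]
        fun y => g' (τ y) (fderiv ℝ τ y Y) (fderiv ℝ τ y Z) := by
      filter_upwards [h.isometry] with y hy using hy Y Z
    have e1 : fderiv ℝ (fun y => g y Y Z) x X = fderiv ℝ g x X Y Z := by
      rw [fderiv_clm_apply_const (c := fun y => g y Y) (hgd.clm_apply (differentiableAt_const Y)),
        fderiv_clm_apply_const hgd]
    rw [← e1, fderiv_congr_apply e, fderiv_metric_along h.metric' (smoothAt_diff h.smooth) h.mem'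
      (hd.clm_apply (differentiableAt_const Y)) (hd.clm_apply (differentiableAt_const Z)),
      ← hC, ← hC, h.apply_eq, h.apply_eq]

theorem fderiv_covVec (h : IsIsometryAt U U' g g' τ x) {Z : F → F} (hZ : DifferentiableAt ℝ Z x)
    (X : F) : fderiv ℝ τ x (covVec g (fun y => y) Z x X) =
      covVec g' τ (fun y => fderiv ℝ τ y (Z y)) x X := by
  have hd := smoothAt_diff (smoothAt_fderiv h.smooth)
  rw [covVec, connForm_id, map_add, h.fderiv_christoffel, covVec, covVec,
    fderiv_clm_apply_apply hd hZ, fderiv_clm_apply_const hd]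
  abel

theorem eventually (h : IsIsometryAt U U' g g' τ x) (hs : ∀ᶠ y in 𝓝 x, ContDiffAt ℝ ∞ τ y) :
    ∀ᶠ y in 𝓝 x, IsIsometryAt U U' g g' τ y := by
  filter_upwards [hs, h.metric.isOpen.mem_nhds h.mem,
    h.smooth.continuousAt.eventually (h.metric'.isOpen.mem_nhds h.mem'),
    eventually_eventually_nhds.2 h.isometry] with y h1 h2 h3 h4
  exact ⟨h.metric, h.metric', h2, h3, h1, h4⟩

/-- Naturality of covariant derivatives transports the Ricci identity for a constant field. Both
sides of the transported identity are curvatures. -/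
theorem fderiv_curvEnd (h : IsIsometryAt U U' g g' τ x) (hs : ∀ᶠ y in 𝓝 x, ContDiffAt ℝ ∞ τ y)
    (X Y Z : F) : fderiv ℝ τ x (curvEnd g x X Y Z) =
      curvEnd g' (τ x) (fderiv ℝ τ x X) (fderiv ℝ τ x Y) (fderiv ℝ τ x Z) := by
  have hid : ∀ y : F, ContDiffAt ℝ ∞ (fun y : F => y) y := fun y => contDiffAt_id
  have h1 := covVec_comm h.metric (hid x) h.mem (Y := fun _ => Z) contDiffAt_const X Y
  have h2 := covVec_comm h.metric' h.smooth h.mem' (Y := fun y => fderiv ℝ τ y Z)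
    ((smoothAt_fderiv h.smooth).clm_apply contDiffAt_const) X Y
  have key : ∀ a b, fderiv ℝ τ x
      (covVec g (fun y => y) (fun y => covVec g (fun y => y) (fun _ => Z) y b) x a) =
      covVec g' τ (fun y => covVec g' τ (fun y => fderiv ℝ τ y Z) y b) x a := fun a b => by
    rw [h.fderiv_covVec (smoothAt_diff (smoothAt_covVec h.metric (hid x) h.mem contDiffAt_const b))]
    refine covVec_congr ?_ a
    filter_upwards [h.eventually hs] with y hy
    exact hy.fderiv_covVec (differentiableAt_const Z) b
  rw [← key, ← key, ← map_sub, h1] at h2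
  simpa using h2

end IsIsometryAt

end Isometry

/-! ### Invariance of scalar curvature and isotropy in dimension four. -/

section IsometryFour

variable {U U' : Set (Coord 4)} {g g' : Coord 4 → Coord 4 →L[ℝ] Coord 4 →L[ℝ] ℝ}
variable {x x' : Coord 4} {e e' : Module.Basis (Fin 4) ℝ (Coord 4)}

/-- Isotropy of the curvature depends only on the components of the curvature tensor. -/
theorem CurvIsotropic.of_curvComp_eq {c : ℝ} (h : CurvIsotropic g x e c) (hg : IsMetricOn U g)
    (hx : x ∈ U) (he : ∀ m n, g x (e m) (e n) = if m = n then 1 else 0)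
    (hg' : IsMetricOn U' g') (hx' : x' ∈ U')
    (he' : ∀ m n, g' x' (e' m) (e' n) = if m = n then 1 else 0)
    (hc : curvComp g x e = curvComp g' x' e') : CurvIsotropic g' x' e' c := by
  have as := hg.symm x hx
  have a1 : curvForm g x (sOne e) (sOne e) = _ :=
    endForm_sOne as he (hg.curvOp_skew hx _)
  have a2 : curvForm g x (sTwo e) (sTwo e) = _ :=
    endForm_sTwo as he (hg.curvOp_skew hx _)
  have a3 : curvForm g x (sThree e) (sThree e) = _ :=
    endForm_sThree as he (hg.curvOp_skew hx _)
  have a4 : curvForm g x (sOne e) (sTwo e) = _ :=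
    endForm_sTwo as he (hg.curvOp_skew hx _)
  have a5 : curvForm g x (sOne e) (sThree e) = _ :=
    endForm_sThree as he (hg.curvOp_skew hx _)
  have a6 : curvForm g x (sTwo e) (sThree e) = _ :=
    endForm_sThree as he (hg.curvOp_skew hx _)
  have bs := hg'.symm x' hx'
  have b1 : curvForm g' x' (sOne e') (sOne e') = _ :=
    endForm_sOne bs he' (hg'.curvOp_skew hx' _)
  have b2 : curvForm g' x' (sTwo e') (sTwo e') = _ :=
    endForm_sTwo bs he' (hg'.curvOp_skew hx' _)
  have b3 : curvForm g' x' (sThree e') (sThree e') = _ :=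
    endForm_sThree bs he' (hg'.curvOp_skew hx' _)
  have b4 : curvForm g' x' (sOne e') (sTwo e') = _ :=
    endForm_sTwo bs he' (hg'.curvOp_skew hx' _)
  have b5 : curvForm g' x' (sOne e') (sThree e') = _ :=
    endForm_sThree bs he' (hg'.curvOp_skew hx' _)
  have b6 : curvForm g' x' (sTwo e') (sThree e') = _ :=
    endForm_sThree bs he' (hg'.curvOp_skew hx' _)
  simp only [curvOp_sOne_inner hg hx he, curvOp_sTwo_inner hg hx he,
    curvOp_sThree_inner hg hx he, hc] at a1 a2 a3 a4 a5 a6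
  simp only [curvOp_sOne_inner hg' hx' he', curvOp_sTwo_inner hg' hx' he',
    curvOp_sThree_inner hg' hx' he'] at b1 b2 b3 b4 b5 b6
  exact ⟨(b1.trans a1.symm).trans h.one, (b2.trans a2.symm).trans h.two,
    (b3.trans a3.symm).trans h.three, (b4.trans a4.symm).trans h.one_two,
    (b5.trans a5.symm).trans h.one_three, (b6.trans a6.symm).trans h.two_three⟩

theorem IsIsometryAt.curvComp_eq {τ : Coord 4 → Coord 4} (h : IsIsometryAt U U' g g' τ x)
    (hs : ∀ᶠ y in 𝓝 x, ContDiffAt ℝ ∞ τ y) (he : ∀ i, e' i = fderiv ℝ τ x (e i)) :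
    curvComp g x e = curvComp g' (τ x) e' := by
  ext m n p q
  rw [curvComp, curvComp, he, he, he, he, ← h.fderiv_curvEnd hs, h.apply_eq]

theorem IsIsometryAt.scalar_eq {τ : Coord 4 → Coord 4} (h : IsIsometryAt U U' g g' τ x)
    (hs : ∀ᶠ y in 𝓝 x, ContDiffAt ℝ ∞ τ y) : scalar g x = scalar g' (τ x) := by
  have h4 : Module.finrank ℝ (Coord 4) = 4 := by simp
  obtain ⟨e0, he0⟩ := exists_orthonormal_basis (h.metric.symm x h.mem) (h.metric.pos x h.mem)
  let e := e0.reindex (finCongr h4)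
  have he : ∀ m n, g x (e m) (e n) = if m = n then 1 else 0 := fun m n => by
    simp [e, he0]
  let L := LinearEquiv.ofBijective (fderiv ℝ τ x : Coord 4 →ₗ[ℝ] Coord 4) ⟨h.injective, h.surjective⟩
  have he' : ∀ m n, g' (τ x) (e.map L m) (e.map L n) = if m = n then 1 else 0 := fun m n => by
    rw [← he, ← h.apply_eq]; simp only [Module.Basis.map_apply]; rfl
  rw [scalar_eq_scalarComp h.metric h.mem he, scalar_eq_scalarComp h.metric' h.mem' he',
    h.curvComp_eq hs (e := e) (e' := e.map L) fun i => by rw [Module.Basis.map_apply]; rfl]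

theorem IsMetricOn.differentiableAt_scalar (hg : IsMetricOn U g) (hx : x ∈ U) :
    DifferentiableAt ℝ (scalar g) x := by
  have h1 := smoothAt_diff (hg.smoothAt_curvEnd hx)
  have h2 := smoothAt_diff (hg.smoothAt_inverse hx)
  unfold scalar metricTrace ricci
  simp only [curvature_eq_curvEnd]
  refine DifferentiableAt.fun_sum fun i _ => DifferentiableAt.fun_sum fun j _ => ?_
  exact (EuclideanSpace.proj j : Coord 4 →L[ℝ] ℝ).differentiableAt.comp x
    (((h1.clm_apply (differentiableAt_const _)).clm_apply (differentiableAt_const _)).clm_apply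
      (h2.clm_apply (differentiableAt_const _)))

end IsometryFour

/-! ### Complex structures and orientations in dimension four -/

section Orient

variable {F : Type*} [NormedAddCommGroup F] [NormedSpace ℝ F] [FiniteDimensional ℝ F]
variable {b : F →L[ℝ] F →L[ℝ] ℝ} {I : F →L[ℝ] F} {o : Orientation ℝ F (Fin 4)}

/-- A complex structure determines an orientation: two bases of the form `(v, Iv, w, Iw)` have the
same orientation. -/
theorem orientation_eq_of_adapted (hI : ∀ v, I (I v) = -v) {e f : Module.Basis (Fin 4) ℝ F}
    (he1 : e 1 = I (e 0)) (he3 : e 3 = I (e 2)) (hf1 : f 1 = I (f 0)) (hf3 : f 3 = I (f 2)) :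
    e.orientation = f.orientation := by
  rw [Module.Basis.orientation_eq_iff_det_pos]
  have hne : e.det f ≠ 0 := (e.isUnit_det f).ne_zero
  have hv : ∀ v, I v = (-e.repr v 1) • e 0 + e.repr v 0 • e 1 + (-e.repr v 3) • e 2
      + e.repr v 2 • e 3 := fun v => by
    nth_rewrite 1 [← e.sum_repr v]
    simp only [Fin.sum_univ_four, map_add, map_smul, he1, he3, hI]
    module
  have r : ∀ v, e.repr (I v) 0 = -e.repr v 1 ∧ e.repr (I v) 1 = e.repr v 0 ∧
      e.repr (I v) 2 = -e.repr v 3 ∧ e.repr (I v) 3 = e.repr v 2 := fun v => by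
    rw [hv]; simp
  obtain ⟨a1, a2, a3, a4⟩ := r (f 0)
  obtain ⟨c1, c2, c3, c4⟩ := r (f 2)
  -- The determinant of a complex linear map over the reals is the squared modulus of its complex
  -- determinant; the two squares are its real and imaginary parts.
  have key : e.det f =
      (e.repr (f 0) 0 * e.repr (f 2) 2 - e.repr (f 0) 1 * e.repr (f 2) 3
        - e.repr (f 0) 2 * e.repr (f 2) 0 + e.repr (f 0) 3 * e.repr (f 2) 1) ^ 2 +
      (e.repr (f 0) 0 * e.repr (f 2) 3 + e.repr (f 0) 1 * e.repr (f 2) 2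
        - e.repr (f 0) 2 * e.repr (f 2) 1 - e.repr (f 0) 3 * e.repr (f 2) 0) ^ 2 := by
    rw [Module.Basis.det_apply, Matrix.det_succ_row_zero]
    simp only [Fin.sum_univ_four, Matrix.det_fin_three, Matrix.submatrix_apply,
      Module.Basis.toMatrix_apply, Fin.succAbove, Fin.succ]
    simp [hf1, hf3, a1, a2, a3, a4, c1, c2, c3, c4]
    ring
  exact lt_of_le_of_ne (key ▸ by positivity) hne.symm

/-- The map `sOne e` sends `e 2` to `-e 3`. So a basis of the form `(v, Iv, w, Iw)` becomes a frame
`e` with `sOne e = I` when its last vector changes sign, and this reverses the orientation. -/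
theorem exists_frame_iff (hs : ∀ v w, b v w = b w v) (hp : ∀ v, v ≠ 0 → 0 < b v v)
    (h4 : Module.finrank ℝ F = 4) : (∃ e, IsFrame b o e ∧ sOne e = I) ↔
      (∀ v, I (I v) = -v) ∧ (∀ v w, b (I v) (I w) = b v w) ∧
      ∀ e : Module.Basis (Fin 4) ℝ F, e 1 = I (e 0) → e 3 = I (e 2) → e.orientation = -o := by
  constructor
  · rintro ⟨e, he, rfl⟩
    have hT := quatTriple_s hs he.orthonormal
    have hI : ∀ v, sOne e (sOne e v) = -v := fun v => congrArg (fun A => A v) hT.rel.ii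
    refine ⟨hI, fun v w => ?_, fun f hf1 hf3 => ?_⟩
    · rw [hT.skew_i, hI, map_neg, neg_neg]
    · rw [← he.orientation, ← e.orientation_neg_single 3]
      refine orientation_eq_of_adapted hI hf1 hf3 ?_ ?_
      · simp [Module.Basis.unitsSMul_apply, Function.update, sOne, quatOf_apply]
      · simp [Module.Basis.unitsSMul_apply, Function.update, sOne, quatOf_apply]
  · rintro ⟨hI, hIo, ho⟩
    have hsk := skew_of_orthogonal hI hIo
    obtain ⟨v, hv⟩ := exists_isUnitaryFamily hs hp hsk 2 h4.ge
    obtain ⟨e0, -⟩ := exists_orthonormal_basis hs hp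
    have hw : ∀ m n, b (![v 0, I (v 0), v 1, I (v 1)] m) (![v 0, I (v 0), v 1, I (v 1)] n) =
        if m = n then 1 else 0 := by
      intro m n
      fin_cases m <;> fin_cases n <;>
        simp [hv.orthonormal, hv.isotropic, hv.apply_acs hsk hI, hv.apply_acs_left hsk, -map_neg]
    obtain ⟨e, he⟩ := exists_basis_of_orthonormal (e0.reindex (finCongr h4)) hw
    have heo := ho e (by simp [he]) (by simp [he])
    have hko := e.orientation_neg_single 3
    have hk0 : e.unitsSMul (Function.update 1 3 (-1)) 0 = v 0 := by
      simp [Module.Basis.unitsSMul_apply, Function.update, he]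
    have hk1 : e.unitsSMul (Function.update 1 3 (-1)) 1 = I (v 0) := by
      simp [Module.Basis.unitsSMul_apply, Function.update, he]
    have hk2 : e.unitsSMul (Function.update 1 3 (-1)) 2 = v 1 := by
      simp [Module.Basis.unitsSMul_apply, Function.update, he]
    have hk3 : e.unitsSMul (Function.update 1 3 (-1)) 3 = -I (v 1) := by
      simp [Module.Basis.unitsSMul_apply, Function.update, he]
    generalize e.unitsSMul (Function.update 1 3 (-1)) = k at *
    refine ⟨k, ⟨fun m n => ?_, by rw [hko, heo, neg_neg]⟩, ?_⟩
    · fin_cases m <;> fin_cases n <;>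
        simp [hk0, hk1, hk2, hk3, hv.orthonormal, hv.isotropic, hv.apply_acs hsk hI,
          hv.apply_acs_left hsk]
    · refine end_ext_four k ?_ ?_ ?_ ?_ <;> rw [sOne, quatOf_apply] <;>
        simp [hk0, hk1, hk2, hk3, hI]

theorem exists_isFrame (hs : ∀ v w, b v w = b w v) (hp : ∀ v, v ≠ 0 → 0 < b v v)
    (h4 : Module.finrank ℝ F = 4) (o : Orientation ℝ F (Fin 4)) : ∃ e, IsFrame b o e := by
  obtain ⟨e0, he0⟩ := exists_orthonormal_basis hs hp
  let e := e0.reindex (finCongr h4)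
  have he : ∀ m n, b (e m) (e n) = if m = n then 1 else 0 := fun m n => by simp [e, he0]
  rcases e.orientation_eq_or_eq_neg o with h | h
  · exact ⟨e, he, h.symm⟩
  · refine ⟨e.unitsSMul (Function.update 1 0 (-1)), fun m n => ?_, by
      rw [e.orientation_neg_single, h]⟩
    rw [Module.Basis.unitsSMul_apply, Module.Basis.unitsSMul_apply]
    fin_cases m <;> fin_cases n <;> simp [Function.update, Units.smul_def, he]

variable {U : Set F} {g : F → F →L[ℝ] F →L[ℝ] ℝ}

theorem frameTwistorSet_eq (hg : IsMetricOn U g) (h4 : Module.finrank ℝ F = 4)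
    (o : F → Orientation ℝ F (Fin 4)) : frameTwistorSet U g o = {z | z ∈ twistorSet U g ∧
      ∀ e : Module.Basis (Fin 4) ℝ F, e 1 = z.2 (e 0) → e 3 = z.2 (e 2) →
        e.orientation = -o z.1} := by
  ext z
  constructor
  · rintro ⟨hz, h⟩
    obtain ⟨h1, h2, h3⟩ := (exists_frame_iff (hg.symm _ hz) (hg.pos _ hz) h4).1 h
    exact ⟨⟨hz, h1, h2⟩, h3⟩
  · rintro ⟨⟨hz, h1, h2⟩, h3⟩
    exact ⟨hz, (exists_frame_iff (hg.symm _ hz) (hg.pos _ hz) h4).2 ⟨h1, h2, h3⟩⟩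

theorem frameTwistorSet_subset (hg : IsMetricOn U g) (h4 : Module.finrank ℝ F = 4)
    (o : F → Orientation ℝ F (Fin 4)) : frameTwistorSet U g o ⊆ twistorSet U g := by
  rw [frameTwistorSet_eq hg h4]; exact fun z hz => hz.1

/-- The complex structures inducing a given locally constant orientation form an open subset of the
twistor space. -/
theorem frameTwistorSet_mem_nhdsWithin (hg : IsMetricOn U g) (h4 : Module.finrank ℝ F = 4)
    {o : F → Orientation ℝ F (Fin 4)} {z₀ : F × (F →L[ℝ] F)} (hz : z₀ ∈ frameTwistorSet U g o)
    (ho : ∀ᶠ x in 𝓝 z₀.1, o x = o z₀.1) :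
    frameTwistorSet U g o ∈ 𝓝[twistorSet U g] z₀ := by
  obtain ⟨hx, e, he, heI⟩ := hz
  -- A basis adapted to `I` that varies continuously with `I`: the sign of its determinant, and with
  -- it the induced orientation, is locally constant.
  let f : (F →L[ℝ] F) → Fin 4 → F := fun I => ![e 0, I (e 0), e 2, I (e 2)]
  let e' := e.unitsSMul (Function.update 1 3 (-1))
  have hf0 : f z₀.2 = e' := by
    funext i
    rw [← heI]
    fin_cases i <;>
      simp [f, e', Module.Basis.unitsSMul_apply, Function.update, sOne, quatOf_apply]
  have hcont : Continuous fun I => e'.det (f I) := by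
    simp only [Module.Basis.det_apply]
    refine Continuous.matrix_det (continuous_matrix fun i j => ?_)
    simp only [Module.Basis.toMatrix_apply]
    have hc : Continuous (e'.coord i) := LinearMap.continuous_of_finiteDimensional _
    refine hc.comp ?_
    fin_cases j
    · exact continuous_const
    · exact (ContinuousLinearMap.apply ℝ F (e 0)).continuous
    · exact continuous_const
    · exact (ContinuousLinearMap.apply ℝ F (e 2)).continuous
  have hpos : ∀ᶠ I in 𝓝 z₀.2, 0 < e'.det (f I) := by
    refine hcont.continuousAt.eventually (lt_mem_nhds ?_)
    dsimp only
    rw [hf0, Module.Basis.det_self]; exact one_pos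
  have h1 := (continuous_snd (X := F) (Y := F →L[ℝ] F)).continuousAt (x := z₀).eventually hpos
  have h2 := (continuous_fst (X := F) (Y := F →L[ℝ] F)).continuousAt (x := z₀).eventually ho
  filter_upwards [nhdsWithin_le_nhds h1, nhdsWithin_le_nhds h2, self_mem_nhdsWithin] with z h1 h2 hz
  rw [frameTwistorSet_eq hg h4]
  refine ⟨hz, fun k hk1 hk3 => ?_⟩
  obtain ⟨hli, hsp⟩ := (Module.Basis.is_basis_iff_det e').2 (IsUnit.mk0 _ h1.ne')
  let F' := Module.Basis.mk hli hsp.ge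
  have hF' : ∀ i, F' i = f z.2 i := fun i => Module.Basis.mk_apply _ _ _
  have hF'' : (F' : Fin 4 → F) = f z.2 := funext hF'
  have e1 : e'.orientation = F'.orientation := by
    rw [Module.Basis.orientation_eq_iff_det_pos, hF'']; exact h1
  rw [orientation_eq_of_adapted hz.2.1 hk1 hk3 (f := F') (by rw [hF', hF']; rfl)
    (by rw [hF', hF']; rfl), ← e1, Module.Basis.orientation_neg_single, he.orientation, h2]

end Orient

/-! ### Riemannian four-manifolds in charts -/

section Charts

variable {M : Type*} [TopologicalSpace M] [ChartedSpace (Coord 4) M] [IsManifold (𝓡 4) ∞ M]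
variable {p p' : M} {x : Coord 4} {y : M}

theorem isManifold_one (M : Type*) [TopologicalSpace M] [ChartedSpace (Coord 4) M]
    [IsManifold (𝓡 4) ∞ M] : IsManifold (𝓡 4) 1 M := IsManifold.of_le (n := ∞) (by simp)

/-- The differential of the inverse of the chart at `p`. -/
def chartSymmDeriv (p : M) (x : Coord 4) :
    Coord 4 →L[ℝ] TangentSpace (𝓡 4) ((extChartAt (𝓡 4) p).symm x) :=
  mfderiv 𝓘(ℝ, Coord 4) (𝓡 4) (extChartAt (𝓡 4) p).symm x

/-- The differential of the chart at `p`. -/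
def chartDeriv (p : M) (y : M) : TangentSpace (𝓡 4) y →L[ℝ] Coord 4 :=
  mfderiv (𝓡 4) 𝓘(ℝ, Coord 4) (extChartAt (𝓡 4) p) y

theorem coordMetric_apply (g : RiemMetric M) (p : M) (x v w : Coord 4) :
    coordMetric g p x v w =
      g.inner ((extChartAt (𝓡 4) p).symm x) (chartSymmDeriv p x v) (chartSymmDeriv p x w) := rfl

theorem chartDeriv_chartSymmDeriv (hx : x ∈ (extChartAt (𝓡 4) p).target) (v : Coord 4) :
    chartDeriv p ((extChartAt (𝓡 4) p).symm x) (chartSymmDeriv p x v) = v := by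
  have := isManifold_one M
  have h := mfderiv_extChartAt_comp_mfderivWithin_extChartAt_symm hx
  rw [ModelWithCorners.range_eq_univ, mfderivWithin_univ] at h
  exact congrArg (fun L => L v) h

theorem chartSymmDeriv_chartDeriv (hx : x ∈ (extChartAt (𝓡 4) p).target)
    (v : TangentSpace (𝓡 4) ((extChartAt (𝓡 4) p).symm x)) :
    chartSymmDeriv p x (chartDeriv p ((extChartAt (𝓡 4) p).symm x) v) = v := by
  have := isManifold_one M
  have h := mfderivWithin_extChartAt_symm_comp_mfderiv_extChartAt hx
  rw [ModelWithCorners.range_eq_univ, mfderivWithin_univ] at h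
  exact congrArg (fun L => L v) h

/-- The differential of the inverse of the chart at `p`, as an isomorphism. -/
def chartSymmEquiv (hx : x ∈ (extChartAt (𝓡 4) p).target) :
    Coord 4 ≃ₗ[ℝ] TangentSpace (𝓡 4) ((extChartAt (𝓡 4) p).symm x) :=
  LinearEquiv.ofLinearMap (chartSymmDeriv p x).toLinearMap
    (chartDeriv p ((extChartAt (𝓡 4) p).symm x)).toLinearMap
    (LinearMap.ext (chartSymmDeriv_chartDeriv hx)) (LinearMap.ext (chartDeriv_chartSymmDeriv hx))

theorem chartSymmEquiv_apply (hx : x ∈ (extChartAt (𝓡 4) p).target) (v : Coord 4) :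
    chartSymmEquiv hx v = chartSymmDeriv p x v := rfl

theorem contMDiffAt_chartSymmDeriv (hx : x ∈ (extChartAt (𝓡 4) p).target) (v : Coord 4) :
    ContMDiffAt 𝓘(ℝ, Coord 4) ((𝓡 4).prod 𝓘(ℝ, Coord 4)) ∞
      (fun x => (⟨(extChartAt (𝓡 4) p).symm x, chartSymmDeriv p x v⟩ : TangentBundle (𝓡 4) M)) x := by
  have := isManifold_one M
  have ho : IsOpen (extChartAt (𝓡 4) p).target := isOpen_extChartAt_target p
  have h1 := (contMDiffOn_extChartAt_symm (I := 𝓡 4) (n := ∞) p).contMDiffOn_tangentMapWithin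
    (m := ∞) (by simp) ho.uniqueMDiffOn
  have h2 := (contMDiff_vectorSpace_iff_contDiff (𝕜 := ℝ) (E := Coord 4) (n := ∞)
    (V := fun _ => v)).2 contDiff_const
  have h3 := (h1.comp h2.contMDiffOn (s := (extChartAt (𝓡 4) p).target) fun x hx => hx).contMDiffAt
    (ho.mem_nhds hx)
  refine h3.congr_of_eventuallyEq ?_
  filter_upwards [ho.mem_nhds hx] with y hy
  simp only [Function.comp_apply, tangentMapWithin, mfderivWithin_of_isOpen ho hy]
  rfl

theorem isMetricOn_coordMetric (g : RiemMetric M) (p : M) :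
    IsMetricOn (extChartAt (𝓡 4) p).target (coordMetric g p) where
  isOpen := isOpen_extChartAt_target p
  smooth := by
    refine contDiffOn_clm_apply.2 fun v => contDiffOn_clm_apply.2 fun w x hx => ?_
    have hv := contMDiffAt_chartSymmDeriv hx v
    have hw := contMDiffAt_chartSymmDeriv hx w
    have hb : ContMDiffAt 𝓘(ℝ, Coord 4) (𝓡 4) ∞ (extChartAt (𝓡 4) p).symm x :=
      (contMDiffOn_extChartAt_symm p).contMDiffAt ((isOpen_extChartAt_target p).mem_nhds hx)
    have : ContMDiffAt 𝓘(ℝ, Coord 4) ((𝓡 4).prod 𝓘(ℝ)) ∞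
        (fun x => Bundle.TotalSpace.mk' ℝ (E := Bundle.Trivial M ℝ) ((extChartAt (𝓡 4) p).symm x)
          (g.inner ((extChartAt (𝓡 4) p).symm x) (chartSymmDeriv p x v)
            (chartSymmDeriv p x w))) x :=
      ContMDiffAt.clm_bundle_apply₂ (F₁ := Coord 4) (F₂ := Coord 4)
        (ContMDiffAt.comp x g.contMDiff.contMDiffAt hb) hv hw
    rw [Bundle.contMDiffAt_totalSpace] at this
    exact this.2.contDiffAt.contDiffWithinAt
  symm x hx v w := g.symm _ _ _
  pos x hx v hv := g.pos _ _ fun h => hv <| by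
    have h' : chartSymmDeriv p x v = 0 := h
    rw [← chartDeriv_chartSymmDeriv hx v, h', map_zero]

theorem coordMetric_chartDeriv (g : RiemMetric M) (hy : y ∈ (extChartAt (𝓡 4) p).source)
    (a b : TangentSpace (𝓡 4) y) : coordMetric g p (extChartAt (𝓡 4) p y) (chartDeriv p y a)
      (chartDeriv p y b) = g.inner y a b := by
  -- The type of `a` and `b` depends on `y`, so the equality of points is generalized and
  -- substituted, not rewritten.
  suffices h : ∀ x ∈ (extChartAt (𝓡 4) p).target, ∀ y, (extChartAt (𝓡 4) p).symm x = y →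
      ∀ a b : TangentSpace (𝓡 4) y,
      coordMetric g p x (chartDeriv p y a) (chartDeriv p y b) = g.inner y a b from
    h _ ((extChartAt (𝓡 4) p).map_source hy) y ((extChartAt (𝓡 4) p).left_inv hy) a b
  rintro x hx _ rfl a b
  rw [coordMetric_apply, chartSymmDeriv_chartDeriv hx, chartSymmDeriv_chartDeriv hx]

/-- The change of coordinates from the chart at `p` to the chart at `p'`. -/
def chartTransition (p p' : M) (x : Coord 4) : Coord 4 :=
  extChartAt (𝓡 4) p' ((extChartAt (𝓡 4) p).symm x)

theorem contDiffAt_chartTransition (hx : x ∈ (extChartAt (𝓡 4) p).target)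
    (hx' : (extChartAt (𝓡 4) p).symm x ∈ (extChartAt (𝓡 4) p').source) :
    ContDiffAt ℝ ∞ (chartTransition p p') x := by
  have h1 : ContMDiffAt 𝓘(ℝ, Coord 4) (𝓡 4) ∞ (extChartAt (𝓡 4) p).symm x :=
    (contMDiffOn_extChartAt_symm p).contMDiffAt ((isOpen_extChartAt_target p).mem_nhds hx)
  have h2 : ContMDiffAt (𝓡 4) 𝓘(ℝ, Coord 4) ∞ (extChartAt (𝓡 4) p')
      ((extChartAt (𝓡 4) p).symm x) := contMDiffAt_extChartAt' (by rwa [← extChartAt_source (𝓡 4)])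
  exact (h2.comp x h1).contDiffAt

theorem eventually_mem_source (hx : x ∈ (extChartAt (𝓡 4) p).target)
    (hx' : (extChartAt (𝓡 4) p).symm x ∈ (extChartAt (𝓡 4) p').source) :
    ∀ᶠ y in 𝓝 x, y ∈ (extChartAt (𝓡 4) p).target ∧
      (extChartAt (𝓡 4) p).symm y ∈ (extChartAt (𝓡 4) p').source := by
  have ho : IsOpen (extChartAt (𝓡 4) p).target := isOpen_extChartAt_target p
  have hc := (continuousOn_extChartAt_symm (I := 𝓡 4) p).continuousAt (ho.mem_nhds hx)
  exact (show ∀ᶠ y in 𝓝 x, y ∈ (extChartAt (𝓡 4) p).target from ho.mem_nhds hx).and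
    (hc.eventually ((isOpen_extChartAt_source p').mem_nhds hx'))

theorem fderiv_chartTransition (hx : x ∈ (extChartAt (𝓡 4) p).target)
    (hx' : (extChartAt (𝓡 4) p).symm x ∈ (extChartAt (𝓡 4) p').source) (v : Coord 4) :
    fderiv ℝ (chartTransition p p') x v =
      chartDeriv p' ((extChartAt (𝓡 4) p).symm x) (chartSymmDeriv p x v) := by
  have := isManifold_one M
  have h1 : MDifferentiableAt 𝓘(ℝ, Coord 4) (𝓡 4) (extChartAt (𝓡 4) p).symm x :=
    ((contMDiffOn_extChartAt_symm (n := ∞) p).contMDiffAt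
      ((isOpen_extChartAt_target p).mem_nhds hx)).mdifferentiableAt (by simp)
  have h2 : MDifferentiableAt (𝓡 4) 𝓘(ℝ, Coord 4) (extChartAt (𝓡 4) p')
      ((extChartAt (𝓡 4) p).symm x) :=
    mdifferentiableAt_extChartAt (by rwa [← extChartAt_source (𝓡 4)])
  have h3 := mfderiv_comp x h2 h1
  rw [← mfderiv_eq_fderiv]
  exact congrArg (fun L => L v) h3

theorem isIsometryAt_chartTransition (g : RiemMetric M) (hx : x ∈ (extChartAt (𝓡 4) p).target)
    (hx' : (extChartAt (𝓡 4) p).symm x ∈ (extChartAt (𝓡 4) p').source) :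
    IsIsometryAt (extChartAt (𝓡 4) p).target (extChartAt (𝓡 4) p').target (coordMetric g p)
      (coordMetric g p') (chartTransition p p') x where
  metric := isMetricOn_coordMetric g p
  metric' := isMetricOn_coordMetric g p'
  mem := hx
  mem' := (extChartAt (𝓡 4) p').map_source hx'
  smooth := contDiffAt_chartTransition hx hx'
  isometry := by
    filter_upwards [eventually_mem_source hx hx'] with y hy v w
    rw [fderiv_chartTransition hy.1 hy.2, fderiv_chartTransition hy.1 hy.2, chartTransition,
      coordMetric_chartDeriv g hy.2, coordMetric_apply]

theorem eventually_contDiffAt_chartTransition (hx : x ∈ (extChartAt (𝓡 4) p).target)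
    (hx' : (extChartAt (𝓡 4) p).symm x ∈ (extChartAt (𝓡 4) p').source) :
    ∀ᶠ y in 𝓝 x, ContDiffAt ℝ ∞ (chartTransition p p') y := by
  filter_upwards [eventually_mem_source hx hx'] with y hy
    using contDiffAt_chartTransition hy.1 hy.2

/-- `scalarCurvature` at a point is read in the preferred chart of that point; the change of charts
is an isometry. -/
theorem scalar_coordMetric (g : RiemMetric M) (hx : x ∈ (extChartAt (𝓡 4) p).target) :
    scalar (coordMetric g p) x = scalarCurvature g ((extChartAt (𝓡 4) p).symm x) :=
  (isIsometryAt_chartTransition g hx (mem_extChartAt_source _)).scalar_eq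
    (eventually_contDiffAt_chartTransition hx (mem_extChartAt_source _))

end Charts

/-! ### The negative twistor space in charts -/

section NegTwistor

variable {M : Type*} [TopologicalSpace M] [ChartedSpace (Coord 4) M] [IsManifold (𝓡 4) ∞ M]
variable {p p' : M} {x : Coord 4} {y : M}

open Classical in
/-- The orientation of `M` in the chart at `p`. -/
def coordOrientation (o : ManifoldOrientation M) (p : M) (x : Coord 4) :
    Orientation ℝ (Coord 4) (Fin 4) :=
  if hx : x ∈ (extChartAt (𝓡 4) p).target then
    Orientation.map (Fin 4) (chartSymmEquiv hx).symm (o.orient ((extChartAt (𝓡 4) p).symm x))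
  else (EuclideanSpace.basisFun (Fin 4) ℝ).toBasis.orientation

theorem map_coordOrientation (o : ManifoldOrientation M) (hx : x ∈ (extChartAt (𝓡 4) p).target) :
    Orientation.map (Fin 4) (chartSymmEquiv hx) (coordOrientation o p x) =
      o.orient ((extChartAt (𝓡 4) p).symm x) := by
  rw [coordOrientation, dif_pos hx, ← Orientation.map_symm, Equiv.apply_symm_apply]

theorem orientation_eq_coordOrientation_iff (o : ManifoldOrientation M)
    (hx : x ∈ (extChartAt (𝓡 4) p).target) (e : Module.Basis (Fin 4) ℝ (Coord 4)) :
    (e.map (chartSymmEquiv hx)).orientation = o.orient ((extChartAt (𝓡 4) p).symm x) ↔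
      e.orientation = coordOrientation o p x := by
  rw [Module.Basis.orientation_map, ← map_coordOrientation o hx]
  exact (Orientation.map (Fin 4) (chartSymmEquiv hx)).injective.eq_iff

theorem orientation_eq_neg_coordOrientation_iff (o : ManifoldOrientation M)
    (hx : x ∈ (extChartAt (𝓡 4) p).target) (e : Module.Basis (Fin 4) ℝ (Coord 4)) :
    (e.map (chartSymmEquiv hx)).orientation = -o.orient ((extChartAt (𝓡 4) p).symm x) ↔
      e.orientation = -coordOrientation o p x := by
  rw [Module.Basis.orientation_map, ← map_coordOrientation o hx, ← Orientation.map_neg]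
  exact (Orientation.map (Fin 4) (chartSymmEquiv hx)).injective.eq_iff

theorem negTwistorPatch_eq (g : RiemMetric M) (o : ManifoldOrientation M) (p : M) :
    negTwistorPatch g o p = frameTwistorSet (extChartAt (𝓡 4) p).target (coordMetric g p)
      (coordOrientation o p) := by
  rw [frameTwistorSet_eq (isMetricOn_coordMetric g p) (by simp)]
  ext ⟨x, I⟩
  constructor
  · rintro ⟨hx, J, hJ, hI⟩
    have hI' : ∀ v, chartSymmDeriv p x (I v) = J (chartSymmDeriv p x v) := hI
    have hinj := (chartSymmEquiv hx).injective
    refine ⟨⟨hx, fun v => hinj ?_, fun v w => ?_⟩, fun e he1 he3 => ?_⟩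
    · simp only [chartSymmEquiv_apply, hI', hJ.sq, map_neg]
    · simp only [coordMetric_apply, hI', hJ.orthogonal]
    · rw [← orientation_eq_neg_coordOrientation_iff o hx]
      refine hJ.orientation _ ?_ ?_
      · simp only [Module.Basis.map_apply, chartSymmEquiv_apply, he1, hI']
      · simp only [Module.Basis.map_apply, chartSymmEquiv_apply, he3, hI']
  · rintro ⟨⟨hx, hI, hIo⟩, ho⟩
    dsimp only at hx hI hIo ho
    let J : TangentSpace (𝓡 4) ((extChartAt (𝓡 4) p).symm x) →L[ℝ]
        TangentSpace (𝓡 4) ((extChartAt (𝓡 4) p).symm x) :=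
      chartSymmDeriv p x ∘L I ∘L chartDeriv p ((extChartAt (𝓡 4) p).symm x)
    have hJ : ∀ v, J (chartSymmDeriv p x v) = chartSymmDeriv p x (I v) := fun v => by
      simp only [J, ContinuousLinearMap.comp_apply, chartDeriv_chartSymmDeriv hx]
    have hJ' : ∀ v, J v = chartSymmDeriv p x (I ((chartSymmEquiv hx).symm v)) := fun v => rfl
    have hs : ∀ v, ∃ w, chartSymmDeriv p x w = v := (chartSymmEquiv hx).surjective
    refine ⟨hx, J, ⟨fun v => ?_, fun v w => ?_, fun b hb1 hb3 => ?_⟩, fun v => (hJ v).symm⟩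
    · obtain ⟨v, rfl⟩ := hs v
      rw [hJ, hJ, hI, map_neg]
    · obtain ⟨v, rfl⟩ := hs v
      obtain ⟨w, rfl⟩ := hs w
      rw [hJ, hJ]
      exact hIo v w
    · have := (orientation_eq_neg_coordOrientation_iff o hx (b.map (chartSymmEquiv hx).symm)).2
        (ho _ ?_ ?_)
      · rw [← this]
        congr 1
        ext i : 1
        exact ((chartSymmEquiv hx).apply_symm_apply (b i)).symm
      · rw [Module.Basis.map_apply, Module.Basis.map_apply, hb1, hJ']
        exact (chartSymmEquiv hx).symm_apply_apply _
      · rw [Module.Basis.map_apply, Module.Basis.map_apply, hb3, hJ']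
        exact (chartSymmEquiv hx).symm_apply_apply _

/-- Local constancy is given in the chart centred at the point. It passes to the chart at `p`
because the Jacobian of the change of charts varies continuously and keeps its sign. -/
theorem coordOrientation_eventually_eq (o : ManifoldOrientation M)
    (hx : x ∈ (extChartAt (𝓡 4) p).target) :
    ∀ᶠ x' in 𝓝 x, coordOrientation o p x' = coordOrientation o p x := by
  set y := (extChartAt (𝓡 4) p).symm x with hy
  have hx' : (extChartAt (𝓡 4) p).symm x ∈ (extChartAt (𝓡 4) y).source := mem_extChartAt_source y
  obtain ⟨c, hc⟩ := o.locally_constant y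
  have hcont := (continuousOn_extChartAt_symm (I := 𝓡 4) p).continuousAt
    ((isOpen_extChartAt_target p).mem_nhds hx)
  have hc' := hcont.eventually hc
  have hτ := smoothAt_fderiv (contDiffAt_chartTransition hx hx')
  obtain ⟨e, he⟩ : ∃ e : Module.Basis (Fin 4) ℝ (Coord 4),
      e.orientation = coordOrientation o p x := by
    let e := (EuclideanSpace.basisFun (Fin 4) ℝ).toBasis
    rcases e.orientation_eq_or_eq_neg (coordOrientation o p x) with h | h
    · exact ⟨e, h.symm⟩
    · exact ⟨e.unitsSMul (Function.update 1 0 (-1)), by rw [e.orientation_neg_single, h]⟩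
  let L : ∀ z, z ∈ (extChartAt (𝓡 4) p).target ∧
      (extChartAt (𝓡 4) p).symm z ∈ (extChartAt (𝓡 4) y).source → (Coord 4 ≃ₗ[ℝ] Coord 4) :=
    fun z hz => LinearEquiv.ofBijective
      (fderiv ℝ (chartTransition p y) z : Coord 4 →ₗ[ℝ] Coord 4) (by
        have hinj : Function.Injective (fderiv ℝ (chartTransition p y) z) := fun v w h => by
          have := isManifold_one M
          rw [fderiv_chartTransition hz.1 hz.2, fderiv_chartTransition hz.1 hz.2] at h
          exact (chartSymmEquiv hz.1).injective
            ((isInvertible_mfderiv_extChartAt hz.2).injective h)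
        exact ⟨hinj, (LinearMap.injective_iff_surjective (f :=
          (fderiv ℝ (chartTransition p y) z : Coord 4 →ₗ[ℝ] Coord 4))).1 hinj⟩)
  have hL : ∀ z hz i, e.map (L z hz) i = fderiv ℝ (chartTransition p y) z (e i) :=
    fun z hz i => rfl
  let e' := e.map (L x ⟨hx, hx'⟩)
  have hdet : ∀ᶠ z in 𝓝 x, 0 < e'.det fun i => fderiv ℝ (chartTransition p y) z (e i) := by
    have hd : ContinuousAt (fun z => e'.det fun i => fderiv ℝ (chartTransition p y) z (e i)) x := by
      simp only [Module.Basis.det_apply]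
      refine ContinuousAt.comp (g := Matrix.det) (Continuous.matrix_det continuous_id).continuousAt ?_
      refine continuousAt_pi.2 fun i => continuousAt_pi.2 fun j => ?_
      simp only [Module.Basis.toMatrix_apply]
      have hc : Continuous (e'.coord i) := LinearMap.continuous_of_finiteDimensional _
      exact ContinuousAt.comp (g := e'.coord i) hc.continuousAt
        (hτ.continuousAt.clm_apply continuousAt_const)
    refine hd.eventually (lt_mem_nhds ?_)
    have : (fun i => fderiv ℝ (chartTransition p y) x (e i)) = e' := rfl
    dsimp only
    rw [this, Module.Basis.det_self]; exact one_pos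
  have key : ∀ z hz, (∀ (b : Module.Basis (Fin 4) ℝ
        (TangentSpace (𝓡 4) ((extChartAt (𝓡 4) p).symm z)))
      (b' : Module.Basis (Fin 4) ℝ (Coord 4)),
      (∀ i, b' i = mfderiv (𝓡 4) 𝓘(ℝ, Coord 4) (extChartAt (𝓡 4) y)
        ((extChartAt (𝓡 4) p).symm z) (b i)) →
      (b.orientation = o.orient ((extChartAt (𝓡 4) p).symm z) ↔ b'.orientation = c)) →
      (e.orientation = coordOrientation o p z ↔ (e.map (L z hz)).orientation = c) := by
    intro z hz h
    rw [← orientation_eq_coordOrientation_iff o hz.1]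
    refine h _ _ fun i => ?_
    rw [hL z hz, fderiv_chartTransition hz.1 hz.2, Module.Basis.map_apply, chartSymmEquiv_apply]
    rfl
  have h0 := (key x ⟨hx, hx'⟩ hc'.self_of_nhds).1 he
  filter_upwards [eventually_mem_source hx hx', hdet, hc'] with z hz hd hcz
  rw [← he, eq_comm, key z hz hcz, ← h0, eq_comm, Module.Basis.orientation_eq_iff_det_pos]
  exact hd

end NegTwistor

/-! ### Self-duality and the vertical part of the trace of the second fundamental form -/

section AlmostComplex

variable {N : Type*} [NormedAddCommGroup N] [NormedSpace ℝ N] [FiniteDimensional ℝ N]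
variable {F : Type*} [NormedAddCommGroup F] [NormedSpace ℝ F] [FiniteDimensional ℝ F]

theorem isTwistorACS_iff {g : F → F →L[ℝ] F →L[ℝ] ℝ} {Ω : Set N} {φ : N → F × (F →L[ℝ] F)}
    {J : N → N →L[ℝ] N} (k : ℕ) :
    (∀ q ∈ Ω, ∀ a, fderiv ℝ φ q (J q a) = twistorACS g k (φ q) (fderiv ℝ φ q a)) ↔
      IsTwistorACS g ((-1) ^ (k + 1)) Ω φ J := by
  have e1 : ∀ z v : F × (F →L[ℝ] F), (twistorACS g k z v).1 = z.2 v.1 := fun z v => by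
    simp [twistorACS, horizontalLift]
  have e2 : ∀ z v : F × (F →L[ℝ] F), verticalPart g z (twistorACS g k z v) =
      (-1 : ℝ) ^ (k + 1) • (z.2 * verticalPart g z v) := fun z v => by
    rw [verticalPart_apply, e1]
    simp only [twistorACS, horizontalLift, Prod.snd_add]
    exact neg_add_cancel_comm _ _
  constructor
  · intro h
    refine ⟨fun q hq a => ?_, fun q hq a => ?_⟩
    · exact (congrArg Prod.fst (h q hq a)).trans (e1 _ _)
    · exact (congrArg (verticalPart g (φ q)) (h q hq a)).trans (e2 _ _)
  · intro h q hq a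
    have h1 : (fderiv ℝ φ q (J q a)).1 = (twistorACS g k (φ q) (fderiv ℝ φ q a)).1 :=
      (h.horiz_apply q hq a).trans (e1 _ _).symm
    have h2 : verticalPart g (φ q) (fderiv ℝ φ q (J q a)) =
        verticalPart g (φ q) (twistorACS g k (φ q) (fderiv ℝ φ q a)) :=
      (h.vert_apply q hq a).trans (e2 _ _).symm
    refine Prod.ext h1 ?_
    rw [verticalPart_apply, verticalPart_apply, h1] at h2
    exact add_right_cancel h2

end AlmostComplex

/-! ### The dimensions six and twelve of the two twistor spaces. -/

section Dimension

theorem finrank_twistor_four {U : Set (Coord 4)} {g : Coord 4 → Coord 4 →L[ℝ] Coord 4 →L[ℝ] ℝ}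
    (hg : IsMetricOn U g) (z : Coord 4 × (Coord 4 →L[ℝ] Coord 4)) (hz : z ∈ twistorSet U g) :
    Module.finrank ℝ (Coord 6) =
      Module.finrank ℝ (Coord 4) + Module.finrank ℝ (verticalSpace (g z.1) z.2) := by
  rw [finrank_verticalSpace_four (hg.symm _ hz.1) (hg.pos _ hz.1)
    (skew_of_orthogonal hz.2.1 hz.2.2) hz.2.1 (by simp)]
  simp

theorem finrank_twistor_six {U : Set (Coord 6)} {g : Coord 6 → Coord 6 →L[ℝ] Coord 6 →L[ℝ] ℝ}
    (hg : IsMetricOn U g) (z : Coord 6 × (Coord 6 →L[ℝ] Coord 6)) (hz : z ∈ twistorSet U g) :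
    Module.finrank ℝ (Coord 12) =
      Module.finrank ℝ (Coord 6) + Module.finrank ℝ (verticalSpace (g z.1) z.2) := by
  rw [finrank_verticalSpace_six (hg.symm _ hz.1) (hg.pos _ hz.1)
    (skew_of_orthogonal hz.2.1 hz.2.2) hz.2.1 (by simp)]
  simp

end Dimension

/-! ### From the curvature conditions in charts to the statement on the manifold. -/

section Main

variable {M : Type*} [TopologicalSpace M] [ChartedSpace (Coord 4) M] [IsManifold (𝓡 4) ∞ M]
variable {p : M} {x : Coord 4}

/-- Self-duality is tested at each point in its own preferred chart, whereas differentiation needs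
isotropy throughout one chart. Isotropy depends only on curvature components, which the change of
charts preserves. -/
theorem isSelfDual_iff (g : RiemMetric M) (o : ManifoldOrientation M) : IsSelfDual g o ↔
    ∀ p : M, ∀ x ∈ (extChartAt (𝓡 4) p).target, ∀ e,
      IsFrame (coordMetric g p x) (coordOrientation o p x) e →
        CurvIsotropic (coordMetric g p) x e (scalar (coordMetric g p) x / 24) := by
  constructor
  · intro h p x hx e he
    have hx' := mem_extChartAt_source (I := 𝓡 4) ((extChartAt (𝓡 4) p).symm x)
    have hτ := isIsometryAt_chartTransition g hx hx'
    have hs := eventually_contDiffAt_chartTransition hx hx'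
    have hsd := h ((extChartAt (𝓡 4) p).symm x) (e.map (chartSymmEquiv hx))
      (fun i j => he.orthonormal i j)
      ((orientation_eq_coordOrientation_iff o hx e).2 he.orientation)
    let L := LinearEquiv.ofBijective
      (fderiv ℝ (chartTransition p ((extChartAt (𝓡 4) p).symm x)) x : Coord 4 →ₗ[ℝ] Coord 4)
      ⟨hτ.injective, hτ.surjective⟩
    have hL : ∀ i, e.map L i =
        fderiv ℝ (chartTransition p ((extChartAt (𝓡 4) p).symm x)) x (e i) := fun i => rfl
    have hL' : ∀ i, e.map L i = mfderiv (𝓡 4) 𝓘(ℝ, Coord 4)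
        (extChartAt (𝓡 4) ((extChartAt (𝓡 4) p).symm x)) ((extChartAt (𝓡 4) p).symm x)
        (e.map (chartSymmEquiv hx) i) := fun i => by
      rw [hL, fderiv_chartTransition hx hx']; rfl
    have hon : ∀ m n, coordMetric g ((extChartAt (𝓡 4) p).symm x)
        (chartTransition p ((extChartAt (𝓡 4) p).symm x) x) (e.map L m) (e.map L n) =
        if m = n then 1 else 0 := fun m n => by
      rw [hL, hL, hτ.apply_eq, he.orthonormal]
    simp only [← hL'] at hsd
    have hiso := (weyl_eq_zero_iff hτ.metric' hτ.mem' hon).1 hsd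
    rw [hτ.scalar_eq hs]
    exact hiso.of_curvComp_eq hτ.metric' hτ.mem' hon hτ.metric hx he.orthonormal
      (hτ.curvComp_eq hs hL).symm
  · intro h p b hb ho
    have hx := mem_extChartAt_target (I := 𝓡 4) p
    obtain ⟨e, he, hbe⟩ : ∃ e, IsFrame (coordMetric g p (extChartAt (𝓡 4) p p))
        (coordOrientation o p (extChartAt (𝓡 4) p p)) e ∧ ∀ i, e i = chartDeriv p p (b i) := by
      suffices key : ∀ x (hx : x ∈ (extChartAt (𝓡 4) p).target) y,
          (extChartAt (𝓡 4) p).symm x = y →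
          ∀ b : Module.Basis (Fin 4) ℝ (TangentSpace (𝓡 4) y),
          (∀ i j, g.inner y (b i) (b j) = if i = j then 1 else 0) → b.orientation = o.orient y →
          ∃ e, IsFrame (coordMetric g p x) (coordOrientation o p x) e ∧
            ∀ i, e i = chartDeriv p y (b i) from
        key _ hx p ((extChartAt (𝓡 4) p).left_inv (mem_extChartAt_source p)) b hb ho
      rintro x hx _ rfl b hb ho
      have hbm : (b.map (chartSymmEquiv hx).symm).map (chartSymmEquiv hx) = b := by
        ext i : 1
        exact (chartSymmEquiv hx).apply_symm_apply (b i)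
      refine ⟨b.map (chartSymmEquiv hx).symm, ⟨fun m n => ?_, ?_⟩, fun i => rfl⟩
      · rw [coordMetric_apply, ← hb]
        congr 1
        · exact congrArg _ ((chartSymmEquiv hx).apply_symm_apply (b m))
        · exact (chartSymmEquiv hx).apply_symm_apply (b n)
      · rw [← orientation_eq_coordOrientation_iff o hx, hbm, ho]
    have hiso := (weyl_eq_zero_iff (isMetricOn_coordMetric g p) hx he.orthonormal).2
      (h p _ hx e he)
    simp only [hbe] at hiso
    exact hiso

theorem exists_isLocalParam_patch (g : RiemMetric M) (o : ManifoldOrientation M)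
    {z : Coord 4 × (Coord 4 →L[ℝ] Coord 4)} (hz : z ∈ negTwistorPatch g o p) :
    ∃ (Ω : Set (Coord 6)) (φ : Coord 6 → Coord 4 × (Coord 4 →L[ℝ] Coord 4)) (q : Coord 6),
      IsLocalParam (negTwistorPatch g o p) Ω φ ∧ q ∈ Ω ∧ φ q = z := by
  have hg := isMetricOn_coordMetric g p
  rw [negTwistorPatch_eq] at hz ⊢
  have hsub := frameTwistorSet_subset hg (by simp) (coordOrientation o p)
  obtain ⟨Ω, φ, ρ, h1, h2, h3, -⟩ := hg.exists_isLocalParam hsub hz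
    (frameTwistorSet_mem_nhdsWithin hg (by simp) hz (coordOrientation_eventually_eq o hz.1))
    (finrank_twistor_four hg z (hsub hz))
  exact ⟨Ω, φ, ρ z, h2, h1, h3⟩

theorem isTwistorChart_patch (g : RiemMetric M) (o : ManifoldOrientation M) {Ω : Set (Coord 6)}
    {φ : Coord 6 → Coord 4 × (Coord 4 →L[ℝ] Coord 4)}
    (h : IsLocalParam (negTwistorPatch g o p) Ω φ) :
    IsTwistorChart (extChartAt (𝓡 4) p).target (coordMetric g p) Ω φ := by
  have hg := isMetricOn_coordMetric g p
  rw [negTwistorPatch_eq] at h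
  exact h.isTwistorChart (frameTwistorSet_subset hg (by simp) _) hg (finrank_twistor_four hg)

theorem hasTwistorCharts_patch (g : RiemMetric M) (o : ManifoldOrientation M) (p : M) :
    HasTwistorCharts (Coord 6) (extChartAt (𝓡 4) p).target (coordMetric g p)
      (frameTwistorSet (extChartAt (𝓡 4) p).target (coordMetric g p) (coordOrientation o p)) := by
  rw [← negTwistorPatch_eq]
  intro z hz
  obtain ⟨Ω, φ, q, h, hq, hφ⟩ := exists_isLocalParam_patch g o hz
  exact ⟨Ω, φ, q, isTwistorChart_patch g o h, hq, hφ, h.mapsTo⟩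

/-- The condition `𝒱 Trace ∇̃𝒥_{k*} = 0` in terms of the curvature in oriented frames. -/
theorem verticalTraceVanishes_iff (g : RiemMetric M) (o : ManifoldOrientation M) {t t' : ℝ}
    (ht : 0 < t) (ht' : 0 < t') (k : ℕ) : VerticalTraceVanishes g o t t' k ↔
    ∀ p : M, ∀ x ∈ (extChartAt (𝓡 4) p).target, ∀ e,
      IsFrame (coordMetric g p x) (coordOrientation o p x) e →
      (lapBlock ((-1) ^ (k + 1)) (sOne e) (sThree e) (sTwo e)
          (t • curvOp (coordMetric g p) x (sTwo e))
          ((-t) • curvOp (coordMetric g p) x (sThree e)) * sOne e =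
        sOne e * lapBlock ((-1) ^ (k + 1)) (sOne e) (sThree e) (sTwo e)
          (t • curvOp (coordMetric g p) x (sTwo e))
          ((-t) • curvOp (coordMetric g p) x (sThree e)) ∧
      sOne e (divOp (coordMetric g p) x e (sTwo e))
        + ((-1 : ℝ) ^ (k + 1)) • divOp (coordMetric g p) x e (sThree e) = 0) := by
  have hε : (-1 : ℝ) ^ (k + 1) * (-1) ^ (k + 1) = 1 := by
    rw [← mul_pow]; norm_num
  constructor
  · intro h p x hx e he
    have hz : ((x, sOne e) : Coord 4 × (Coord 4 →L[ℝ] Coord 4)) ∈ negTwistorPatch g o p := by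
      rw [negTwistorPatch_eq]; exact ⟨hx, e, he, rfl⟩
    -- The hypothesis speaks of given parametrizations only. One of the negative twistor space
    -- through the chosen point is supplied here, and below one of its own twistor space through the
    -- value of `J`.
    obtain ⟨Ω, φ, q, hφ, hq, hφq⟩ := exists_isLocalParam_patch g o hz
    have hc := isTwistorChart_patch g o hφ
    have hJ := hc.isTwistorACS_acs (ε := (-1) ^ (k + 1)) ht
    generalize acs (coordMetric g p) t ((-1) ^ (k + 1)) φ = J at hJ
    have hm := hc.isMetricOn ht
    have hmem : ∀ y ∈ Ω, (y, J y) ∈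
        twistorSet Ω (pullbackMetric (twistorMetric (coordMetric g p) t) φ) := fun y hy => by
      have hsq : ∀ v, J y (J y v) = -v := fun v =>
        congrArg (fun A => A v) (hc.twistorACS_sq hJ hε hy)
      refine ⟨hy, hsq, fun v w => ?_⟩
      dsimp only
      rw [hc.twistorACS_skew hJ hy, hsq, map_neg, neg_neg]
    obtain ⟨Ω', Ψ, ρ, h1, h2, h3, h4, h5⟩ := hm.exists_isLocalParam (N := Coord 12) Set.Subset.rfl
      (hmem q hq) self_mem_nhdsWithin (finrank_twistor_six hm _ (hmem q hq))
    have hsJ : ContDiffAt ℝ ∞ (fun y => (y, J y)) q :=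
      contDiffAt_id.prodMk (hc.smoothAt_twistorACS hJ hq)
    -- The coordinate expression of the section is obtained by composing with the smooth left
    -- inverse `ρ` of `Ψ`.
    have hu : ContDiffAt ℝ ∞ (fun y => ρ (y, J y)) q := ContDiffAt.comp q h4 hsJ
    have hJu : ∀ᶠ y in 𝓝 q, Ψ (ρ (y, J y)) = (y, J y) := by
      filter_upwards [hsJ.continuousAt.eventually h5, hc.eventually_mem hq] with y hy hyΩ
        using hy (hmem y hyΩ)
    have hx1 : (φ q).1 = x := by rw [hφq]
    have hx2 : sOne e = (φ q).2 := by rw [hφq]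
    have key := (hc.verticalTrace_iff hJ hε ht ht' hq (e := e) (by rw [hx1]; exact he.orthonormal)
      hx2 (h2.isTwistorChart Set.Subset.rfl hm (finrank_twistor_six hm)) hu h1 hJu).1
      (h p Ω φ J hφ ((isTwistorACS_iff k).2 hJ) q hq Ω' Ψ _ h2 hu h1 hJu)
    rwa [hx1] at key
  · intro h p Ω φ J hφ hJ q hq Ω' Ψ u hΨ hu huq hJu
    have hc := isTwistorChart_patch g o hφ
    have hm := hc.isMetricOn ht
    have hz := hφ.mapsTo hq
    rw [negTwistorPatch_eq] at hz
    obtain ⟨hx, e, he, heI⟩ := hz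
    exact (hc.verticalTrace_iff ((isTwistorACS_iff k).1 hJ) hε ht ht' hq he.orthonormal heI
      (hΨ.isTwistorChart Set.Subset.rfl hm (finrank_twistor_six hm)) hu huq hJu).2
      (h p _ hx e he)

/-- `𝒱 Trace ∇̃𝒥_{k*} = 0` if and only if `M` is self-dual and, when `k` is even, the differential of
the scalar curvature vanishes. -/
theorem verticalTraceVanishes_iff_isSelfDual (g : RiemMetric M) (o : ManifoldOrientation M)
    {t t' : ℝ} (ht : 0 < t) (ht' : 0 < t') (k : ℕ) : VerticalTraceVanishes g o t t' k ↔
    IsSelfDual g o ∧ ∀ p : M, ∀ x ∈ (extChartAt (𝓡 4) p).target,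
      (-1 : ℝ) ^ (k + 1) = 1 ∨ fderiv ℝ (scalar (coordMetric g p)) x = 0 := by
  rw [verticalTraceVanishes_iff g o ht ht', isSelfDual_iff]
  have hs : ∀ p : M, ∀ x ∈ (extChartAt (𝓡 4) p).target,
      HasFDerivAt (fun y => scalar (coordMetric g p) y / 24)
        ((24⁻¹ : ℝ) • fderiv ℝ (scalar (coordMetric g p)) x) x := fun p x hx => by
    simpa only [div_eq_mul_inv] using
      ((isMetricOn_coordMetric g p).differentiableAt_scalar hx).hasFDerivAt.mul_const (24⁻¹ : ℝ)
  have hdiv := fun (hiso : ∀ p : M, ∀ x ∈ (extChartAt (𝓡 4) p).target, ∀ e,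
      IsFrame (coordMetric g p x) (coordOrientation o p x) e →
        CurvIsotropic (coordMetric g p) x e (scalar (coordMetric g p) x / 24)) p x hx e
      (he : IsFrame (coordMetric g p x) (coordOrientation o p x) e) =>
    (isMetricOn_coordMetric g p).divTerm_of_isotropic hx (hasTwistorCharts_patch g o p) (hiso p)
      (hs p x hx).differentiableAt he ((-1) ^ (k + 1))
  constructor
  · intro h
    have hiso : ∀ p : M, ∀ x ∈ (extChartAt (𝓡 4) p).target, ∀ e,
        IsFrame (coordMetric g p x) (coordOrientation o p x) e →
        CurvIsotropic (coordMetric g p) x e (scalar (coordMetric g p) x / 24) := by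
      intro p x hx e he
      have hg := isMetricOn_coordMetric g p
      -- Varying the frame over a fixed point means varying the point of the fibre, which is why the
      -- condition is required on all of the twistor space.
      obtain ⟨c, hc⟩ := hg.curvIsotropic_of_comm hx ht (fun e he => (h p x hx e he).1) he
      rw [scalar_eq_scalarComp hg hx he.orthonormal, ← hc.const_eq hg hx he.orthonormal]
      exact hc
    refine ⟨hiso, fun p x hx => ?_⟩
    by_cases hk : (-1 : ℝ) ^ (k + 1) = 1
    · exact Or.inl hk
    refine Or.inr ?_
    have hg := isMetricOn_coordMetric g p
    obtain ⟨e, he⟩ := exists_isFrame (hg.symm x hx) (hg.pos x hx) (by simp) (coordOrientation o p x)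
    have h0 := (hdiv hiso p x hx e he).symm.trans (h p x hx e he).2
    have hT := quatTriple_s (hg.symm x hx) he.orthonormal
    have h1 := (smul_eq_zero.1 h0).resolve_left
      (mul_ne_zero two_ne_zero (sub_ne_zero.2 hk))
    -- Applying `j` once more removes it, and the coefficients of the gradient in the basis `e` must
    -- vanish.
    have h2 := congrArg (sThree e) h1
    rw [← end_mul_apply, hT.rel.jj, map_zero (sThree e), neg_apply, one_apply_eq_self, neg_eq_zero,
      (hs p x hx).fderiv] at h2
    have hli := Fintype.linearIndependent_iff.1 e.linearIndependent
      (fun m => ((24⁻¹ : ℝ) • fderiv ℝ (scalar (coordMetric g p)) x) (e m))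
      (by rw [Fin.sum_univ_four]; exact h2)
    refine ContinuousLinearMap.coe_injective (e.ext fun m => ?_)
    simpa using hli m
  · rintro ⟨hiso, hsc⟩ p x hx e he
    refine ⟨(hiso p x hx e he).comm (isMetricOn_coordMetric g p) hx he.orthonormal ht, ?_⟩
    rw [hdiv hiso p x hx e he]
    rcases hsc p x hx with h | h
    · rw [h]; simp
    · rw [(hs p x hx).fderiv, h]; simp

/-- A vanishing differential gives constancy on convex coordinate balls, hence local constancy, and
connectedness does the rest. -/
theorem scalarCurvature_const_iff [ConnectedSpace M] (g : RiemMetric M) :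
    (∃ c : ℝ, ∀ p : M, scalarCurvature g p = c) ↔
      ∀ p : M, ∀ x ∈ (extChartAt (𝓡 4) p).target, fderiv ℝ (scalar (coordMetric g p)) x = 0 := by
  constructor
  · rintro ⟨c, hc⟩ p x hx
    have e : scalar (coordMetric g p) =ᶠ[𝓝 x] fun _ => c := by
      filter_upwards [(isMetricOn_coordMetric g p).isOpen.mem_nhds hx] with y hy
      rw [scalar_coordMetric g hy, hc]
    rw [e.fderiv_eq, fderiv_fun_const]; rfl
  · intro h
    have hloc : IsLocallyConstant (scalarCurvature g) := by
      rw [IsLocallyConstant.iff_eventually_eq]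
      intro p
      have ho := (isMetricOn_coordMetric g p).isOpen
      obtain ⟨r, hr, hball⟩ := Metric.isOpen_iff.1 ho _ (mem_extChartAt_target (I := 𝓡 4) p)
      have hcont := (continuousAt_extChartAt (I := 𝓡 4) p).eventually (Metric.ball_mem_nhds _ hr)
      filter_upwards [hcont, extChartAt_source_mem_nhds (I := 𝓡 4) p] with y hy hys
      have hconst := (convex_ball (extChartAt (𝓡 4) p p) r).is_const_of_fderivWithin_eq_zero
        (𝕜 := ℝ) (f := scalar (coordMetric g p))
        (fun z hz => ((isMetricOn_coordMetric g p).differentiableAt_scalar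
          (hball hz)).differentiableWithinAt)
        (fun z hz => by rw [fderivWithin_of_isOpen Metric.isOpen_ball hz, h p z (hball hz)])
        hy (Metric.mem_ball_self hr)
      rw [scalar_coordMetric g (hball hy), scalar_coordMetric g (mem_extChartAt_target p),
        (extChartAt (𝓡 4) p).left_inv hys,
        (extChartAt (𝓡 4) p).left_inv (mem_extChartAt_source p)] at hconst
      exact hconst
    obtain ⟨p₀⟩ := (inferInstance : Nonempty M)
    exact ⟨scalarCurvature g p₀, fun p => hloc.apply_eq_of_preconnectedSpace p p₀⟩

end Main

end

end Twistor

theorem corollary2 {M : Type*} [TopologicalSpace M] [T2Space M] [SecondCountableTopology M]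
    [ConnectedSpace M] [ChartedSpace (EuclideanSpace ℝ (Fin 4)) M] [IsManifold (𝓡 4) ∞ M]
    (g : Twistor.RiemMetric M) (o : Twistor.ManifoldOrientation M)
    (t t' : ℝ) (ht : 0 < t) (ht' : 0 < t') :
    (Twistor.VerticalTraceVanishes g o t t' 1 ↔ Twistor.IsSelfDual g o) ∧
    (Twistor.VerticalTraceVanishes g o t t' 2 ↔
      Twistor.IsSelfDual g o ∧ ∃ c : ℝ, ∀ p : M, Twistor.scalarCurvature g p = c) := by
  rw [Twistor.verticalTraceVanishes_iff_isSelfDual g o ht ht',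
    Twistor.verticalTraceVanishes_iff_isSelfDual g o ht ht', Twistor.scalarCurvature_const_iff]
  -- The sign `(-1) ^ (k + 1)` is `1` for `k = 1`, where the second condition is empty, and `-1` for
  -- `k = 2`.
  norm_num
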